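/- **Setting.** Let $K\in\mathbb R^{N\times N}$ ($N\ge 1$) be symmetric with $0\preceq K\preceq I$. A random set $Y\subseteq[N]$ has law $\mathsf{DPP}(K)$ if $\mathbb P[S\subseteq Y]=\det K_S$ for all $S\subseteq [N]$. The graph $G_K$ on $[N]$ joins $i\ne j$ iff $K_{i,j}\neq0$; let $m$ be its number of edges. Let $\mathcal D_N$ be the set of diagonal matrices with diagonal entries $\pm1$, and $\rho(K,K')=\min_{D\in\mathcal D_N}\max_{i,j}|(DKD-K')_{i,j}|$. The *cycle sparsity* of a graph is the least $\ell$ such that its cycle space over $GF(2)$ has a basis of induced simple cycles of length at most $\ell$ (and $2$ if the cycle space is trivial); such a basis is a *shortest maximal cycle basis*. **Algorithm 1.** Input: $\alpha\in(0,1)$ and $Y_1,\dots,Y_n\subseteq[N]$, $n\ge1$. Put $\hat\Delta_S=\frac1n\#\{p: S\subseteq Y_p\}$, $\hat K_{i,i}=\hat\Delta_{\{i\}}$, $\hat B_{i,j}=\hat K_{i,i}\hat K_{j,j}-\hat\Delta_{\{i,j\}}$. Let $\hat G$ be the graph on $[N]$ joining $i\ne j$ iff $\hat B_{i,j}\ge\frac12\alpha^2$,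 with $\hat m$ edges. Compute a shortest maximal cycle basis $\hat C_1,\dots,\hat C_\nu$ of $\hat G$, with vertex sets $\hat S_1,\dots,\hat S_\nu$, and $$\hat H_i=\hat\Delta_{\hat S_i}-\sum_{M}(-1)^{|M|}\prod_{\{j,k\}\in M}\hat B_{j,k}\prod_{j\in \hat S_i\setminus V(M)}\hat K_{j,j},$$ where $M$ ranges over the matchings of the subgraph of $\hat G$ induced by $\hat S_i$. Let $A$ be the $\nu\times\hat m$ matrix over $GF(2)$ whose $i$-th row is the incidence vector of $\hat C_i$, and let $b_i=1$ if $\hat H_i>0$, $b_i=0$ if $\hat H_i<0$ (either value if $\hat H_i=0$). Let $x$ be a solution of $Ax=b$, or the all-ones vector if there is none. Output $\hat K$ with the above diagonal, $\hat K_{i,j}=0$ for non-adjacent $i\neq j$ in $\hat G$, and $\hat K_{i,j}=(2x_{\{i,j\}}-1)\hat B_{i,j}^{1/2}$ for edges $\{i,j\}$ of $\hat G$. **Theorem.** There are a program $P$ for a real random access machine (unit-cost arithmetic $+,-,\times,/,\sqrt{\cdot}$ and comparison on reals; unit-cost increment, decrement and comparison on integers; two-dimensional arrays) and an absolute constant $c$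 with the following properties. 1. For all $N,n\ge1$, $\alpha\in(0,1)$ and all $Y_1,\dots,Y_n\subseteq[N]$, $P$ outputs a result of Algorithm 1 after at most $c(\hat m^3+nN^2)$ steps. 2. Let $\alpha,\delta\in(0,1)$, let $K$ be as above with $K_{i,j}=0$ or $|K_{i,j}|\ge\alpha$ for all $i<j$, let $\ell$ be the cycle sparsity of $G_K$, and let $Y_1,\dots,Y_n$ be independent samples from $\mathsf{DPP}(K)$. If $$n>\frac{\log(N^{\ell+1}/\delta)}{(\alpha/4)^{2\ell}},$$ then with probability at least $1-\delta$ the program $P$ halts with a result of Algorithm 1 after at most $c(m^3+nN^2)$ steps, and every result $\hat K$ of Algorithm 1 (for every admissible choice of cycle basis, $b$ and $x$) satisfies both: there is $D\in\mathcal D_N$ such that $\hat K_{i,j}$ and $(DKD)_{i,j}$ have the same sign in $\{-1,0,1\}$ for all $i\ne j$; and $$\rho(K,\hat K)<\frac1\alpha\left(\frac{8\log(4N^{\ell+1}/\delta)}{n}\right)^{1/2}.$$ -/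

import Mathlib

/-! ### Determinantal point processes and kernels -/

/-- The submatrix `K_S` of `K` indexed by `S`, and its determinant. -/
noncomputable def principalMinor {N : ℕ} (K : Matrix (Fin N) (Fin N) ℝ)
    (S : Finset (Fin N)) : ℝ :=
  (K.submatrix (fun i : S => (i : Fin N)) (fun i : S => (i : Fin N))).det

/-- The random set `Y` is distributed as `DPP(K)`: `P[S ⊆ Y] = det K_S` for all `S`. -/
def IsDPP {N : ℕ} {Ω : Type*} [MeasurableSpace Ω] (μ : MeasureTheory.Measure Ω)
    (K : Matrix (Fin N) (Fin N) ℝ) (Y : Ω → Finset (Fin N)) : Prop :=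
  Measurable Y ∧ ∀ S : Finset (Fin N), μ.real {ω | S ⊆ Y ω} = principalMinor K S

/-- Every off-diagonal entry is zero or at least `α` in absolute value. -/
def EntrySeparated {N : ℕ} (α : ℝ) (K : Matrix (Fin N) (Fin N) ℝ) : Prop :=
  ∀ i j : Fin N, i < j → K i j = 0 ∨ α ≤ |K i j|

/-- The graph induced by (the symmetric matrix) `K`: `i ≠ j` are joined iff `K i j ≠ 0`. -/
def kernelGraph {N : ℕ} (K : Matrix (Fin N) (Fin N) ℝ) : SimpleGraph (Fin N) :=
  SimpleGraph.fromRel (fun i j => K i j ≠ 0)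

/-- The set `𝒟_N` of diagonal matrices with diagonal entries `1` and `-1`. -/
def signMatrices (N : ℕ) : Set (Matrix (Fin N) (Fin N) ℝ) :=
  {D | ∃ d : Fin N → ℝ, (∀ i, d i = 1 ∨ d i = -1) ∧ D = Matrix.diagonal d}

/-- The entrywise sup-norm (a maximum over finitely many entries). -/
noncomputable def entrySupNorm {N : ℕ} (A : Matrix (Fin N) (Fin N) ℝ) : ℝ :=
  ⨆ p : Fin N × Fin N, |A p.1 p.2|

/-- `ρ(K, K') = inf_{D ∈ 𝒟_N} |D K D - K'|_∞`. -/
noncomputable def kernelDist {N : ℕ} (K K' : Matrix (Fin N) (Fin N) ℝ) : ℝ :=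
  ⨅ D : signMatrices N, entrySupNorm (D.1 * K * D.1 - K')

/-- `K'` has the same off-diagonal signs (in `{-1, 0, 1}`) as some `D K D`, `D ∈ 𝒟_N`. -/
def RecoversSigns {N : ℕ} (K K' : Matrix (Fin N) (Fin N) ℝ) : Prop :=
  ∃ D ∈ signMatrices N, ∀ i j : Fin N, i ≠ j →
    SignType.sign (K' i j) = SignType.sign ((D * K * D) i j)

/-! ### Cycles, cycle bases, cycle sparsity -/

section Graphs

variable {V : Type*} {G : SimpleGraph V}

/-- A cycle: a connected subgraph in which each vertex has even degree. -/
def IsEvenCycle (C : G.Subgraph) : Prop :=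
  C.Connected ∧ ∀ v ∈ C.verts, Even (C.neighborSet v).ncard

/-- A simple cycle: a connected subgraph in which each vertex has degree two. -/
def IsSimpleCycle (C : G.Subgraph) : Prop :=
  C.Connected ∧ ∀ v ∈ C.verts, (C.neighborSet v).ncard = 2

open scoped Classical in
/-- The incidence vector over `GF(2)` of a subgraph, indexed by the edges of `G`. -/
noncomputable def incidenceVec (C : G.Subgraph) : G.edgeSet → ZMod 2 :=
  fun e => if e.1 ∈ C.edgeSet then 1 else 0

variable (G) in
/-- The cycle space of `G`: the span of the incidence vectors of the cycles. -/
def cycleSpace : Submodule (ZMod 2) (G.edgeSet → ZMod 2) :=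
  Submodule.span (ZMod 2) {x | ∃ C : G.Subgraph, IsEvenCycle C ∧ x = incidenceVec C}

/-- A cycle basis: simple cycles whose incidence vectors form a basis of the cycle space. -/
def IsCycleBasis {ν : ℕ} (C : Fin ν → G.Subgraph) : Prop :=
  (∀ i, IsSimpleCycle (C i)) ∧
  LinearIndependent (ZMod 2) (fun i => incidenceVec (C i)) ∧
  Submodule.span (ZMod 2) (Set.range fun i => incidenceVec (C i)) = cycleSpace G

/-- A cycle basis consisting of induced cycles of length at most `l`. -/
def IsInducedCycleBasis {ν : ℕ} (C : Fin ν → G.Subgraph) (l : ℕ) : Prop :=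
  IsCycleBasis C ∧ ∀ i, (C i).IsInduced ∧ (C i).verts.ncard ≤ l

open scoped Classical in
variable (G) in
/-- The cycle sparsity of `G`, with value `2` if the cycle space is trivial. -/
noncomputable def cycleSparsity : ℕ :=
  if cycleSpace G = ⊥ then 2
  else sInf {l : ℕ | ∃ (ν : ℕ) (C : Fin ν → G.Subgraph), IsInducedCycleBasis C l}

/-- A shortest maximal cycle basis. -/
def IsShortestMaximalCycleBasis {ν : ℕ} (C : Fin ν → G.Subgraph) : Prop :=
  IsInducedCycleBasis C (cycleSparsity G)

open scoped Classical in
variable (G) in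
/-- The matchings of the subgraph of `G` induced by `S`, as sets of edges. -/
noncomputable def matchings [Fintype V] (S : Finset V) : Finset (Finset (Sym2 V)) :=
  Finset.univ.filter fun M =>
    (∀ e ∈ M, e ∈ G.edgeSet ∧ ∀ v ∈ e, v ∈ S) ∧
    (∀ e ∈ M, ∀ f ∈ M, e ≠ f → ∀ v, v ∈ e → v ∉ f)

end Graphs

/-! ### The estimator -/

section Estimator

variable {N n : ℕ} (α : ℝ) (Y : Fin n → Finset (Fin N))

/-- `Δ̂_S`, the fraction of the samples that contain `S`. -/
noncomputable def empMinor (S : Finset (Fin N)) : ℝ :=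
  (1 / (n : ℝ)) * ((Finset.univ.filter fun p => S ⊆ Y p).card : ℝ)

/-- `B̂ i j = K̂ i i * K̂ j j - Δ̂_{i,j}`. -/
noncomputable def empB (i j : Fin N) : ℝ :=
  empMinor Y {i} * empMinor Y {j} - empMinor Y {i, j}

theorem empB_comm (i j : Fin N) : empB Y i j = empB Y j i := by
  unfold empB
  rw [mul_comm, Finset.pair_comm]

/-- `B̂` as a function on unordered pairs. -/
noncomputable def empBSym (e : Sym2 (Fin N)) : ℝ :=
  Sym2.lift ⟨empB Y, empB_comm Y⟩ e

/-- `Ĝ`: distinct `i, j` are joined iff `B̂ i j ≥ α² / 2`. -/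
def empGraph : SimpleGraph (Fin N) :=
  SimpleGraph.fromRel (fun i j => α ^ 2 / 2 ≤ empB Y i j)

open scoped Classical in
/-- `Ĥ_S`, the empirical minor of `S` minus the signed matching sum of `Ĝ(S)`. -/
noncomputable def empH (S : Finset (Fin N)) : ℝ :=
  empMinor Y S - ∑ M ∈ matchings (empGraph α Y) S,
    (-1) ^ M.card * (∏ e ∈ M, empBSym Y e) *
      ∏ v ∈ S.filter (fun v => ∀ e ∈ M, v ∉ e), empMinor Y {v}

open scoped Classical in
/-- `Khat` is a possible result of the estimation procedure on the samples `Y` with parameter `α`: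
the procedure may use any shortest maximal cycle basis `C` of `Ĝ` and any solution `x` of `A x = b`,
where the rows of `A` are the incidence vectors of the cycles `C i` and `b i` is `1` or `0`
according to the sign of `Ĥ` on the vertex set of `C i`; if there is no solution, `x = 1`.
If that `Ĥ` vanishes, then either value of `b i` is allowed. -/
def IsMomentEstimate (Khat : Matrix (Fin N) (Fin N) ℝ) : Prop :=
  ∃ (ν : ℕ) (C : Fin ν → (empGraph α Y).Subgraph) (b : Fin ν → ZMod 2)
    (x : (empGraph α Y).edgeSet → ZMod 2),
    IsShortestMaximalCycleBasis C ∧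
    (∀ i, (0 < empH α Y (C i).verts.toFinset → b i = 1) ∧
      (empH α Y (C i).verts.toFinset < 0 → b i = 0)) ∧
    ((Matrix.of fun i => incidenceVec (C i)).mulVec x = b ∨
      (¬ ∃ y, (Matrix.of fun i => incidenceVec (C i)).mulVec y = b) ∧ x = fun _ => 1) ∧
    (∀ i, Khat i i = empMinor Y {i}) ∧
    (∀ i j, i ≠ j → ¬ (empGraph α Y).Adj i j → Khat i j = 0) ∧
    (∀ i j (h : (empGraph α Y).Adj i j),
      Khat i j = (2 * ((x ⟨s(i, j), h⟩).val : ℝ) - 1) * Real.sqrt (empB Y i j))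

end Estimator

/-! ### Programs and their running time

A real RAM with structured control flow.  A program is a fixed finite piece of syntax.
It works on integer and real variables and on two-dimensional integer and real arrays, all named by
numerals.  Integers can only be incremented, decremented and compared (so every integer
that occurs is bounded by the input integers plus the program's constants plus the running time);
reals are subject to `+, -, *, /, √` and comparison.  Every node of an expression that is evaluated
and every statement or test that is executed costs one step. -/

/-- The memory of the machine. -/
structure MState where
  natVar : ℕ → ℕ
  natArr : ℕ → ℕ → ℕ → ℕ
  realVar : ℕ → ℝ
  realArr : ℕ → ℕ → ℕ → ℝ

/-- Integer expressions. -/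
inductive NExp where
  | const (c : ℕ)
  | var (x : ℕ)
  | succ (e : NExp)
  | pred (e : NExp)
  | get (a : ℕ) (e₁ e₂ : NExp)

/-- Real expressions. -/
inductive RExp where
  | const (c : ℤ)
  | var (x : ℕ)
  | get (a : ℕ) (e₁ e₂ : NExp)
  | add (r₁ r₂ : RExp)
  | sub (r₁ r₂ : RExp)
  | mul (r₁ r₂ : RExp)
  | div (r₁ r₂ : RExp)
  | sqrt (r : RExp)

/-- Tests. -/
inductive BExp where
  | natEq (e₁ e₂ : NExp)
  | natLt (e₁ e₂ : NExp)
  | realLe (r₁ r₂ : RExp)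
  | not (b : BExp)
  | and (b₁ b₂ : BExp)

/-- Programs. -/
inductive Prog where
  | skip
  | setNat (x : ℕ) (e : NExp)
  | putNat (a : ℕ) (e₁ e₂ e : NExp)
  | setReal (x : ℕ) (r : RExp)
  | putReal (a : ℕ) (e₁ e₂ : NExp) (r : RExp)
  | seq (p q : Prog)
  | cond (b : BExp) (p q : Prog)
  | loop (b : BExp) (p : Prog)

def NExp.eval (σ : MState) : NExp → ℕ
  | .const c => c
  | .var x => σ.natVar x
  | .succ e => e.eval σ + 1
  | .pred e => e.eval σ - 1
  | .get a e₁ e₂ => σ.natArr a (e₁.eval σ) (e₂.eval σ)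

def NExp.cost : NExp → ℕ
  | .const _ => 1
  | .var _ => 1
  | .succ e => e.cost + 1
  | .pred e => e.cost + 1
  | .get _ e₁ e₂ => e₁.cost + e₂.cost + 1

noncomputable def RExp.eval (σ : MState) : RExp → ℝ
  | .const c => (c : ℝ)
  | .var x => σ.realVar x
  | .get a e₁ e₂ => σ.realArr a (e₁.eval σ) (e₂.eval σ)
  | .add r₁ r₂ => r₁.eval σ + r₂.eval σ
  | .sub r₁ r₂ => r₁.eval σ - r₂.eval σ
  | .mul r₁ r₂ => r₁.eval σ * r₂.eval σ
  | .div r₁ r₂ => r₁.eval σ / r₂.eval σ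
  | .sqrt r => Real.sqrt (r.eval σ)

def RExp.cost : RExp → ℕ
  | .const _ => 1
  | .var _ => 1
  | .get _ e₁ e₂ => e₁.cost + e₂.cost + 1
  | .add r₁ r₂ => r₁.cost + r₂.cost + 1
  | .sub r₁ r₂ => r₁.cost + r₂.cost + 1
  | .mul r₁ r₂ => r₁.cost + r₂.cost + 1
  | .div r₁ r₂ => r₁.cost + r₂.cost + 1
  | .sqrt r => r.cost + 1

def BExp.eval (σ : MState) : BExp → Prop
  | .natEq e₁ e₂ => e₁.eval σ = e₂.eval σ
  | .natLt e₁ e₂ => e₁.eval σ < e₂.eval σ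
  | .realLe r₁ r₂ => r₁.eval σ ≤ r₂.eval σ
  | .not b => ¬ b.eval σ
  | .and b₁ b₂ => b₁.eval σ ∧ b₂.eval σ

def BExp.cost : BExp → ℕ
  | .natEq e₁ e₂ => e₁.cost + e₂.cost + 1
  | .natLt e₁ e₂ => e₁.cost + e₂.cost + 1
  | .realLe r₁ r₂ => r₁.cost + r₂.cost + 1
  | .not b => b.cost + 1
  | .and b₁ b₂ => b₁.cost + b₂.cost + 1

/-- Write `v` at position `(i, j)` of the array named `a`. -/
def arrWrite {β : Type*} (A : ℕ → ℕ → ℕ → β) (a i j : ℕ) (v : β) : ℕ → ℕ → ℕ → β :=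
  Function.update A a (Function.update (A a) i (Function.update (A a i) j v))

/-- `Exec p σ t τ`: started in the state `σ`, the program `p` halts in the state `τ` after
exactly `t` steps. -/
inductive Exec : Prog → MState → ℕ → MState → Prop where
  | skip (σ : MState) : Exec .skip σ 1 σ
  | setNat (x : ℕ) (e : NExp) (σ : MState) :
      Exec (.setNat x e) σ (e.cost + 1)
        { σ with natVar := Function.update σ.natVar x (e.eval σ) }
  | putNat (a : ℕ) (e₁ e₂ e : NExp) (σ : MState) :
      Exec (.putNat a e₁ e₂ e) σ (e₁.cost + e₂.cost + e.cost + 1)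
        { σ with natArr := arrWrite σ.natArr a (e₁.eval σ) (e₂.eval σ) (e.eval σ) }
  | setReal (x : ℕ) (r : RExp) (σ : MState) :
      Exec (.setReal x r) σ (r.cost + 1)
        { σ with realVar := Function.update σ.realVar x (r.eval σ) }
  | putReal (a : ℕ) (e₁ e₂ : NExp) (r : RExp) (σ : MState) :
      Exec (.putReal a e₁ e₂ r) σ (e₁.cost + e₂.cost + r.cost + 1)
        { σ with realArr := arrWrite σ.realArr a (e₁.eval σ) (e₂.eval σ) (r.eval σ) }
  | seq {p q : Prog} {σ τ υ : MState} {s t : ℕ} (hp : Exec p σ s τ) (hq : Exec q τ t υ) :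
      Exec (.seq p q) σ (s + t) υ
  | condTrue {b : BExp} {p : Prog} (q : Prog) {σ τ : MState} {t : ℕ}
      (hb : b.eval σ) (hp : Exec p σ t τ) : Exec (.cond b p q) σ (b.cost + 1 + t) τ
  | condFalse {b : BExp} (p : Prog) {q : Prog} {σ τ : MState} {t : ℕ}
      (hb : ¬ b.eval σ) (hq : Exec q σ t τ) : Exec (.cond b p q) σ (b.cost + 1 + t) τ
  | loopTrue {b : BExp} {p : Prog} {σ τ υ : MState} {s t : ℕ}
      (hb : b.eval σ) (hp : Exec p σ s τ) (hl : Exec (.loop b p) τ t υ) :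
      Exec (.loop b p) σ (b.cost + 1 + s + t) υ
  | loopFalse {b : BExp} (p : Prog) {σ : MState} (hb : ¬ b.eval σ) :
      Exec (.loop b p) σ (b.cost + 1) σ

open scoped Classical in
/-- The input: the integers `N` and `n`, the real `α`, and the table of the bits `1[i ∈ Y_p]`.
All other cells hold `0`. -/
noncomputable def inputState {N n : ℕ} (α : ℝ) (Y : Fin n → Finset (Fin N)) : MState where
  natVar x := if x = 0 then N else if x = 1 then n else 0
  natArr a p i :=
    if a = 0 ∧ ∃ (hp : p < n) (hi : i < N), (⟨i, hi⟩ : Fin N) ∈ Y ⟨p, hp⟩ then 1 else 0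
  realVar x := if x = 0 then α else 0
  realArr _ _ _ := 0

/-- The output matrix is read from the real array named `0`. -/
def outputMatrix (N : ℕ) (σ : MState) : Matrix (Fin N) (Fin N) ℝ :=
  Matrix.of fun i j => σ.realArr 0 i j

/-- On the samples `Y` and the parameter `α`, the program `P` halts after at most `T` steps and
outputs a result of the estimation procedure. -/
def ComputesEstimateWithin {N n : ℕ} (P : Prog) (α : ℝ) (Y : Fin n → Finset (Fin N))
    (T : ℕ) : Prop :=
  ∃ (t : ℕ) (σ : MState), Exec P (inputState α Y) t σ ∧ t ≤ T ∧
    IsMomentEstimate α Y (outputMatrix N σ)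

/-! ### Weights of walks over `GF(2)` -/

/-! Cycle basis. The program uses the method of witnesses over GF(2). The witnesses start as the
unit vectors on the edges. For each one in turn a shortest closed walk of odd weight is sought; if
there is one, it is recorded and the witness is added to every later witness that pairs oddly with
it. A shortest odd closed walk is an induced simple cycle, since a repeated vertex or a chord would
split it into two shorter closed walks, one of them odd (`IsShortestOdd.split`). A witness without
odd closed walks is a coboundary and annihilates the cycle space. Recorded cycles and their
witnesses pair in a unitriangular matrix and the witnesses keep separating all edge vectors, so the
cycles form a basis. Every other basis has a member that is odd for a given witness, hence at least
as long as the recorded cycle, so the basis is a shortest maximal one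
(`isShortestMaximalCycleBasis_of_witnesses`).

Running time. Call a vertex with a smaller neighbor a root; there are at most min(m, N) of them and
every edge has one as its larger end. One breadth-first tree per root is built once and for all. A
shortest odd closed walk can be taken to consist of two tree paths from a root and one edge
(`exists_odd_candidate`), so a witness costs one scan of all edges for each root, and the whole
basis O(m³). The same shape lets one mark, for each sample, the tree paths contained in it, after
which each cycle is tested by two lookups; all samples together take O(nN²). On an induced cycle the
matching sum obeys a three-term recurrence, so Ĥ takes linear time. The linear system is solved by
forward substitution with the witnesses themselves.

Statistics. In the Leibniz expansion of a principal minor on an induced cycle of length s only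
involutions, which are matchings, and the two rotations survive. Hence the minor is the matching sum
plus 2(-1)^(s+1) times the product of K along the cycle (`principalMinor_cycle`), and Ĥ estimates
-2∏(-K), whose sign gives the parity of the number of positive entries. If all minors up to the
cycle sparsity ℓ are known up to t < (α/4)^ℓ, the graph is exact and the error 2·4^s·t of Ĥ is below
2α^s, so all right-hand sides are correct. A solution of the system then differs from the true signs
by a vector that annihilates the cycle space, i.e. by a coboundary, which is conjugation by a sign
matrix (`IsMomentEstimate.recovers`). Hoeffding's inequality and a union bound over N^ℓ tuples
provide the accuracy (`one_sub_le_measureReal_of_empMinor`). -/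

namespace SimpleGraph

variable {V : Type*} {G : SimpleGraph V}

/-- The total weight of the darts of a walk. -/
def Walk.weight (F : V → V → ZMod 2) {u v : V} (p : G.Walk u v) : ZMod 2 :=
  (p.darts.map fun d => F d.fst d.snd).sum

variable {F : V → V → ZMod 2}

@[simp] theorem Walk.weight_nil (u : V) : (Walk.nil : G.Walk u u).weight F = 0 := by
  simp [Walk.weight]

@[simp] theorem Walk.weight_cons {u v x : V} (h : G.Adj u v) (p : G.Walk v x) :
    (Walk.cons h p).weight F = F u v + p.weight F := by
  simp [Walk.weight]

@[simp] theorem Walk.weight_append {u v x : V} (p : G.Walk u v) (q : G.Walk v x) :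
    (p.append q).weight F = p.weight F + q.weight F := by
  simp [Walk.weight]

@[simp] theorem Walk.weight_copy {u v u' v' : V} (p : G.Walk u v) (hu : u = u') (hv : v = v') :
    (p.copy hu hv).weight F = p.weight F := by
  subst hu hv; rfl

theorem Walk.weight_reverse (hF : ∀ a b, F a b = F b a) {u v : V} (p : G.Walk u v) :
    p.reverse.weight F = p.weight F := by
  induction p with
  | nil => simp
  | cons h p ih => simp [ih, hF, add_comm]

/-- No closed walk has odd weight. -/
def NoOddWalk (G : SimpleGraph V) (F : V → V → ZMod 2) : Prop :=
  ∀ (v : V) (p : G.Walk v v), p.weight F = 0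

theorem zmod_two_cases (a : ZMod 2) : a = 0 ∨ a = 1 := by
  revert a; decide

theorem zmod_two_add_self (a : ZMod 2) : a + a = 0 := by
  revert a; decide

/-- If no closed walk has odd weight, then the weight is the coboundary of a vertex function. -/
theorem NoOddWalk.exists_potential (hF : ∀ a b, F a b = F b a) (h : NoOddWalk G F) :
    ∃ l : V → ZMod 2, ∀ a b, G.Adj a b → F a b = l a + l b := by
  classical
  have hr : ∀ v, G.Reachable (G.connectedComponentMk v).out v := fun v =>
    ConnectedComponent.exact (Quot.out_eq (G.connectedComponentMk v))
  refine ⟨fun v => (hr v).some.weight F, fun a b hab => ?_⟩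
  have hc : (G.connectedComponentMk b).out = (G.connectedComponentMk a).out := by
    rw [ConnectedComponent.connectedComponentMk_eq_of_adj hab]
  -- The potential of a vertex is the weight of a fixed walk from the representative of its
  -- component. The tour from the representative to a, along the edge to b and back is closed, so
  -- its weight vanishes.
  have := h _ (((hr a).some.append (Walk.cons hab Walk.nil)).append
    ((hr b).some.copy hc rfl).reverse)
  rw [Walk.weight_append, Walk.weight_append, Walk.weight_reverse hF] at this
  simp only [Walk.weight_cons, Walk.weight_nil, Walk.weight_copy, add_zero] at this
  exact (by decide : ∀ x y z : ZMod 2, x + z + y = 0 → z = x + y) _ _ _ this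

/-- A walk whose weight differs from the difference of a potential at its ends traverses an edge
at which the potential fails. -/
theorem Walk.exists_odd_edge (l : V → ZMod 2) {u v : V} (p : G.Walk u v)
    (hp : p.weight F ≠ l u + l v) :
    ∃ (a b : V) (p₁ : G.Walk u a) (_ : G.Adj a b) (p₂ : G.Walk b v),
      F a b ≠ l a + l b ∧ p.length = p₁.length + 1 + p₂.length := by
  induction p with
  | nil => exact absurd (zmod_two_add_self _).symm (by simpa using hp)
  | @cons u b v h p ih =>
    by_cases hb : F u b = l u + l b
    · obtain ⟨a, c, p₁, hac, p₂, hne, hl⟩ := ih (by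
        intro h'
        apply hp
        rw [Walk.weight_cons, hb, h']
        generalize l u = x; generalize l b = y; generalize l v = z
        revert x y z; decide)
      exact ⟨a, c, Walk.cons h p₁, hac, p₂, hne, by simp [hl]; ring⟩
    · exact ⟨u, b, Walk.nil, h, p, hb, by simp; ring⟩

/-! ### Closed vertex sequences -/

/-- The weight of a vertex sequence. -/
def seqWeight (F : V → V → ZMod 2) (w : ℕ → V) (s : ℕ) : ZMod 2 :=
  ∑ i ∈ Finset.range s, F (w i) (w (i + 1))

/-- A closed walk given by its sequence of vertices. -/
structure ClosedSeq (G : SimpleGraph V) (w : ℕ → V) (s : ℕ) : Prop where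
  closed : w s = w 0
  adj : ∀ i < s, G.Adj (w i) (w (i + 1))

/-- A closed sequence of odd weight, of the least length among all odd closed walks. -/
structure IsShortestOdd (G : SimpleGraph V) (F : V → V → ZMod 2) (w : ℕ → V) (s : ℕ) : Prop
    extends ClosedSeq G w s where
  odd : seqWeight F w s = 1
  le_length : ∀ (v : V) (p : G.Walk v v), p.weight F = 1 → s ≤ p.length

theorem exists_walk_of_seq {w : ℕ → V} {s : ℕ} (hw : ∀ i < s, G.Adj (w i) (w (i + 1)))
    {i j : ℕ} (hij : i ≤ j) (hj : j ≤ s) :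
    ∃ p : G.Walk (w i) (w j), p.length = j - i ∧
      p.weight F = ∑ t ∈ Finset.Ico i j, F (w t) (w (t + 1)) := by
  induction j, hij using Nat.le_induction with
  | base => exact ⟨Walk.nil, by simp⟩
  | succ j hij ih =>
    obtain ⟨p, hl, hp⟩ := ih (by omega)
    refine ⟨p.append (Walk.cons (hw j (by omega)) Walk.nil), ?_, ?_⟩
    · simp [hl]; omega
    · rw [Finset.sum_Ico_succ_top hij, ← hp]; simp

theorem ClosedSeq.exists_walk {w : ℕ → V} {s : ℕ} (h : ClosedSeq G w s) :
    ∃ p : G.Walk (w 0) (w 0), p.length = s ∧ p.weight F = seqWeight F w s := by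
  obtain ⟨p, hl, hp⟩ := exists_walk_of_seq (F := F) h.adj (Nat.zero_le s) le_rfl
  exact ⟨p.copy rfl h.closed, by simpa using hl, by simp [hp, seqWeight]⟩

namespace IsShortestOdd

variable {w : ℕ → V} {s : ℕ}

/-- A detour `q` shorter than the arc from `w i` to `w j` produces two closed walks: the arc closed
up by `q`, and the rest with the arc replaced by `q`. Their weights add up to 1 because `q` counts
twice, so one of them is odd, while `h₁` and `h₂` make both shorter than `s`. A trivial `q` excludes
repeated vertices, a single edge excludes chords. -/
theorem split (h : IsShortestOdd G F w s) (hF : ∀ a b, F a b = F b a) {i j : ℕ} (hij : i ≤ j)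
    (hj : j ≤ s) (q : G.Walk (w i) (w j)) (h₁ : q.length + (j - i) < s)
    (h₂ : q.length < j - i) : False := by
  obtain ⟨p₁, hl₁, hp₁⟩ := exists_walk_of_seq (F := F) h.adj hij hj
  obtain ⟨p₀, hl₀, hp₀⟩ := exists_walk_of_seq (F := F) h.adj (Nat.zero_le i) (hij.trans hj)
  obtain ⟨p₂, hl₂, hp₂⟩ := exists_walk_of_seq (F := F) h.adj hj le_rfl
  have hs := h.odd
  rw [seqWeight, Finset.range_eq_Ico, ← Finset.sum_Ico_consecutive _ (Nat.zero_le j) hj,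
    ← Finset.sum_Ico_consecutive _ (Nat.zero_le i) hij, ← hp₀, ← hp₁, ← hp₂] at hs
  have e₁ := h.le_length _ (p₁.append q.reverse)
  have e₂ := h.le_length _ ((p₀.append q).append (p₂.copy rfl h.closed))
  rw [Walk.weight_append, Walk.weight_reverse hF] at e₁
  simp only [Walk.weight_append, Walk.weight_copy, Walk.length_append, Walk.length_copy,
    Walk.length_reverse] at e₁ e₂
  have : p₁.weight F + q.weight F = 1 ∨ p₀.weight F + q.weight F + p₂.weight F = 1 := by
    revert hs
    generalize p₀.weight F = a; generalize p₁.weight F = b; generalize p₂.weight F = c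
    generalize q.weight F = d
    revert a b c d; decide
  rcases this with h' | h'
  · have := e₁ h'; omega
  · have := e₂ h'; omega

theorem injOn (h : IsShortestOdd G F w s) (hF : ∀ a b, F a b = F b a) :
    Set.InjOn w (Set.Iio s) := by
  have key : ∀ i j, i < j → j < s → w i ≠ w j := fun i j hij hj he =>
    h.split hF hij.le hj.le (Walk.nil.copy rfl he) (by simp; omega) (by simp; omega)
  intro i hi j hj he
  rcases lt_trichotomy i j with hij | hij | hij
  · exact absurd he (key i j hij hj)
  · exact hij
  · exact absurd he.symm (key j i hij hi)

/-- A closed walk of length two traverses one edge twice and has even weight; length one would be a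
loop. -/
theorem three_le (h : IsShortestOdd G F w s) (hF : ∀ a b, F a b = F b a) : 3 ≤ s := by
  by_contra hs
  have ho := h.odd
  have hc := h.closed
  have ha := h.adj
  interval_cases s
  · simp [seqWeight] at ho
  · exact (ha 0 (by omega)).ne (by simpa using hc.symm)
  · simp only [seqWeight, Finset.sum_range_succ, Finset.sum_range_zero, zero_add] at ho
    rw [show w (1 + 1) = w 0 from hc, hF (w 1), zmod_two_add_self] at ho
    exact absurd ho (by decide)

/-- A single edge is fed to `split`. The two alternatives are exactly the cases in which one of its
length conditions fails: consecutive vertices, and the closing edge. -/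
theorem consecutive_of_adj (h : IsShortestOdd G F w s) (hF : ∀ a b, F a b = F b a) {i j : ℕ}
    (hij : i < j) (hj : j < s) (ha : G.Adj (w i) (w j)) : j = i + 1 ∨ (i = 0 ∧ j + 1 = s) := by
  by_contra hc
  exact h.split hF hij.le hj.le (Walk.cons ha Walk.nil) (by simp; omega) (by simp; omega)

end IsShortestOdd

end SimpleGraph

/-! ### Simple cycles as cyclic vertex sequences -/

namespace SimpleGraph

variable {V : Type*} {G : SimpleGraph V}

/-- The vertices of the simple cycle `C` in cyclic order are `w 0, …, w (s - 1)`. -/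
structure TracesCycle (C : G.Subgraph) (w : ℕ → V) (s : ℕ) : Prop where
  three_le : 3 ≤ s
  closed : w s = w 0
  injOn : Set.InjOn w (Set.Iio s)
  verts : C.verts = w '' Set.Iio s
  adj_iff : ∀ a b, C.Adj a b ↔ ∃ i < s, s(a, b) = s(w i, w (i + 1))

/-- The cyclic predecessor of `i` among `0, …, s - 1`. -/
def cyclicPred (s i : ℕ) : ℕ := if i = 0 then s - 1 else i - 1

namespace TracesCycle

variable {C : G.Subgraph} {w : ℕ → V} {s : ℕ}

theorem ne (h : TracesCycle C w s) {i j : ℕ} (hi : i < s) (hj : j < s) (hij : i ≠ j) :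
    w i ≠ w j := fun e => hij (h.injOn hi hj e)

theorem apply_pred_succ (h : TracesCycle C w s) {i : ℕ} : w (cyclicPred s i + 1) = w i := by
  unfold cyclicPred
  have := h.three_le
  split_ifs with h0
  · rw [Nat.sub_add_cancel (by omega), h.closed, h0]
  · rw [Nat.sub_add_cancel (by omega)]

theorem succ_ne_pred (h : TracesCycle C w s) {i : ℕ} (hi : i < s) :
    w (i + 1) ≠ w (cyclicPred s i) := by
  have := h.three_le
  unfold cyclicPred
  rcases Nat.lt_or_ge (i + 1) s with h1 | h1
  · split_ifs <;> exact h.ne h1 (by omega) (by omega)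
  · rw [show i + 1 = s by omega, h.closed, if_neg (by omega)]
    exact h.ne (by omega) (by omega) (by omega)

theorem neighborSet_eq (h : TracesCycle C w s) {i : ℕ} (hi : i < s) :
    C.neighborSet (w i) = {w (i + 1), w (cyclicPred s i)} := by
  have h3 := h.three_le
  ext b
  rw [Subgraph.mem_neighborSet, h.adj_iff]
  constructor
  · rintro ⟨j, hj, he⟩
    rcases Sym2.eq_iff.1 he with ⟨e, rfl⟩ | ⟨e, rfl⟩
    · rw [h.injOn hi hj e]; simp
    · right
      rcases Nat.lt_or_ge (j + 1) s with h1 | h1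
      · have := h.injOn hi h1 e
        subst this
        simp [cyclicPred]
      · rw [show j + 1 = s by omega, h.closed] at e
        have := h.injOn hi (show 0 < s by omega) e
        subst this
        rw [show j = s - 1 by omega]
        simp [cyclicPred]
  · rintro (rfl | rfl)
    · exact ⟨i, hi, rfl⟩
    · refine ⟨cyclicPred s i, by unfold cyclicPred; split_ifs <;> omega, ?_⟩
      rw [h.apply_pred_succ, Sym2.eq_swap]

theorem adj_succ (h : TracesCycle C w s) {i : ℕ} (hi : i < s) : C.Adj (w i) (w (i + 1)) :=
  (h.adj_iff _ _).2 ⟨i, hi, rfl⟩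

theorem closedSeq (h : TracesCycle C w s) : ClosedSeq G w s :=
  ⟨h.closed, fun _ hi => (h.adj_succ hi).adj_sub⟩

theorem verts_eq_image [DecidableEq V] (h : TracesCycle C w s) :
    C.verts = ((Finset.range s).image w : Finset V) := by
  rw [h.verts]; ext; simp

theorem ncard_verts (h : TracesCycle C w s) : C.verts.ncard = s := by
  classical
  rw [h.verts_eq_image, Set.ncard_coe_finset, Finset.card_image_of_injOn, Finset.card_range]
  intro i hi j hj e
  exact h.injOn (by simpa using hi) (by simpa using hj) e

theorem isSimpleCycle (h : TracesCycle C w s) : IsSimpleCycle C := by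
  have h3 := h.three_le
  have hv : ∀ i < s, w i ∈ C.verts := fun i hi => h.verts ▸ ⟨i, hi, rfl⟩
  refine ⟨⟨?_⟩, fun v hv' => ?_⟩
  · rw [connected_iff_exists_forall_reachable]
    refine ⟨⟨w 0, hv 0 (by omega)⟩, ?_⟩
    rintro ⟨v, hv'⟩
    have hv2 := hv'
    rw [h.verts] at hv2
    obtain ⟨i, hi, rfl⟩ := hv2
    have hi : i < s := hi
    induction i with
    | zero => exact Reachable.refl _
    | succ i ih =>
      refine (ih (show i < s by omega) (hv i (by omega)) (by omega)).trans (Adj.reachable ?_)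
      exact h.adj_succ (by omega)
  · rw [h.verts] at hv'
    obtain ⟨i, hi, rfl⟩ := hv'
    rw [h.neighborSet_eq hi, Set.ncard_pair (h.succ_ne_pred hi)]

/-- The edges of a traced cycle are listed without repetition by its consecutive vertices. -/
theorem edge_injOn (h : TracesCycle C w s) :
    Set.InjOn (fun i => s(w i, w (i + 1))) (Set.Iio s) := by
  have h3 := h.three_le
  intro i hi j hj e
  have hi : i < s := hi
  have hj : j < s := hj
  rcases Sym2.eq_iff.1 e with ⟨e₁, -⟩ | ⟨e₁, e₂⟩
  · exact h.injOn hi hj e₁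
  · exfalso
    have : w (cyclicPred s j) ≠ w (j + 1) := (h.succ_ne_pred hj).symm
    by_cases hj1 : j + 1 = s
    · rw [hj1, h.closed] at e₁
      have := h.injOn hi (show 0 < s by omega) e₁
      subst this
      have := h.injOn (show 0 + 1 < s by omega) hj e₂
      omega
    · have := h.injOn hi (show j + 1 < s by omega) e₁
      subst this
      by_cases hj2 : j + 1 + 1 = s
      · rw [hj2, h.closed] at e₂
        have := h.injOn (show 0 < s by omega) hj e₂
        omega
      · have := h.injOn (show j + 1 + 1 < s by omega) hj e₂
        omega

/-- Pairing the incidence vector of a traced cycle with an edge function. -/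
theorem sum_incidenceVec (h : TracesCycle C w s) [Fintype G.edgeSet] (x : G.edgeSet → ZMod 2)
    (F : V → V → ZMod 2) (hx : ∀ a b (hab : G.Adj a b), F a b = x ⟨s(a, b), hab⟩) :
    ∑ e, incidenceVec C e * x e = seqWeight F w s := by
  classical
  simp only [incidenceVec, ite_mul, one_mul, zero_mul]
  rw [← Finset.sum_filter, seqWeight]
  symm
  refine Finset.sum_bij (fun i hi => (⟨s(w i, w (i + 1)),
    (h.adj_succ (Finset.mem_range.1 hi)).adj_sub⟩ : G.edgeSet)) ?_ ?_ ?_ ?_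
  · intro i hi
    simp only [Finset.mem_filter, Finset.mem_univ, true_and]
    exact h.adj_succ (Finset.mem_range.1 hi)
  · intro i hi j hj e
    exact h.edge_injOn (Finset.mem_range.1 hi) (Finset.mem_range.1 hj) (Subtype.ext_iff.1 e)
  · rintro ⟨e, he⟩ hb
    simp only [Finset.mem_filter, Finset.mem_univ, true_and] at hb
    induction e with
    | _ a b =>
      obtain ⟨i, hi, e⟩ := (h.adj_iff a b).1 hb
      exact ⟨i, Finset.mem_range.2 hi, Subtype.ext e.symm⟩
  · intro i hi
    exact hx _ _ _

end TracesCycle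

/-- All degrees of `C.coe` are two, so a cycle through one vertex fills the component of that
vertex, which is everything by connectedness. -/
theorem exists_tracesCycle [Finite V] {C : G.Subgraph} (hC : IsSimpleCycle C) :
    ∃ (w : ℕ → V) (s : ℕ), TracesCycle C w s := by
  classical
  have hn : ∀ v : C.verts, (C.coe.neighborSet v).ncard = 2 := by
    intro v
    rw [← hC.2 v v.2, ← Set.ncard_image_of_injective _ Subtype.val_injective]
    congr 1
    ext b
    simp only [Set.mem_image, mem_neighborSet, Subgraph.coe_adj, Subtype.exists,
      exists_and_right, exists_eq_right, Subgraph.mem_neighborSet]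
    exact ⟨fun ⟨_, h⟩ => h, fun h => ⟨h.snd_mem, h⟩⟩
  have hcyc : C.coe.IsCycles := fun v _ => hn v
  obtain ⟨v⟩ := hC.1.coe.nonempty
  obtain ⟨p, hp, hv⟩ := hcyc.exists_cycle_toSubgraph_verts_eq_connectedComponentSupp
    (c := C.coe.connectedComponentMk v) rfl
    (Set.nonempty_of_ncard_ne_zero (by rw [hn]; norm_num))
  have h3 := hp.three_le_length
  have hinj : ∀ i < p.length, ∀ j < p.length, p.getVert i = p.getVert j → i = j :=
    fun i hi j hj e => hp.getVert_injOn' (show i ≤ p.length - 1 by omega)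
      (show j ≤ p.length - 1 by omega) e
  have hcl : p.getVert p.length = p.getVert 0 := by simp
  have hsurj : ∀ u : C.verts, ∃ i < p.length, p.getVert i = u := by
    intro u
    have : u ∈ p.toSubgraph.verts := by
      rw [hv, ConnectedComponent.mem_supp_iff, ConnectedComponent.eq]
      exact hC.1.coe.preconnected _ _
    rw [Walk.mem_verts_toSubgraph, Walk.mem_support_iff_exists_getVert] at this
    obtain ⟨i, rfl, hi⟩ := this
    rcases hi.lt_or_eq with hi | rfl
    · exact ⟨i, hi, rfl⟩
    · exact ⟨0, by omega, hcl.symm⟩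
  refine ⟨fun i => p.getVert i, p.length, h3, by simp, ?_, ?_, ?_⟩
  · intro i hi j hj e
    exact hinj i hi j hj (Subtype.ext e)
  · ext u
    constructor
    · intro hu
      obtain ⟨i, hi, e⟩ := hsurj ⟨u, hu⟩
      exact ⟨i, hi, by simp [e]⟩
    · rintro ⟨i, -, rfl⟩
      exact (p.getVert i).2
  · intro a b
    constructor
    · intro hab
      -- The walk uses two edges at each of its vertices and `C` has only two there, so every edge
      -- of `C` lies on the walk.
      have hs : C.coe.neighborSet ⟨a, hab.fst_mem⟩ = p.toSubgraph.neighborSet ⟨a, hab.fst_mem⟩ := by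
        symm
        refine Set.eq_of_subset_of_ncard_le (Subgraph.neighborSet_subset _ _) ?_ (Set.toFinite _)
        rw [hn, hp.ncard_neighborSet_toSubgraph_eq_two]
        obtain ⟨i, hi, e⟩ := hsurj ⟨a, hab.fst_mem⟩
        exact e ▸ p.getVert_mem_support i
      have : (⟨b, hab.snd_mem⟩ : C.verts) ∈ C.coe.neighborSet ⟨a, hab.fst_mem⟩ := hab
      rw [hs, Subgraph.mem_neighborSet, Walk.toSubgraph_adj_iff] at this
      obtain ⟨i, e, hi⟩ := this
      refine ⟨i, hi, ?_⟩
      have := congrArg (Sym2.map Subtype.val) e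
      simpa using this.symm
    · rintro ⟨i, hi, e⟩
      have hadj : C.Adj (p.getVert i) (p.getVert (i + 1)) := p.adj_getVert_succ hi
      rcases Sym2.eq_iff.1 e with ⟨rfl, rfl⟩ | ⟨rfl, rfl⟩
      · exact hadj
      · exact hadj.symm

/-- Without chords, the subgraph induced by the vertices of the walk has no edges besides those of
the walk. -/
theorem IsShortestOdd.tracesCycle {F : V → V → ZMod 2} {w : ℕ → V} {s : ℕ}
    (h : IsShortestOdd G F w s) (hF : ∀ a b, F a b = F b a) :
    TracesCycle ((⊤ : G.Subgraph).induce (w '' Set.Iio s)) w s := by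
  have h3 := h.three_le hF
  refine ⟨h3, h.closed, h.injOn hF, rfl, fun a b => ?_⟩
  rw [Subgraph.induce_adj, Subgraph.top_adj]
  have key : ∀ i j, i < j → j < s → G.Adj (w i) (w j) →
      ∃ k < s, s(w i, w j) = s(w k, w (k + 1)) := by
    intro i j hij hj ha
    rcases h.consecutive_of_adj hF hij hj ha with rfl | ⟨rfl, e⟩
    · exact ⟨i, by omega, rfl⟩
    · exact ⟨j, hj, by rw [e, h.closed, Sym2.eq_swap]⟩
  constructor
  · rintro ⟨⟨i, hi, rfl⟩, ⟨j, hj, rfl⟩, ha⟩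
    rcases lt_trichotomy i j with hij | rfl | hij
    · exact key i j hij hj ha
    · exact absurd rfl ha.ne
    · rw [Sym2.eq_swap]; exact key j i hij hi ha.symm
  · rintro ⟨i, hi, e⟩
    have h1 : w (i + 1) ∈ w '' Set.Iio s := by
      rcases Nat.lt_or_ge (i + 1) s with h1 | h1
      · exact ⟨_, h1, rfl⟩
      · rw [show i + 1 = s by omega, h.closed]; exact ⟨0, by simp; omega, rfl⟩
    rcases Sym2.eq_iff.1 e with ⟨rfl, rfl⟩ | ⟨rfl, rfl⟩
    · exact ⟨⟨i, hi, rfl⟩, h1, h.adj i hi⟩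
    · exact ⟨h1, ⟨i, hi, rfl⟩, (h.adj i hi).symm⟩

theorem induce_top_isInduced (S : Set V) : ((⊤ : G.Subgraph).induce S).IsInduced := by
  intro a ha b hb hab
  exact ⟨ha, hb, hab⟩

end SimpleGraph

/-! ### The annihilator of the cycle space and the witness criterion -/

namespace SimpleGraph

variable {V : Type*} {G : SimpleGraph V}

open scoped Classical in
/-- An edge function as a symmetric function of pairs of vertices, `0` on non-edges. -/
noncomputable def edgeFun (x : G.edgeSet → ZMod 2) (a b : V) : ZMod 2 :=
  if h : G.Adj a b then x ⟨s(a, b), h⟩ else 0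

theorem edgeFun_of_adj (x : G.edgeSet → ZMod 2) {a b : V} (h : G.Adj a b) :
    edgeFun x a b = x ⟨s(a, b), h⟩ := dif_pos h

theorem edgeFun_comm (x : G.edgeSet → ZMod 2) (a b : V) : edgeFun x a b = edgeFun x b a := by
  by_cases h : G.Adj a b
  · rw [edgeFun_of_adj x h, edgeFun_of_adj x h.symm]
    congr 2
    exact Sym2.eq_swap
  · rw [edgeFun, edgeFun, dif_neg h, dif_neg fun h' => h h'.symm]

theorem _root_.IsSimpleCycle.isEvenCycle {C : G.Subgraph} (h : IsSimpleCycle C) : IsEvenCycle C :=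
  ⟨h.1, fun v hv => by rw [h.2 v hv]; exact even_two⟩

theorem _root_.IsSimpleCycle.incidenceVec_mem {C : G.Subgraph} (h : IsSimpleCycle C) :
    incidenceVec C ∈ cycleSpace G :=
  Submodule.subset_span ⟨C, h.isEvenCycle, rfl⟩

theorem Walk.weight_eq_seqWeight {F : V → V → ZMod 2} {u v : V} (p : G.Walk u v) :
    p.weight F = seqWeight F p.getVert p.length := by
  induction p with
  | nil => simp [seqWeight]
  | cons hab p ih =>
    rw [Walk.weight_cons, seqWeight, Walk.length_cons, Finset.sum_range_succ', add_comm, ih]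
    simp [seqWeight]

theorem exists_isShortestOdd {F : V → V → ZMod 2} (h : ¬ NoOddWalk G F) :
    ∃ w s, IsShortestOdd G F w s := by
  classical
  have hex : ∃ n, ∃ (v : V) (p : G.Walk v v), p.weight F = 1 ∧ p.length = n := by
    simp only [NoOddWalk, not_forall] at h
    obtain ⟨v, p, hp⟩ := h
    exact ⟨_, v, p, (zmod_two_cases _).resolve_left hp, rfl⟩
  obtain ⟨v, p, hp, hl⟩ := Nat.find_spec hex
  refine ⟨p.getVert, p.length, ⟨by simp, fun i hi => p.adj_getVert_succ hi⟩, ?_, ?_⟩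
  · rw [← hp, p.weight_eq_seqWeight]
  · intro u q hq
    rw [hl]
    exact Nat.find_min' hex ⟨u, q, hq, rfl⟩

variable [Fintype G.edgeSet]

/-- The bilinear pairing of edge functions. -/
def edgePairing (c x : G.edgeSet → ZMod 2) : ZMod 2 := ∑ e, c e * x e

/-- Coboundaries are orthogonal to even subgraphs: the sum of l a + l b over the edges of `C` counts
`l v` once for each edge of `C` at `v`, an even number of times. -/
theorem edgePairing_incidenceVec_potential [Fintype V] {C : G.Subgraph} (hC : IsEvenCycle C)
    (x : G.edgeSet → ZMod 2) (l : V → ZMod 2)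
    (hx : ∀ a b (h : G.Adj a b), x ⟨s(a, b), h⟩ = l a + l b) :
    edgePairing (incidenceVec C) x = 0 := by
  classical
  have h1 : ∀ e : G.edgeSet, x e = ∑ v, if v ∈ e.1 then l v else 0 := by
    rintro ⟨e, he⟩
    induction e with
    | _ a b =>
      have hab : a ≠ b := G.ne_of_adj he
      rw [hx a b he, ← Finset.sum_filter]
      have : (Finset.univ.filter fun v => v ∈ s(a, b)) = {a, b} := by ext v; simp
      rw [this, Finset.sum_pair hab]
  have h2 : ∀ v, ∑ e : G.edgeSet, incidenceVec C e * (if v ∈ e.1 then l v else 0) =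
      ((C.neighborSet v).ncard : ZMod 2) * l v := by
    intro v
    have : ∀ e : G.edgeSet, incidenceVec C e * (if v ∈ e.1 then l v else 0) =
        if e.1 ∈ C.edgeSet ∧ v ∈ e.1 then l v else 0 := by
      intro e; unfold incidenceVec; split_ifs <;> simp_all
    simp only [this]
    rw [← Finset.sum_filter, Finset.sum_const, nsmul_eq_mul, Set.ncard_eq_toFinset_card']
    congr 2
    symm
    refine Finset.card_bij (fun u hu => ⟨s(v, u), (show C.Adj v u by simpa using hu).adj_sub⟩)
      ?_ ?_ ?_
    · intro u hu
      have : C.Adj v u := by simpa using hu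
      simpa using this
    · intro u hu u' hu' e
      exact Sym2.congr_right.1 (Subtype.ext_iff.1 e)
    · rintro ⟨e, he⟩ h
      simp only [Finset.mem_filter, Finset.mem_univ, true_and] at h
      obtain ⟨u, rfl⟩ := Sym2.mem_iff_exists.1 h.2
      exact ⟨u, by simpa using h.1, rfl⟩
  unfold edgePairing
  simp only [h1, Finset.mul_sum]
  rw [Finset.sum_comm]
  refine Finset.sum_eq_zero fun v _ => ?_
  rw [h2]
  by_cases hv : v ∈ C.verts
  · obtain ⟨k, hk⟩ := hC.2 v hv
    rw [hk, Nat.cast_add, zmod_two_add_self, zero_mul]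
  · have : C.neighborSet v = ∅ := by
      ext u
      simp only [Subgraph.mem_neighborSet, Set.mem_empty_iff_false, iff_false]
      exact fun h => hv h.fst_mem
    simp [this]

theorem edgePairing_add_left (c c' x : G.edgeSet → ZMod 2) :
    edgePairing (c + c') x = edgePairing c x + edgePairing c' x := by
  simp [edgePairing, add_mul, Finset.sum_add_distrib]

theorem edgePairing_smul_left (a : ZMod 2) (c x : G.edgeSet → ZMod 2) :
    edgePairing (a • c) x = a * edgePairing c x := by
  simp [edgePairing, Finset.mul_sum, mul_assoc]

/-- The pairing with `x` as a linear functional. -/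
def edgePairingLeft (x : G.edgeSet → ZMod 2) : (G.edgeSet → ZMod 2) →ₗ[ZMod 2] ZMod 2 where
  toFun c := edgePairing c x
  map_add' c c' := edgePairing_add_left c c' x
  map_smul' a c := edgePairing_smul_left a c x

/-- Together with `noOddWalk_of_edgePairing` this describes the annihilator of the cycle space: `x`
annihilates it iff no closed walk is odd for `x`, iff `x` is a coboundary. -/
theorem NoOddWalk.edgePairing_eq_zero [Fintype V] {x : G.edgeSet → ZMod 2}
    (h : NoOddWalk G (edgeFun x)) {c : G.edgeSet → ZMod 2} (hc : c ∈ cycleSpace G) :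
    edgePairing c x = 0 := by
  obtain ⟨l, hl⟩ := h.exists_potential (edgeFun_comm x)
  have : cycleSpace G ≤ LinearMap.ker (edgePairingLeft x) := by
    refine Submodule.span_le.2 ?_
    rintro _ ⟨C, hC, rfl⟩
    exact edgePairing_incidenceVec_potential hC x l fun a b h => by
      rw [← edgeFun_of_adj x h, hl a b h]
  exact this hc

theorem TracesCycle.edgePairing_eq {C : G.Subgraph} {w : ℕ → V} {s : ℕ} (h : TracesCycle C w s)
    (x : G.edgeSet → ZMod 2) :
    edgePairing (incidenceVec C) x = seqWeight (edgeFun x) w s :=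
  h.sum_incidenceVec x _ fun _ _ h => edgeFun_of_adj x h

theorem IsShortestOdd.edgePairing_eq_one {x : G.edgeSet → ZMod 2} {w : ℕ → V} {s : ℕ}
    (h : IsShortestOdd G (edgeFun x) w s) :
    edgePairing (incidenceVec ((⊤ : G.Subgraph).induce (w '' Set.Iio s))) x = 1 := by
  rw [(h.tracesCycle (edgeFun_comm x)).edgePairing_eq, h.odd]

/-- If some closed walk were odd, a shortest one would be a simple cycle, hence a member of the
cycle space that pairs to 1 with `x`. -/
theorem noOddWalk_of_edgePairing {x : G.edgeSet → ZMod 2}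
    (h : ∀ c ∈ cycleSpace G, edgePairing c x = 0) : NoOddWalk G (edgeFun x) := by
  by_contra hn
  obtain ⟨w, s, hw⟩ := exists_isShortestOdd hn
  have := h _ (hw.tracesCycle (edgeFun_comm x)).isSimpleCycle.incidenceVec_mem
  rw [hw.edgePairing_eq_one] at this
  exact one_ne_zero this

/-- The cycles that a triangular family of witnesses selects as shortest odd closed walks form a
shortest maximal cycle basis. -/
theorem isShortestMaximalCycleBasis_of_witnesses [Fintype V] {ν : ℕ}
    (x : Fin ν → G.edgeSet → ZMod 2) (w : Fin ν → ℕ → V) (s : Fin ν → ℕ)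
    (hw : ∀ f, IsShortestOdd G (edgeFun (x f)) (w f) (s f))
    (htri : ∀ f g, f < g → seqWeight (edgeFun (x g)) (w f) (s f) = 0)
    (T : Set (G.edgeSet → ZMod 2)) (hT : ∀ t ∈ T, NoOddWalk G (edgeFun t))
    (hspan : ∀ z, (∀ f, edgePairing z (x f) = 0) → (∀ t ∈ T, edgePairing z t = 0) → z = 0) :
    IsShortestMaximalCycleBasis
      (fun f => (⊤ : G.Subgraph).induce (w f '' Set.Iio (s f))) := by
  classical
  set C : Fin ν → G.Subgraph := fun f => (⊤ : G.Subgraph).induce (w f '' Set.Iio (s f)) with hCdef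
  have hC : ∀ f, TracesCycle (C f) (w f) (s f) := fun f => (hw f).tracesCycle (edgeFun_comm _)
  let Φ : (G.edgeSet → ZMod 2) →ₗ[ZMod 2] (Fin ν → ZMod 2) :=
    LinearMap.pi fun g => edgePairingLeft (x g)
  have hΦ : ∀ c g, Φ c g = edgePairing c (x g) := fun c g => rfl
  have hli : LinearIndependent (ZMod 2) fun f => incidenceVec (C f) := by
    refine LinearIndependent.of_comp Φ ?_
    let A : Matrix (Fin ν) (Fin ν) (ZMod 2) := fun f g => Φ (incidenceVec (C f)) g
    -- Each cycle pairs to 1 with its own witness and to 0 with every later one, so the matrix of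
    -- pairings is unitriangular.
    have hA : A.det = 1 := by
      rw [Matrix.det_of_isLowerTriangular A]
      · exact Finset.prod_eq_one fun f _ => (hw f).edgePairing_eq_one
      · intro f g hfg
        change Φ (incidenceVec (C f)) g = 0
        rw [hΦ, (hC f).edgePairing_eq]
        exact htri f g (OrderDual.toDual_lt_toDual.1 hfg)
    have : IsUnit A := by rw [Matrix.isUnit_iff_isUnit_det, hA]; exact isUnit_one
    exact Matrix.linearIndependent_rows_iff_isUnit.2 this
  have hle : Submodule.span (ZMod 2) (Set.range fun f => incidenceVec (C f)) ≤ cycleSpace G := by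
    refine Submodule.span_le.2 ?_
    rintro _ ⟨f, rfl⟩
    exact (hC f).isSimpleCycle.incidenceVec_mem
  have hbasis : IsCycleBasis C := by
    refine ⟨fun f => (hC f).isSimpleCycle, hli, Submodule.eq_of_le_of_finrank_le hle ?_⟩
    rw [finrank_span_eq_card hli, Fintype.card_fin]
    -- The vectors in `T` annihilate the cycle space, so by `hspan` a member of that space is
    -- determined by its pairings with the `ν` witnesses. This bounds the dimension by `ν`, and `ν`
    -- independent cycles must span.
    have hinj : Function.Injective (Φ ∘ₗ (cycleSpace G).subtype) := by
      rw [← LinearMap.ker_eq_bot, LinearMap.ker_eq_bot']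
      rintro ⟨c, hc⟩ h0
      have : c = 0 := by
        refine hspan c (fun f => ?_) fun t ht => (hT t ht).edgePairing_eq_zero hc
        rw [← hΦ]
        exact congrFun h0 f
      exact Subtype.ext this
    have := LinearMap.finrank_le_finrank_of_injective hinj
    simpa using this
  -- Any finite length bound serves here: it shows that the infimum in `cycleSparsity` is over a
  -- nonempty set, hence attained.
  have hind : IsInducedCycleBasis C (Finset.univ.sup s) := by
    refine ⟨hbasis, fun f => ⟨induce_top_isInduced _, ?_⟩⟩
    rw [(hC f).ncard_verts]
    exact Finset.le_sup (Finset.mem_univ f)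
  refine ⟨hbasis, fun f => ⟨induce_top_isInduced _, ?_⟩⟩
  have hmem : incidenceVec (C f) ∈ cycleSpace G := (hC f).isSimpleCycle.incidenceVec_mem
  have hne : cycleSpace G ≠ ⊥ := by
    intro hbot
    have h1 := (hw f).edgePairing_eq_one
    rw [hbot, Submodule.mem_bot] at hmem
    change edgePairing (incidenceVec (C f)) _ = 1 at h1
    rw [hmem] at h1
    simp [edgePairing] at h1
  rw [cycleSparsity, if_neg hne]
  obtain ⟨ν', C', hC'⟩ := Nat.sInf_mem (s := {l : ℕ | ∃ (ν : ℕ) (C : Fin ν → G.Subgraph),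
    IsInducedCycleBasis C l}) ⟨_, ν, C, hind⟩
  -- If all cycles of an optimal basis were even for `x f`, then `x f` would annihilate the whole
  -- cycle space, including `C f`. An odd one among them is a closed walk against which `C f` is
  -- shortest.
  have : ∃ g, edgePairing (incidenceVec (C' g)) (x f) ≠ 0 := by
    by_contra! hz
    have : Submodule.span (ZMod 2) (Set.range fun i => incidenceVec (C' i)) ≤
        LinearMap.ker (edgePairingLeft (x f)) := by
      refine Submodule.span_le.2 ?_
      rintro _ ⟨g, rfl⟩
      exact hz g
    rw [hC'.1.2.2] at this
    have h0 : edgePairing (incidenceVec (C f)) (x f) = 0 := this hmem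
    have h1 : edgePairing (incidenceVec (C f)) (x f) = 1 := (hw f).edgePairing_eq_one
    rw [h1] at h0
    exact one_ne_zero h0
  obtain ⟨g, hg⟩ := this
  obtain ⟨w', s', hws⟩ := exists_tracesCycle (hC'.1.1 g)
  obtain ⟨p, hpl, hpw⟩ := hws.closedSeq.exists_walk (F := edgeFun (x f))
  rw [hws.edgePairing_eq] at hg
  have := (hw f).le_length _ p (hpw.trans ((zmod_two_cases _).resolve_left hg))
  rw [(hC f).ncard_verts]
  refine this.trans (hpl.le.trans ?_)
  rw [← hws.ncard_verts]
  exact (hC'.2 g).2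

end SimpleGraph

/-! ### Reasoning about programs -/

@[simp] theorem arrWrite_apply {β : Type*} (A : ℕ → ℕ → ℕ → β) (a i j : ℕ) (v : β) (b k l : ℕ) :
    arrWrite A a i j v b k l = if b = a ∧ k = i ∧ l = j then v else A b k l := by
  unfold arrWrite
  by_cases hb : b = a
  · subst hb
    by_cases hk : k = i
    · subst hk
      by_cases hl : l = j
      · subst hl; simp
      · simp [hl]
    · simp [hk]
  · simp [hb]

theorem arrWrite_of_ne {β : Type*} (A : ℕ → ℕ → ℕ → β) {a b : ℕ} (h : b ≠ a) (i j : ℕ) (v : β) :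
    arrWrite A a i j v b = A b := by
  funext k l; simp [h]

theorem arrWrite_row_of_ne {β : Type*} (A : ℕ → ℕ → ℕ → β) (a b : ℕ) {i k : ℕ} (h : k ≠ i)
    (j : ℕ) (v : β) : arrWrite A a i j v b k = A b k := by
  funext l; simp [h]

namespace Prog

/-- Programs without loops. -/
def Straight : Prog → Prop
  | skip | setNat _ _ | putNat _ _ _ _ | setReal _ _ | putReal _ _ _ _ => True
  | seq p q | cond _ p q => p.Straight ∧ q.Straight
  | loop _ _ => False

open scoped Classical in
/-- The effect of a loop-free program. -/
noncomputable def sem : Prog → MState → MState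
  | skip, σ => σ
  | setNat x e, σ => { σ with natVar := Function.update σ.natVar x (e.eval σ) }
  | putNat a e₁ e₂ e, σ =>
      { σ with natArr := arrWrite σ.natArr a (e₁.eval σ) (e₂.eval σ) (e.eval σ) }
  | setReal x r, σ => { σ with realVar := Function.update σ.realVar x (r.eval σ) }
  | putReal a e₁ e₂ r, σ =>
      { σ with realArr := arrWrite σ.realArr a (e₁.eval σ) (e₂.eval σ) (r.eval σ) }
  | seq p q, σ => q.sem (p.sem σ)
  | cond b p q, σ => if b.eval σ then p.sem σ else q.sem σ
  | loop _ _, σ => σ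

/-- A bound for the number of steps of a loop-free program. -/
def time : Prog → ℕ
  | skip => 1
  | setNat _ e => e.cost + 1
  | putNat _ e₁ e₂ e => e₁.cost + e₂.cost + e.cost + 1
  | setReal _ r => r.cost + 1
  | putReal _ e₁ e₂ r => e₁.cost + e₂.cost + r.cost + 1
  | seq p q => p.time + q.time
  | cond b p q => b.cost + 1 + max p.time q.time
  | loop _ _ => 0

theorem Straight.exec {p : Prog} (hp : p.Straight) (σ : MState) :
    ∃ t, Exec p σ t (p.sem σ) ∧ t ≤ p.time := by
  induction p generalizing σ with
  | skip => exact ⟨_, .skip σ, le_rfl⟩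
  | setNat x e => exact ⟨_, .setNat x e σ, le_rfl⟩
  | putNat a e₁ e₂ e => exact ⟨_, .putNat a e₁ e₂ e σ, le_rfl⟩
  | setReal x r => exact ⟨_, .setReal x r σ, le_rfl⟩
  | putReal a e₁ e₂ r => exact ⟨_, .putReal a e₁ e₂ r σ, le_rfl⟩
  | seq p q ihp ihq =>
    obtain ⟨s, hs, hs'⟩ := ihp hp.1 σ
    obtain ⟨t, ht, ht'⟩ := ihq hp.2 (p.sem σ)
    exact ⟨s + t, .seq hs ht, Nat.add_le_add hs' ht'⟩
  | cond b p q ihp ihq =>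
    by_cases hb : b.eval σ
    · obtain ⟨s, hs, hs'⟩ := ihp hp.1 σ
      refine ⟨_, by rw [sem, if_pos hb]; exact .condTrue q hb hs, ?_⟩
      simp only [time]; omega
    · obtain ⟨s, hs, hs'⟩ := ihq hp.2 σ
      refine ⟨_, by rw [sem, if_neg hb]; exact .condFalse p hb hs, ?_⟩
      simp only [time]; omega
  | loop b p => exact hp.elim

/-- Whether the program assigns to the integer variable `x`. -/
def setsNat (x : ℕ) : Prog → Bool
  | setNat y _ => x == y
  | seq p q | cond _ p q => p.setsNat x || q.setsNat x
  | loop _ p => p.setsNat x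
  | _ => false

/-- Whether the program assigns to the real variable `x`. -/
def setsReal (x : ℕ) : Prog → Bool
  | setReal y _ => x == y
  | seq p q | cond _ p q => p.setsReal x || q.setsReal x
  | loop _ p => p.setsReal x
  | _ => false

/-- Whether the program writes to the integer array `a`. -/
def putsNat (a : ℕ) : Prog → Bool
  | putNat b _ _ _ => a == b
  | seq p q | cond _ p q => p.putsNat a || q.putsNat a
  | loop _ p => p.putsNat a
  | _ => false

/-- Whether the program writes to the real array `a`. -/
def putsReal (a : ℕ) : Prog → Bool
  | putReal b _ _ _ => a == b
  | seq p q | cond _ p q => p.putsReal a || q.putsReal a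
  | loop _ p => p.putsReal a
  | _ => false

/-- Whether every write of the program to an array named `a` has the integer variable `x` as its
row index. -/
def rowOnly (x a : ℕ) : Prog → Bool
  | putNat b (.var y) _ _ | putReal b (.var y) _ _ => x == y || !(a == b)
  | putNat b _ _ _ | putReal b _ _ _ => !(a == b)
  | setNat y _ => !(x == y)
  | seq p q | cond _ p q => p.rowOnly x a && q.rowOnly x a
  | loop _ p => p.rowOnly x a
  | _ => true

end Prog

/-- `τ` agrees with `σ` on all cells that `p` does not write. -/
structure Frame (p : Prog) (σ τ : MState) : Prop where
  natVar : ∀ x, p.setsNat x = false → τ.natVar x = σ.natVar x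
  natArr : ∀ a, p.putsNat a = false → τ.natArr a = σ.natArr a
  realVar : ∀ x, p.setsReal x = false → τ.realVar x = σ.realVar x
  realArr : ∀ a, p.putsReal a = false → τ.realArr a = σ.realArr a
  natRow : ∀ x a, p.rowOnly x a = true → ∀ q, q ≠ σ.natVar x → τ.natArr a q = σ.natArr a q
  realRow : ∀ x a, p.rowOnly x a = true → ∀ q, q ≠ σ.natVar x → τ.realArr a q = σ.realArr a q

namespace Prog

/-- The index variable is never reassigned, so "the row with index `x`" denotes one and the same row
during the whole run; this is what makes the row clauses of `Frame` transitive. -/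
theorem setsNat_of_rowOnly {x a : ℕ} {p : Prog} (h : p.rowOnly x a = true) : p.setsNat x = false := by
  induction p with
  | setNat y e => simpa [rowOnly, setsNat] using h
  | seq p q ihp ihq =>
    simp only [rowOnly, Bool.and_eq_true] at h
    simp [setsNat, ihp h.1, ihq h.2]
  | cond b p q ihp ihq =>
    simp only [rowOnly, Bool.and_eq_true] at h
    simp [setsNat, ihp h.1, ihq h.2]
  | loop b p ih => exact ih h
  | _ => rfl

end Prog

namespace Frame

theorem refl (p : Prog) (σ : MState) : Frame p σ σ := by constructor <;> intros <;> rfl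

theorem trans {p : Prog} {σ τ υ : MState} (h : Frame p σ τ) (h' : Frame p τ υ) : Frame p σ υ where
  natVar x hx := (h'.natVar x hx).trans (h.natVar x hx)
  natArr a ha := (h'.natArr a ha).trans (h.natArr a ha)
  realVar x hx := (h'.realVar x hx).trans (h.realVar x hx)
  realArr a ha := (h'.realArr a ha).trans (h.realArr a ha)
  natRow x a hx q hq := (h'.natRow x a hx q (by
    rwa [h.natVar x (Prog.setsNat_of_rowOnly hx)])).trans (h.natRow x a hx q hq)
  realRow x a hx q hq := (h'.realRow x a hx q (by
    rwa [h.natVar x (Prog.setsNat_of_rowOnly hx)])).trans (h.realRow x a hx q hq)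

theorem weaken {p q : Prog} {σ τ : MState} (h : Frame p σ τ)
    (h₁ : ∀ x, q.setsNat x = false → p.setsNat x = false)
    (h₂ : ∀ x, q.putsNat x = false → p.putsNat x = false)
    (h₃ : ∀ x, q.setsReal x = false → p.setsReal x = false)
    (h₄ : ∀ x, q.putsReal x = false → p.putsReal x = false)
    (h₅ : ∀ x a, q.rowOnly x a = true → p.rowOnly x a = true) : Frame q σ τ where
  natVar x hx := h.natVar x (h₁ x hx)
  natArr a ha := h.natArr a (h₂ a ha)
  realVar x hx := h.realVar x (h₃ x hx)
  realArr a ha := h.realArr a (h₄ a ha)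
  natRow x a hx := h.natRow x a (h₅ x a hx)
  realRow x a hx := h.realRow x a (h₅ x a hx)

theorem seq_left {p : Prog} (q : Prog) {σ τ : MState} (h : Frame p σ τ) : Frame (.seq p q) σ τ := by
  apply h.weaken <;> intros <;>
    simp_all [Prog.setsNat, Prog.putsNat, Prog.setsReal, Prog.putsReal, Prog.rowOnly]

theorem seq_right (p : Prog) {q : Prog} {σ τ : MState} (h : Frame q σ τ) :
    Frame (.seq p q) σ τ := by
  apply h.weaken <;> intros <;>
    simp_all [Prog.setsNat, Prog.putsNat, Prog.setsReal, Prog.putsReal, Prog.rowOnly]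

theorem loop {b : BExp} {p : Prog} {σ τ : MState} (h : Frame p σ τ) : Frame (.loop b p) σ τ := by
  apply h.weaken <;> intros <;>
    simp_all [Prog.setsNat, Prog.putsNat, Prog.setsReal, Prog.putsReal, Prog.rowOnly]

end Frame

/-- The write sets are Boolean functions of the syntax. Hence the survival of a cell through a
concrete piece of program is this lemma applied to `rfl`, which is how state is carried along in all
specifications. -/
theorem Exec.frame {p : Prog} {σ τ : MState} {t : ℕ} (h : Exec p σ t τ) : Frame p σ τ := by
  induction h with
  | skip σ => exact .refl _ _
  | setNat x e σ =>
    constructor <;> intros <;> simp_all [Prog.setsNat]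
  | putNat a e₁ e₂ e σ =>
    constructor
    · intros; rfl
    · intro b hb
      exact arrWrite_of_ne _ (by simpa [Prog.putsNat] using hb) _ _ _
    · intros; rfl
    · intros; rfl
    · intro x b hx q hq
      by_cases hb : b = a
      · cases e₁ with
        | var y =>
          have : x = y := by simpa [Prog.rowOnly, hb] using hx
          subst this
          exact arrWrite_row_of_ne _ _ _ hq _ _
        | _ => simp [Prog.rowOnly, hb] at hx
      · exact congrFun (arrWrite_of_ne _ hb _ _ _) q
    · intros; rfl
  | setReal x r σ =>
    constructor <;> intros <;> simp_all [Prog.setsReal]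
  | putReal a e₁ e₂ r σ =>
    constructor
    · intros; rfl
    · intros; rfl
    · intros; rfl
    · intro b hb
      exact arrWrite_of_ne _ (by simpa [Prog.putsReal] using hb) _ _ _
    · intros; rfl
    · intro x b hx q hq
      by_cases hb : b = a
      · cases e₁ with
        | var y =>
          have : x = y := by simpa [Prog.rowOnly, hb] using hx
          subst this
          exact arrWrite_row_of_ne _ _ _ hq _ _
        | _ => simp [Prog.rowOnly, hb] at hx
      · exact congrFun (arrWrite_of_ne _ hb _ _ _) q
  | seq hp hq ihp ihq => exact (ihp.seq_left _).trans (ihq.seq_right _)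
  | condTrue q hb hp ih =>
    apply ih.weaken <;> intros <;>
      simp_all [Prog.setsNat, Prog.putsNat, Prog.setsReal, Prog.putsReal, Prog.rowOnly]
  | condFalse p hb hq ih =>
    apply ih.weaken <;> intros <;>
      simp_all [Prog.setsNat, Prog.putsNat, Prog.setsReal, Prog.putsReal, Prog.rowOnly]
  | loopTrue hb hp hl ihp ihl => exact ihp.loop.trans ihl
  | loopFalse p hb => exact .refl _ _

/-- Started in `σ`, the program halts after at most `T` steps in a state that satisfies `Q`. -/
def Runs (p : Prog) (σ : MState) (T : ℕ) (Q : MState → Prop) : Prop :=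
  ∃ t τ, Exec p σ t τ ∧ t ≤ T ∧ Q τ

namespace Runs

variable {p q : Prog} {σ : MState} {T T' : ℕ} {Q Q' : MState → Prop}

theorem mono (h : Runs p σ T Q) (hT : T ≤ T') (hQ : ∀ τ, Frame p σ τ → Q τ → Q' τ) :
    Runs p σ T' Q' := by
  obtain ⟨t, τ, he, ht, hq⟩ := h
  exact ⟨t, τ, he, ht.trans hT, hQ τ he.frame hq⟩

theorem straight (hp : p.Straight) (hT : p.time ≤ T) (hQ : Q (p.sem σ)) : Runs p σ T Q := by
  obtain ⟨t, he, ht⟩ := hp.exec σ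
  exact ⟨t, _, he, ht.trans hT, hQ⟩

theorem seq {T₁ T₂ : ℕ} (hp : Runs p σ T₁ Q')
    (hq : ∀ τ, Frame p σ τ → Q' τ → Runs q τ T₂ Q) (hT : T₁ + T₂ ≤ T) :
    Runs (.seq p q) σ T Q := by
  obtain ⟨t, τ, he, ht, hτ⟩ := hp
  obtain ⟨t', υ, he', ht', hυ⟩ := hq τ he.frame hτ
  exact ⟨t + t', υ, .seq he he', by omega, hυ⟩

theorem cond {b : BExp} (hp : b.eval σ → Runs p σ T Q) (hq : ¬ b.eval σ → Runs q σ T Q)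
    (hT : b.cost + 1 + T ≤ T') : Runs (.cond b p q) σ T' Q := by
  by_cases hb : b.eval σ
  · obtain ⟨t, τ, he, ht, hτ⟩ := hp hb
    exact ⟨_, τ, .condTrue q hb he, by omega, hτ⟩
  · obtain ⟨t, τ, he, ht, hτ⟩ := hq hb
    exact ⟨_, τ, .condFalse p hb he, by omega, hτ⟩

end Runs

/-- `for x < hi do p`. -/
def Prog.forLoop (x : ℕ) (hi : NExp) (p : Prog) : Prog :=
  .seq (.setNat x (.const 0))
    (.loop (.natLt (.var x) hi) (.seq p (.setNat x (.succ (.var x)))))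

/-- The state with the integer variable `x` set to `v`. -/
def MState.withNat (σ : MState) (x v : ℕ) : MState :=
  { σ with natVar := Function.update σ.natVar x v }

namespace MState

variable (σ : MState) (x v : ℕ)

@[simp] theorem withNat_natVar_self : (σ.withNat x v).natVar x = v := by simp [withNat]
theorem withNat_natVar_of_ne {y : ℕ} (h : y ≠ x) : (σ.withNat x v).natVar y = σ.natVar y := by
  simp [withNat, h]
@[simp] theorem withNat_natArr : (σ.withNat x v).natArr = σ.natArr := rfl
@[simp] theorem withNat_realVar : (σ.withNat x v).realVar = σ.realVar := rfl
@[simp] theorem withNat_realArr : (σ.withNat x v).realArr = σ.realArr := rfl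

end MState

theorem Frame.withNat {p : Prog} {σ τ : MState} (h : Frame p σ τ) {x : ℕ} (hx : p.setsNat x = true)
    (v : ℕ) : Frame p σ (τ.withNat x v) where
  natVar y hy := by
    rw [MState.withNat_natVar_of_ne _ _ _ (by rintro rfl; simp_all), h.natVar y hy]
  natArr := h.natArr
  realVar := h.realVar
  realArr := h.realArr
  natRow := h.natRow
  realRow := h.realRow

/-- The bound is an expression that is evaluated anew in each round, so `hhi` fixes its value in all
states compatible with the frame. A round costs the body, `hi.cost + 3` for the test and 3 for the
increment; the initial assignment and the failing test cost `hi.cost + 5`. The invariant is asserted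
after the counter has been advanced. -/
theorem Runs.forLoop {x : ℕ} {hi : NExp} {p : Prog} {σ : MState} {B C T : ℕ}
    {Q : MState → Prop} (Inv : ℕ → MState → Prop) (hx : p.setsNat x = false)
    (hhi : ∀ τ, Frame (Prog.forLoop x hi p) σ τ → hi.eval τ = B)
    (h0 : Inv 0 (σ.withNat x 0))
    (hstep : ∀ i < B, ∀ τ, Frame (Prog.forLoop x hi p) σ τ → τ.natVar x = i → Inv i τ →
      Runs p τ C fun τ' => Inv (i + 1) (τ'.withNat x (i + 1)))
    (hQ : ∀ τ, Frame (Prog.forLoop x hi p) σ τ → Inv B τ → Q τ)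
    (hT : B * (C + hi.cost + 6) + hi.cost + 5 ≤ T) :
    Runs (Prog.forLoop x hi p) σ T Q := by
  have hsx : (Prog.forLoop x hi p).setsNat x = true := by simp [Prog.forLoop, Prog.setsNat]
  have hp : ∀ {τ υ : MState}, Frame p τ υ → Frame (Prog.forLoop x hi p) τ υ := fun h =>
    ((h.seq_left _).loop).seq_right _
  have key : ∀ k i τ, i + k = B → Frame (Prog.forLoop x hi p) σ τ → τ.natVar x = i → Inv i τ →
      Runs (.loop (.natLt (.var x) hi) (.seq p (.setNat x (.succ (.var x))))) τ
        (k * (C + hi.cost + 6) + hi.cost + 3) Q := by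
    intro k
    induction k with
    | zero =>
      intro i τ hi' hf hv hInv
      refine ⟨_, τ, .loopFalse _ ?_, ?_, hQ τ hf (by rwa [← hi'])⟩
      · simp only [BExp.eval, NExp.eval, hhi τ hf]; omega
      · simp only [BExp.cost, NExp.cost]; omega
    | succ k ih =>
      intro i τ hi' hf hv hInv
      obtain ⟨t, υ, he, ht, hυ⟩ := hstep i (by omega) τ hf hv hInv
      have hυx : υ.natVar x = i := by rw [he.frame.natVar x hx, hv]
      have hf' : Frame (Prog.forLoop x hi p) σ (υ.withNat x (i + 1)) :=
        (hf.trans (hp he.frame)).withNat hsx _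
      obtain ⟨t', ω, he', ht', hω⟩ := ih (i + 1) (υ.withNat x (i + 1)) (by omega) hf'
        (by simp) hυ
      have hset : Exec (.setNat x (.succ (.var x))) υ 3 (υ.withNat x (i + 1)) := by
        have := Exec.setNat x (.succ (.var x)) υ
        simpa [NExp.cost, NExp.eval, hυx, MState.withNat] using this
      refine ⟨_, ω, .loopTrue ?_ (.seq he hset) he', ?_, hω⟩
      · simp only [BExp.eval, NExp.eval, hhi τ hf]; omega
      · simp only [BExp.cost, NExp.cost]; ring_nf at ht' ⊢; omega
  obtain ⟨t, τ, he, ht, hτ⟩ := key B 0 (σ.withNat x 0) (by omega)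
    ((Frame.refl _ _).withNat hsx _) (by simp) h0
  have hset : Exec (.setNat x (.const 0)) σ 2 (σ.withNat x 0) := Exec.setNat x (.const 0) σ
  exact ⟨_, τ, .seq hset he, by omega, hτ⟩

/-! ### The program

Integer variables: `0` is `N`, `1` is `n`, `2` the number of directed edges, `3` the number of
edges, `4` the number of roots, `5` the number of cycles found.

Integer arrays: `0` samples, `1` directed edges, `2` edge indices, `3` roots with the sizes of their
components, `4` witnesses (and, in the row after the last one, the solution `x`), `5`-`8` marks,
queue, parents and distances of the search trees, `9` labels, `10` root, end edge, length and
witness of each cycle, `11` vertices of each cycle, `12` containment of tree paths in a sample.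

Real arrays: `0` output, `1` pair counts, `2` `B̂`, `3` distances, `4` cycle counts. -/

namespace MomentProgram

open Prog

/-- Counts, for each pair, the samples that contain it; the real variable `1` becomes `n`. -/
def countPairs : Prog :=
  forLoop 6 (.var 1) (.seq (.setReal 1 (.add (.var 1) (.const 1)))
    (forLoop 7 (.var 0) (forLoop 8 (.var 0)
      (.cond (.and (.natEq (.get 0 (.var 6) (.var 7)) (.const 1))
          (.natEq (.get 0 (.var 6) (.var 8)) (.const 1)))
        (.putReal 1 (.var 7) (.var 8) (.add (.get 1 (.var 7) (.var 8)) (.const 1))) .skip))))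

/-- Appends the edge between the vertices in variables `6` and `7`. -/
def addEdge : Prog :=
  .seq (.putNat 1 (.var 2) (.const 0) (.var 6)) <|
  .seq (.putNat 1 (.var 2) (.const 1) (.var 7)) <|
  .seq (.setNat 2 (.succ (.var 2))) <|
  .seq (.putNat 1 (.var 2) (.const 0) (.var 7)) <|
  .seq (.putNat 1 (.var 2) (.const 1) (.var 6)) <|
  .seq (.setNat 2 (.succ (.var 2))) <|
  .seq (.putNat 2 (.var 6) (.var 7) (.var 3)) <|
  .seq (.putNat 2 (.var 7) (.var 6) (.var 3)) <|
  .seq (.putNat 4 (.var 3) (.var 3) (.const 1)) <|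
  .seq (.setNat 3 (.succ (.var 3))) (.setNat 9 (.const 1))

/-- Computes `B̂` at the pair in variables `6` and `7` and tests for an edge. -/
def testEdge : Prog :=
  .seq (.putReal 2 (.var 6) (.var 7)
    (.sub (.mul (.div (.get 1 (.var 6) (.var 6)) (.var 1))
      (.div (.get 1 (.var 7) (.var 7)) (.var 1))) (.div (.get 1 (.var 6) (.var 7)) (.var 1)))) <|
  .seq (.putReal 2 (.var 7) (.var 6) (.get 2 (.var 6) (.var 7))) <|
  .cond (.realLe (.div (.mul (.var 0) (.var 0)) (.const 2)) (.get 2 (.var 6) (.var 7)))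
    addEdge .skip

/-- Builds the graph. -/
def buildGraph : Prog :=
  forLoop 6 (.var 0) <|
    .seq (.seq (.putReal 0 (.var 6) (.var 6) (.div (.get 1 (.var 6) (.var 6)) (.var 1)))
      (.setNat 9 (.const 0))) <|
    .seq (forLoop 7 (.var 6) testEdge)
      (.cond (.natEq (.var 9) (.const 1))
        (.seq (.putNat 3 (.var 4) (.const 0) (.var 6)) (.setNat 4 (.succ (.var 4)))) .skip)

/-- Appends the head of the directed edge in variable `11` to the queue, if it is reached from the
vertex in variable `10` for the first time. -/
def bfsVisit : Prog :=
  .cond (.and (.natEq (.get 1 (.var 11) (.const 0)) (.var 10))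
      (.natEq (.get 5 (.var 6) (.get 1 (.var 11) (.const 1))) (.const 0)))
    (.seq (.setNat 12 (.get 1 (.var 11) (.const 1))) <|
      .seq (.putNat 5 (.var 6) (.var 12) (.const 1)) <|
      .seq (.putNat 6 (.var 6) (.var 8) (.var 12)) <|
      .seq (.putNat 7 (.var 6) (.var 12) (.var 10)) <|
      .seq (.putNat 8 (.var 6) (.var 12) (.succ (.get 8 (.var 6) (.var 10)))) <|
      .seq (.putReal 3 (.var 6) (.var 12) (.add (.get 3 (.var 6) (.var 10)) (.const 1)))
        (.setNat 8 (.succ (.var 8))))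
    .skip

/-- Breadth-first search from the root with the index in variable `6`. -/
def bfsRoot : Prog :=
  .seq (.seq (.setNat 7 (.get 3 (.var 6) (.const 0))) <|
    .seq (.putNat 5 (.var 6) (.var 7) (.const 1)) <|
    .seq (.putNat 6 (.var 6) (.const 0) (.var 7)) <|
    .seq (.putNat 7 (.var 6) (.var 7) (.var 7)) (.setNat 8 (.const 1))) <|
  .seq (forLoop 9 (.var 2) (.cond (.natLt (.var 9) (.var 8))
    (.seq (.setNat 10 (.get 6 (.var 6) (.var 9))) (forLoop 11 (.var 2) bfsVisit)) .skip))
    (.putNat 3 (.var 6) (.const 1) (.var 8))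

/-- The search trees of all roots. -/
def bfsAll : Prog := forLoop 6 (.var 4) bfsRoot

/-- The labels of the vertices in the component of root `8` with respect to witness `6`. -/
def labelTree : Prog :=
  .seq (.seq (.setNat 9 (.get 3 (.var 8) (.const 0))) (.putNat 9 (.const 0) (.var 9) (.const 0)))
    (forLoop 10 (.get 3 (.var 8) (.const 1))
      (.seq (.setNat 11 (.get 6 (.var 8) (.var 10))) <|
        .seq (.setNat 12 (.get 7 (.var 8) (.var 11))) <|
        .cond (.natEq (.var 11) (.var 9)) .skip <|
          .cond (.natEq (.get 9 (.const 0) (.var 12))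
              (.get 4 (.var 6) (.get 2 (.var 12) (.var 11))))
            (.putNat 9 (.const 0) (.var 11) (.const 0))
            (.putNat 9 (.const 0) (.var 11) (.const 1))))

/-- Records the closed walk through the directed edge `10` if it is odd and a shortest one so
far. -/
def scanEdge : Prog :=
  .seq (.setNat 11 (.get 1 (.var 10) (.const 0))) <|
  .seq (.setNat 12 (.get 1 (.var 10) (.const 1))) <|
  .seq (.cond (.natEq (.get 9 (.const 0) (.var 11)) (.get 9 (.const 0) (.var 12)))
    (.setNat 13 (.const 0)) (.setNat 13 (.const 1))) <|
  -- Integers cannot be added, so depths are stored a second time as reals and the length of the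
  -- closed walk is formed there in one step.
  .seq (.setReal 2 (.add (.add (.get 3 (.var 8) (.var 11)) (.get 3 (.var 8) (.var 12)))
    (.const 1))) <|
  .cond (.and (.and (.natEq (.get 5 (.var 8) (.var 11)) (.const 1))
      (.not (.natEq (.var 13) (.get 4 (.var 6) (.get 2 (.var 11) (.var 12))))))
      (.not (.and (.natEq (.var 7) (.const 1)) (.realLe (.var 3) (.var 2)))))
    (.seq (.setNat 7 (.const 1)) <|
      .seq (.setReal 3 (.var 2)) <|
      .seq (.putNat 10 (.var 5) (.const 0) (.var 8)) <|
      .seq (.putNat 10 (.var 5) (.const 1) (.var 11))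
        (.putNat 10 (.var 5) (.const 2) (.var 12)))
    .skip

/-- Searches for a shortest closed walk that is odd with respect to witness `6`. -/
def findOdd : Prog :=
  .seq (.setNat 7 (.const 0))
    (forLoop 8 (.var 4) (.seq labelTree (forLoop 10 (.var 2) scanEdge)))

/-- Lists the vertices of the closed walk recorded for cycle `5`. -/
def extractCycle : Prog :=
  .seq (.seq (.setNat 16 (.get 10 (.var 5) (.const 0))) <|
    .seq (.setNat 17 (.get 10 (.var 5) (.const 1))) (.setNat 18 (.const 0))) <|
  .seq (forLoop 14 (.get 8 (.var 16) (.get 10 (.var 5) (.const 1)))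
    (.seq (.putNat 11 (.var 5) (.var 18) (.var 17)) <|
      .seq (.setNat 18 (.succ (.var 18))) (.setNat 17 (.get 7 (.var 16) (.var 17))))) <|
  .seq (.putNat 11 (.var 5) (.var 18) (.var 17)) <|
  -- The sum of the two depths is reached by counting on from the first one. The second path is then
  -- written from the end of the list backwards, because parent pointers lead only towards the root.
  .seq (forLoop 14 (.get 8 (.var 16) (.get 10 (.var 5) (.const 2)))
    (.setNat 18 (.succ (.var 18)))) <|
  .seq (.seq (.putNat 10 (.var 5) (.const 3) (.succ (.var 18))) <|
    .seq (.putNat 11 (.var 5) (.succ (.var 18)) (.get 10 (.var 5) (.const 1))) <|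
      .setNat 17 (.get 10 (.var 5) (.const 2)))
  (forLoop 14 (.get 8 (.var 16) (.get 10 (.var 5) (.const 2)))
    (.seq (.putNat 11 (.var 5) (.var 18) (.var 17)) <|
      .seq (.setNat 18 (.pred (.var 18))) (.setNat 17 (.get 7 (.var 16) (.var 17)))))

/-- The parity of the row `row` along the cycle `f`, in variable `13`. -/
def pairRow (f row : NExp) : Prog :=
  .seq (.setNat 13 (.const 0))
    (forLoop 14 (.get 10 f (.const 3))
      (.seq (.setNat 15 (.get 4 row (.get 2 (.get 11 f (.var 14)) (.get 11 f (.succ (.var 14))))))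
        (.cond (.natEq (.var 13) (.var 15)) (.setNat 13 (.const 0)) (.setNat 13 (.const 1)))))

/-- Adds the row `src` to the row `dst`. -/
def addRow (dst src : NExp) : Prog :=
  forLoop 14 (.var 3)
    (.cond (.natEq (.get 4 dst (.var 14)) (.get 4 src (.var 14)))
      (.putNat 4 dst (.var 14) (.const 0)) (.putNat 4 dst (.var 14) (.const 1)))

/-- Makes the witnesses after `6` orthogonal to the cycle `5`. -/
def updateWitnesses : Prog :=
  forLoop 12 (.var 3) (.cond (.natLt (.var 6) (.var 12))
    (.seq (pairRow (.var 5) (.var 12))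
      (.cond (.natEq (.var 13) (.const 1)) (addRow (.var 12) (.var 6)) .skip)) .skip)

/-- Processes witness `6`. -/
def witnessStep : Prog :=
  .seq findOdd (.cond (.natEq (.var 7) (.const 1))
    (.seq extractCycle <| .seq (.putNat 10 (.var 5) (.const 4) (.var 6)) <|
      .seq updateWitnesses (.setNat 5 (.succ (.var 5)))) .skip)

/-- Computes the cycle basis. -/
def cycleBasis : Prog := forLoop 6 (.var 3) witnessStep

/-- Marks the tree paths of root `7` that are contained in sample `6`. -/
def markPaths : Prog :=
  .seq (.putNat 12 (.var 7) (.get 3 (.var 7) (.const 0)) (.const 1))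
    (forLoop 8 (.get 3 (.var 7) (.const 1))
      (.seq (.setNat 9 (.get 6 (.var 7) (.var 8)))
        (.cond (.and (.natEq (.get 12 (.var 7) (.get 7 (.var 7) (.var 9))) (.const 1))
            (.natEq (.get 0 (.var 6) (.var 9)) (.const 1)))
          (.putNat 12 (.var 7) (.var 9) (.const 1)) (.putNat 12 (.var 7) (.var 9) (.const 0)))))

/-- Counts cycle `7` if it is contained in the sample. -/
def countCycle : Prog :=
  .cond (.and
      (.natEq (.get 12 (.get 10 (.var 7) (.const 0)) (.get 10 (.var 7) (.const 1))) (.const 1))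
      (.natEq (.get 12 (.get 10 (.var 7) (.const 0)) (.get 10 (.var 7) (.const 2))) (.const 1)))
    (.putReal 4 (.var 7) (.const 0) (.add (.get 4 (.var 7) (.const 0)) (.const 1))) .skip

/-- Counts, for each cycle, the samples that contain it. -/
def countCycles : Prog :=
  forLoop 6 (.var 1) (.seq (forLoop 7 (.var 4) markPaths) (forLoop 7 (.var 5) countCycle))

/-- The sign bit of `Ĥ` for cycle `6`, in variable `19`. -/
def signBit : Prog :=
  .seq (.seq (.setReal 2 (.const 1)) <|
    .seq (.setReal 3 (.get 0 (.get 11 (.var 6) (.const 0)) (.get 11 (.var 6) (.const 0)))) <|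
    .seq (.setReal 4 (.const 0)) (.setReal 5 (.const 1))) <|
  -- Variables 2 and 3 carry two consecutive sums of the path that starts at vertex 0, variables 4
  -- and 5 those of the path that starts at vertex 1 and is one vertex shorter.
  .seq (forLoop 14 (.pred (.get 10 (.var 6) (.const 3)))
    (.seq (.setNat 15 (.get 11 (.var 6) (.var 14))) <|
      .seq (.setNat 16 (.get 11 (.var 6) (.succ (.var 14)))) <|
      .seq (.setReal 6 (.sub (.mul (.get 0 (.var 16) (.var 16)) (.var 3))
        (.mul (.get 2 (.var 15) (.var 16)) (.var 2)))) <|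
      .seq (.setReal 2 (.var 3)) <|
      .seq (.setReal 3 (.var 6)) <|
      .seq (.setReal 6 (.sub (.mul (.get 0 (.var 16) (.var 16)) (.var 5))
        (.mul (.get 2 (.var 15) (.var 16)) (.var 4)))) <|
      .seq (.setReal 4 (.var 5)) (.setReal 5 (.var 6))))
  (.cond (.realLe (.sub (.div (.get 4 (.var 6) (.const 0)) (.var 1)) (.sub (.var 3) (.mul
      (.get 2 (.get 11 (.var 6) (.pred (.get 10 (.var 6) (.const 3))))
        (.get 11 (.var 6) (.const 0))) (.var 4)))) (.const 0))
    (.setNat 19 (.const 0)) (.setNat 19 (.const 1)))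

/-- Solves the linear system. -/
def solveSigns : Prog :=
  -- Adding the witness of a cycle flips the parity of the solution along that cycle and along no
  -- earlier one.
  forLoop 6 (.var 5) (.seq signBit (.seq (pairRow (.var 6) (.var 3))
    (.cond (.natEq (.var 13) (.var 19)) .skip (addRow (.var 3) (.get 10 (.var 6) (.const 4))))))

/-- Writes the off-diagonal entries of the output. -/
def writeOutput : Prog :=
  forLoop 6 (.var 2)
    (.seq (.setNat 7 (.get 1 (.var 6) (.const 0))) <| .seq (.setNat 8 (.get 1 (.var 6) (.const 1)))
      (.cond (.natEq (.get 4 (.var 3) (.get 2 (.var 7) (.var 8))) (.const 1))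
        (.putReal 0 (.var 7) (.var 8) (.sqrt (.get 2 (.var 7) (.var 8))))
        (.putReal 0 (.var 7) (.var 8) (.sub (.const 0) (.sqrt (.get 2 (.var 7) (.var 8)))))))

/-- The estimation program. -/
def estimate : Prog :=
  .seq countPairs <| .seq buildGraph <| .seq bfsAll <| .seq cycleBasis <|
    .seq countCycles <| .seq solveSigns writeOutput

end MomentProgram

/-! ### Edge tables, search trees and the closed walks they define -/

namespace MomentProgram

open SimpleGraph

/-- The tables that describe the edges (`A` is adjacency) on the vertices below `N`: the
directed edges `D`, the edge indices `I` and the roots. -/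
structure EdgeTables (A : ℕ → ℕ → Prop) (D I : ℕ → ℕ → ℕ) (m₂ m : ℕ) : Prop where
  two_mul : m₂ = 2 * m
  dir_adj : ∀ d < m₂, A (D d 0) (D d 1)
  exists_dir : ∀ i j, A i j → ∃ d < m₂, D d 0 = i ∧ D d 1 = j
  idx_lt : ∀ i j, A i j → I i j < m
  idx_comm : ∀ i j, I i j = I j i
  idx_inj : ∀ i j i' j', A i j → A i' j' → I i j = I i' j' → s(i, j) = s(i', j')
  idx_surj : ∀ e < m, ∃ i j, A i j ∧ I i j = e

/-- The breadth-first search tree of the component of `v`. -/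
structure IsSearchTree (H : SimpleGraph ℕ) (v cnt : ℕ) (seen ord par dn : ℕ → ℕ) (dr : ℕ → ℝ) :
    Prop where
  pos : 0 < cnt
  ord_zero : ord 0 = v
  seen_iff : ∀ x, seen x = 1 ↔ ∃ i < cnt, ord i = x
  inj : ∀ i < cnt, ∀ j < cnt, ord i = ord j → i = j
  par_ord : ∀ i < cnt, 0 < i → ∃ i' < i, par (ord i) = ord i' ∧ H.Adj (ord i') (ord i) ∧
    dn (ord i) = dn (ord i') + 1
  par_root : par v = v
  dn_root : dn v = 0
  closure : ∀ x y, seen x = 1 → H.Adj x y → seen y = 1 ∧ dn y ≤ dn x + 1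
  dr_eq : ∀ x, dr x = dn x

namespace IsSearchTree

variable {H : SimpleGraph ℕ} {v cnt : ℕ} {seen ord par dn : ℕ → ℕ} {dr : ℕ → ℝ}

theorem seen_root (h : IsSearchTree H v cnt seen ord par dn dr) : seen v = 1 :=
  (h.seen_iff v).2 ⟨0, h.pos, h.ord_zero⟩

theorem seen_par (h : IsSearchTree H v cnt seen ord par dn dr) {x : ℕ} (hx : seen x = 1) :
    seen (par x) = 1 := by
  obtain ⟨i, hi, rfl⟩ := (h.seen_iff x).1 hx
  rcases Nat.eq_zero_or_pos i with rfl | h0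
  · rw [h.ord_zero, h.par_root]; exact h.seen_root
  · obtain ⟨i', hi', e, -⟩ := h.par_ord i hi h0
    rw [e]; exact (h.seen_iff _).2 ⟨i', by omega, rfl⟩

theorem par_spec (h : IsSearchTree H v cnt seen ord par dn dr) {x : ℕ} (hx : seen x = 1)
    (hv : x ≠ v) : H.Adj (par x) x ∧ dn x = dn (par x) + 1 := by
  obtain ⟨i, hi, rfl⟩ := (h.seen_iff x).1 hx
  have h0 : 0 < i := by
    rcases Nat.eq_zero_or_pos i with rfl | h0
    · exact absurd h.ord_zero hv
    · exact h0
  obtain ⟨i', hi', e, ha, hd⟩ := h.par_ord i hi h0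
  rw [e]; exact ⟨ha, hd⟩

theorem dn_ord_le (h : IsSearchTree H v cnt seen ord par dn dr) :
    ∀ i < cnt, dn (ord i) ≤ i := by
  intro i
  induction i using Nat.strong_induction_on with
  | _ i ih =>
    intro hi
    rcases Nat.eq_zero_or_pos i with rfl | h0
    · rw [h.ord_zero, h.dn_root]
    · obtain ⟨i', hi', -, -, hd⟩ := h.par_ord i hi h0
      have := ih i' hi' (by omega)
      omega

theorem dn_lt (h : IsSearchTree H v cnt seen ord par dn dr) {x : ℕ} (hx : seen x = 1) :
    dn x < cnt := by
  obtain ⟨i, hi, rfl⟩ := (h.seen_iff x).1 hx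
  exact (h.dn_ord_le i hi).trans_lt hi

theorem seen_iterate (h : IsSearchTree H v cnt seen ord par dn dr) {x : ℕ} (hx : seen x = 1)
    (t : ℕ) : seen (par^[t] x) = 1 := by
  induction t with
  | zero => exact hx
  | succ t ih => rw [Function.iterate_succ_apply']; exact h.seen_par ih

theorem dn_iterate (h : IsSearchTree H v cnt seen ord par dn dr) {x : ℕ} (hx : seen x = 1)
    {t : ℕ} (ht : t ≤ dn x) : dn (par^[t] x) = dn x - t := by
  induction t with
  | zero => rfl
  | succ t ih =>
    rw [Function.iterate_succ_apply']
    have ih := ih (by omega)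
    have hv : par^[t] x ≠ v := by
      intro e; rw [e, h.dn_root] at ih; omega
    have := (h.par_spec (h.seen_iterate hx t) hv).2
    omega

theorem eq_root_of_dn (h : IsSearchTree H v cnt seen ord par dn dr) {x : ℕ} (hx : seen x = 1)
    (h0 : dn x = 0) : x = v := by
  by_contra hv
  have := (h.par_spec hx hv).2
  omega

theorem iterate_dn (h : IsSearchTree H v cnt seen ord par dn dr) {x : ℕ} (hx : seen x = 1) :
    par^[dn x] x = v :=
  h.eq_root_of_dn (h.seen_iterate hx _) (by rw [h.dn_iterate hx le_rfl]; omega)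

theorem iterate_ne (h : IsSearchTree H v cnt seen ord par dn dr) {x : ℕ} (hx : seen x = 1)
    {t : ℕ} (ht : t < dn x) : par^[t] x ≠ v := by
  intro e
  have := h.dn_iterate hx ht.le
  rw [e, h.dn_root] at this
  omega

theorem adj_iterate (h : IsSearchTree H v cnt seen ord par dn dr) {x : ℕ} (hx : seen x = 1)
    {t : ℕ} (ht : t < dn x) : H.Adj (par^[t + 1] x) (par^[t] x) := by
  rw [Function.iterate_succ_apply']
  exact (h.par_spec (h.seen_iterate hx t) (h.iterate_ne hx ht)).1

/-- The field `closure` bounds the growth of the depth along every edge, not only along tree edges;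
summed along a walk from the root it bounds the depth by the length of the walk. -/
theorem dn_le_length (h : IsSearchTree H v cnt seen ord par dn dr) {u x : ℕ} (p : H.Walk u x)
    (hu : seen u = 1) : seen x = 1 ∧ dn x ≤ dn u + p.length := by
  induction p with
  | nil => exact ⟨hu, by simp⟩
  | cons ha p ih =>
    obtain ⟨h1, h2⟩ := h.closure _ _ hu ha
    obtain ⟨h3, h4⟩ := ih h1
    exact ⟨h3, by rw [Walk.length_cons]; omega⟩

/-- The labels of the vertices: the weights of the tree paths. -/
def IsLabeling (v : ℕ) (seen par : ℕ → ℕ) (F : ℕ → ℕ → ZMod 2) (lab : ℕ → ZMod 2) : Prop :=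
  lab v = 0 ∧ ∀ x, seen x = 1 → x ≠ v → lab x = lab (par x) + F (par x) x

theorem lab_eq_sum (h : IsSearchTree H v cnt seen ord par dn dr) {F : ℕ → ℕ → ZMod 2}
    {lab : ℕ → ZMod 2} (hl : IsLabeling v seen par F lab) {x : ℕ} (hx : seen x = 1) :
    lab x = ∑ t ∈ Finset.range (dn x), F (par^[t + 1] x) (par^[t] x) := by
  have : ∀ k ≤ dn x, lab x = ∑ t ∈ Finset.range k, F (par^[t + 1] x) (par^[t] x) +
      lab (par^[k] x) := by
    intro k
    induction k with
    | zero => simp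
    | succ k ih =>
      intro hk
      rw [ih (by omega), Finset.sum_range_succ,
        hl.2 _ (h.seen_iterate hx k) (h.iterate_ne hx (by omega)), Function.iterate_succ_apply']
      ring
  rw [this _ le_rfl, h.iterate_dn hx, hl.1, add_zero]

/-- The closed walk that goes from `x` to the root, down to `y` and back to `x`. -/
def treeWalk (par dn : ℕ → ℕ) (x y i : ℕ) : ℕ :=
  if i ≤ dn x then par^[i] x else if i ≤ dn x + dn y then par^[dn x + dn y - i] y else x

theorem treeWalk_closedSeq (h : IsSearchTree H v cnt seen ord par dn dr) {x y : ℕ}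
    (hx : seen x = 1) (hy : seen y = 1) (ha : H.Adj x y) :
    ClosedSeq H (treeWalk par dn x y) (dn x + dn y + 1) := by
  refine ⟨by simp [treeWalk], fun i hi => ?_⟩
  unfold treeWalk
  rcases lt_trichotomy i (dn x) with h1 | h1 | h1
  · rw [if_pos h1.le, if_pos (by omega)]; exact (h.adj_iterate hx h1).symm
  · subst h1
    rw [if_pos le_rfl, if_neg (by omega), h.iterate_dn hx]
    split_ifs with h2
    · have := h.adj_iterate hy (t := dn y - 1) (by omega)
      rw [Nat.sub_add_cancel (by omega), h.iterate_dn hy] at this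
      rwa [show dn x + dn y - (dn x + 1) = dn y - 1 by omega]
    · have : dn y = 0 := by omega
      rw [← h.eq_root_of_dn hy this]; exact ha.symm
  · rw [if_neg (by omega), if_pos (by omega), if_neg (by omega)]
    split_ifs with h2
    · have := h.adj_iterate hy (t := dn x + dn y - (i + 1)) (by omega)
      rwa [show dn x + dn y - (i + 1) + 1 = dn x + dn y - i by omega] at this
    · rw [show dn x + dn y - i = 0 by omega]; exact ha.symm

/-- The weight is symmetric, so each tree path contributes the label of its end whatever the
direction of travel, and the closing edge adds its own weight. Common portions of the two paths
cancel by themselves modulo 2. -/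
theorem treeWalk_seqWeight (h : IsSearchTree H v cnt seen ord par dn dr) {F : ℕ → ℕ → ZMod 2}
    (hF : ∀ a b, F a b = F b a) {lab : ℕ → ZMod 2} (hl : IsLabeling v seen par F lab) {x y : ℕ}
    (hx : seen x = 1) (hy : seen y = 1) :
    seqWeight F (treeWalk par dn x y) (dn x + dn y + 1) = lab x + lab y + F x y := by
  have e1 : ∀ i ∈ Finset.range (dn x), F (treeWalk par dn x y i) (treeWalk par dn x y (i + 1)) =
      F (par^[i + 1] x) (par^[i] x) := by
    intro i hi
    have := Finset.mem_range.1 hi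
    rw [treeWalk, treeWalk, if_pos (by omega), if_pos (by omega), hF]
  -- The descent to `y` runs through the iterated parents of `y` in reverse order, hence the
  -- reflected index.
  have e2 : ∀ i ∈ Finset.range (dn y), F (treeWalk par dn x y (dn x + (dn y - 1 - i)))
      (treeWalk par dn x y (dn x + (dn y - 1 - i) + 1)) = F (par^[i + 1] y) (par^[i] y) := by
    intro i hi
    have := Finset.mem_range.1 hi
    have a1 : treeWalk par dn x y (dn x + (dn y - 1 - i)) = par^[i + 1] y := by
      unfold treeWalk
      split_ifs with h1 h2
      · have : dn y = i + 1 := by omega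
        rw [show dn x + (dn y - 1 - i) = dn x by omega, h.iterate_dn hx, ← this, h.iterate_dn hy]
      · congr 1; omega
      · omega
    have a2 : treeWalk par dn x y (dn x + (dn y - 1 - i) + 1) = par^[i] y := by
      rw [treeWalk, if_neg (by omega), if_pos (by omega)]
      congr 1; omega
    rw [a1, a2]
  have e3 : treeWalk par dn x y (dn x + dn y) = y := by
    unfold treeWalk
    split_ifs with h1 h2
    · have : dn y = 0 := by omega
      rw [this, add_zero, h.iterate_dn hx, h.eq_root_of_dn hy this]
    · rw [Nat.sub_self]; rfl
    · omega
  have e4 : treeWalk par dn x y (dn x + dn y + 1) = x := by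
    rw [treeWalk, if_neg (by omega), if_neg (by omega)]
  rw [seqWeight, Finset.sum_range_succ, Finset.sum_range_add, Finset.sum_congr rfl e1,
    ← Finset.sum_range_reflect (fun i => F (treeWalk par dn x y (dn x + i))
      (treeWalk par dn x y (dn x + i + 1))) (dn y), Finset.sum_congr rfl e2, ← h.lab_eq_sum hl hx,
    ← h.lab_eq_sum hl hy, e3, e4, hF]

end IsSearchTree

/-- An odd closed walk provides an odd closed walk of at most the same length that consists of two
tree paths and an edge. -/
theorem exists_odd_candidate {H : SimpleGraph ℕ} {R : ℕ} {rt cnt : ℕ → ℕ}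
    {seen ord par dn : ℕ → ℕ → ℕ} {dr : ℕ → ℕ → ℝ}
    (ht : ∀ q < R, IsSearchTree H (rt q) (cnt q) (seen q) (ord q) (par q) (dn q) (dr q))
    (hR : ∀ i j, H.Adj i j → j < i → ∃ q < R, rt q = i)
    {F : ℕ → ℕ → ZMod 2} {lab : ℕ → ℕ → ZMod 2}
    (hl : ∀ q < R, lab q (rt q) = 0) {u : ℕ} (p : H.Walk u u) (hp : p.weight F = 1) :
    ∃ q < R, ∃ x y, H.Adj x y ∧ seen q x = 1 ∧ seen q y = 1 ∧
      F x y ≠ lab q x + lab q y ∧ dn q x + dn q y + 1 ≤ p.length := by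
  -- An odd closed walk has a first edge, and the larger end of any edge is a root; the walk can be
  -- rotated so as to start there.
  have hroot : ∃ q < R, rt q ∈ p.support := by
    cases p with
    | nil => simp at hp
    | @cons _ b _ ha p =>
      rcases lt_or_gt_of_ne ha.ne with hlt | hlt
      · obtain ⟨q, hq, e⟩ := hR _ _ ha.symm hlt
        exact ⟨q, hq, by rw [e]; simp⟩
      · obtain ⟨q, hq, e⟩ := hR _ _ ha hlt
        exact ⟨q, hq, by rw [e]; simp⟩
  obtain ⟨q, hq, hmem⟩ := hroot
  have hw : (p.rotate (rt q) hmem).weight F = 1 := by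
    rw [Walk.rotate, Walk.weight_append, add_comm, ← Walk.weight_append, Walk.take_spec, hp]
  -- The label vanishes at the root, so if it were a potential along the walk, the weight would be
  -- 0. At an edge where it fails, the two remaining portions of the walk join the root to the ends
  -- of the edge and bound their depths.
  obtain ⟨a, b, p₁, hab, p₂, hne, hlen⟩ := (p.rotate (rt q) hmem).exists_odd_edge (lab q)
    (by rw [hw, hl q hq]; decide)
  rw [Walk.length_rotate] at hlen
  have t := ht q hq
  obtain ⟨h1, h2⟩ := t.dn_le_length p₁ t.seen_root
  obtain ⟨h3, h4⟩ := t.dn_le_length p₂.reverse t.seen_root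
  rw [t.dn_root, Walk.length_reverse] at *
  exact ⟨q, hq, a, b, hab, h1, h3, hne, by omega⟩

end MomentProgram

/-! ### Counting the samples that contain a pair -/

namespace MomentProgram

open Prog

/-- The number of samples below `p` that contain both `i` and `j`. -/
noncomputable def pairCount (bit : ℕ → ℕ → ℕ) (p i j : ℕ) : ℝ :=
  ∑ q ∈ Finset.range p, if bit q i = 1 ∧ bit q j = 1 then 1 else 0

theorem pairCount_succ (bit : ℕ → ℕ → ℕ) (p i j : ℕ) :
    pairCount bit (p + 1) i j =
      pairCount bit p i j + if bit p i = 1 ∧ bit p j = 1 then 1 else 0 :=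
  Finset.sum_range_succ _ _

/-- The diagonal of the table counts the samples that contain a single element, so one table serves
the diagonal of the estimate and `B̂`. -/
theorem countPairs_spec {σ : MState} {N n : ℕ} (hN : σ.natVar 0 = N) (hn : σ.natVar 1 = n)
    (h0 : σ.realVar 1 = 0) (h1 : ∀ i j, σ.realArr 1 i j = 0) :
    Runs countPairs σ (n * (N * (N * 50 + 50) + 50) + 50) fun τ =>
      τ.realVar 1 = n ∧ ∀ i < N, ∀ j < N, τ.realArr 1 i j = pairCount (σ.natArr 0) n i j := by
  refine Runs.forLoop (B := n) (C := N * (N * 40 + 20) + 20) (fun p τ => τ.realVar 1 = p ∧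
    ∀ i < N, ∀ j < N, τ.realArr 1 i j = pairCount (σ.natArr 0) p i j) rfl
    (fun τ hf => (hf.natVar 1 rfl).trans hn) ?_ ?_ ?_ ?_
  · simp [h0, h1, pairCount]
  · rintro p hp τ hf hv ⟨hr, hc⟩
    refine Runs.seq (Q' := fun τ' => τ'.realVar 1 = p + 1 ∧ τ'.realArr = τ.realArr)
      (Runs.straight trivial le_rfl ?_) ?_ (T₂ := N * (N * 40 + 20) + 10)
      (by simp only [Prog.time, RExp.cost]; omega)
    · simp [Prog.sem, RExp.eval, hr]
    rintro τ₁ hf₁ ⟨hr₁, ha₁⟩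
    refine Runs.forLoop (B := N) (C := N * 30 + 10) (fun i υ => ∀ i' < N, ∀ j < N,
      υ.realArr 1 i' j = pairCount (σ.natArr 0) (if i' < i then p + 1 else p) i' j) rfl
      (fun τ hf' => by
        rw [NExp.eval, hf'.natVar 0 rfl, hf₁.natVar 0 rfl, hf.natVar 0 rfl, hN]) ?_ ?_ ?_ ?_
    · simp only [MState.withNat_realArr, ha₁]
      simpa using hc
    · intro i hi υ hfυ hvi hυ
      refine Runs.forLoop (B := N) (C := 20) (fun j ω => ∀ i' < N, ∀ j' < N,
        ω.realArr 1 i' j' = pairCount (σ.natArr 0)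
          (if i' < i ∨ (i' = i ∧ j' < j) then p + 1 else p) i' j') rfl
        (fun τ hf' => by
          rw [NExp.eval, hf'.natVar 0 rfl, hfυ.natVar 0 rfl, hf₁.natVar 0 rfl, hf.natVar 0 rfl,
            hN]) ?_ ?_ ?_ ?_
      · simpa using hυ
      · intro j hj ω hfω hvj hω
        refine Runs.straight (by simp [Prog.Straight]) (by decide) ?_
        have e6 : ω.natVar 6 = p := by
          rw [hfω.natVar 6 rfl, hfυ.natVar 6 rfl, hf₁.natVar 6 rfl, hv]
        have e7 : ω.natVar 7 = i := by rw [hfω.natVar 7 rfl, hvi]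
        have eA : ω.natArr 0 = σ.natArr 0 := by
          rw [hfω.natArr 0 rfl, hfυ.natArr 0 rfl, hf₁.natArr 0 rfl, hf.natArr 0 rfl]
        intro i' hi' j' hj'
        have := hω i' hi' j' hj'
        simp only [Prog.sem, BExp.eval, NExp.eval, RExp.eval, e6, e7, hvj, eA]
        by_cases hb : i' = i ∧ j' = j
        · obtain ⟨rfl, rfl⟩ := hb
          simp only [lt_irrefl, and_false, or_false, if_false] at this
          simp only [lt_irrefl, lt_add_iff_pos_right, zero_lt_one, and_true, or_true, if_true,
            pairCount_succ, ← this]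
          split_ifs with hc <;> simp
        · have e : (i' < i ∨ (i' = i ∧ j' < j + 1)) = (i' < i ∨ (i' = i ∧ j' < j)) := by
            apply propext; omega
          simp only [e, ← this]
          split_ifs with hc
          · simp [hb]
          · simp
      · intro ω hfω hω i' hi' j hj
        rw [MState.withNat_realArr, hω i' hi' j hj]
        congr 1
        have : (i' < i ∨ (i' = i ∧ j < N)) = (i' < i + 1) := by apply propext; omega
        simp [this]
      · simp only [NExp.cost]; omega
    · intro υ hfυ hυ
      refine ⟨?_, fun i hi j hj => ?_⟩
      · simp [hfυ.realVar 1 rfl, hr₁]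
      · rw [MState.withNat_realArr, hυ i hi j hj, if_pos hi]
    · simp only [NExp.cost]; ring_nf; omega
  · exact fun τ _ h => h
  · simp only [NExp.cost]; ring_nf; omega

end MomentProgram

/-! ### Construction of the edge tables -/

namespace MomentProgram

open Prog

/-- The new edge takes the first free index `m`, its orientations the positions `m₂` and `m₂ + 1`;
thus indices stay a bijection from edges onto an initial segment. -/
theorem EdgeTables.insert {A A' : ℕ → ℕ → Prop} {D D' I I' : ℕ → ℕ → ℕ} {m₂ m i j : ℕ}
    (h : EdgeTables A D I m₂ m) (hA : ¬ A i j) (hA' : ¬ A j i)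
    (hAA : ∀ x y, A' x y ↔ A x y ∨ (x = i ∧ y = j) ∨ (x = j ∧ y = i))
    (hD : ∀ d < m₂, ∀ c, D' d c = D d c) (hD0 : D' m₂ 0 = i) (hD1 : D' m₂ 1 = j)
    (hD2 : D' (m₂ + 1) 0 = j) (hD3 : D' (m₂ + 1) 1 = i)
    (hI : ∀ x y, I' x y = if (x = i ∧ y = j) ∨ (x = j ∧ y = i) then m else I x y) :
    EdgeTables A' D' I' (m₂ + 2) (m + 1) := by
  have hIA : ∀ x y, A x y → I' x y = I x y := by
    intro x y hxy
    rw [hI, if_neg]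
    rintro (⟨rfl, rfl⟩ | ⟨rfl, rfl⟩)
    · exact hA hxy
    · exact hA' hxy
  refine ⟨by have := h.two_mul; omega, ?_, ?_, ?_, ?_, ?_, ?_⟩
  · intro d hd
    rw [hAA]
    rcases Nat.lt_or_ge d m₂ with h1 | h1
    · rw [hD d h1, hD d h1]; exact Or.inl (h.dir_adj d h1)
    · rcases (show d = m₂ ∨ d = m₂ + 1 by omega) with rfl | rfl
      · exact Or.inr (Or.inl ⟨hD0, hD1⟩)
      · exact Or.inr (Or.inr ⟨hD2, hD3⟩)
  · intro x y hxy
    rcases (hAA x y).1 hxy with hxy | ⟨rfl, rfl⟩ | ⟨rfl, rfl⟩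
    · obtain ⟨d, hd, h0, h1⟩ := h.exists_dir x y hxy
      exact ⟨d, by omega, by rw [hD d hd, h0], by rw [hD d hd, h1]⟩
    · exact ⟨m₂, by omega, hD0, hD1⟩
    · exact ⟨m₂ + 1, by omega, hD2, hD3⟩
  · intro x y hxy
    rw [hI]
    split_ifs with hc
    · omega
    · have := h.idx_lt x y (((hAA x y).1 hxy).resolve_right hc); omega
  · intro x y
    rw [hI, hI, h.idx_comm x y]
    congr 1
    apply propext; tauto
  · intro x y x' y' hxy hxy' e
    rw [hI, hI] at e
    split_ifs at e with h1 h2 h2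
    · rcases h1 with ⟨rfl, rfl⟩ | ⟨rfl, rfl⟩ <;> rcases h2 with ⟨rfl, rfl⟩ | ⟨rfl, rfl⟩ <;>
        first | rfl | exact Sym2.eq_swap
    · have := h.idx_lt x' y' (((hAA x' y').1 hxy').resolve_right h2); omega
    · have := h.idx_lt x y (((hAA x y).1 hxy).resolve_right h1); omega
    · exact h.idx_inj x y x' y' (((hAA x y).1 hxy).resolve_right h1)
        (((hAA x' y').1 hxy').resolve_right h2) e
  · intro e he
    rcases Nat.lt_or_ge e m with h1 | h1
    · obtain ⟨x, y, hxy, hI'⟩ := h.idx_surj e h1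
      exact ⟨x, y, (hAA x y).2 (Or.inl hxy), by rw [hIA x y hxy, hI']⟩
    · exact ⟨i, j, (hAA i j).2 (Or.inr (Or.inl ⟨rfl, rfl⟩)), by rw [hI, if_pos (by simp)]; omega⟩

/-- The pairs that precede `(i, j)` in the order in which the graph is built. -/
def Precedes (i j x y : ℕ) : Prop :=
  (max x y < i) ∨ (max x y = i ∧ min x y < j)

/-- The empirical `B̂` in terms of the counts. -/
noncomputable def countB (c : ℕ → ℕ → ℝ) (n : ℝ) (i j : ℕ) : ℝ :=
  c i i / n * (c j j / n) - c i j / n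

/-- The state of the construction of the graph before the pair `(i, j)` is treated, apart from the
roots. -/
structure GraphInv (H : SimpleGraph ℕ) (B : ℕ → ℕ → ℝ) (i j : ℕ) (τ : MState) : Prop where
  tables : EdgeTables (fun x y => H.Adj x y ∧ Precedes i j x y) (τ.natArr 1) (τ.natArr 2)
    (τ.natVar 2) (τ.natVar 3)
  identity : ∀ k e, τ.natArr 4 k e = if k = e ∧ k < τ.natVar 3 then 1 else 0
  values : ∀ x y, y < x → Precedes i j x y → τ.realArr 2 x y = B x y ∧ τ.realArr 2 y x = B x y

theorem GraphInv.congr {H : SimpleGraph ℕ} {B : ℕ → ℕ → ℝ} {i j i' j' : ℕ} {τ τ' : MState}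
    (h : GraphInv H B i j τ) (hp : ∀ x y, y < x → (Precedes i j x y ↔ Precedes i' j' x y))
    (h1 : τ'.natArr 1 = τ.natArr 1) (h2 : τ'.natArr 2 = τ.natArr 2) (h4 : τ'.natArr 4 = τ.natArr 4)
    (h5 : τ'.natVar 2 = τ.natVar 2) (h6 : τ'.natVar 3 = τ.natVar 3)
    (h7 : τ'.realArr 2 = τ.realArr 2) : GraphInv H B i' j' τ' := by
  have e : (fun x y => H.Adj x y ∧ Precedes i' j' x y) =
      fun x y => H.Adj x y ∧ Precedes i j x y := by
    funext x y
    apply propext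
    refine and_congr_right fun ha => ?_
    rcases lt_or_gt_of_ne ha.ne with hlt | hlt
    · have := hp y x hlt
      simp only [Precedes, max_comm x, min_comm x] at this ⊢
      exact this.symm
    · exact (hp x y hlt).symm
  refine ⟨?_, ?_, ?_⟩
  · rw [e, h1, h2, h5, h6]; exact h.tables
  · rw [h4, h6]; exact h.identity
  · rw [h7]; exact fun x y hxy hpr => h.values x y hxy ((hp x y hxy).2 hpr)

theorem testEdge_spec {H : SimpleGraph ℕ} {σ : MState} {n : ℝ} {i j : ℕ} (hji : j < i)
    (h6 : σ.natVar 6 = i) (h7 : σ.natVar 7 = j) (hn : σ.realVar 1 = n)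
    (hH : H.Adj i j ↔ σ.realVar 0 * σ.realVar 0 / 2 ≤ countB (σ.realArr 1) n i j)
    (hg : GraphInv H (countB (σ.realArr 1) n) i j σ) :
    Runs testEdge σ 110 fun τ => GraphInv H (countB (σ.realArr 1) n) i (j + 1) τ ∧
      (H.Adj i j → τ.natVar 3 = σ.natVar 3 + 1 ∧ τ.natVar 9 = 1) ∧
      (¬ H.Adj i j → τ.natVar 3 = σ.natVar 3 ∧ τ.natVar 9 = σ.natVar 9) := by
  have hij : i ≠ j := by omega
  have hprec : ∀ x y, y < x → (Precedes i (j + 1) x y ↔ Precedes i j x y ∨ (x = i ∧ y = j)) := by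
    intro x y hxy; unfold Precedes; omega
  have hval : ∀ A : ℕ → ℕ → ℝ, (∀ x y, A x y = if x = j ∧ y = i then countB (σ.realArr 1) n i j
      else if x = i ∧ y = j then countB (σ.realArr 1) n i j else σ.realArr 2 x y) →
      ∀ x y, y < x → Precedes i (j + 1) x y → A x y = countB (σ.realArr 1) n x y ∧
        A y x = countB (σ.realArr 1) n x y := by
    intro A hA x y hxy hp
    rcases (hprec x y hxy).1 hp with hp | ⟨rfl, rfl⟩
    · have := hg.values x y hxy hp
      unfold Precedes at hp
      rw [hA, hA, if_neg (by omega), if_neg (by omega), if_neg (by omega), if_neg (by omega)]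
      exact this
    · rw [hA, hA, if_neg (by omega), if_pos ⟨rfl, rfl⟩, if_pos ⟨rfl, rfl⟩]
      exact ⟨rfl, rfl⟩
  refine Runs.straight (by simp [testEdge, addEdge, Prog.Straight]) (by decide) ?_
  simp only [testEdge, Prog.sem, BExp.eval, RExp.eval, NExp.eval, h6, h7, hn, arrWrite_apply]
  have hB : σ.realArr 1 i i / n * (σ.realArr 1 j j / n) - σ.realArr 1 i j / n =
    countB (σ.realArr 1) n i j := rfl
  simp only [hB, true_and, hij, if_true]
  by_cases hadj : H.Adj i j
  · rw [if_pos (by simpa using hH.1 hadj)]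
    refine ⟨?_, fun _ => ⟨by simp [addEdge, Prog.sem, NExp.eval],
      by simp [addEdge, Prog.sem, NExp.eval]⟩,
      fun h => absurd hadj h⟩
    simp [addEdge, Prog.sem, NExp.eval, h6, h7]
    refine ⟨?_, ?_, ?_⟩
    · refine hg.tables.insert (i := i) (j := j) ?_ ?_ ?_ ?_ ?_ ?_ ?_ ?_ ?_
      · rintro ⟨-, h⟩; unfold Precedes at h; omega
      · rintro ⟨-, h⟩; unfold Precedes at h; omega
      · intro x y
        constructor
        · rintro ⟨ha, hp⟩
          unfold Precedes at hp ⊢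
          rcases lt_or_gt_of_ne ha.ne with hlt | hlt
          · by_cases hc : x = j ∧ y = i
            · exact Or.inr (Or.inr hc)
            · exact Or.inl ⟨ha, by omega⟩
          · by_cases hc : x = i ∧ y = j
            · exact Or.inr (Or.inl hc)
            · exact Or.inl ⟨ha, by omega⟩
        · rintro (⟨ha, hp⟩ | ⟨rfl, rfl⟩ | ⟨rfl, rfl⟩)
          · exact ⟨ha, by unfold Precedes at hp ⊢; omega⟩
          · exact ⟨hadj, by unfold Precedes; omega⟩
          · exact ⟨hadj.symm, by unfold Precedes; omega⟩
      · intro d hd c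
        simp [arrWrite_apply, show d ≠ σ.natVar 2 by omega, show d ≠ σ.natVar 2 + 1 by omega]
      · simp [arrWrite_apply]
      · simp [arrWrite_apply]
      · simp [arrWrite_apply]
      · simp [arrWrite_apply]
      · intro x y
        simp only [arrWrite_apply]
        by_cases h1 : x = i ∧ y = j <;> by_cases h2 : x = j ∧ y = i <;> simp [h1, h2]
    · intro k e
      have := hg.identity k e
      simp only [arrWrite_apply]
      simp [this]
      split_ifs <;> omega
    · refine hval _ fun x y => ?_
      simp [arrWrite_apply]
  · rw [if_neg (by simpa using lt_of_not_ge fun h => hadj (hH.2 h))]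
    simp only [hadj, false_imp_iff, not_false_eq_true, and_self, forall_const, and_true]
    refine ⟨?_, hg.identity, ?_⟩
    · convert hg.tables using 3 with x y
      refine and_congr_right fun ha => ?_
      rcases lt_or_gt_of_ne ha.ne with hlt | hlt
      · have := hprec y x hlt
        unfold Precedes at this ⊢
        have hc : ¬ (y = i ∧ x = j) := by rintro ⟨rfl, rfl⟩; exact hadj ha.symm
        omega
      · have := hprec x y hlt
        have hc : ¬ (x = i ∧ y = j) := by rintro ⟨rfl, rfl⟩; exact hadj ha
        simp only [hc, or_false] at this
        exact this
    · refine hval _ fun x y => ?_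
      simp [arrWrite_apply]

end MomentProgram

/-! ### Roots -/

namespace MomentProgram

open Prog

/-- The vertices listed in the first `R` entries of `rt` are those below `i` with a smaller
neighbor. -/
structure RootTable (H : SimpleGraph ℕ) (rt : ℕ → ℕ → ℕ) (R i : ℕ) : Prop where
  le : R ≤ i
  lt : ∀ q < R, rt q 0 < i
  exists_root : ∀ x y, H.Adj x y → y < x → x < i → ∃ q < R, rt q 0 = x

/-- The state after the construction of the graph. -/
structure BuiltGraph (H : SimpleGraph ℕ) (N : ℕ) (c : ℕ → ℕ → ℝ) (n : ℝ) (τ : MState) : Prop where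
  graph : GraphInv H (countB c n) N 0 τ
  roots : RootTable H (τ.natArr 3) (τ.natVar 4) N
  roots_le : τ.natVar 4 ≤ τ.natVar 3
  diag : ∀ i < N, τ.realArr 0 i i = c i i / n
  offDiag : ∀ i j, i ≠ j → τ.realArr 0 i j = 0

/-- A vertex becomes a root only if its row of the scan has produced an edge. Therefore the number
of roots never exceeds the number of edges, on which the cubic time bound rests. -/
theorem buildGraph_spec {H : SimpleGraph ℕ} {σ : MState} {N : ℕ} {n : ℝ} (hN : σ.natVar 0 = N)
    (hn : σ.realVar 1 = n) (h2 : σ.natVar 2 = 0) (h3 : σ.natVar 3 = 0) (h4 : σ.natVar 4 = 0)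
    (hA : ∀ k e, σ.natArr 4 k e = 0) (hI : ∀ x y, σ.natArr 2 x y = 0)
    (hO : ∀ i j, σ.realArr 0 i j = 0)
    (hH : ∀ i j, j < i → i < N →
      (H.Adj i j ↔ σ.realVar 0 * σ.realVar 0 / 2 ≤ countB (σ.realArr 1) n i j)) :
    Runs buildGraph σ (N * (N * 120 + 100) + 10) (BuiltGraph H N (σ.realArr 1) n) := by
  refine Runs.forLoop (B := N) (C := N * 120 + 80) (fun i τ => GraphInv H (countB (σ.realArr 1) n) i 0 τ ∧
    RootTable H (τ.natArr 3) (τ.natVar 4) i ∧ τ.natVar 4 ≤ τ.natVar 3 ∧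
    (∀ a < i, τ.realArr 0 a a = σ.realArr 1 a a / n) ∧ ∀ a b, a ≠ b → τ.realArr 0 a b = 0) rfl
    (fun τ hf => (hf.natVar 0 rfl).trans hN) ?_ ?_ ?_ ?_
  · refine ⟨⟨?_, ?_, ?_⟩, ⟨?_, ?_, ?_⟩, ?_, ?_, ?_⟩
    · have hp : ∀ x y, ¬ Precedes 0 0 x y := by intro x y; unfold Precedes; omega
      refine ⟨?_, ?_, ?_, ?_, ?_, ?_, ?_⟩ <;>
        simp [MState.withNat_natVar_of_ne, h2, h3, hp, hI]
    · simp [MState.withNat_natVar_of_ne, h3, hA]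
    · intro x y _ h; unfold Precedes at h; omega
    · simp [MState.withNat_natVar_of_ne, h4]
    · simp [MState.withNat_natVar_of_ne, h4]
    · simp
    · simp [MState.withNat_natVar_of_ne, h4]
    · simp
    · simpa using fun a b _ => hO a b
  · rintro i hi τ hf hv ⟨hg, hr, hle, hd, ho⟩
    have hrv : ∀ υ : MState, υ.realVar = τ.realVar → υ.realVar 1 = n := by
      intro υ e; rw [e, hf.realVar 1 rfl, hn]
    refine Runs.seq (Q' := fun υ => υ.natVar 9 = 0 ∧ GraphInv H (countB (σ.realArr 1) n) i 0 υ ∧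
        (∀ a < i + 1, υ.realArr 0 a a = σ.realArr 1 a a / n) ∧
        (∀ a b, a ≠ b → υ.realArr 0 a b = 0)) (T₂ := N * 120 + 60)
      (Runs.straight (by simp [Straight]) le_rfl ?_) ?_
      (by simp only [Prog.time, RExp.cost, NExp.cost]; omega)
    · simp only [Prog.sem, NExp.eval, RExp.eval, hv]
      refine ⟨by simp, ?_, ?_, ?_⟩
      · refine hg.congr (fun _ _ _ => Iff.rfl) rfl rfl rfl (by simp) (by simp) ?_
        funext k l; simp
      · intro a ha
        simp only [arrWrite_apply, hf.realArr 1 rfl, hrv τ rfl]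
        rcases Nat.lt_succ_iff_lt_or_eq.1 ha with h | rfl
        · simp [h.ne, hd a h]
        · simp
      · intro a b hab
        simp only [arrWrite_apply]
        rw [if_neg (by omega), ho a b hab]
    rintro υ hfυ ⟨h9, hgυ, hdυ, hoυ⟩
    have e3 : υ.natVar 3 = τ.natVar 3 := hfυ.natVar 3 rfl
    have e4 : υ.natVar 4 = τ.natVar 4 := hfυ.natVar 4 rfl
    have ea : υ.natArr 3 = τ.natArr 3 := hfυ.natArr 3 rfl
    -- A raised flag certifies that this row has added an edge; that edge pays for the root
    -- registered afterwards.
    refine Runs.seq (Q' := fun ω => GraphInv H (countB (σ.realArr 1) n) i i ω ∧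
        (ω.natVar 9 = 1 → τ.natVar 3 + 1 ≤ ω.natVar 3) ∧ τ.natVar 3 ≤ ω.natVar 3 ∧
        ((∃ y < i, H.Adj i y) → ω.natVar 9 = 1)) (T₁ := N * 120 + 20) (T₂ := 20)
      ?_ ?_ (by omega)
    · refine Runs.forLoop (B := i) (C := 110) (fun j ω => GraphInv H (countB (σ.realArr 1) n) i j ω ∧
        (ω.natVar 9 = 1 → τ.natVar 3 + 1 ≤ ω.natVar 3) ∧ τ.natVar 3 ≤ ω.natVar 3 ∧
        ((∃ y < j, H.Adj i y) → ω.natVar 9 = 1)) rfl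
        (fun ω hω => by rw [NExp.eval, hω.natVar 6 rfl, hfυ.natVar 6 rfl, hv]) ?_ ?_ ?_ ?_
      · refine ⟨hgυ.congr (fun _ _ _ => Iff.rfl) rfl rfl rfl ?_ ?_ rfl, ?_⟩
        · simp [MState.withNat_natVar_of_ne]
        · simp [MState.withNat_natVar_of_ne]
        · simp [MState.withNat_natVar_of_ne, h9, e3]
      · rintro j hj ω hfω hvω ⟨hgω, h1, h2, h3⟩
        have er : ω.realArr 1 = σ.realArr 1 := by
          rw [hfω.realArr 1 rfl, hfυ.realArr 1 rfl, hf.realArr 1 rfl]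
        have e0 : ω.realVar 0 = σ.realVar 0 := by
          rw [hfω.realVar 0 rfl, hfυ.realVar 0 rfl, hf.realVar 0 rfl]
        have en : ω.realVar 1 = n := by
          rw [hfω.realVar 1 rfl, hfυ.realVar 1 rfl, hf.realVar 1 rfl, hn]
        have e6 : ω.natVar 6 = i := by rw [hfω.natVar 6 rfl, hfυ.natVar 6 rfl, hv]
        refine (testEdge_spec (H := H) hj e6 hvω en (by rw [er, e0]; exact hH i j hj hi)
          (by rw [er]; exact hgω)).mono le_rfl ?_
        rintro χ - ⟨hg', hyes, hno⟩
        rw [er] at hg'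
        refine ⟨hg'.congr (fun _ _ _ => Iff.rfl) rfl rfl rfl ?_ ?_ rfl, ?_⟩
        · simp [MState.withNat_natVar_of_ne]
        · simp [MState.withNat_natVar_of_ne]
        simp only [MState.withNat_natVar_of_ne, ne_eq, Nat.reduceEqDiff, not_false_eq_true]
        by_cases hadj : H.Adj i j
        · obtain ⟨y1, y2⟩ := hyes hadj
          exact ⟨fun _ => by omega, by omega, fun _ => y2⟩
        · obtain ⟨y1, y2⟩ := hno hadj
          rw [y1, y2]
          refine ⟨h1, h2, ?_⟩
          rintro ⟨y, hy, hay⟩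
          rcases Nat.lt_succ_iff_lt_or_eq.1 hy with h | rfl
          · exact h3 ⟨y, h, hay⟩
          · exact absurd hay hadj
      · exact fun ω _ h => h
      · simp only [NExp.cost]; omega
    · rintro ω hfω ⟨hgω, h1, h2, h3⟩
      refine Runs.straight (by simp [Straight]) (by decide) ?_
      have ea' : ω.natArr 3 = τ.natArr 3 := by rw [hfω.natArr 3 rfl, ea]
      have e4' : ω.natVar 4 = τ.natVar 4 := by rw [hfω.natVar 4 rfl, e4]
      have e6 : ω.natVar 6 = i := by rw [hfω.natVar 6 rfl, hfυ.natVar 6 rfl, hv]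
      have eO : ω.realArr 0 = υ.realArr 0 := hfω.realArr 0 rfl
      simp only [Prog.sem, BExp.eval, NExp.eval, e6]
      split_ifs with h9'
      · refine ⟨hgω.congr ?_ ?_ ?_ ?_ ?_ ?_ rfl, ⟨?_, ?_, ?_⟩, ?_, ?_, ?_⟩
        · intro x y hxy; unfold Precedes; omega
        · funext k l; simp
        · funext k l; simp
        · funext k l; simp
        · simp [MState.withNat_natVar_of_ne]
        · simp [MState.withNat_natVar_of_ne]
        · simp [MState.withNat_natVar_of_ne, e4', hr.le]
        · intro q hq
          simp only [MState.withNat_natVar_of_ne, ne_eq, Nat.reduceEqDiff, not_false_eq_true,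
            Function.update_self, e4'] at hq
          simp only [MState.withNat_natArr, arrWrite_apply, e4', ea']
          by_cases hc : q = τ.natVar 4
          · simp [hc]
          · have := hr.lt q (by omega)
            simp [hc]; omega
        · intro x y hxy hlt hx
          simp only [MState.withNat_natVar_of_ne, ne_eq, Nat.reduceEqDiff, not_false_eq_true,
            Function.update_self, e4', MState.withNat_natArr, arrWrite_apply, ea']
          rcases Nat.lt_succ_iff_lt_or_eq.1 hx with h | rfl
          · obtain ⟨q, hq, e⟩ := hr.exists_root x y hxy hlt h
            exact ⟨q, by omega, by simp [hq.ne, e]⟩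
          · exact ⟨τ.natVar 4, by omega, by simp⟩
        · have := h1 h9'
          simp [MState.withNat_natVar_of_ne, e4']; omega
        · simpa [eO] using hdυ
        · simpa [eO] using hoυ
      · refine ⟨hgω.congr ?_ rfl rfl rfl ?_ ?_ rfl, ⟨?_, ?_, ?_⟩, ?_, ?_, ?_⟩
        · intro x y hxy; unfold Precedes; omega
        · simp [MState.withNat_natVar_of_ne]
        · simp [MState.withNat_natVar_of_ne]
        · have := hr.le
          simp [MState.withNat_natVar_of_ne, e4']; omega
        · intro q hq
          simp only [MState.withNat_natVar_of_ne, ne_eq, Nat.reduceEqDiff, not_false_eq_true,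
            e4', MState.withNat_natArr, ea'] at hq ⊢
          have := hr.lt q hq; omega
        · intro x y hxy hlt hx
          simp only [MState.withNat_natVar_of_ne, ne_eq, Nat.reduceEqDiff, not_false_eq_true,
            e4', MState.withNat_natArr, ea']
          rcases Nat.lt_succ_iff_lt_or_eq.1 hx with h | rfl
          · exact hr.exists_root x y hxy hlt h
          · exact absurd (h3 ⟨y, hlt, hxy⟩) h9'
        · simp [MState.withNat_natVar_of_ne, e4']; omega
        · simpa [eO] using hdυ
        · simpa [eO] using hoυ
  · rintro τ - ⟨h1, h2, h3, h4, h5⟩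
    exact ⟨h1, h2, h3, h4, h5⟩
  · simp only [NExp.cost]; ring_nf; omega

end MomentProgram

@[simp] theorem arrWrite_row_self {β : Type*} (A : ℕ → ℕ → ℕ → β) (a i j : ℕ) (v : β) :
    arrWrite A a i j v a i = Function.update (A a i) j v := by
  funext l; simp [Function.update_apply]

/-! ### Breadth-first search -/

namespace MomentProgram

open Prog SimpleGraph

/-- The invariant of breadth-first search from `v` before the queue entry `head` is treated. -/
structure BfsInv (H : SimpleGraph ℕ) (v cnt : ℕ) (seen ord par dn : ℕ → ℕ) (dr : ℕ → ℝ)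
    (head : ℕ) : Prop where
  pos : 0 < cnt
  ord_zero : ord 0 = v
  seen_iff : ∀ x, seen x = 1 ↔ ∃ i < cnt, ord i = x
  seen_bit : ∀ x, seen x = 0 ∨ seen x = 1
  inj : ∀ i < cnt, ∀ j < cnt, ord i = ord j → i = j
  par_ord : ∀ i < cnt, 0 < i → ∃ i' < i, par (ord i) = ord i' ∧ H.Adj (ord i') (ord i) ∧
    dn (ord i) = dn (ord i') + 1
  par_root : par v = v
  dn_root : dn v = 0
  dr_eq : ∀ x, dr x = dn x
  mono : ∀ i j, i ≤ j → j < cnt → dn (ord i) ≤ dn (ord j)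
  bound : head < cnt → ∀ j < cnt, dn (ord j) ≤ dn (ord head) + 1
  done : ∀ i < head, i < cnt → ∀ y, H.Adj (ord i) y → seen y = 1 ∧ dn y ≤ dn (ord i) + 1

namespace BfsInv

variable {H : SimpleGraph ℕ} {v cnt head : ℕ} {seen ord par dn : ℕ → ℕ} {dr : ℕ → ℝ}

/-- The queue is sorted by depth and no depth in it exceeds that of the head by more than one
(`mono`, `bound`). A vertex one deeper than the head can therefore be appended without violating
either. -/
theorem insert (h : BfsInv H v cnt seen ord par dn dr head) (hc : head < cnt) {w : ℕ}
    (ha : H.Adj (ord head) w) (hw : seen w = 0) :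
    BfsInv H v (cnt + 1) (Function.update seen w 1) (Function.update ord cnt w)
      (Function.update par w (ord head)) (Function.update dn w (dn (ord head) + 1))
      (Function.update dr w (dr (ord head) + 1)) head := by
  have hne : ∀ i < cnt, ord i ≠ w := by
    intro i hi e
    have := (h.seen_iff w).2 ⟨i, hi, e⟩
    omega
  have hvw : v ≠ w := h.ord_zero ▸ hne 0 h.pos
  have ho : ∀ i < cnt, Function.update ord cnt w i = ord i := fun i hi =>
    Function.update_of_ne hi.ne _ _
  have hs : ∀ x, seen x = 1 → x ≠ w := by rintro x hx rfl; omega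
  refine ⟨by omega, ?_, ?_, ?_, ?_, ?_, ?_, ?_, ?_, ?_, ?_, ?_⟩
  · rw [ho 0 h.pos, h.ord_zero]
  · intro x
    by_cases hx : x = w
    · subst hx
      simp only [Function.update_self, true_iff]
      exact ⟨cnt, by omega, by simp⟩
    · rw [Function.update_of_ne hx, h.seen_iff]
      constructor
      · rintro ⟨i, hi, e⟩; exact ⟨i, by omega, by rw [ho i hi, e]⟩
      · rintro ⟨i, hi, e⟩
        rcases Nat.lt_succ_iff_lt_or_eq.1 hi with h1 | rfl
        · exact ⟨i, h1, by rw [← e, ho i h1]⟩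
        · simp at e; exact absurd e.symm hx
  · intro x
    rw [Function.update_apply]
    split_ifs
    · simp
    · exact h.seen_bit x
  · intro i hi j hj e
    rcases Nat.lt_succ_iff_lt_or_eq.1 hi with h1 | rfl <;>
      rcases Nat.lt_succ_iff_lt_or_eq.1 hj with h2 | rfl
    · rw [ho i h1, ho j h2] at e; exact h.inj i h1 j h2 e
    · rw [ho i h1, Function.update_self] at e; exact absurd e (hne i h1)
    · rw [ho j h2, Function.update_self] at e; exact absurd e.symm (hne j h2)
    · rfl
  · intro i hi h0
    rcases Nat.lt_succ_iff_lt_or_eq.1 hi with h1 | rfl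
    · obtain ⟨i', hi', e1, e2, e3⟩ := h.par_ord i h1 h0
      refine ⟨i', hi', ?_⟩
      rw [ho i h1, ho i' (by omega), Function.update_of_ne (hne i h1),
        Function.update_of_ne (hne i h1), Function.update_of_ne (hne i' (by omega))]
      exact ⟨e1, e2, e3⟩
    · refine ⟨head, hc, ?_⟩
      rw [ho head hc, Function.update_self, Function.update_self, Function.update_self,
        Function.update_of_ne (hne head hc)]
      exact ⟨rfl, ha, rfl⟩
  · rw [Function.update_of_ne hvw, h.par_root]
  · rw [Function.update_of_ne hvw, h.dn_root]
  · intro x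
    rw [Function.update_apply, Function.update_apply]
    split_ifs
    · rw [h.dr_eq]; push_cast; rfl
    · exact h.dr_eq x
  · intro i j hij hj
    rcases Nat.lt_succ_iff_lt_or_eq.1 hj with h1 | rfl
    · rw [ho i (by omega), ho j h1, Function.update_of_ne (hne i (by omega)),
        Function.update_of_ne (hne j h1)]
      exact h.mono i j hij h1
    · rcases hij.lt_or_eq with h2 | rfl
      · rw [ho i h2, Function.update_self, Function.update_self, Function.update_of_ne (hne i h2)]
        exact h.bound hc i h2
      · exact le_rfl
  · intro _ j hj
    rw [ho head hc, Function.update_of_ne (hne head hc)]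
    rcases Nat.lt_succ_iff_lt_or_eq.1 hj with h1 | rfl
    · rw [ho j h1, Function.update_of_ne (hne j h1)]; exact h.bound hc j h1
    · rw [Function.update_self, Function.update_self]
  · intro i hi _ y hy
    rw [ho i (by omega)] at hy ⊢
    obtain ⟨h1, h2⟩ := h.done i hi (by omega) y hy
    rw [Function.update_of_ne (hs y h1), Function.update_of_ne (hs y h1),
      Function.update_of_ne (hne i (by omega))]
    exact ⟨h1, h2⟩

theorem next (h : BfsInv H v cnt seen ord par dn dr head)
    (hd : head < cnt → ∀ y, H.Adj (ord head) y → seen y = 1 ∧ dn y ≤ dn (ord head) + 1) :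
    BfsInv H v cnt seen ord par dn dr (head + 1) :=
  { h with
    bound := fun hc j hj => (h.bound (by omega) j hj).trans
      (Nat.add_le_add_right (h.mono _ _ (Nat.le_succ _) hc) 1)
    done := fun i hi hic => by
      rcases Nat.lt_succ_iff_lt_or_eq.1 hi with h1 | rfl
      · exact h.done i h1 hic
      · exact hd hic }

theorem isSearchTree (h : BfsInv H v cnt seen ord par dn dr head) (hc : cnt ≤ head) :
    IsSearchTree H v cnt seen ord par dn dr :=
  { h with
    closure := fun x y hx ha => by
      obtain ⟨i, hi, rfl⟩ := (h.seen_iff x).1 hx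
      exact h.done i (by omega) hi y ha }

/-- In a queue with at least two entries every vertex has a neighbor and so is the tail of some
directed edge. Hence `m₂` rounds exhaust the queue, a number that does not involve isolated
vertices. -/
theorem cnt_le (h : BfsInv H v cnt seen ord par dn dr head) {D I : ℕ → ℕ → ℕ} {m₂ m : ℕ}
    (ht : EdgeTables H.Adj D I m₂ m) (hm : 0 < m₂) : cnt ≤ m₂ := by
  rcases Nat.lt_or_ge 1 cnt with h1 | h1
  · have hadj : ∀ i < cnt, ∃ y, H.Adj (ord i) y := by
      intro i hi
      rcases Nat.eq_zero_or_pos i with rfl | h0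
      · obtain ⟨i', hi', -, ha, -⟩ := h.par_ord 1 h1 one_pos
        have : i' = 0 := by omega
        subst this
        exact ⟨_, ha⟩
      · obtain ⟨i', -, -, ha, -⟩ := h.par_ord i hi h0
        exact ⟨_, ha.symm⟩
    have hsub : (Finset.range cnt).image ord ⊆ (Finset.range m₂).image (fun d => D d 0) := by
      intro x hx
      obtain ⟨i, hi, rfl⟩ := Finset.mem_image.1 hx
      obtain ⟨y, hy⟩ := hadj i (Finset.mem_range.1 hi)
      obtain ⟨d, hd, e, -⟩ := ht.exists_dir _ _ hy
      exact Finset.mem_image.2 ⟨d, Finset.mem_range.2 hd, e⟩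
    have := Finset.card_le_card hsub
    rw [Finset.card_image_of_injOn (fun i hi j hj e => h.inj i (Finset.mem_range.1 hi) j
      (Finset.mem_range.1 hj) e), Finset.card_range] at this
    exact this.trans (Finset.card_image_le.trans (by simp))
  · omega

end BfsInv

/-- The search invariant for the rows with index `q`. -/
def BfsState (H : SimpleGraph ℕ) (q v head : ℕ) (τ : MState) : Prop :=
  BfsInv H v (τ.natVar 8) (τ.natArr 5 q) (τ.natArr 6 q) (τ.natArr 7 q) (τ.natArr 8 q)
    (τ.realArr 3 q) head

theorem bfsVisit_spec {H : SimpleGraph ℕ} {q v head d : ℕ} {τ : MState}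
    (h : BfsState H q v head τ) (hc : head < τ.natVar 8) (h6 : τ.natVar 6 = q)
    (h10 : τ.natVar 10 = τ.natArr 6 q head) (h11 : τ.natVar 11 = d)
    (hD : H.Adj (τ.natArr 1 d 0) (τ.natArr 1 d 1)) :
    Runs bfsVisit τ 60 fun τ' => BfsState H q v head τ' ∧ head < τ'.natVar 8 ∧
      τ'.natArr 6 q head = τ.natArr 6 q head ∧
      (∀ x, τ.natArr 5 q x = 1 → τ'.natArr 5 q x = 1 ∧ τ'.natArr 8 q x = τ.natArr 8 q x) ∧
      (τ.natArr 1 d 0 = τ.natArr 6 q head → τ'.natArr 5 q (τ.natArr 1 d 1) = 1 ∧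
        τ'.natArr 8 q (τ.natArr 1 d 1) ≤ τ'.natArr 8 q (τ.natArr 6 q head) + 1) := by
  refine Runs.straight (by simp [bfsVisit, Straight]) (by decide) ?_
  simp only [bfsVisit, Prog.sem, BExp.eval, NExp.eval, h6, h10, h11]
  split_ifs with hcond
  · obtain ⟨hu, hw⟩ := hcond
    have hs : ∀ x, τ.natArr 5 q x = 1 → x ≠ τ.natArr 1 d 1 := by rintro x hx rfl; omega
    have hhead : τ.natArr 5 q (τ.natArr 6 q head) = 1 := (h.seen_iff _).2 ⟨head, hc, rfl⟩
    have hins := h.insert hc (w := τ.natArr 1 d 1) (by rw [← hu]; exact hD) hw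
    refine ⟨?_, ?_, ?_, ?_, ?_⟩
    · unfold BfsState
      convert hins using 1 <;> first
        | (funext l; simp [RExp.eval, NExp.eval, h6, h10, Function.update_apply])
        | simp
    · simp; omega
    · simp [hc.ne]
    · intro x hx
      simp [hs x hx, hx]
    · intro _
      simp [hs _ hhead, h6, h10]
  · refine ⟨h, hc, rfl, fun x hx => ⟨hx, rfl⟩, fun hu => ?_⟩
    have hseen : τ.natArr 5 q (τ.natArr 1 d 1) = 1 := by
      rcases h.seen_bit (τ.natArr 1 d 1) with h0 | h1
      · exact absurd ⟨hu, h0⟩ hcond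
      · exact h1
    obtain ⟨i, hi, e⟩ := (h.seen_iff _).1 hseen
    exact ⟨hseen, by rw [← e]; exact h.bound hc i hi⟩

/-- The search tree stored in the rows with index `q`. -/
def TreeState (H : SimpleGraph ℕ) (q : ℕ) (τ : MState) : Prop :=
  IsSearchTree H (τ.natArr 3 q 0) (τ.natArr 3 q 1) (τ.natArr 5 q) (τ.natArr 6 q) (τ.natArr 7 q)
    (τ.natArr 8 q) (τ.realArr 3 q) ∧ τ.natArr 3 q 1 ≤ τ.natVar 2

/-- The full edge list is scanned at every queue position. This quadratic cost is paid once per root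
and not once per witness, so it stays within the cubic budget. -/
theorem bfsRoot_spec {H : SimpleGraph ℕ} {q : ℕ} {σ : MState} (h6 : σ.natVar 6 = q)
    {I : ℕ → ℕ → ℕ} {m : ℕ} (ht : EdgeTables H.Adj (σ.natArr 1) I (σ.natVar 2) m) (hm : 0 < m)
    (h5 : ∀ x, σ.natArr 5 q x = 0) (h8 : ∀ x, σ.natArr 8 q x = 0)
    (h3 : ∀ x, σ.realArr 3 q x = 0) :
    Runs bfsRoot σ (σ.natVar 2 * (σ.natVar 2 * 70 + 50) + 60) fun τ =>
      TreeState H q τ ∧ τ.natArr 3 q 0 = σ.natArr 3 q 0 := by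
  set v := σ.natArr 3 q 0 with hv
  have hm2 : 0 < σ.natVar 2 := by rw [ht.two_mul]; omega
  refine Runs.seq (Q' := BfsState H q v 0) (T₁ := 40)
    (T₂ := σ.natVar 2 * (σ.natVar 2 * 70 + 50) + 20)
    (Runs.straight (by simp [Straight]) (by decide) ?_) ?_ (by omega)
  · simp only [Prog.sem, NExp.eval, h6, BfsState]
    simp [← hv, h6]
    refine ⟨by simp, by simp, ?_, ?_, ?_, ?_, by simp, h8 v, ?_, ?_, ?_, ?_⟩
    · intro x; simp [h5, eq_comm]
    · intro x; simp only [arrWrite_apply]; split_ifs <;> simp_all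
    · intro i hi j hj _; omega
    · intro i hi h0; omega
    · intro x; simp [h8, h3]
    · intro i j _ _; simp [h8]
    · intro _ j _; simp [h8]
    · intro i hi; omega
  · intro τ hf hτ
    have e1 : τ.natArr 1 = σ.natArr 1 := hf.natArr 1 rfl
    have e3 : τ.natArr 3 = σ.natArr 3 := hf.natArr 3 rfl
    have e2 : τ.natVar 2 = σ.natVar 2 := hf.natVar 2 rfl
    have e6 : τ.natVar 6 = q := by rw [hf.natVar 6 rfl, h6]
    refine Runs.seq (Q' := BfsState H q v (σ.natVar 2)) (T₂ := 10)
      (T₁ := σ.natVar 2 * (σ.natVar 2 * 70 + 50) + 10) ?_ ?_ (by omega)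
    · refine Runs.forLoop (B := σ.natVar 2) (C := σ.natVar 2 * 70 + 30)
        (fun head υ => BfsState H q v head υ) rfl
        (fun υ hυ => by rw [NExp.eval, hυ.natVar 2 rfl, e2]) hτ ?_ (fun _ _ h => h)
        (by simp only [NExp.cost]; ring_nf; omega)
      intro head hh υ hfυ hv9 hυ
      have f1 : υ.natArr 1 = σ.natArr 1 := by rw [hfυ.natArr 1 rfl, e1]
      have f2 : υ.natVar 2 = σ.natVar 2 := by rw [hfυ.natVar 2 rfl, e2]
      have f6 : υ.natVar 6 = q := by rw [hfυ.natVar 6 rfl, e6]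
      refine Runs.cond (T := σ.natVar 2 * 70 + 20) (fun hb => ?_) (fun hb => ?_)
        (by simp only [BExp.cost, NExp.cost]; omega)
      · simp only [BExp.eval, NExp.eval, hv9] at hb
        refine Runs.seq (Q' := fun ω => BfsState H q v head ω ∧ head < ω.natVar 8 ∧
          ω.natVar 10 = ω.natArr 6 q head) (T₁ := 5) (T₂ := σ.natVar 2 * 70 + 10)
          (Runs.straight trivial (by decide) ?_) ?_ (by omega)
        · simp only [Prog.sem, NExp.eval, f6, hv9]
          exact ⟨hυ, hb, by simp⟩
        · rintro ω hfω ⟨hω, hlt, h10⟩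
          have g1 : ω.natArr 1 = σ.natArr 1 := by rw [hfω.natArr 1 rfl, f1]
          have g2 : ω.natVar 2 = σ.natVar 2 := by rw [hfω.natVar 2 rfl, f2]
          have g6 : ω.natVar 6 = q := by rw [hfω.natVar 6 rfl, f6]
          refine Runs.forLoop (B := σ.natVar 2) (C := 60) (fun d χ => BfsState H q v head χ ∧
            head < χ.natVar 8 ∧ χ.natArr 6 q head = ω.natArr 6 q head ∧
            ∀ d' < d, σ.natArr 1 d' 0 = ω.natArr 6 q head → χ.natArr 5 q (σ.natArr 1 d' 1) = 1 ∧
              χ.natArr 8 q (σ.natArr 1 d' 1) ≤ χ.natArr 8 q (ω.natArr 6 q head) + 1) rfl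
            (fun χ hχ => by rw [NExp.eval, hχ.natVar 2 rfl, g2]) ⟨hω, hlt, rfl, by simp⟩ ?_ ?_
            (by simp only [NExp.cost]; omega)
          · rintro d hd χ hfχ hv11 ⟨hχ, hcχ, ho, hdone⟩
            have k1 : χ.natArr 1 = σ.natArr 1 := by rw [hfχ.natArr 1 rfl, g1]
            refine (bfsVisit_spec hχ hcχ (by rw [hfχ.natVar 6 rfl, g6])
              (by rw [hfχ.natVar 10 rfl, h10, ho]) hv11
              (by rw [k1]; exact ht.dir_adj d hd)).mono le_rfl ?_
            rintro χ' - ⟨h1, h2, h3, h4, h5⟩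
            rw [k1, ho] at h5
            refine ⟨h1, h2, h3.trans ho, fun d' hd' e => ?_⟩
            rcases Nat.lt_succ_iff_lt_or_eq.1 hd' with hlt' | rfl
            · obtain ⟨a1, a2⟩ := hdone d' hlt' e
              obtain ⟨b1, b2⟩ := h4 _ a1
              have hhd : χ.natArr 5 q (ω.natArr 6 q head) = 1 :=
                (hχ.seen_iff _).2 ⟨head, hcχ, ho⟩
              obtain ⟨-, b3⟩ := h4 _ hhd
              exact ⟨b1, by simp only [MState.withNat_natArr]; rw [b2, b3]; exact a2⟩
            · exact h5 e
          · rintro χ - ⟨hχ, hcχ, ho, hdone⟩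
            refine BfsInv.next hχ fun _ y hy => ?_
            simp only [MState.withNat_natArr] at hy ⊢
            rw [ho] at hy ⊢
            obtain ⟨d, hd, d0, rfl⟩ := ht.exists_dir _ _ hy
            exact hdone d hd d0
      · simp only [BExp.eval, NExp.eval, hv9, not_lt] at hb
        refine Runs.straight trivial (by simp only [Prog.time]; omega) ?_
        exact BfsInv.next hυ fun h => absurd h
          (by simpa [Prog.sem, MState.withNat_natVar_of_ne] using hb)
    · intro υ hfυ hυ
      have f2 : υ.natVar 2 = σ.natVar 2 := by rw [hfυ.natVar 2 rfl, e2]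
      have f3 : υ.natArr 3 = σ.natArr 3 := by rw [hfυ.natArr 3 rfl, e3]
      have f6 : υ.natVar 6 = q := by rw [hfυ.natVar 6 rfl, e6]
      refine Runs.straight trivial (by decide) ?_
      have hcnt := BfsInv.cnt_le hυ ht hm2
      simp only [Prog.sem, NExp.eval, f6, TreeState]
      refine ⟨⟨?_, ?_⟩, by simp [f3, ← hv]⟩
      · simpa [f3, ← hv, arrWrite_of_ne] using BfsInv.isSearchTree hυ hcnt
      · simpa [f2] using hcnt

/-- All writes go to the row of the current root: finished trees persist, and the rows of later
roots are still zero when their search begins. -/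
theorem bfsAll_spec {H : SimpleGraph ℕ} {σ : MState}
    (ht : EdgeTables H.Adj (σ.natArr 1) (σ.natArr 2) (σ.natVar 2) (σ.natVar 3))
    (hR : σ.natVar 4 ≤ σ.natVar 3)
    (h5 : ∀ q x, σ.natArr 5 q x = 0) (h8 : ∀ q x, σ.natArr 8 q x = 0)
    (h3 : ∀ q x, σ.realArr 3 q x = 0) :
    Runs bfsAll σ (σ.natVar 4 * (σ.natVar 2 * (σ.natVar 2 * 70 + 50) + 70) + 10) fun τ =>
      (∀ q < σ.natVar 4, TreeState H q τ) ∧ ∀ q, τ.natArr 3 q 0 = σ.natArr 3 q 0 := by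
  refine Runs.forLoop (B := σ.natVar 4) (C := σ.natVar 2 * (σ.natVar 2 * 70 + 50) + 60)
    (fun q τ => (∀ q' < q, TreeState H q' τ) ∧ (∀ q', τ.natArr 3 q' 0 = σ.natArr 3 q' 0) ∧
      (∀ q', q ≤ q' → ∀ x, τ.natArr 5 q' x = 0 ∧ τ.natArr 8 q' x = 0 ∧ τ.realArr 3 q' x = 0)) rfl
    (fun τ hf => hf.natVar 4 rfl) ⟨by simp, by simp, by simp [h5, h8, h3]⟩ ?_ ?_
    (by simp only [NExp.cost]; ring_nf; omega)
  · rintro q hq τ hf hv ⟨h1, h2, h4⟩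
    have e2 : τ.natVar 2 = σ.natVar 2 := hf.natVar 2 rfl
    refine (bfsRoot_spec (H := H) hv (I := σ.natArr 2) (m := σ.natVar 3)
      (by rw [e2, hf.natArr 1 rfl]; exact ht) (by omega)
      (fun x => (h4 q le_rfl x).1) (fun x => (h4 q le_rfl x).2.1)
      (fun x => (h4 q le_rfl x).2.2)).mono (by rw [e2]) ?_
    rintro τ' hf' ⟨h6, h7⟩
    have hrow : ∀ q', q' ≠ q → (∀ a, τ'.natArr a q' = τ.natArr a q') ∧
        ∀ a, τ'.realArr a q' = τ.realArr a q' := fun q' hne =>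
      ⟨fun a => hf'.natRow 6 a rfl q' (by rwa [hv]), fun a => hf'.realRow 6 a rfl q' (by rwa [hv])⟩
    have e2' : τ'.natVar 2 = τ.natVar 2 := hf'.natVar 2 rfl
    refine ⟨fun q' hq' => ?_, fun q' => ?_, fun q' hq' x => ?_⟩
    · unfold TreeState
      rw [MState.withNat_natVar_of_ne _ _ _ (by norm_num)]
      rcases Nat.lt_succ_iff_lt_or_eq.1 hq' with hlt | rfl
      · have := h1 q' hlt
        unfold TreeState at this
        obtain ⟨r1, r2⟩ := hrow q' hlt.ne
        simpa only [MState.withNat_natArr, MState.withNat_realArr, r1, r2, e2'] using this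
      · exact h6
    · by_cases hqq : q' = q
      · subst hqq; exact h7.trans (h2 _)
      · simp only [MState.withNat_natArr]
        rw [(hrow q' hqq).1]; exact h2 q'
    · obtain ⟨r1, r2⟩ := hrow q' (by omega)
      simp only [MState.withNat_natArr, MState.withNat_realArr]
      rw [r1, r1, r2]
      exact h4 q' (by omega) x
  · exact fun τ _ h => ⟨h.1, h.2.1⟩

end MomentProgram

/-! ### Search for a shortest odd closed walk -/

namespace MomentProgram

open Prog SimpleGraph

/-- The state after the breadth-first searches. -/
structure Searched (H : SimpleGraph ℕ) (τ : MState) : Prop where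
  tables : EdgeTables H.Adj (τ.natArr 1) (τ.natArr 2) (τ.natVar 2) (τ.natVar 3)
  trees : ∀ q < τ.natVar 4, TreeState H q τ
  roots : ∀ i j, H.Adj i j → j < i → ∃ q < τ.natVar 4, τ.natArr 3 q 0 = i
  roots_le : τ.natVar 4 ≤ τ.natVar 3

theorem Searched.frame {H : SimpleGraph ℕ} {σ τ : MState} {p : Prog} (h : Searched H σ)
    (hf : Frame p σ τ) (h₁ : ∀ a ∈ [1, 2, 3, 5, 6, 7, 8], p.putsNat a = false)
    (h₂ : ∀ x ∈ [2, 3, 4], p.setsNat x = false) (h₃ : p.putsReal 3 = false) : Searched H τ := by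
  have a1 := hf.natArr 1 (h₁ 1 (by simp))
  have a2 := hf.natArr 2 (h₁ 2 (by simp))
  have a3 := hf.natArr 3 (h₁ 3 (by simp))
  have a5 := hf.natArr 5 (h₁ 5 (by simp))
  have a6 := hf.natArr 6 (h₁ 6 (by simp))
  have a7 := hf.natArr 7 (h₁ 7 (by simp))
  have a8 := hf.natArr 8 (h₁ 8 (by simp))
  have v2 := hf.natVar 2 (h₂ 2 (by simp))
  have v3 := hf.natVar 3 (h₂ 3 (by simp))
  have v4 := hf.natVar 4 (h₂ 4 (by simp))
  have r3 := hf.realArr 3 h₃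
  obtain ⟨t1, t2, t3, t4⟩ := h
  refine ⟨?_, ?_, ?_, ?_⟩
  · rw [a1, a2, v2, v3]; exact t1
  · intro q hq
    have := t2 q (by omega)
    unfold TreeState at this ⊢
    rwa [a3, a5, a6, a7, a8, v2, r3]
  · rw [v4, a3]; exact t3
  · rw [v3, v4]; exact t4

/-- The weight on pairs of vertices that a row of bits defines. -/
def rowWeight (I : ℕ → ℕ → ℕ) (row : ℕ → ℕ) (a b : ℕ) : ZMod 2 := (row (I a b) : ZMod 2)

theorem EdgeTables.rowWeight_comm {A : ℕ → ℕ → Prop} {D I : ℕ → ℕ → ℕ} {m₂ m : ℕ}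
    (h : EdgeTables A D I m₂ m) (row : ℕ → ℕ) (a b : ℕ) :
    rowWeight I row a b = rowWeight I row b a := by
  rw [rowWeight, rowWeight, h.idx_comm]

/-- The machine adds bits modulo 2 by comparing them; this translates the comparison into addition
in `ZMod 2`. -/
theorem cast_xor {a b : ℕ} (ha : a ≤ 1) (hb : b ≤ 1) :
    ((if a = b then 0 else 1 : ℕ) : ZMod 2) = (a : ZMod 2) + b := by
  interval_cases a <;> interval_cases b <;> decide

theorem cast_bit_inj {a b : ℕ} (ha : a ≤ 1) (hb : b ≤ 1) : (a : ZMod 2) = b ↔ a = b := by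
  interval_cases a <;> interval_cases b <;> decide

theorem labelTree_spec {H : SimpleGraph ℕ} {σ : MState} (hs : Searched H σ) {q k : ℕ}
    (hq : q < σ.natVar 4) (h8 : σ.natVar 8 = q) (h6 : σ.natVar 6 = k)
    (hb : ∀ e, σ.natArr 4 k e ≤ 1) :
    Runs labelTree σ (σ.natVar 2 * 60 + 40) fun τ =>
      IsSearchTree.IsLabeling (σ.natArr 3 q 0) (σ.natArr 5 q) (σ.natArr 7 q)
        (rowWeight (σ.natArr 2) (σ.natArr 4 k)) (fun x => (τ.natArr 9 0 x : ZMod 2)) ∧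
      ∀ x, σ.natArr 5 q x = 1 → τ.natArr 9 0 x ≤ 1 := by
  obtain ⟨ht, hcnt⟩ := hs.trees q hq
  set v := σ.natArr 3 q 0 with hv
  refine Runs.seq (Q' := fun τ => τ.natVar 9 = v ∧ τ.natArr 9 0 v = 0) (T₁ := 12)
    (T₂ := σ.natVar 2 * 60 + 20) (Runs.straight (by simp [Straight]) (by decide) ?_) ?_ (by omega)
  · simp [Prog.sem, NExp.eval, h8, hv]
  rintro τ hf ⟨h9, hlv⟩
  -- Parents precede their children in the queue, so the label of the parent is final when that of
  -- the child is computed. The root is its own parent and is skipped by the program.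
  have hparlt : ∀ i < σ.natArr 3 q 1, ∃ i' ≤ i,
      σ.natArr 7 q (σ.natArr 6 q i) = σ.natArr 6 q i' ∧ (0 < i → i' < i) := by
    intro i hi
    rcases Nat.eq_zero_or_pos i with rfl | h0
    · exact ⟨0, le_rfl, by rw [ht.ord_zero, ht.par_root], fun h => h⟩
    · obtain ⟨i', hi', e, -⟩ := ht.par_ord i hi h0
      exact ⟨i', hi'.le, e, fun _ => hi'⟩
  refine Runs.forLoop (B := σ.natArr 3 q 1) (C := 40) (fun idx υ =>
    υ.natArr 9 0 v = 0 ∧ ∀ i < idx, υ.natArr 9 0 (σ.natArr 6 q i) ≤ 1 ∧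
      (0 < i → (υ.natArr 9 0 (σ.natArr 6 q i) : ZMod 2) =
        υ.natArr 9 0 (σ.natArr 7 q (σ.natArr 6 q i)) +
          rowWeight (σ.natArr 2) (σ.natArr 4 k) (σ.natArr 7 q (σ.natArr 6 q i))
            (σ.natArr 6 q i))) rfl
    (fun υ hυ => by
      simp only [NExp.eval]
      rw [hυ.natArr 3 rfl, hf.natArr 3 rfl, hυ.natVar 8 rfl, hf.natVar 8 rfl, h8])
    ⟨hlv, by simp⟩ ?_ ?_ (by
      simp only [NExp.cost]
      have := Nat.mul_le_mul_right 60 hcnt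
      omega)
  · rintro idx hidx υ hfυ hv10 ⟨h0, hυ⟩
    refine Runs.straight (by simp [Straight]) (by decide) ?_
    have a2 : υ.natArr 2 = σ.natArr 2 := by rw [hfυ.natArr 2 rfl, hf.natArr 2 rfl]
    have a4 : υ.natArr 4 = σ.natArr 4 := by rw [hfυ.natArr 4 rfl, hf.natArr 4 rfl]
    have a6 : υ.natArr 6 = σ.natArr 6 := by rw [hfυ.natArr 6 rfl, hf.natArr 6 rfl]
    have a7 : υ.natArr 7 = σ.natArr 7 := by rw [hfυ.natArr 7 rfl, hf.natArr 7 rfl]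
    have e8 : υ.natVar 8 = q := by rw [hfυ.natVar 8 rfl, hf.natVar 8 rfl, h8]
    have e6 : υ.natVar 6 = k := by rw [hfυ.natVar 6 rfl, hf.natVar 6 rfl, h6]
    have e9 : υ.natVar 9 = v := by rw [hfυ.natVar 9 rfl, h9]
    simp [Prog.sem, NExp.eval, BExp.eval, e8, e6, e9, a2, a4, a6, a7, hv10]
    rcases Nat.eq_zero_or_pos idx with rfl | hpos
    · rw [if_pos ht.ord_zero]
      refine ⟨h0, fun i hi => ?_⟩
      have : i = 0 := by omega
      subst this
      rw [ht.ord_zero]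
      exact ⟨by simp [h0], by simp⟩
    · have hne : ∀ i < idx, σ.natArr 6 q i ≠ σ.natArr 6 q idx := fun i hi e => by
        have := ht.inj i (by omega) idx hidx e; omega
      have hwv : σ.natArr 6 q idx ≠ v := by rw [← ht.ord_zero]; exact (hne 0 hpos).symm
      obtain ⟨i', -, e', hi'⟩ := hparlt idx hidx
      have hbit := (hυ i' (hi' hpos)).1
      have hbv := hne i' (hi' hpos)
      rw [← e'] at hbit hbv
      have hval : ∀ z : ℕ, z = (if υ.natArr 9 0 (σ.natArr 7 q (σ.natArr 6 q idx)) =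
          σ.natArr 4 k (σ.natArr 2 (σ.natArr 7 q (σ.natArr 6 q idx)) (σ.natArr 6 q idx))
          then 0 else 1) → z ≤ 1 ∧ (z : ZMod 2) =
            υ.natArr 9 0 (σ.natArr 7 q (σ.natArr 6 q idx)) +
            rowWeight (σ.natArr 2) (σ.natArr 4 k) (σ.natArr 7 q (σ.natArr 6 q idx))
            (σ.natArr 6 q idx) := by
        rintro z rfl
        refine ⟨by split_ifs <;> simp, ?_⟩
        rw [cast_xor hbit (hb _)]; rfl
      have hnew : ∀ (χ : MState), (∀ x, χ.natArr 9 0 x = if x = σ.natArr 6 q idx then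
          (if υ.natArr 9 0 (σ.natArr 7 q (σ.natArr 6 q idx)) =
          σ.natArr 4 k (σ.natArr 2 (σ.natArr 7 q (σ.natArr 6 q idx)) (σ.natArr 6 q idx))
          then 0 else 1) else υ.natArr 9 0 x) →
          χ.natArr 9 0 v = 0 ∧ ∀ i < idx + 1, χ.natArr 9 0 (σ.natArr 6 q i) ≤ 1 ∧
            (0 < i → (χ.natArr 9 0 (σ.natArr 6 q i) : ZMod 2) =
            χ.natArr 9 0 (σ.natArr 7 q (σ.natArr 6 q i)) +
            rowWeight (σ.natArr 2) (σ.natArr 4 k) (σ.natArr 7 q (σ.natArr 6 q i))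
              (σ.natArr 6 q i)) := by
        intro χ hχ
        refine ⟨by rw [hχ, if_neg hwv.symm, h0], fun i hi => ?_⟩
        rcases Nat.lt_succ_iff_lt_or_eq.1 hi with hlt | rfl
        · obtain ⟨j, hj, ej, -⟩ := hparlt i (by omega)
          rw [hχ, if_neg (hne i hlt), ej, hχ (σ.natArr 6 q j), if_neg (hne j (by omega)), ← ej]
          exact hυ i hlt
        · obtain ⟨z1, z2⟩ := hval _ rfl
          rw [hχ, if_pos rfl, hχ (σ.natArr 7 q _), if_neg hbv]
          exact ⟨z1, fun _ => z2⟩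
      rw [if_neg hwv]
      split_ifs with hc
      · have := hnew { υ with natArr := arrWrite υ.natArr 9 0 (σ.natArr 6 q idx) 0 }
          (by intro x; simp [hc])
        simpa using this
      · have := hnew { υ with natArr := arrWrite υ.natArr 9 0 (σ.natArr 6 q idx) 1 }
          (by intro x; simp [hc])
        simpa using this
  · rintro υ hfυ ⟨h0, hυ⟩
    refine ⟨⟨by simp [h0], fun x hx hxv => ?_⟩, fun x hx => ?_⟩
    · obtain ⟨i, hi, rfl⟩ := (ht.seen_iff x).1 hx
      refine (hυ i hi).2 ?_
      rcases Nat.eq_zero_or_pos i with rfl | h0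
      · exact absurd ht.ord_zero hxv
      · exact h0
    · obtain ⟨i, hi, rfl⟩ := (ht.seen_iff x).1 hx
      exact (hυ i hi).1

/-- The weight of the tree path to `x`. -/
def treeLabel (par dn : ℕ → ℕ) (F : ℕ → ℕ → ZMod 2) (x : ℕ) : ZMod 2 :=
  ∑ t ∈ Finset.range (dn x), F (par^[t + 1] x) (par^[t] x)

/-- The tree paths of the `q`th root to `x` and `y` and an edge form a closed walk of odd weight. -/
def OddCandidate (H : SimpleGraph ℕ) (σ : MState) (F : ℕ → ℕ → ZMod 2) (q x y : ℕ) : Prop :=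
  q < σ.natVar 4 ∧ H.Adj x y ∧ σ.natArr 5 q x = 1 ∧
    F x y ≠ treeLabel (σ.natArr 7 q) (σ.natArr 8 q) F x +
      treeLabel (σ.natArr 7 q) (σ.natArr 8 q) F y

/-- The length of the closed walk of a candidate. -/
def candidateLength (σ : MState) (q x y : ℕ) : ℕ := σ.natArr 8 q x + σ.natArr 8 q y + 1

/-- The record `f` holds a shortest candidate among those that satisfy `P`. -/
def BestInv (cand P : ℕ → ℕ → ℕ → Prop) (len : ℕ → ℕ → ℕ → ℕ) (f : ℕ) (τ : MState) : Prop :=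
  (τ.natVar 7 = 0 ∧ ∀ q x y, P q x y → ¬ cand q x y) ∨
  (τ.natVar 7 = 1 ∧ cand (τ.natArr 10 f 0) (τ.natArr 10 f 1) (τ.natArr 10 f 2) ∧
    τ.realVar 3 = len (τ.natArr 10 f 0) (τ.natArr 10 f 1) (τ.natArr 10 f 2) ∧
    ∀ q x y, P q x y → cand q x y →
      len (τ.natArr 10 f 0) (τ.natArr 10 f 1) (τ.natArr 10 f 2) ≤ len q x y)

theorem BestInv.withNat {cand P P' : ℕ → ℕ → ℕ → Prop} {len : ℕ → ℕ → ℕ → ℕ} {f : ℕ} {τ : MState}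
    (h : BestInv cand P len f τ) {x : ℕ} (hx : 7 ≠ x) (v : ℕ)
    (hP : ∀ q x y, P' q x y → P q x y) : BestInv cand P' len f (τ.withNat x v) := by
  unfold BestInv at h ⊢
  simp only [MState.withNat_natVar_of_ne _ _ _ hx, MState.withNat_natArr]
  rcases h with ⟨h1, h2⟩ | ⟨h1, h2, h3, h4⟩
  · exact Or.inl ⟨h1, fun q x y hp => h2 q x y (hP q x y hp)⟩
  · exact Or.inr ⟨h1, h2, h3, fun q x y hp => h4 q x y (hP q x y hp)⟩

/-- `P` describes the candidates examined so far and `P'` adds the one of the directed edge `d`. The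
record is replaced only by a strictly shorter candidate, so it remains a minimum. -/
theorem scanEdge_spec {cand P P' : ℕ → ℕ → ℕ → Prop} {len : ℕ → ℕ → ℕ → ℕ} {τ : MState}
    {f k q d : ℕ} (h : BestInv cand P len f τ) (h5 : τ.natVar 5 = f) (h6 : τ.natVar 6 = k)
    (h8 : τ.natVar 8 = q) (h10 : τ.natVar 10 = d)
    (hcand : cand q (τ.natArr 1 d 0) (τ.natArr 1 d 1) ↔ τ.natArr 5 q (τ.natArr 1 d 0) = 1 ∧
      (if τ.natArr 9 0 (τ.natArr 1 d 0) = τ.natArr 9 0 (τ.natArr 1 d 1) then 0 else 1) ≠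
        τ.natArr 4 k (τ.natArr 2 (τ.natArr 1 d 0) (τ.natArr 1 d 1)))
    (hlen : τ.realArr 3 q (τ.natArr 1 d 0) + τ.realArr 3 q (τ.natArr 1 d 1) + 1 =
      len q (τ.natArr 1 d 0) (τ.natArr 1 d 1))
    (hP : ∀ q' x y, P' q' x y ↔
      P q' x y ∨ (q' = q ∧ x = τ.natArr 1 d 0 ∧ y = τ.natArr 1 d 1)) :
    Runs scanEdge τ 80 (BestInv cand P' len f) := by
  refine Runs.seq (Q' := fun τ' => τ'.natVar 11 = τ.natArr 1 d 0) (T₁ := 6) (T₂ := 74)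
    (Runs.straight trivial (by decide) (by simp [Prog.sem, NExp.eval, h10])) ?_ (by omega)
  intro τ₁ f₁ e11
  refine Runs.seq (Q' := fun τ' => τ'.natVar 12 = τ.natArr 1 d 1) (T₁ := 6) (T₂ := 68)
    (Runs.straight trivial (by decide) (by
      simp [Prog.sem, NExp.eval, f₁.natVar 10 rfl, f₁.natArr 1 rfl, h10])) ?_ (by omega)
  intro τ₂ f₂ e12
  have g11 : τ₂.natVar 11 = τ.natArr 1 d 0 := by rw [f₂.natVar 11 rfl, e11]
  have g9 : τ₂.natArr 9 = τ.natArr 9 := by rw [f₂.natArr 9 rfl, f₁.natArr 9 rfl]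
  refine Runs.seq (Q' := fun τ' => τ'.natVar 13 =
    if τ.natArr 9 0 (τ.natArr 1 d 0) = τ.natArr 9 0 (τ.natArr 1 d 1) then 0 else 1) (T₁ := 12)
    (T₂ := 56) (Runs.straight (by simp [Straight]) (by decide) (by
      simp only [Prog.sem, NExp.eval, BExp.eval, g11, e12, g9]; split_ifs <;> simp)) ?_ (by omega)
  intro τ₃ f₃ e13
  refine Runs.seq (Q' := fun τ' => τ'.realVar 2 = len q (τ.natArr 1 d 0) (τ.natArr 1 d 1))
    (T₁ := 12) (T₂ := 44) (Runs.straight (by simp [Straight]) (by decide) (by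
      have i11 : τ₃.natVar 11 = τ.natArr 1 d 0 := by rw [f₃.natVar 11 rfl, g11]
      have i12 : τ₃.natVar 12 = τ.natArr 1 d 1 := by rw [f₃.natVar 12 rfl, e12]
      have i8 : τ₃.natVar 8 = q := by
        rw [f₃.natVar 8 rfl, f₂.natVar 8 rfl, f₁.natVar 8 rfl, h8]
      have ir : τ₃.realArr 3 = τ.realArr 3 := by
        rw [f₃.realArr 3 rfl, f₂.realArr 3 rfl, f₁.realArr 3 rfl]
      simp [Prog.sem, NExp.eval, RExp.eval, i11, i12, i8, ir, ← hlen])) ?_ (by omega)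
  intro τ₄ f₄ e2
  have nv : ∀ x, x ≠ 11 → x ≠ 12 → x ≠ 13 → τ₄.natVar x = τ.natVar x := by
    intro x h1 h2 h3
    rw [f₄.natVar x rfl, f₃.natVar x (by simp [setsNat, h3]), f₂.natVar x (by simp [setsNat, h2]),
      f₁.natVar x (by simp [setsNat, h1])]
  have na : ∀ a, τ₄.natArr a = τ.natArr a := fun a => by
    rw [f₄.natArr a rfl, f₃.natArr a rfl, f₂.natArr a rfl, f₁.natArr a rfl]
  have r3 : τ₄.realVar 3 = τ.realVar 3 := by
    rw [f₄.realVar 3 rfl, f₃.realVar 3 rfl, f₂.realVar 3 rfl, f₁.realVar 3 rfl]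
  have k11 : τ₄.natVar 11 = τ.natArr 1 d 0 := by rw [f₄.natVar 11 rfl, f₃.natVar 11 rfl, g11]
  have k12 : τ₄.natVar 12 = τ.natArr 1 d 1 := by rw [f₄.natVar 12 rfl, f₃.natVar 12 rfl, e12]
  have k13 := e13
  rw [← f₄.natVar 13 rfl] at k13
  refine Runs.straight (by simp [Straight]) (by decide) ?_
  simp only [Prog.sem, BExp.eval, NExp.eval, RExp.eval, na, k11, k12, k13, e2, r3,
    nv 8 (by norm_num) (by norm_num) (by norm_num), nv 6 (by norm_num) (by norm_num) (by norm_num),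
    nv 7 (by norm_num) (by norm_num) (by norm_num), h8, h6]
  by_cases hc : cand q (τ.natArr 1 d 0) (τ.natArr 1 d 1) ∧
      ¬ (τ.natVar 7 = 1 ∧ τ.realVar 3 ≤ len q (τ.natArr 1 d 0) (τ.natArr 1 d 1))
  · obtain ⟨hc1, hc2⟩ := hc
    rw [if_pos ⟨hcand.1 hc1, hc2⟩]
    refine Or.inr ?_
    simp [k11, k12, nv 5 (by norm_num) (by norm_num) (by norm_num),
      nv 8 (by norm_num) (by norm_num) (by norm_num), h5, h8]
    refine ⟨hc1, fun q' x y hp hcd => ?_⟩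
    rcases (hP q' x y).1 hp with hp | ⟨rfl, rfl, rfl⟩
    · rcases h with ⟨-, hno⟩ | ⟨h7, -, hl, hmin⟩
      · exact absurd hcd (hno q' x y hp)
      · have := hmin q' x y hp hcd
        have hlt : len q (τ.natArr 1 d 0) (τ.natArr 1 d 1) <
            len (τ.natArr 10 f 0) (τ.natArr 10 f 1) (τ.natArr 10 f 2) := by
          have := lt_of_not_ge fun h => hc2 ⟨h7, h⟩
          rw [hl] at this
          exact_mod_cast this
        omega
    · exact le_rfl
  · rw [if_neg fun h => hc ⟨hcand.2 h.1, h.2⟩]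
    have hnew : ∀ q' x y, P' q' x y → cand q' x y → P q' x y ∨ (τ.natVar 7 = 1 ∧
        τ.realVar 3 ≤ len q' x y) := by
      intro q' x y hp hcd
      rcases (hP q' x y).1 hp with hp | ⟨rfl, rfl, rfl⟩
      · exact Or.inl hp
      · right
        by_contra h'
        exact hc ⟨hcd, h'⟩
    rcases h with ⟨h7, hno⟩ | ⟨h7, hcd0, hl, hmin⟩
    · refine Or.inl ⟨by rw [nv 7 (by norm_num) (by norm_num) (by norm_num), h7], ?_⟩
      intro q' x y hp hcd
      rcases hnew q' x y hp hcd with hp | ⟨h, -⟩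
      · exact hno q' x y hp hcd
      · omega
    · refine Or.inr ⟨by rw [nv 7 (by norm_num) (by norm_num) (by norm_num), h7], ?_⟩
      rw [na, r3]
      refine ⟨hcd0, hl, fun q' x y hp hcd => ?_⟩
      rcases hnew q' x y hp hcd with hp | ⟨-, h⟩
      · exact hmin q' x y hp hcd
      · rw [hl] at h; exact_mod_cast h

/-- The outcome of the search for an odd closed walk. -/
def FoundOdd (H : SimpleGraph ℕ) (σ : MState) (F : ℕ → ℕ → ZMod 2) (f : ℕ) (τ : MState) : Prop :=
  (τ.natVar 7 = 0 ∧ NoOddWalk H F) ∨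
  (τ.natVar 7 = 1 ∧ ∃ q x y, τ.natArr 10 f 0 = q ∧ τ.natArr 10 f 1 = x ∧ τ.natArr 10 f 2 = y ∧
    q < σ.natVar 4 ∧ H.Adj x y ∧ σ.natArr 5 q x = 1 ∧
    IsShortestOdd H F (IsSearchTree.treeWalk (σ.natArr 7 q) (σ.natArr 8 q) x y)
      (σ.natArr 8 q x + σ.natArr 8 q y + 1))

/-- By `exists_odd_candidate` every odd closed walk is matched by a candidate that is not longer. So
the absence of candidates excludes odd closed walks, and a shortest candidate is shortest among all
odd closed walks; that it is a simple cycle then comes for free. -/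
theorem foundOdd_of_bestInv {H : SimpleGraph ℕ} {σ τ : MState} (hs : Searched H σ)
    {F : ℕ → ℕ → ZMod 2} (hF : ∀ a b, F a b = F b a) {f : ℕ}
    (h : BestInv (OddCandidate H σ F) (fun q x y => q < σ.natVar 4 ∧ H.Adj x y)
      (candidateLength σ) f τ) : FoundOdd H σ F f τ := by
  have hlab0 : ∀ q < σ.natVar 4, treeLabel (σ.natArr 7 q) (σ.natArr 8 q) F (σ.natArr 3 q 0) = 0 := by
    intro q hq
    rw [treeLabel, (hs.trees q hq).1.dn_root]; simp
  have hex : ∀ (u : ℕ) (p : H.Walk u u), p.weight F = 1 →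
      ∃ q x y, OddCandidate H σ F q x y ∧ candidateLength σ q x y ≤ p.length := by
    intro u p hp
    obtain ⟨q, hq, x, y, ha, hx, hy, hne, hl⟩ := exists_odd_candidate (fun q hq => (hs.trees q hq).1)
      hs.roots (lab := fun q => treeLabel (σ.natArr 7 q) (σ.natArr 8 q) F) hlab0 p hp
    exact ⟨q, x, y, ⟨hq, ha, hx, hne⟩, hl⟩
  rcases h with ⟨h7, hno⟩ | ⟨h7, hc, hl, hmin⟩
  · refine Or.inl ⟨h7, fun u p => ?_⟩
    by_contra hne
    obtain ⟨q, x, y, hc, -⟩ := hex u p ((zmod_two_cases _).resolve_left hne)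
    exact hno q x y ⟨hc.1, hc.2.1⟩ hc
  · refine Or.inr ⟨h7, _, _, _, rfl, rfl, rfl, hc.1, hc.2.1, hc.2.2.1, ?_⟩
    generalize τ.natArr 10 f 0 = q at *
    generalize τ.natArr 10 f 1 = x at *
    generalize τ.natArr 10 f 2 = y at *
    obtain ⟨hq, ha, hx, hne⟩ := hc
    have t := (hs.trees q hq).1
    have hy := (t.closure x y hx ha).1
    refine ⟨t.treeWalk_closedSeq hx hy ha, ?_, fun u p hp => ?_⟩
    · have hlab : IsSearchTree.IsLabeling (σ.natArr 3 q 0) (σ.natArr 5 q) (σ.natArr 7 q) F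
          (treeLabel (σ.natArr 7 q) (σ.natArr 8 q) F) := by
        refine ⟨hlab0 q hq, fun z hz hzv => ?_⟩
        rw [treeLabel, (t.par_spec hz hzv).2, Finset.sum_range_succ', treeLabel]
        rfl
      rw [t.treeWalk_seqWeight hF hlab hx hy]
      revert hne
      generalize treeLabel _ _ F x = a; generalize treeLabel _ _ F y = b
      generalize F x y = c
      revert a b c; decide
    · obtain ⟨q', x', y', hc', hl'⟩ := hex u p hp
      exact (hmin q' x' y' ⟨hc'.1, hc'.2.1⟩ hc').trans hl'

theorem findOdd_spec {H : SimpleGraph ℕ} {σ : MState} (hs : Searched H σ) {k f : ℕ}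
    (h5 : σ.natVar 5 = f) (h6 : σ.natVar 6 = k) (hb : ∀ e, σ.natArr 4 k e ≤ 1) :
    Runs findOdd σ (σ.natVar 4 * (σ.natVar 2 * 150 + 70) + 10)
      (FoundOdd H σ (rowWeight (σ.natArr 2) (σ.natArr 4 k)) f) := by
  set F := rowWeight (σ.natArr 2) (σ.natArr 4 k) with hF
  have hcomm : ∀ a b, F a b = F b a := hs.tables.rowWeight_comm _
  refine Runs.seq (Q' := fun τ => τ.natVar 7 = 0) (T₁ := 2)
    (T₂ := σ.natVar 4 * (σ.natVar 2 * 150 + 70) + 8) (Runs.straight trivial (by decide)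
      (by simp [Prog.sem, NExp.eval])) ?_ (by omega)
  intro τ hf h7
  refine Runs.forLoop (B := σ.natVar 4) (C := σ.natVar 2 * 150 + 50) (fun q υ =>
    BestInv (OddCandidate H σ F) (fun q' x y => q' < q ∧ H.Adj x y) (candidateLength σ) f υ) rfl
    (fun υ hυ => by rw [NExp.eval, hυ.natVar 4 rfl, hf.natVar 4 rfl])
    (Or.inl ⟨by simp [MState.withNat_natVar_of_ne, h7], by simp⟩) ?_
    (fun υ _ h => foundOdd_of_bestInv hs hcomm h) (by simp only [NExp.cost]; ring_nf; omega)
  intro q hq υ hfυ hv8 hυ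
  have hf' : Frame findOdd σ υ := (hf.seq_left _).trans (hfυ.seq_right _)
  have hsυ : Searched H υ := hs.frame hf' (by decide) (by decide) rfl
  have a : ∀ a, a ≠ 9 → a ≠ 10 → υ.natArr a = σ.natArr a := fun a h1 h2 =>
    hf'.natArr a (by simp [findOdd, labelTree, scanEdge, forLoop, putsNat, h1, h2])
  have v : ∀ x ∈ [2, 4, 5, 6], υ.natVar x = σ.natVar x := fun x hx =>
    hf'.natVar x (by revert x; decide)
  have hlabel := labelTree_spec hsυ (q := q) (k := k) (by rw [v 4 (by simp)]; exact hq) hv8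
    (by rw [v 6 (by simp), h6]) (by rw [a 4 (by norm_num) (by norm_num)]; exact hb)
  rw [v 2 (by simp), a 2 (by norm_num) (by norm_num), a 3 (by norm_num) (by norm_num),
    a 4 (by norm_num) (by norm_num), a 5 (by norm_num) (by norm_num),
    a 7 (by norm_num) (by norm_num)] at hlabel
  refine Runs.seq hlabel (T₂ := σ.natVar 2 * 90 + 10) ?_ (by omega)
  rintro ω hfω ⟨hlab, hbit⟩
  have b : ∀ a, a ≠ 9 → a ≠ 10 → ω.natArr a = σ.natArr a := fun c h1 h2 => by
    rw [hfω.natArr c (by simp [labelTree, forLoop, putsNat, h1]), a c h1 h2]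
  have w : ∀ x ∈ [2, 4, 5, 6], ω.natVar x = σ.natVar x := fun x hx => by
    rw [hfω.natVar x (by revert x; decide), v x hx]
  have r3 : ω.realArr 3 = σ.realArr 3 := by rw [hfω.realArr 3 rfl, hf'.realArr 3 rfl]
  have t := (hs.trees q hq).1
  have hlabt : ∀ x, σ.natArr 5 q x = 1 → (ω.natArr 9 0 x : ZMod 2) =
      treeLabel (σ.natArr 7 q) (σ.natArr 8 q) F x := fun x hx => t.lab_eq_sum hlab hx
  have hω : BestInv (OddCandidate H σ F) (fun q' x y => q' < q ∧ H.Adj x y)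
      (candidateLength σ) f ω := by
    unfold BestInv
    rw [hfω.natVar 7 rfl, hfω.natArr 10 rfl, hfω.realVar 3 rfl]
    exact hυ
  refine Runs.forLoop (B := σ.natVar 2) (C := 80) (fun d χ =>
    BestInv (OddCandidate H σ F) (fun q' x y => (q' < q ∧ H.Adj x y) ∨
      (q' = q ∧ ∃ d' < d, x = σ.natArr 1 d' 0 ∧ y = σ.natArr 1 d' 1)) (candidateLength σ) f χ) rfl
    (fun χ hχ => by rw [NExp.eval, hχ.natVar 2 rfl, w 2 (by simp)]) (hω.withNat (by norm_num) 0 (by simp)) ?_ ?_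
    (by simp only [NExp.cost]; ring_nf; omega)
  · intro d hd χ hfχ hv10 hχ
    have c : ∀ a, a ≠ 9 → a ≠ 10 → χ.natArr a = σ.natArr a := fun c h1 h2 => by
      rw [hfχ.natArr c (by simp [scanEdge, forLoop, putsNat, h2]), b c h1 h2]
    have x : ∀ x ∈ [2, 4, 5, 6], χ.natVar x = σ.natVar x := fun x hx => by
      rw [hfχ.natVar x (by revert x; decide), w x hx]
    have c1 := c 1 (by norm_num) (by norm_num)
    have c9 : χ.natArr 9 = ω.natArr 9 := hfχ.natArr 9 rfl
    have hadj := hs.tables.dir_adj d hd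
    refine (scanEdge_spec (P' := fun q' x y => (q' < q ∧ H.Adj x y) ∨
      (q' = q ∧ ∃ d' < d + 1, x = σ.natArr 1 d' 0 ∧ y = σ.natArr 1 d' 1)) hχ
      (by rw [x 5 (by simp), h5]) (by rw [x 6 (by simp), h6])
      (by rw [hfχ.natVar 8 rfl, hfω.natVar 8 rfl, hv8]) hv10 ?_ ?_ ?_).mono le_rfl
      (fun _ _ h => h.withNat (by norm_num) _ fun _ _ _ h => h)
    · rw [c1, c9, c 5 (by norm_num) (by norm_num), c 2 (by norm_num) (by norm_num),
        c 4 (by norm_num) (by norm_num)]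
      unfold OddCandidate
      simp only [hq, hadj, true_and]
      refine and_congr_right fun hseen => ?_
      have hseen' := (t.closure _ _ hseen hadj).1
      rw [← hlabt _ hseen, ← hlabt _ hseen', ← cast_xor (hbit _ hseen) (hbit _ hseen'), hF,
        rowWeight, ne_eq, cast_bit_inj (hb _) (by split_ifs <;> simp), eq_comm]
    · rw [c1, hfχ.realArr 3 rfl, r3, t.dr_eq, t.dr_eq, candidateLength]
      push_cast; rfl
    · intro q' y z
      rw [c1, or_assoc]
      refine or_congr_right ?_
      constructor
      · rintro ⟨rfl, d', hd', h⟩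
        rcases Nat.lt_succ_iff_lt_or_eq.1 hd' with hlt | rfl
        · exact Or.inl ⟨rfl, d', hlt, h⟩
        · exact Or.inr ⟨rfl, h⟩
      · rintro (⟨rfl, d', hd', h⟩ | ⟨rfl, h⟩)
        · exact ⟨rfl, d', by omega, h⟩
        · exact ⟨rfl, d, by omega, h⟩
  · intro χ hfχ hχ
    refine hχ.withNat (by norm_num) _ ?_
    rintro q' x y ⟨hq', ha⟩
    rcases Nat.lt_succ_iff_lt_or_eq.1 hq' with hlt | rfl
    · exact Or.inl ⟨hlt, ha⟩
    · obtain ⟨d, hd, rfl, rfl⟩ := hs.tables.exists_dir _ _ ha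
      exact Or.inr ⟨rfl, d, hd, rfl, rfl⟩

end MomentProgram

/-! ### Listing a cycle and operating on GF(2) rows -/

namespace MomentProgram

open Prog SimpleGraph

/-- The list includes the return to the first vertex at the index equal to the length, so that its
consecutive entries run through all edges of the cycle. -/
theorem extractCycle_spec {H : SimpleGraph ℕ} {σ : MState} (hs : Searched H σ) {f q x y : ℕ}
    (h5 : σ.natVar 5 = f) (hq : σ.natArr 10 f 0 = q) (hx : σ.natArr 10 f 1 = x)
    (hy : σ.natArr 10 f 2 = y) (hqR : q < σ.natVar 4) (hsx : σ.natArr 5 q x = 1)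
    (hsy : σ.natArr 5 q y = 1) :
    Runs extractCycle σ (σ.natVar 2 * 100 + 100) fun τ =>
      τ.natArr 10 f 3 = σ.natArr 8 q x + σ.natArr 8 q y + 1 ∧
      (∀ c, c ≠ 3 → τ.natArr 10 f c = σ.natArr 10 f c) ∧
      ∀ i ≤ σ.natArr 8 q x + σ.natArr 8 q y + 1, τ.natArr 11 f i =
        IsSearchTree.treeWalk (σ.natArr 7 q) (σ.natArr 8 q) x y i := by
  obtain ⟨t, hcnt⟩ := hs.trees q hqR
  set par := σ.natArr 7 q with hpar
  set dn := σ.natArr 8 q with hdn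
  have hdx := t.dn_lt hsx
  have hdy := t.dn_lt hsy
  refine Runs.seq (Q' := fun τ => τ.natVar 16 = q ∧ τ.natVar 17 = x ∧ τ.natVar 18 = 0) (T₁ := 10)
    (T₂ := σ.natVar 2 * 100 + 90) (Runs.straight (by simp [Straight]) (by decide) ?_) ?_ (by omega)
  · simp [Prog.sem, NExp.eval, h5, hq, hx]
  rintro τ₁ f₁ ⟨a16, a17, a18⟩
  have b5 : τ₁.natVar 5 = f := by rw [f₁.natVar 5 rfl, h5]
  have b10 : τ₁.natArr 10 = σ.natArr 10 := f₁.natArr 10 rfl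
  have b7 : τ₁.natArr 7 = σ.natArr 7 := f₁.natArr 7 rfl
  have b8 : τ₁.natArr 8 = σ.natArr 8 := f₁.natArr 8 rfl
  refine Runs.seq (Q' := fun τ => τ.natVar 17 = par^[dn x] x ∧ τ.natVar 18 = dn x ∧
    ∀ i < dn x, τ.natArr 11 f i = par^[i] x) (T₁ := σ.natVar 2 * 35 + 10)
    (T₂ := σ.natVar 2 * 65 + 80) ?_ ?_ (by ring_nf; omega)
  · refine Runs.forLoop (B := dn x) (C := 15) (fun i τ => τ.natVar 17 = par^[i] x ∧
      τ.natVar 18 = i ∧ ∀ j < i, τ.natArr 11 f j = par^[j] x) rfl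
      (fun τ hτ => by
        simp only [NExp.eval]
        rw [hτ.natArr 8 rfl, hτ.natVar 16 rfl, hτ.natArr 10 rfl, hτ.natVar 5 rfl, b5, b8, b10,
          a16, hx])
      (by simp [MState.withNat_natVar_of_ne, a17, a18]) ?_ (fun _ _ h => h)
      (by simp only [NExp.cost]; omega)
    rintro i hi τ hτ - ⟨c17, c18, c11⟩
    refine Runs.straight (by simp [Straight]) (by decide) ?_
    have c5 : τ.natVar 5 = f := by rw [hτ.natVar 5 rfl, b5]
    have c16 : τ.natVar 16 = q := by rw [hτ.natVar 16 rfl, a16]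
    have c7 : τ.natArr 7 = σ.natArr 7 := by rw [hτ.natArr 7 rfl, b7]
    simp [Prog.sem, NExp.eval, MState.withNat_natVar_of_ne, c5, c16, c7, c17, c18, ← hpar]
    refine ⟨(Function.iterate_succ_apply' par i x).symm, fun j hj => ?_⟩
    rcases hj.lt_or_eq with hlt | rfl
    · simp [hlt.ne, c11 j hlt]
    · simp
  rintro τ₂ f₂ ⟨d17, d18, d11⟩
  have e5 : τ₂.natVar 5 = f := by rw [f₂.natVar 5 rfl, b5]
  have e16 : τ₂.natVar 16 = q := by rw [f₂.natVar 16 rfl, a16]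
  have e10 : τ₂.natArr 10 = σ.natArr 10 := by rw [f₂.natArr 10 rfl, b10]
  have e7 : τ₂.natArr 7 = σ.natArr 7 := by rw [f₂.natArr 7 rfl, b7]
  have e8 : τ₂.natArr 8 = σ.natArr 8 := by rw [f₂.natArr 8 rfl, b8]
  refine Runs.seq (Q' := fun τ => ∀ i ≤ dn x, τ.natArr 11 f i = par^[i] x) (T₁ := 4)
    (T₂ := σ.natVar 2 * 65 + 70) (Runs.straight trivial (by decide) ?_) ?_ (by omega)
  · intro i hi
    rcases hi.lt_or_eq with hlt | rfl
    · simp [Prog.sem, NExp.eval, e5, d17, d18, hlt.ne, d11 i hlt]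
    · simp [Prog.sem, NExp.eval, e5, d17, d18]
  intro τ₃ f₃ g11
  have g5 : τ₃.natVar 5 = f := by rw [f₃.natVar 5 rfl, e5]
  have g16 : τ₃.natVar 16 = q := by rw [f₃.natVar 16 rfl, e16]
  have g18 : τ₃.natVar 18 = dn x := by rw [f₃.natVar 18 rfl, d18]
  have g10 : τ₃.natArr 10 = σ.natArr 10 := by rw [f₃.natArr 10 rfl, e10]
  have g7 : τ₃.natArr 7 = σ.natArr 7 := by rw [f₃.natArr 7 rfl, e7]
  have g8 : τ₃.natArr 8 = σ.natArr 8 := by rw [f₃.natArr 8 rfl, e8]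
  refine Runs.seq (Q' := fun τ => τ.natVar 18 = dn x + dn y) (T₁ := σ.natVar 2 * 20 + 10)
    (T₂ := σ.natVar 2 * 45 + 60) ?_ ?_ (by ring_nf; omega)
  · refine Runs.forLoop (B := dn y) (C := 5) (fun i τ => τ.natVar 18 = dn x + i) rfl
      (fun τ hτ => by
        simp only [NExp.eval]
        rw [hτ.natArr 8 rfl, hτ.natVar 16 rfl, hτ.natArr 10 rfl, hτ.natVar 5 rfl, g5, g8, g10,
          g16, hy])
      (by simp [MState.withNat_natVar_of_ne, g18]) ?_ (fun _ _ h => h)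
      (by simp only [NExp.cost]; omega)
    intro i hi τ hτ _ c18
    refine Runs.straight trivial (by decide) ?_
    simp [Prog.sem, NExp.eval, MState.withNat_natVar_of_ne, c18]; ring
  intro τ₄ f₄ k18
  have k5 : τ₄.natVar 5 = f := by rw [f₄.natVar 5 rfl, g5]
  have k16 : τ₄.natVar 16 = q := by rw [f₄.natVar 16 rfl, g16]
  have k10 : τ₄.natArr 10 = σ.natArr 10 := by rw [f₄.natArr 10 rfl, g10]
  have k11 : τ₄.natArr 11 = τ₃.natArr 11 := f₄.natArr 11 rfl
  have k7 : τ₄.natArr 7 = σ.natArr 7 := by rw [f₄.natArr 7 rfl, g7]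
  have k8 : τ₄.natArr 8 = σ.natArr 8 := by rw [f₄.natArr 8 rfl, g8]
  refine Runs.seq (Q' := fun τ => τ.natVar 17 = y ∧ τ.natArr 10 f 3 = dn x + dn y + 1 ∧
    (∀ c, c ≠ 3 → τ.natArr 10 f c = σ.natArr 10 f c) ∧
    (∀ i ≤ dn x, τ.natArr 11 f i = par^[i] x) ∧ τ.natArr 11 f (dn x + dn y + 1) = x) (T₁ := 20)
    (T₂ := σ.natVar 2 * 45 + 40) (Runs.straight (by simp [Straight]) (by decide) ?_) ?_ (by omega)
  · simp [Prog.sem, NExp.eval, k5, k18, k10, k11, hx, hy]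
    refine ⟨fun c hc => by simp [hc], fun i hi => ?_⟩
    rw [if_neg (by omega), g11 i hi]
  rintro τ₅ f₅ ⟨l17, l10, l10', l11, l11'⟩
  have l5 : τ₅.natVar 5 = f := by rw [f₅.natVar 5 rfl, k5]
  have l16 : τ₅.natVar 16 = q := by rw [f₅.natVar 16 rfl, k16]
  have l18 : τ₅.natVar 18 = dn x + dn y := by rw [f₅.natVar 18 rfl, k18]
  have l7 : τ₅.natArr 7 = σ.natArr 7 := by rw [f₅.natArr 7 rfl, k7]
  have l8 : τ₅.natArr 8 = σ.natArr 8 := by rw [f₅.natArr 8 rfl, k8]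
  refine Runs.forLoop (B := dn y) (C := 15) (fun i τ => τ.natVar 17 = par^[i] y ∧
      τ.natVar 18 = dn x + dn y - i ∧ (∀ j ≤ dn x, τ.natArr 11 f j = par^[j] x) ∧
      τ.natArr 11 f (dn x + dn y + 1) = x ∧
      ∀ j, dn x + dn y - i < j → j ≤ dn x + dn y → τ.natArr 11 f j = par^[dn x + dn y - j] y) rfl
      (fun τ hτ => by
        simp only [NExp.eval]
        rw [hτ.natArr 8 rfl, hτ.natVar 16 rfl, hτ.natArr 10 rfl, hτ.natVar 5 rfl, l5, l8,
          l10' 2 (by norm_num), l16, hy])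
      ⟨by simp [MState.withNat_natVar_of_ne, l17], by simp [MState.withNat_natVar_of_ne, l18],
        by simpa using l11, by simpa using l11', fun j _ _ => by omega⟩ ?_ ?_
      (by simp only [NExp.cost]; omega)
  · rintro i hi τ hτ - ⟨c17, c18, c11, c11', c11''⟩
    refine Runs.straight (by simp [Straight]) (by decide) ?_
    have c5 : τ.natVar 5 = f := by rw [hτ.natVar 5 rfl, l5]
    have c16 : τ.natVar 16 = q := by rw [hτ.natVar 16 rfl, l16]
    have c7 : τ.natArr 7 = σ.natArr 7 := by rw [hτ.natArr 7 rfl, l7]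
    simp [Prog.sem, NExp.eval, MState.withNat_natVar_of_ne, c5, c16, c7, c17, c18, ← hpar]
    refine ⟨(Function.iterate_succ_apply' par i y).symm, by omega, fun j hj => ?_, ?_,
      fun j h1 h2 => ?_⟩
    · rw [if_neg (by omega), c11 j hj]
    · rw [if_neg (by omega), c11']
    · split_ifs with h
      · subst h; rw [show dn x + dn y - (dn x + dn y - i) = i by omega]
      · exact c11'' j (by omega) h2
  · rintro τ hτ ⟨-, -, c11, c11', c11''⟩
    refine ⟨by rw [hτ.natArr 10 rfl, l10], fun c hc => by rw [hτ.natArr 10 rfl, l10' c hc], ?_⟩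
    intro i hi
    unfold IsSearchTree.treeWalk
    split_ifs with h1 h2
    · exact c11 i h1
    · exact c11'' i (by omega) h2
    · rw [show i = dn x + dn y + 1 by omega, c11']

theorem pairRow_spec {σ : MState} {f row : NExp} {F r : ℕ} (hcf : f.cost = 1) (hcr : row.cost = 1)
    (hf : ∀ τ, Frame (pairRow f row) σ τ → f.eval τ = F)
    (hr : ∀ τ, Frame (pairRow f row) σ τ → row.eval τ = r) (hb : ∀ e, σ.natArr 4 r e ≤ 1) :
    Runs (pairRow f row) σ (σ.natArr 10 F 3 * 50 + 20) fun τ => τ.natVar 13 ≤ 1 ∧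
      (τ.natVar 13 : ZMod 2) = seqWeight (rowWeight (σ.natArr 2) (σ.natArr 4 r)) (σ.natArr 11 F)
        (σ.natArr 10 F 3) := by
  refine Runs.seq (Q' := fun τ => τ.natVar 13 = 0) (T₁ := 2) (T₂ := σ.natArr 10 F 3 * 50 + 18)
    (Runs.straight trivial (by decide) (by simp [Prog.sem, NExp.eval])) ?_ (by omega)
  intro τ h₁ h13
  refine Runs.forLoop (B := σ.natArr 10 F 3) (C := 30) (fun i υ => υ.natVar 13 ≤ 1 ∧
    (υ.natVar 13 : ZMod 2) = seqWeight (rowWeight (σ.natArr 2) (σ.natArr 4 r)) (σ.natArr 11 F) i)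
    rfl (fun υ hυ => ?_) (by simp [MState.withNat_natVar_of_ne, h13, seqWeight]) ?_
    (fun _ _ h => h) (by simp only [NExp.cost, hcf]; omega)
  · have hfr : Frame (pairRow f row) σ υ := (h₁.seq_left _).trans (hυ.seq_right _)
    simp only [NExp.eval]
    rw [hf υ hfr, hfr.natArr 10 rfl]
  · rintro i hi υ hυ hv ⟨hbit, hsum⟩
    have hfr : Frame (pairRow f row) σ υ := (h₁.seq_left _).trans (hυ.seq_right _)
    refine Runs.straight (by simp [Straight])
      (by simp [Prog.time, NExp.cost, BExp.cost, hcf, hcr]) ?_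
    have hd : NExp.eval υ (.get 4 row (.get 2 (.get 11 f (.var 14)) (.get 11 f (.succ (.var 14)))))
        = σ.natArr 4 r (σ.natArr 2 (σ.natArr 11 F i) (σ.natArr 11 F (i + 1))) := by
      simp only [NExp.eval]
      rw [hf υ hfr, hr υ hfr, hv, hfr.natArr 4 rfl, hfr.natArr 2 rfl, hfr.natArr 11 rfl]
    have key : ∀ χ : MState, χ.natVar 13 = (if υ.natVar 13 =
        σ.natArr 4 r (σ.natArr 2 (σ.natArr 11 F i) (σ.natArr 11 F (i + 1))) then 0 else 1) →
        χ.natVar 13 ≤ 1 ∧ (χ.natVar 13 : ZMod 2) =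
          seqWeight (rowWeight (σ.natArr 2) (σ.natArr 4 r)) (σ.natArr 11 F) (i + 1) := by
      intro χ hχ
      rw [hχ]
      refine ⟨by split_ifs <;> simp, ?_⟩
      rw [cast_xor hbit (hb _), hsum, seqWeight, seqWeight, Finset.sum_range_succ]
      rfl
    refine key _ ?_
    rw [MState.withNat_natVar_of_ne _ _ _ (by norm_num)]
    simp only [Prog.sem, hd, BExp.eval]
    simp [NExp.eval]
    split_ifs <;> simp

theorem addRow_spec {σ : MState} {dst src : NExp} {D S : ℕ} (hcd : dst.cost = 1)
    (hcs : src.cost ≤ 3) (hDS : D ≠ S)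
    (hd : ∀ τ, Frame (addRow dst src) σ τ → dst.eval τ = D)
    (hs : ∀ τ, Frame (addRow dst src) σ τ → src.eval τ = S)
    (hbD : ∀ e, σ.natArr 4 D e ≤ 1) (hbS : ∀ e, σ.natArr 4 S e ≤ 1) :
    Runs (addRow dst src) σ (σ.natVar 3 * 40 + 10) fun τ =>
      (∀ k, k ≠ D → τ.natArr 4 k = σ.natArr 4 k) ∧ (∀ e, τ.natArr 4 D e ≤ 1) ∧
      ∀ e < σ.natVar 3, (τ.natArr 4 D e : ZMod 2) = σ.natArr 4 D e + σ.natArr 4 S e := by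
  refine Runs.forLoop (B := σ.natVar 3) (C := 30) (fun i τ =>
    (∀ k, k ≠ D → τ.natArr 4 k = σ.natArr 4 k) ∧ (∀ e, τ.natArr 4 D e ≤ 1) ∧
    (∀ e, i ≤ e → τ.natArr 4 D e = σ.natArr 4 D e) ∧
      ∀ e < i, (τ.natArr 4 D e : ZMod 2) = σ.natArr 4 D e + σ.natArr 4 S e) rfl
    (fun τ hτ => hτ.natVar 3 rfl) (by simpa using hbD) ?_ (fun _ _ h => ⟨h.1, h.2.1, h.2.2.2⟩)
    (by simp only [NExp.cost]; omega)
  rintro i hi τ hτ hv ⟨h1, h2, h3, h4⟩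
  refine Runs.straight (by simp [Straight])
    (by simp [Prog.time, NExp.cost, BExp.cost, hcd]; omega) ?_
  have key : ∀ χ : MState, (∀ k e, χ.natArr 4 k e = if k = D ∧ e = i then
      (if σ.natArr 4 D i = σ.natArr 4 S i then 0 else 1) else τ.natArr 4 k e) →
      (∀ k, k ≠ D → χ.natArr 4 k = σ.natArr 4 k) ∧ (∀ e, χ.natArr 4 D e ≤ 1) ∧
      (∀ e, i + 1 ≤ e → χ.natArr 4 D e = σ.natArr 4 D e) ∧
      ∀ e < i + 1, (χ.natArr 4 D e : ZMod 2) = σ.natArr 4 D e + σ.natArr 4 S e := by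
    intro χ hχ
    refine ⟨fun k hk => ?_, fun e => ?_, fun e he => ?_, fun e he => ?_⟩
    · funext e; rw [hχ, if_neg (fun h => hk h.1), h1 k hk]
    · rw [hχ]
      split_ifs
      · omega
      · omega
      · exact h2 e
    · rw [hχ, if_neg (by omega), h3 e (by omega)]
    · rcases Nat.lt_succ_iff_lt_or_eq.1 he with hlt | rfl
      · rw [hχ, if_neg (by omega), h4 e hlt]
      · rw [hχ, if_pos ⟨rfl, rfl⟩, cast_xor (hbD _) (hbS _)]
  refine key _ fun k e => ?_
  have hdst := hd τ hτ
  have hsrc := hs τ hτ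
  have e1 : τ.natArr 4 D i = σ.natArr 4 D i := h3 i le_rfl
  have e2 : τ.natArr 4 S = σ.natArr 4 S := h1 S hDS.symm
  by_cases hc : σ.natArr 4 D i = σ.natArr 4 S i
  · have hc' : BExp.eval τ (.natEq (.get 4 dst (.var 14)) (.get 4 src (.var 14))) := by
      simp only [BExp.eval, NExp.eval, hdst, hsrc, hv, e1, e2, hc]
    simp only [Prog.sem, if_pos hc', if_pos hc, NExp.eval, hdst, hv, MState.withNat_natArr,
      arrWrite_apply, true_and]
  · have hc' : ¬ BExp.eval τ (.natEq (.get 4 dst (.var 14)) (.get 4 src (.var 14))) := by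
      simp only [BExp.eval, NExp.eval, hdst, hsrc, hv, e1, e2, hc, not_false_eq_true]
    simp only [Prog.sem, if_neg hc', if_neg hc, NExp.eval, hdst, hv, MState.withNat_natArr,
      arrWrite_apply, true_and]

end MomentProgram

/-! ### The witness iteration -/

namespace MomentProgram

open Prog SimpleGraph

/-- The rows are related only at indices below `m`; the edges of a closed sequence use no others. -/
theorem rowWeight_add {H : SimpleGraph ℕ} {D I : ℕ → ℕ → ℕ} {m₂ m : ℕ}
    (ht : EdgeTables H.Adj D I m₂ m) {a b c : ℕ → ℕ} {t : ZMod 2}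
    (h : ∀ e < m, (c e : ZMod 2) = a e + t * b e) {w : ℕ → ℕ} {s : ℕ} (hw : ClosedSeq H w s) :
    seqWeight (rowWeight I c) w s = seqWeight (rowWeight I a) w s +
      t * seqWeight (rowWeight I b) w s := by
  unfold seqWeight
  rw [Finset.mul_sum, ← Finset.sum_add_distrib]
  refine Finset.sum_congr rfl fun i hi => h _ (ht.idx_lt _ _ (hw.adj i (Finset.mem_range.1 hi)))

/-- The row `r` has been made orthogonal to the cycle `f` by means of the row `k`. -/
def UpdatedRow (σ : MState) (f k r : ℕ) (row : ℕ → ℕ) : Prop :=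
  ∀ e < σ.natVar 3, (row e : ZMod 2) = σ.natArr 4 r e +
    seqWeight (rowWeight (σ.natArr 2) (σ.natArr 4 r)) (σ.natArr 11 f) (σ.natArr 10 f 3) *
      σ.natArr 4 k e

theorem updateWitnesses_spec {σ : MState} {f k : ℕ} (h5 : σ.natVar 5 = f) (h6 : σ.natVar 6 = k)
    (hb : ∀ r e, σ.natArr 4 r e ≤ 1) :
    Runs updateWitnesses σ (σ.natVar 3 * (σ.natArr 10 f 3 * 50 + σ.natVar 3 * 40 + 60) + 10)
      fun τ => (∀ r e, τ.natArr 4 r e ≤ 1) ∧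
        (∀ r, r ≤ k ∨ σ.natVar 3 ≤ r → τ.natArr 4 r = σ.natArr 4 r) ∧
        ∀ r, k < r → r < σ.natVar 3 → UpdatedRow σ f k r (τ.natArr 4 r) := by
  refine Runs.forLoop (B := σ.natVar 3) (C := σ.natArr 10 f 3 * 50 + σ.natVar 3 * 40 + 50)
    (fun j τ => (∀ r e, τ.natArr 4 r e ≤ 1) ∧
        (∀ r, r ≤ k ∨ j ≤ r → τ.natArr 4 r = σ.natArr 4 r) ∧
        ∀ r, k < r → r < j → UpdatedRow σ f k r (τ.natArr 4 r)) rfl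
    (fun τ hτ => hτ.natVar 3 rfl) ⟨by simpa using hb, by simp, by simp⟩ ?_ (fun _ _ h => h)
    (by simp only [NExp.cost]; ring_nf; omega)
  rintro j hj τ hτ hv ⟨h1, h2, h3⟩
  have a5 : τ.natVar 5 = f := by rw [hτ.natVar 5 rfl, h5]
  have a6 : τ.natVar 6 = k := by rw [hτ.natVar 6 rfl, h6]
  have a3 : τ.natVar 3 = σ.natVar 3 := hτ.natVar 3 rfl
  have a2 : τ.natArr 2 = σ.natArr 2 := hτ.natArr 2 rfl
  have a10 : τ.natArr 10 = σ.natArr 10 := hτ.natArr 10 rfl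
  have a11 : τ.natArr 11 = σ.natArr 11 := hτ.natArr 11 rfl
  refine Runs.cond (T := σ.natArr 10 f 3 * 50 + σ.natVar 3 * 40 + 45) (fun hc => ?_)
    (fun hc => ?_) (by simp only [NExp.cost, BExp.cost]; omega)
  · have hkj : k < j := by simpa [BExp.eval, NExp.eval, hv, a6] using hc
    have hrow : τ.natArr 4 j = σ.natArr 4 j := h2 j (Or.inr le_rfl)
    have hrowk : τ.natArr 4 k = σ.natArr 4 k := h2 k (Or.inl le_rfl)
    refine Runs.seq (T₁ := σ.natArr 10 f 3 * 50 + 20) (T₂ := σ.natVar 3 * 40 + 20)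
      (by simpa only [a10] using (pairRow_spec (σ := τ) (f := .var 5) (row := .var 12) (F := f) (r := j) rfl rfl
        (fun υ hυ => by simp only [NExp.eval]; rw [hυ.natVar 5 rfl, a5])
        (fun υ hυ => by simp only [NExp.eval]; rw [hυ.natVar 12 rfl, hv]) (h1 j))) ?_ (by omega)
    rintro υ hυ ⟨hbit, hpair⟩
    rw [a2, a11, hrow] at hpair
    have b4 : υ.natArr 4 = τ.natArr 4 := hυ.natArr 4 rfl
    have b12 : υ.natVar 12 = j := by rw [hυ.natVar 12 rfl, hv]
    have b6 : υ.natVar 6 = k := by rw [hυ.natVar 6 rfl, a6]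
    have b3 : υ.natVar 3 = σ.natVar 3 := by rw [hυ.natVar 3 rfl, a3]
    refine Runs.cond (T := σ.natVar 3 * 40 + 10) (fun hc => ?_)
      (fun hc => Runs.straight trivial (by simp [Prog.time]) ?_)
      (by simp only [NExp.cost, BExp.cost]; omega)
    · have h13 : υ.natVar 13 = 1 := hc
      rw [h13, Nat.cast_one] at hpair
      refine (addRow_spec (σ := υ) (dst := .var 12) (src := .var 6) (D := j) (S := k) rfl
        (by simp [NExp.cost]) hkj.ne'
        (fun ω hω => by simp only [NExp.eval]; rw [hω.natVar 12 rfl, b12])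
        (fun ω hω => by simp only [NExp.eval]; rw [hω.natVar 6 rfl, b6])
        (by rw [b4]; exact h1 j) (by rw [b4]; exact h1 k)).mono (by rw [b3]) ?_
      rintro ω hω ⟨c1, c2, c3⟩
      rw [b4, b3, hrow, hrowk] at c3
      rw [b4] at c1
      simp only [MState.withNat_natArr]
      refine ⟨fun r e => ?_, fun r hr => ?_, fun r hr1 hr2 => ?_⟩
      · by_cases hr : r = j
        · subst hr; exact c2 e
        · rw [c1 r hr]; exact h1 r e
      · rw [c1 r (by omega), h2 r (by omega)]
      · rcases Nat.lt_succ_iff_lt_or_eq.1 hr2 with hlt | rfl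
        · rw [c1 r hlt.ne]; exact h3 r hr1 hlt
        · intro e he
          rw [c3 e he, ← hpair, one_mul]
    · have h13 : υ.natVar 13 ≠ 1 := hc
      have h13' : υ.natVar 13 = 0 := by omega
      rw [h13', Nat.cast_zero] at hpair
      simp only [Prog.sem, MState.withNat_natArr, b4]
      refine ⟨h1, fun r hr => h2 r (by omega), fun r hr1 hr2 => ?_⟩
      rcases Nat.lt_succ_iff_lt_or_eq.1 hr2 with hlt | rfl
      · exact h3 r hr1 hlt
      · intro e he
        rw [← hpair, zero_mul, add_zero, hrow]
  · have hkj : j ≤ k := by simpa [BExp.eval, NExp.eval, hv, a6] using hc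
    refine Runs.straight trivial (by simp [Prog.time]) ?_
    exact ⟨h1, fun r hr => h2 r (by omega), fun r hr1 hr2 => by omega⟩

/-- The first two arguments of `treeWalk` come from the tables of `σ`; `rec` is the record of the
cycle and `lst` lists its vertices. -/
structure CycleRecord (H : SimpleGraph ℕ) (σ : MState) (rec lst : ℕ → ℕ) : Prop where
  root_lt : rec 0 < σ.natVar 4
  adj : H.Adj (rec 1) (rec 2)
  seen : σ.natArr 5 (rec 0) (rec 1) = 1
  length : rec 3 = σ.natArr 8 (rec 0) (rec 1) + σ.natArr 8 (rec 0) (rec 2) + 1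
  walk : ∀ i ≤ rec 3, lst i =
    IsSearchTree.treeWalk (σ.natArr 7 (rec 0)) (σ.natArr 8 (rec 0)) (rec 1) (rec 2) i

/-- The state after the first `k` witnesses have been processed. -/
structure CycleBasisInv (H : SimpleGraph ℕ) (σ : MState) (k : ℕ) (τ : MState) : Prop where
  bits : ∀ r e, τ.natArr 4 r e ≤ 1
  row_eq : ∀ r, σ.natVar 3 ≤ r → τ.natArr 4 r = σ.natArr 4 r
  found_le : τ.natVar 5 ≤ k
  records : ∀ f < τ.natVar 5, CycleRecord H σ (τ.natArr 10 f) (τ.natArr 11 f)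
  witness_lt : ∀ f < τ.natVar 5, τ.natArr 10 f 4 < k
  witness_mono : ∀ f g, f < g → g < τ.natVar 5 → τ.natArr 10 f 4 < τ.natArr 10 g 4
  shortest : ∀ f < τ.natVar 5, IsShortestOdd H
    (rowWeight (σ.natArr 2) (τ.natArr 4 (τ.natArr 10 f 4))) (τ.natArr 11 f) (τ.natArr 10 f 3)
  orth : ∀ f < τ.natVar 5, ∀ l, τ.natArr 10 f 4 < l → l < σ.natVar 3 →
    seqWeight (rowWeight (σ.natArr 2) (τ.natArr 4 l)) (τ.natArr 11 f) (τ.natArr 10 f 3) = 0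
  rest : ∀ l < k, (∃ f < τ.natVar 5, τ.natArr 10 f 4 = l) ∨
    NoOddWalk H (rowWeight (σ.natArr 2) (τ.natArr 4 l))
  span : ∀ z : ℕ → ZMod 2, (∀ l < σ.natVar 3,
    ∑ e ∈ Finset.range (σ.natVar 3), (τ.natArr 4 l e : ZMod 2) * z e = 0) →
      ∀ e < σ.natVar 3, z e = 0

theorem _root_.SimpleGraph.IsShortestOdd.congr {V : Type*} {G : SimpleGraph V} {F : V → V → ZMod 2}
    {w w' : ℕ → V} {s : ℕ} (h : IsShortestOdd G F w s) (hw : ∀ i ≤ s, w' i = w i) :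
    IsShortestOdd G F w' s where
  closed := by rw [hw s le_rfl, hw 0 (Nat.zero_le s), h.closed]
  adj i hi := by rw [hw i hi.le, hw (i + 1) hi]; exact h.adj i hi
  odd := by
    rw [← h.odd]
    refine Finset.sum_congr rfl fun i hi => ?_
    have := Finset.mem_range.1 hi
    rw [hw i this.le, hw (i + 1) this]
  le_length := h.le_length

theorem CycleBasisInv.step_none {H : SimpleGraph ℕ} {σ τ υ : MState} {k : ℕ}
    (h : CycleBasisInv H σ k τ) (h4 : υ.natArr 4 = τ.natArr 4) (h5 : υ.natVar 5 = τ.natVar 5)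
    (h10 : ∀ f < τ.natVar 5, υ.natArr 10 f = τ.natArr 10 f) (h11 : υ.natArr 11 = τ.natArr 11)
    (hk : NoOddWalk H (rowWeight (σ.natArr 2) (τ.natArr 4 k))) : CycleBasisInv H σ (k + 1) υ where
  bits := by rw [h4]; exact h.bits
  row_eq := by rw [h4]; exact h.row_eq
  found_le := by rw [h5]; exact h.found_le.trans (Nat.le_succ k)
  records f hf := by rw [h5] at hf; rw [h10 f hf, h11]; exact h.records f hf
  witness_lt f hf := by rw [h5] at hf; rw [h10 f hf]; exact (h.witness_lt f hf).trans (Nat.lt_succ_self k)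
  witness_mono f g hfg hg := by
    rw [h5] at hg; rw [h10 f (hfg.trans hg), h10 g hg]; exact h.witness_mono f g hfg hg
  shortest f hf := by rw [h5] at hf; rw [h10 f hf, h11, h4]; exact h.shortest f hf
  orth f hf := by rw [h5] at hf; rw [h10 f hf, h11, h4]; exact h.orth f hf
  rest l hl := by
    rcases Nat.lt_succ_iff_lt_or_eq.1 hl with hlt | rfl
    · rcases h.rest l hlt with ⟨f, hf, e⟩ | hn
      · exact Or.inl ⟨f, by rwa [h5], by rw [h10 f hf, e]⟩
      · exact Or.inr (by rwa [h4])
    · exact Or.inr (by rwa [h4])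
  span := by rw [h4]; exact h.span

/-- A later row l is replaced by row l plus its pairing with the new cycle times row k. Earlier
cycles are orthogonal to both rows and remain so. The new cycle is odd for row k, so its pairing
with row l is doubled and vanishes. The operation is invertible, which preserves `span`. -/
theorem CycleBasisInv.step_found {H : SimpleGraph ℕ} {σ τ υ : MState} {k : ℕ}
    (ht : EdgeTables H.Adj (σ.natArr 1) (σ.natArr 2) (σ.natVar 2) (σ.natVar 3))
    (h : CycleBasisInv H σ k τ) (hkM : k < σ.natVar 3) (h5 : υ.natVar 5 = τ.natVar 5 + 1)
    (h10 : ∀ f < τ.natVar 5, υ.natArr 10 f = τ.natArr 10 f)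
    (h11 : ∀ f < τ.natVar 5, υ.natArr 11 f = τ.natArr 11 f)
    (hrec : CycleRecord H σ (υ.natArr 10 (τ.natVar 5)) (υ.natArr 11 (τ.natVar 5)))
    (hwit : υ.natArr 10 (τ.natVar 5) 4 = k)
    (hk : IsShortestOdd H (rowWeight (σ.natArr 2) (τ.natArr 4 k)) (υ.natArr 11 (τ.natVar 5))
      (υ.natArr 10 (τ.natVar 5) 3))
    (hbits : ∀ r e, υ.natArr 4 r e ≤ 1)
    (hrow : ∀ r, r ≤ k ∨ σ.natVar 3 ≤ r → υ.natArr 4 r = τ.natArr 4 r)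
    (hupd : ∀ r, k < r → r < σ.natVar 3 → ∀ e < σ.natVar 3, (υ.natArr 4 r e : ZMod 2) =
      τ.natArr 4 r e + seqWeight (rowWeight (σ.natArr 2) (τ.natArr 4 r)) (υ.natArr 11 (τ.natVar 5))
        (υ.natArr 10 (τ.natVar 5) 3) * τ.natArr 4 k e) : CycleBasisInv H σ (k + 1) υ where
  bits := hbits
  row_eq r hr := by rw [hrow r (Or.inr hr)]; exact h.row_eq r hr
  found_le := by rw [h5]; exact Nat.succ_le_succ h.found_le
  records f hf := by
    rw [h5] at hf
    rcases Nat.lt_succ_iff_lt_or_eq.1 hf with hlt | rfl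
    · rw [h10 f hlt, h11 f hlt]; exact h.records f hlt
    · exact hrec
  witness_lt f hf := by
    rw [h5] at hf
    rcases Nat.lt_succ_iff_lt_or_eq.1 hf with hlt | rfl
    · rw [h10 f hlt]; exact (h.witness_lt f hlt).trans (Nat.lt_succ_self k)
    · omega
  witness_mono f g hfg hg := by
    rw [h5] at hg
    rcases Nat.lt_succ_iff_lt_or_eq.1 hg with hlt | rfl
    · rw [h10 f (hfg.trans hlt), h10 g hlt]; exact h.witness_mono f g hfg hlt
    · rw [h10 f hfg, hwit]; exact h.witness_lt f hfg
  shortest f hf := by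
    rw [h5] at hf
    rcases Nat.lt_succ_iff_lt_or_eq.1 hf with hlt | rfl
    · rw [h10 f hlt, h11 f hlt, hrow _ (Or.inl (h.witness_lt f hlt).le)]; exact h.shortest f hlt
    · rw [hwit, hrow k (Or.inl le_rfl)]; exact hk
  orth f hf l hfl hl := by
    rw [h5] at hf
    rcases Nat.lt_succ_iff_lt_or_eq.1 hf with hlt | rfl
    · rw [h10 f hlt] at hfl ⊢
      rw [h11 f hlt]
      rcases Nat.lt_or_ge k l with hkl | hkl
      · rw [rowWeight_add ht (hupd l hkl hl) (h.shortest f hlt).toClosedSeq, h.orth f hlt l hfl hl,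
          h.orth f hlt k (h.witness_lt f hlt) hkM, mul_zero, add_zero]
      · rw [hrow l (Or.inl hkl)]; exact h.orth f hlt l hfl hl
    · rw [hwit] at hfl
      rw [rowWeight_add ht (hupd l hfl hl) hk.toClosedSeq, hk.odd, mul_one, zmod_two_add_self]
  rest l hl := by
    rcases Nat.lt_succ_iff_lt_or_eq.1 hl with hlt | rfl
    · rcases h.rest l hlt with ⟨f, hf, e⟩ | hn
      · exact Or.inl ⟨f, by omega, by rw [h10 f hf, e]⟩
      · exact Or.inr (by rwa [hrow l (Or.inl hlt.le)])
    · exact Or.inl ⟨τ.natVar 5, by omega, hwit⟩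
  span z hz := by
    refine h.span z fun l hl => ?_
    rcases Nat.lt_or_ge k l with hkl | hkl
    · have h1 := hz l hl
      have h2 := hz k hkM
      rw [hrow k (Or.inl le_rfl)] at h2
      rw [Finset.sum_congr rfl fun e he => by rw [hupd l hkl hl e (Finset.mem_range.1 he), add_mul,
        mul_assoc], Finset.sum_add_distrib, ← Finset.mul_sum, h2, mul_zero, add_zero] at h1
      exact h1
    · have h1 := hz l hl
      rwa [hrow l (Or.inl hkl)] at h1

-- Everything done for one witness is quadratic in the number of edges: the search runs over at most
-- m roots and 2m directed edges, and at most m later rows are updated, each in linear time.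
set_option maxHeartbeats 800000 in
theorem witnessStep_spec {H : SimpleGraph ℕ} {σ τ : MState} {k : ℕ} (hs : Searched H σ)
    (hst : ∀ a ∈ [1, 2, 3, 5, 6, 7, 8], τ.natArr a = σ.natArr a)
    (hsv : ∀ x ∈ [2, 3, 4], τ.natVar x = σ.natVar x) (hsr : τ.realArr 3 = σ.realArr 3)
    (h : CycleBasisInv H σ k τ) (hkM : k < σ.natVar 3) (h6 : τ.natVar 6 = k) :
    Runs witnessStep τ (σ.natVar 3 * (σ.natVar 3 * 540 + 600) + 200)
      (CycleBasisInv H σ (k + 1)) := by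
  have a2 := hst 2 (by simp)
  have a5 := hst 5 (by simp)
  have a7 := hst 7 (by simp)
  have a8 := hst 8 (by simp)
  have v2 := hsv 2 (by simp)
  have v3 := hsv 3 (by simp)
  have v4 := hsv 4 (by simp)
  have hsτ : Searched H τ := by
    have a1 := hst 1 (by simp)
    have a3 := hst 3 (by simp)
    have a6 := hst 6 (by simp)
    refine ⟨?_, fun q hq => ?_, ?_, ?_⟩
    · rw [a1, a2, v2, v3]; exact hs.tables
    · unfold TreeState
      rw [a3, a5, a6, a7, a8, hsr, v2]
      exact hs.trees q (by rwa [← v4])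
    · rw [a3, v4]; exact hs.roots
    · rw [v3, v4]; exact hs.roots_le
  have hM2 := hs.tables.two_mul
  have hR := hs.roots_le
  refine Runs.seq (findOdd_spec hsτ rfl h6 (h.bits k))
    (T₂ := σ.natVar 3 * (σ.natVar 3 * 240 + 520) + 180) ?_ (by
      rw [v2, v4, hM2]
      have : σ.natVar 4 * (2 * σ.natVar 3 * 150 + 70) ≤ σ.natVar 3 * (2 * σ.natVar 3 * 150 + 70) :=
        Nat.mul_le_mul_right _ hR
      ring_nf at this ⊢; omega)
  intro υ hυ hfo
  have b4 : υ.natArr 4 = τ.natArr 4 := hυ.natArr 4 rfl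
  have b5 : υ.natVar 5 = τ.natVar 5 := hυ.natVar 5 rfl
  have b6 : υ.natVar 6 = k := by rw [hυ.natVar 6 rfl, h6]
  have b11 : υ.natArr 11 = τ.natArr 11 := hυ.natArr 11 rfl
  have b10 : ∀ f < τ.natVar 5, υ.natArr 10 f = τ.natArr 10 f :=
    fun f hf => hυ.natRow 5 10 rfl f hf.ne
  refine Runs.cond (T := σ.natVar 3 * (σ.natVar 3 * 240 + 520) + 170) (fun hc => ?_)
    (fun hc => ?_) (by simp only [NExp.cost, BExp.cost]; omega)
  swap
  · have h7 : υ.natVar 7 ≠ 1 := hc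
    refine Runs.straight trivial (by simp [Prog.time]) ?_
    rcases hfo with ⟨-, hno⟩ | ⟨h7', -⟩
    · rw [a2] at hno
      exact h.step_none b4 b5 b10 b11 hno
    · exact absurd h7' h7
  have h7 : υ.natVar 7 = 1 := hc
  obtain ⟨q, x, y, hq, hx, hy, hqR, hadj, hsx, hsh⟩ : ∃ q x y, υ.natArr 10 (τ.natVar 5) 0 = q ∧
      υ.natArr 10 (τ.natVar 5) 1 = x ∧ υ.natArr 10 (τ.natVar 5) 2 = y ∧ q < σ.natVar 4 ∧
      H.Adj x y ∧ σ.natArr 5 q x = 1 ∧ IsShortestOdd H (rowWeight (σ.natArr 2) (τ.natArr 4 k))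
        (IsSearchTree.treeWalk (σ.natArr 7 q) (σ.natArr 8 q) x y)
        (σ.natArr 8 q x + σ.natArr 8 q y + 1) := by
    rcases hfo with ⟨h7', -⟩ | ⟨-, hfo⟩
    · omega
    · rw [a2, a5, a7, a8, v4] at hfo; exact hfo
  obtain ⟨t, hcnt⟩ := hs.trees q hqR
  have hsy : σ.natArr 5 q y = 1 := (t.closure x y hsx hadj).1
  have hdx := t.dn_lt hsx
  have hdy := t.dn_lt hsy
  have hsυ : Searched H υ := hsτ.frame hυ (by decide) (by decide) rfl
  have c5 : υ.natArr 5 = σ.natArr 5 := by rw [hυ.natArr 5 rfl, a5]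
  have c7 : υ.natArr 7 = σ.natArr 7 := by rw [hυ.natArr 7 rfl, a7]
  have c8 : υ.natArr 8 = σ.natArr 8 := by rw [hυ.natArr 8 rfl, a8]
  have c2 : υ.natArr 2 = σ.natArr 2 := by rw [hυ.natArr 2 rfl, a2]
  have cv2 : υ.natVar 2 = σ.natVar 2 := by rw [hυ.natVar 2 rfl, v2]
  have cv3 : υ.natVar 3 = σ.natVar 3 := by rw [hυ.natVar 3 rfl, v3]
  refine Runs.seq (extractCycle_spec hsυ b5 hq hx hy (by rw [hυ.natVar 4 rfl, v4]; exact hqR)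
    (by rw [c5]; exact hsx) (by rw [c5]; exact hsy))
    (T₂ := σ.natVar 3 * (σ.natVar 3 * 240 + 60) + 60) ?_ (by rw [cv2, hM2]; ring_nf; omega)
  rw [c7, c8]
  rintro χ hχ ⟨d3, d10, d11⟩
  have dr10 : ∀ f < τ.natVar 5, χ.natArr 10 f = τ.natArr 10 f := fun f hf => by
    rw [hχ.natRow 5 10 rfl f (by omega), b10 f hf]
  have dr11 : ∀ f < τ.natVar 5, χ.natArr 11 f = τ.natArr 11 f := fun f hf => by
    rw [hχ.natRow 5 11 rfl f (by omega), b11]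
  have dv5 : χ.natVar 5 = τ.natVar 5 := by rw [hχ.natVar 5 rfl, b5]
  have dv6 : χ.natVar 6 = k := by rw [hχ.natVar 6 rfl, b6]
  refine Runs.seq (Q' := fun ω => (∀ c, c ≠ 4 → ω.natArr 10 (τ.natVar 5) c =
      χ.natArr 10 (τ.natVar 5) c) ∧ ω.natArr 10 (τ.natVar 5) 4 = k) (T₁ := 6)
    (T₂ := σ.natVar 3 * (σ.natVar 3 * 240 + 60) + 30) (Runs.straight trivial (by decide) ?_) ?_
    (by omega)
  · simp +contextual [Prog.sem, NExp.eval, dv5, dv6]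
  rintro ω hω ⟨e10, e4⟩
  have er10 : ∀ f < τ.natVar 5, ω.natArr 10 f = τ.natArr 10 f := fun f hf => by
    rw [hω.natRow 5 10 rfl f (by omega), dr10 f hf]
  have e11 : ω.natArr 11 = χ.natArr 11 := hω.natArr 11 rfl
  have ev5 : ω.natVar 5 = τ.natVar 5 := by rw [hω.natVar 5 rfl, dv5]
  have ev6 : ω.natVar 6 = k := by rw [hω.natVar 6 rfl, dv6]
  have ev3 : ω.natVar 3 = σ.natVar 3 := by rw [hω.natVar 3 rfl, hχ.natVar 3 rfl, cv3]
  have ea4 : ω.natArr 4 = τ.natArr 4 := by rw [hω.natArr 4 rfl, hχ.natArr 4 rfl, b4]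
  have ea2 : ω.natArr 2 = σ.natArr 2 := by rw [hω.natArr 2 rfl, hχ.natArr 2 rfl, c2]
  have es : ω.natArr 10 (τ.natVar 5) 3 = σ.natArr 8 q x + σ.natArr 8 q y + 1 := by
    rw [e10 3 (by norm_num), d3]
  -- Both depths are below the size of the component, which is at most twice the number of edges, so
  -- the cycle has length at most 4m; 4·50 + 40 gives 240.
  have hcost : ω.natVar 3 * (ω.natArr 10 (τ.natVar 5) 3 * 50 + ω.natVar 3 * 40 + 60) + 10 ≤
      σ.natVar 3 * (σ.natVar 3 * 240 + 60) + 10 := by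
    rw [ev3, es]
    exact Nat.add_le_add_right (Nat.mul_le_mul_left _ (by omega)) _
  have hupd := (updateWitnesses_spec ev5 ev6 (by rw [ea4]; exact h.bits)).mono hcost
    (fun _ _ h => h)
  refine Runs.seq hupd (T₂ := 5) ?_ (Nat.add_le_add_left (by norm_num : 10 + 5 ≤ 30) _)
  rintro ζ hζ ⟨g1, g2, g3⟩
  refine Runs.straight trivial (by decide) ?_
  have gv5 : ζ.natVar 5 = τ.natVar 5 := by rw [hζ.natVar 5 rfl, ev5]
  have g10 : ζ.natArr 10 = ω.natArr 10 := hζ.natArr 10 rfl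
  have g11 : ζ.natArr 11 = χ.natArr 11 := by rw [hζ.natArr 11 rfl, e11]
  rw [ev3, ea4] at g2
  unfold UpdatedRow at g3
  rw [ev3, ea4, ea2, e11] at g3
  have r0 : ω.natArr 10 (τ.natVar 5) 0 = q := by
    rw [e10 0 (by norm_num), d10 0 (by norm_num), hq]
  have r1 : ω.natArr 10 (τ.natVar 5) 1 = x := by
    rw [e10 1 (by norm_num), d10 1 (by norm_num), hx]
  have r2 : ω.natArr 10 (τ.natVar 5) 2 = y := by
    rw [e10 2 (by norm_num), d10 2 (by norm_num), hy]
  refine h.step_found (υ := (Prog.setNat 5 (.succ (.var 5))).sem ζ) hs.tables hkM ?_ ?_ ?_ ?_ ?_ ?_ g1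
    g2 ?_
  · simp [Prog.sem, NExp.eval, gv5]
  · intro f hf; simp only [Prog.sem]; rw [g10, er10 f hf]
  · intro f hf; simp only [Prog.sem]; rw [g11, dr11 f hf]
  · simp only [Prog.sem]
    rw [g10, g11]
    refine ⟨by rw [r0]; exact hqR, by rw [r1, r2]; exact hadj, by rw [r0, r1]; exact hsx,
      by rw [r0, r1, r2]; exact es, fun i hi => ?_⟩
    rw [r0, r1, r2]
    exact d11 i (by rwa [es] at hi)
  · simp only [Prog.sem]; rw [g10, e4]
  · simp only [Prog.sem]; rw [g10, g11, es]
    exact hsh.congr d11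
  · simp only [Prog.sem]; rw [g10, g11]
    exact g3

/-- Initially the witnesses are the unit vectors, so `span` holds trivially and no cycle has been
found. -/
theorem cycleBasis_spec {H : SimpleGraph ℕ} {σ : MState} (hs : Searched H σ)
    (h5 : σ.natVar 5 = 0) (h4 : ∀ k e, σ.natArr 4 k e = if k = e ∧ k < σ.natVar 3 then 1 else 0) :
    Runs cycleBasis σ (σ.natVar 3 * (σ.natVar 3 * (σ.natVar 3 * 540 + 600) + 210) + 10)
      (CycleBasisInv H σ (σ.natVar 3)) := by
  refine Runs.forLoop (B := σ.natVar 3) (C := σ.natVar 3 * (σ.natVar 3 * 540 + 600) + 200)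
    (fun k τ => CycleBasisInv H σ k τ) rfl (fun τ hτ => hτ.natVar 3 rfl) ?_ ?_ (fun _ _ h => h)
    (by simp only [NExp.cost]; ring_nf; omega)
  · have hF : ∀ f, ¬ f < (σ.withNat 6 0).natVar 5 := by
      intro f; rw [MState.withNat_natVar_of_ne _ _ _ (by norm_num), h5]; omega
    refine ⟨fun r e => ?_, fun r _ => rfl, ?_, fun f hf => (hF f hf).elim,
      fun f hf => (hF f hf).elim, fun f g _ hg => (hF g hg).elim, fun f hf => (hF f hf).elim,
      fun f hf => (hF f hf).elim, fun l hl => by omega, fun z hz l hl => ?_⟩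
    · rw [MState.withNat_natArr, h4]; split_ifs <;> simp
    · rw [MState.withNat_natVar_of_ne _ _ _ (by norm_num), h5]
    · have := hz l hl
      rw [Finset.sum_eq_single l] at this
      · simpa [h4, hl] using this
      · intro e _ he
        rw [MState.withNat_natArr, h4, if_neg (by omega)]; simp
      · intro hl'; simp [hl] at hl'
  · intro k hk τ hτ hv hinv
    have := witnessStep_spec (σ := σ) (τ := τ) (k := k) hs (fun a ha => hτ.natArr a (by
      revert a; decide)) (fun x hx => hτ.natVar x (by revert x; decide)) (hτ.realArr 3 rfl) hinv hk hv
    refine this.mono le_rfl fun υ hυ hi => ?_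
    exact ⟨hi.bits, hi.row_eq, hi.found_le, hi.records, hi.witness_lt, hi.witness_mono,
      hi.shortest, hi.orth, hi.rest, hi.span⟩

end MomentProgram

/-! ### Counting the samples that contain a cycle -/

namespace MomentProgram

open Prog SimpleGraph

/-- The tree path from the root to `x` is contained in the set `S` (given by its bits). -/
def PathIn (par dn S : ℕ → ℕ) (x : ℕ) : Prop := ∀ t ≤ dn x, S (par^[t] x) = 1

theorem IsSearchTree.pathIn_iff {H : SimpleGraph ℕ} {v cnt : ℕ} {seen ord par dn : ℕ → ℕ}
    {dr : ℕ → ℝ} (h : IsSearchTree H v cnt seen ord par dn dr) (S : ℕ → ℕ) {x : ℕ}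
    (hx : seen x = 1) :
    PathIn par dn S x ↔ (x = v ∨ PathIn par dn S (par x)) ∧ S x = 1 := by
  by_cases hv : x = v
  · subst hv; simp [PathIn, h.dn_root]
  · have hd := (h.par_spec hx hv).2
    simp only [hv, false_or, PathIn]
    constructor
    · intro H
      exact ⟨fun t ht => by simpa using H (t + 1) (by omega), by simpa using H 0 (by omega)⟩
    · rintro ⟨h1, h2⟩ t ht
      cases t with
      | zero => exact h2
      | succ t => exact h1 t (by omega)

/-- This reduces the containment of a whole cycle in a sample to two lookups, once the contained
tree paths have been marked. -/
theorem IsSearchTree.treeWalk_mem_iff {H : SimpleGraph ℕ} {v cnt : ℕ} {seen ord par dn : ℕ → ℕ}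
    {dr : ℕ → ℝ} (h : IsSearchTree H v cnt seen ord par dn dr) (S : ℕ → ℕ) {x y : ℕ}
    (hx : seen x = 1) (hy : seen y = 1) :
    (PathIn par dn S x ∧ PathIn par dn S y) ↔
      ∀ i < dn x + dn y + 1, S (treeWalk par dn x y i) = 1 := by
  constructor
  · rintro ⟨h1, h2⟩ i hi
    unfold treeWalk
    split_ifs with a b
    · exact h1 i a
    · exact h2 _ (by omega)
    · omega
  · intro H
    have h1 : PathIn par dn S x := fun t ht => by
      have := H t (by omega)
      rwa [treeWalk, if_pos ht] at this
    refine ⟨h1, fun t ht => ?_⟩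
    rcases ht.lt_or_eq with hlt | rfl
    · have := H (dn x + dn y - t) (by omega)
      rwa [treeWalk, if_neg (by omega), if_pos (by omega),
        show dn x + dn y - (dn x + dn y - t) = t by omega] at this
    · rw [h.iterate_dn hy, ← h.iterate_dn hx]
      exact h1 _ le_rfl

theorem markPaths_spec {H : SimpleGraph ℕ} {σ : MState} (hs : Searched H σ) {p q N : ℕ}
    (h6 : σ.natVar 6 = p) (h7 : σ.natVar 7 = q) (hq : q < σ.natVar 4) (hN : σ.natArr 3 q 1 ≤ N) :
    Runs markPaths σ (N * 60 + 30) fun τ => ∀ x, σ.natArr 5 q x = 1 →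
      (τ.natArr 12 q x = 1 ↔ PathIn (σ.natArr 7 q) (σ.natArr 8 q) (σ.natArr 0 p) x) := by
  obtain ⟨t, -⟩ := hs.trees q hq
  refine Runs.seq (Q' := fun τ => τ.natArr 12 q (σ.natArr 3 q 0) = 1) (T₁ := 8) (T₂ := N * 60 + 20)
    (Runs.straight trivial (by decide) (by simp [Prog.sem, NExp.eval, h7])) ?_ (by omega)
  intro τ₁ f₁ h12
  have b7 : τ₁.natVar 7 = q := by rw [f₁.natVar 7 rfl, h7]
  have b6 : τ₁.natVar 6 = p := by rw [f₁.natVar 6 rfl, h6]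
  have b3 : τ₁.natArr 3 = σ.natArr 3 := f₁.natArr 3 rfl
  -- The root is its own parent, so its test reads the very cell it is about to write. The clause
  -- for `i = 0` records that this cell has been preset to 1.
  refine Runs.forLoop (B := σ.natArr 3 q 1) (C := 40) (fun i τ =>
    (i = 0 → τ.natArr 12 q (σ.natArr 3 q 0) = 1) ∧ ∀ j < i, τ.natArr 12 q (σ.natArr 6 q j) = 1 ↔
      PathIn (σ.natArr 7 q) (σ.natArr 8 q) (σ.natArr 0 p) (σ.natArr 6 q j)) rfl
    (fun τ hτ => by
      simp only [NExp.eval]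
      rw [hτ.natArr 3 rfl, hτ.natVar 7 rfl, b7, b3]) (by simpa using h12) ?_ ?_
    (by
      have := Nat.mul_le_mul_right 50 hN
      simp only [NExp.cost]; omega)
  · rintro i hi τ hτ hv ⟨h0, hj⟩
    have c7 : τ.natVar 7 = q := by rw [hτ.natVar 7 rfl, b7]
    have c6 : τ.natVar 6 = p := by rw [hτ.natVar 6 rfl, b6]
    have a6 : τ.natArr 6 = σ.natArr 6 := by rw [hτ.natArr 6 rfl, f₁.natArr 6 rfl]
    have a7 : τ.natArr 7 = σ.natArr 7 := by rw [hτ.natArr 7 rfl, f₁.natArr 7 rfl]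
    have a0 : τ.natArr 0 = σ.natArr 0 := by rw [hτ.natArr 0 rfl, f₁.natArr 0 rfl]
    set x := σ.natArr 6 q i with hx
    have hsx : σ.natArr 5 q x = 1 := (t.seen_iff x).2 ⟨i, hi, rfl⟩
    have key : (τ.natArr 12 q (σ.natArr 7 q x) = 1 ∧ σ.natArr 0 p x = 1) ↔
        PathIn (σ.natArr 7 q) (σ.natArr 8 q) (σ.natArr 0 p) x := by
      rw [t.pathIn_iff _ hsx]
      refine and_congr_left fun _ => ?_
      rcases Nat.eq_zero_or_pos i with rfl | hpos
      · have hxv : x = σ.natArr 3 q 0 := t.ord_zero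
        simp [hxv, t.par_root, h0 rfl]
      · obtain ⟨i', hi', e, -, -⟩ := t.par_ord i hi hpos
        have hxv : x ≠ σ.natArr 3 q 0 := by
          intro e'
          have := t.inj i hi 0 t.pos (e'.trans t.ord_zero.symm)
          omega
        simp only [hxv, false_or]
        rw [e]
        exact hj i' hi'
    refine Runs.straight (by simp [Straight]) (by decide) ?_
    simp only [Prog.sem, NExp.eval, BExp.eval, hv, c7, c6, a6, a7, a0, Function.update_self, ← hx,
      ne_eq, Nat.reduceEqDiff, not_false_eq_true, Function.update_of_ne]
    refine ⟨fun h => absurd h (by simp), fun j hj' => ?_⟩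
    by_cases hji : j = i
    · subst hji
      rw [← hx, ← key]
      split_ifs with hp <;> simp [hp]
    · have hne : σ.natArr 6 q j ≠ x := fun e => hji (t.inj j (by omega) i hi e)
      rw [← hj j (by omega)]
      split_ifs <;> simp [hne]
  · rintro τ hτ ⟨-, hj⟩ x hx
    obtain ⟨i, hi, rfl⟩ := (t.seen_iff x).1 hx
    exact hj i hi

/-- The number of the first `n` samples that contain the first `s` vertices of `w`. -/
noncomputable def containCount (S : ℕ → ℕ → ℕ) (n : ℕ) (w : ℕ → ℕ) (s : ℕ) : ℝ :=
  ∑ p ∈ Finset.range n, if ∀ i < s, S p (w i) = 1 then 1 else 0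

theorem containCount_succ (S : ℕ → ℕ → ℕ) (n : ℕ) (w : ℕ → ℕ) (s : ℕ) :
    containCount S (n + 1) w s = containCount S n w s + if ∀ i < s, S n (w i) = 1 then 1 else 0 :=
  Finset.sum_range_succ _ _

theorem countCycle_spec {H : SimpleGraph ℕ} {σ τ : MState} (hs : Searched H σ) {f p : ℕ}
    (hr : CycleRecord H σ (σ.natArr 10 f) (σ.natArr 11 f)) (h7 : τ.natVar 7 = f)
    (h10 : τ.natArr 10 = σ.natArr 10)
    (h12 : ∀ q < σ.natVar 4, ∀ x, σ.natArr 5 q x = 1 → (τ.natArr 12 q x = 1 ↔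
      PathIn (σ.natArr 7 q) (σ.natArr 8 q) (σ.natArr 0 p) x)) :
    Runs countCycle τ 40 fun υ => (∀ f', f' ≠ f → υ.realArr 4 f' = τ.realArr 4 f') ∧
      υ.realArr 4 f 0 = τ.realArr 4 f 0 +
        if ∀ i < σ.natArr 10 f 3, σ.natArr 0 p (σ.natArr 11 f i) = 1 then 1 else 0 := by
  obtain ⟨t, -⟩ := hs.trees _ hr.root_lt
  have hsy := (t.closure _ _ hr.seen hr.adj).1
  refine Runs.straight (by simp [countCycle, Straight]) (by decide) ?_
  have key : (τ.natArr 12 (σ.natArr 10 f 0) (σ.natArr 10 f 1) = 1 ∧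
      τ.natArr 12 (σ.natArr 10 f 0) (σ.natArr 10 f 2) = 1) ↔
      ∀ i < σ.natArr 10 f 3, σ.natArr 0 p (σ.natArr 11 f i) = 1 := by
    rw [h12 _ hr.root_lt _ hr.seen, h12 _ hr.root_lt _ hsy, t.treeWalk_mem_iff _ hr.seen hsy,
      ← hr.length]
    refine forall₂_congr fun i hi => ?_
    rw [hr.walk i hi.le]
  simp only [countCycle, Prog.sem, NExp.eval, BExp.eval, h7, h10]
  simp only [key]
  split_ifs with hc
  · refine ⟨fun f' hf' => arrWrite_row_of_ne τ.realArr 4 4 hf' 0 _, ?_⟩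
    simp [RExp.eval, NExp.eval, h7]
  · simp

/-- For one sample, marking costs at most N per root and each cycle a constant. Bounding the trees
by N, and not by the number of edges, is what keeps the total at the order of nN². -/
theorem countCycles_spec {H : SimpleGraph ℕ} {σ : MState} (hs : Searched H σ) {N : ℕ}
    (hr : ∀ f < σ.natVar 5, CycleRecord H σ (σ.natArr 10 f) (σ.natArr 11 f))
    (hN : ∀ q < σ.natVar 4, σ.natArr 3 q 1 ≤ N) (h4 : ∀ f, σ.realArr 4 f 0 = 0) :
    Runs countCycles σ
      (σ.natVar 1 * (σ.natVar 4 * (N * 60 + 50) + σ.natVar 5 * 50 + 40) + 10) fun τ =>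
        ∀ f < σ.natVar 5, τ.realArr 4 f 0 =
          containCount (σ.natArr 0) (σ.natVar 1) (σ.natArr 11 f) (σ.natArr 10 f 3) := by
  refine Runs.forLoop (B := σ.natVar 1)
    (C := σ.natVar 4 * (N * 60 + 50) + σ.natVar 5 * 50 + 30) (fun p τ => ∀ f < σ.natVar 5,
      τ.realArr 4 f 0 = containCount (σ.natArr 0) p (σ.natArr 11 f) (σ.natArr 10 f 3)) rfl
    (fun τ hτ => hτ.natVar 1 rfl) (by simp [containCount, h4]) ?_ (fun _ _ h => h)
    (by simp only [NExp.cost]; ring_nf; omega)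
  intro p hp τ hτ hv hinv
  have hsτ : Searched H τ := hs.frame hτ (by decide) (by decide) rfl
  have a0 : τ.natArr 0 = σ.natArr 0 := hτ.natArr 0 rfl
  have a3 : τ.natArr 3 = σ.natArr 3 := hτ.natArr 3 rfl
  have a5 : τ.natArr 5 = σ.natArr 5 := hτ.natArr 5 rfl
  have a7 : τ.natArr 7 = σ.natArr 7 := hτ.natArr 7 rfl
  have a8 : τ.natArr 8 = σ.natArr 8 := hτ.natArr 8 rfl
  have v4 : τ.natVar 4 = σ.natVar 4 := hτ.natVar 4 rfl
  have v5 : τ.natVar 5 = σ.natVar 5 := hτ.natVar 5 rfl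
  refine Runs.seq (T₁ := σ.natVar 4 * (N * 60 + 50) + 10) (T₂ := σ.natVar 5 * 50 + 10)
    (Q' := fun υ => ∀ q < σ.natVar 4, ∀ x, σ.natArr 5 q x = 1 → (υ.natArr 12 q x = 1 ↔
      PathIn (σ.natArr 7 q) (σ.natArr 8 q) (σ.natArr 0 p) x)) ?_ ?_ (by omega)
  · refine Runs.forLoop (B := σ.natVar 4) (C := N * 60 + 30)
      (fun i υ => ∀ q < i, ∀ x, σ.natArr 5 q x = 1 → (υ.natArr 12 q x = 1 ↔
        PathIn (σ.natArr 7 q) (σ.natArr 8 q) (σ.natArr 0 p) x)) rfl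
      (fun υ hυ => by simp only [NExp.eval]; rw [hυ.natVar 4 rfl, v4]) (by simp) ?_
      (fun _ _ h => h) (by simp only [NExp.cost]; ring_nf; omega)
    intro q hq υ hυ hvυ hinv'
    have hsυ : Searched H υ := hsτ.frame hυ (by decide) (by decide) rfl
    refine (markPaths_spec hsυ (by rw [hυ.natVar 6 rfl, hv]) hvυ
      (by rw [hυ.natVar 4 rfl, v4]; exact hq)
      (by rw [hυ.natArr 3 rfl, a3]; exact hN q hq)).mono le_rfl ?_
    intro ω hω hmark q' hq' x hx
    rw [hυ.natArr 0 rfl, hυ.natArr 5 rfl, hυ.natArr 7 rfl, hυ.natArr 8 rfl, a0, a5, a7, a8] at hmark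
    rw [MState.withNat_natArr]
    rcases Nat.lt_succ_iff_lt_or_eq.1 hq' with hlt | rfl
    · rw [hω.natRow 7 12 rfl q' (by omega)]; exact hinv' q' hlt x hx
    · exact hmark x hx
  · intro υ hυ hmark
    refine Runs.forLoop (B := σ.natVar 5) (C := 40) (fun i ω =>
      (∀ f < i, ω.realArr 4 f 0 = containCount (σ.natArr 0) (p + 1) (σ.natArr 11 f)
        (σ.natArr 10 f 3)) ∧ ∀ f < σ.natVar 5, i ≤ f → ω.realArr 4 f 0 =
          containCount (σ.natArr 0) p (σ.natArr 11 f) (σ.natArr 10 f 3)) rfl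
      (fun ω hω => by simp only [NExp.eval]; rw [hω.natVar 5 rfl, hυ.natVar 5 rfl, v5]) ?_ ?_
      (fun _ _ h => h.1) (by simp only [NExp.cost]; omega)
    · refine ⟨by simp, fun f hf _ => ?_⟩
      rw [MState.withNat_realArr, hυ.realArr 4 rfl]; exact hinv f hf
    · rintro f hf ω hω hvω ⟨h1, h2⟩
      refine (countCycle_spec (p := p) hs (hr f hf) hvω (by
        rw [hω.natArr 10 rfl, hυ.natArr 10 rfl, hτ.natArr 10 rfl]) (by
        rw [hω.natArr 12 rfl]; exact hmark)).mono le_rfl ?_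
      rintro χ - ⟨g1, g2⟩
      rw [MState.withNat_realArr]
      refine ⟨fun f' hf' => ?_, fun f' hf' hle => ?_⟩
      · rcases Nat.lt_succ_iff_lt_or_eq.1 hf' with hlt | rfl
        · rw [g1 f' hlt.ne]; exact h1 f' hlt
        · rw [g2, containCount_succ, h2 f' hf le_rfl]
      · rw [g1 f' (by omega)]; exact h2 f' hf' (by omega)

end MomentProgram

/-! ### Matching sums of paths and cycles, and the linear system -/

namespace MomentProgram

open Prog SimpleGraph

/-- The signed matching sum of a path on the first `k` vertices of `w`. -/
noncomputable def pathSum {V : Type*} (K : V → ℝ) (B : V → V → ℝ) (w : ℕ → V) : ℕ → ℝ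
  | 0 => 1
  | 1 => K (w 0)
  | k + 2 => K (w (k + 1)) * pathSum K B w (k + 1) - B (w k) (w (k + 1)) * pathSum K B w k

/-- The signed matching sum of a cycle on the first `s` vertices of `w`. -/
noncomputable def cycleSum {V : Type*} (K : V → ℝ) (B : V → V → ℝ) (w : ℕ → V) (s : ℕ) : ℝ :=
  pathSum K B w s - B (w (s - 1)) (w 0) * pathSum K B (fun i => w (i + 1)) (s - 2)

open scoped Classical in
/-- The bit that the procedure assigns to the cycle `f`. -/
noncomputable def cycleBit (σ : MState) (f : ℕ) : ℕ :=
  if σ.realArr 4 f 0 / σ.realVar 1 - cycleSum (fun i => σ.realArr 0 i i) (σ.realArr 2)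
    (σ.natArr 11 f) (σ.natArr 10 f 3) ≤ 0 then 0 else 1

theorem signBit_spec {σ : MState} {f : ℕ} (h6 : σ.natVar 6 = f) (hs : 2 ≤ σ.natArr 10 f 3) :
    Runs signBit σ (σ.natArr 10 f 3 * 80 + 80) fun τ => τ.natVar 19 = cycleBit σ f := by
  set s := σ.natArr 10 f 3 with hsdef
  set w := σ.natArr 11 f with hw
  set K := fun i => σ.realArr 0 i i with hK
  refine Runs.seq (Q' := fun τ => τ.realVar 2 = 1 ∧ τ.realVar 3 = K (w 0) ∧ τ.realVar 4 = 0 ∧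
    τ.realVar 5 = 1) (T₁ := 20) (T₂ := s * 80 + 60)
    (Runs.straight (by simp [Straight]) (by decide) ?_) ?_ (by omega)
  · simp [Prog.sem, NExp.eval, RExp.eval, h6, hK, hw]
  rintro τ₁ f₁ ⟨a2, a3, a4, a5⟩
  have b6 : τ₁.natVar 6 = f := by rw [f₁.natVar 6 rfl, h6]
  refine Runs.seq (Q' := fun τ => τ.realVar 3 = pathSum K (σ.realArr 2) w s ∧
    τ.realVar 4 = pathSum K (σ.realArr 2) (fun i => w (i + 1)) (s - 2)) (T₁ := s * 80 + 20)
    (T₂ := 40) ?_ ?_ (by omega)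
  · refine Runs.forLoop (B := s - 1) (C := 60) (fun i τ =>
      τ.realVar 2 = pathSum K (σ.realArr 2) w i ∧ τ.realVar 3 = pathSum K (σ.realArr 2) w (i + 1) ∧
      τ.realVar 5 = pathSum K (σ.realArr 2) (fun i => w (i + 1)) i ∧
      -- The value 0 at `i = 0` stands for the term before the empty path; with it the first round
      -- of the recurrence yields K (w 1).
      τ.realVar 4 = if i = 0 then 0 else pathSum K (σ.realArr 2) (fun i => w (i + 1)) (i - 1)) rfl
      (fun τ hτ => by
        simp only [NExp.eval]
        rw [hτ.natArr 10 rfl, hτ.natVar 6 rfl, f₁.natArr 10 rfl, b6])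
      (by simp [a2, a3, a4, a5, pathSum]) ?_ ?_ (by simp only [NExp.cost]; omega)
    · rintro i hi τ hτ hv ⟨c2, c3, c5, c4⟩
      have d6 : τ.natVar 6 = f := by rw [hτ.natVar 6 rfl, b6]
      have d11 : τ.natArr 11 f = w := by rw [hτ.natArr 11 rfl, f₁.natArr 11 rfl]
      have d0 : τ.realArr 0 = σ.realArr 0 := by rw [hτ.realArr 0 rfl, f₁.realArr 0 rfl]
      have d2 : τ.realArr 2 = σ.realArr 2 := by rw [hτ.realArr 2 rfl, f₁.realArr 2 rfl]
      refine Runs.straight (by simp [Straight]) (by decide) ?_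
      simp [Prog.sem, NExp.eval, RExp.eval, hv, d6, d11, d0, d2, c2, c3, c4, c5]
      refine ⟨by rw [pathSum], ?_⟩
      rcases i with _ | i
      · simp [pathSum, hK]
      · simp [pathSum, hK]
    · rintro τ hτ ⟨-, c3, -, c4⟩
      rw [if_neg (by omega)] at c4
      rw [Nat.sub_add_cancel (by omega)] at c3
      exact ⟨c3, by rw [c4]; rfl⟩
  rintro τ₂ f₂ ⟨c3, c4⟩
  refine Runs.straight (by simp [Straight]) (by decide) ?_
  have d6 : τ₂.natVar 6 = f := by rw [f₂.natVar 6 rfl, b6]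
  have d11 : τ₂.natArr 11 = σ.natArr 11 := by rw [f₂.natArr 11 rfl, f₁.natArr 11 rfl]
  have d10 : τ₂.natArr 10 = σ.natArr 10 := by rw [f₂.natArr 10 rfl, f₁.natArr 10 rfl]
  have d4 : τ₂.realArr 4 = σ.realArr 4 := by rw [f₂.realArr 4 rfl, f₁.realArr 4 rfl]
  have d2 : τ₂.realArr 2 = σ.realArr 2 := by rw [f₂.realArr 2 rfl, f₁.realArr 2 rfl]
  have d1 : τ₂.realVar 1 = σ.realVar 1 := by rw [f₂.realVar 1 rfl, f₁.realVar 1 rfl]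
  simp only [Prog.sem, BExp.eval, RExp.eval, NExp.eval, d6, d11, d10, d4, d2, d1, c3, c4, cycleBit,
    cycleSum, ← hsdef, ← hw, Int.cast_zero]
  split_ifs <;> simp

/-- Forward substitution. The witness of cycle f is orthogonal to all earlier cycles and odd on f,
so adding it when the parity on f is wrong corrects f and disturbs nothing already settled. In
particular every right-hand side is attained. The row with index M, beyond all witnesses, holds the
solution. -/
theorem solveSigns_spec {H : SimpleGraph ℕ} {σ τ : MState}
    (ht : EdgeTables H.Adj (σ.natArr 1) (σ.natArr 2) (σ.natVar 2) (σ.natVar 3))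
    (h : CycleBasisInv H σ (σ.natVar 3) τ) (h2 : τ.natArr 2 = σ.natArr 2)
    (h3 : τ.natVar 3 = σ.natVar 3) {S : ℕ} (hS : ∀ f < τ.natVar 5, τ.natArr 10 f 3 ≤ S) :
    Runs solveSigns τ (τ.natVar 5 * (S * 130 + σ.natVar 3 * 40 + 150) + 10) fun υ =>
      (∀ e, υ.natArr 4 (σ.natVar 3) e ≤ 1) ∧ ∀ f < τ.natVar 5,
        seqWeight (rowWeight (σ.natArr 2) (υ.natArr 4 (σ.natVar 3))) (τ.natArr 11 f)
          (τ.natArr 10 f 3) = (cycleBit τ f : ZMod 2) := by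
  set M := σ.natVar 3 with hM
  refine Runs.forLoop (B := τ.natVar 5) (C := S * 130 + M * 40 + 140) (fun i υ =>
    (∀ r e, υ.natArr 4 r e ≤ 1) ∧ (∀ r, r ≠ M → υ.natArr 4 r = τ.natArr 4 r) ∧ ∀ f < i,
        seqWeight (rowWeight (σ.natArr 2) (υ.natArr 4 M)) (τ.natArr 11 f)
          (τ.natArr 10 f 3) = (cycleBit τ f : ZMod 2)) rfl (fun υ hυ => hυ.natVar 5 rfl)
    ⟨h.bits, fun _ _ => rfl, by simp⟩ ?_ (fun _ _ h => ⟨h.1 _, h.2.2⟩)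
    (by simp only [NExp.cost]; ring_nf; omega)
  rintro f hf υ hυ hv ⟨i1, i2, i3⟩
  have a10 : υ.natArr 10 = τ.natArr 10 := hυ.natArr 10 rfl
  have a11 : υ.natArr 11 = τ.natArr 11 := hυ.natArr 11 rfl
  have a2 : υ.natArr 2 = σ.natArr 2 := by rw [hυ.natArr 2 rfl, h2]
  have a3 : υ.natVar 3 = M := by rw [hυ.natVar 3 rfl, h3]
  have hcb : cycleBit υ f = cycleBit τ f := by
    rw [cycleBit, a10, a11, hυ.realArr 4 rfl, hυ.realArr 0 rfl, hυ.realArr 2 rfl, hυ.realVar 1 rfl]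
    rfl
  have hsh := h.shortest f hf
  have h3le : 3 ≤ τ.natArr 10 f 3 := hsh.three_le (ht.rowWeight_comm _)
  have hSf := hS f hf
  refine Runs.seq (T₁ := S * 80 + 80) (T₂ := S * 50 + M * 40 + 60)
    ((signBit_spec (σ := υ) hv (by rw [a10]; omega)).mono (by rw [a10]; omega) (fun _ _ h => h)) ?_
    (by omega)
  intro χ hχ h19
  rw [hcb] at h19
  have b10 : χ.natArr 10 = τ.natArr 10 := by rw [hχ.natArr 10 rfl, a10]
  have b11 : χ.natArr 11 = τ.natArr 11 := by rw [hχ.natArr 11 rfl, a11]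
  have b4 : χ.natArr 4 = υ.natArr 4 := hχ.natArr 4 rfl
  have b2 : χ.natArr 2 = σ.natArr 2 := by rw [hχ.natArr 2 rfl, a2]
  have b6 : χ.natVar 6 = f := by rw [hχ.natVar 6 rfl, hv]
  have b3 : χ.natVar 3 = M := by rw [hχ.natVar 3 rfl, a3]
  refine Runs.seq (T₁ := S * 50 + 20) (T₂ := M * 40 + 40)
    ((pairRow_spec (σ := χ) (f := .var 6) (row := .var 3) (F := f) (r := M) rfl rfl
      (fun ω hω => by simp only [NExp.eval]; rw [hω.natVar 6 rfl, b6])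
      (fun ω hω => by simp only [NExp.eval]; rw [hω.natVar 3 rfl, b3])
      (by rw [b4]; exact i1 M)).mono (by rw [b10]; omega) (fun _ _ h => h)) ?_ (by omega)
  rintro ω hω ⟨h13, hpair⟩
  rw [b10, b11, b4, b2] at hpair
  have c10 : ω.natArr 10 = τ.natArr 10 := by rw [hω.natArr 10 rfl, b10]
  have c4 : ω.natArr 4 = υ.natArr 4 := by rw [hω.natArr 4 rfl, b4]
  have c6 : ω.natVar 6 = f := by rw [hω.natVar 6 rfl, b6]
  have c3 : ω.natVar 3 = M := by rw [hω.natVar 3 rfl, b3]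
  have c19 : ω.natVar 19 = cycleBit τ f := by rw [hω.natVar 19 rfl, h19]
  have hbit : cycleBit τ f ≤ 1 := by unfold cycleBit; split_ifs <;> simp
  refine Runs.cond (T := M * 40 + 30) (fun hc => Runs.straight trivial (by simp [Prog.time]) ?_)
    (fun hc => ?_) (by simp only [NExp.cost, BExp.cost]; omega)
  · have hc' : ω.natVar 13 = cycleBit τ f := by simpa [BExp.eval, NExp.eval, c19] using hc
    simp only [Prog.sem, MState.withNat_natArr, c4]
    refine ⟨i1, i2, fun g hg => ?_⟩
    rcases Nat.lt_succ_iff_lt_or_eq.1 hg with hlt | rfl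
    · exact i3 g hlt
    · rw [← hpair, hc']
  · have hc' : ω.natVar 13 ≠ cycleBit τ f := by simpa [BExp.eval, NExp.eval, c19] using hc
    have hkf := h.witness_lt f hf
    refine (addRow_spec (σ := ω) (dst := .var 3) (src := .get 10 (.var 6) (.const 4)) (D := M)
      (S := τ.natArr 10 f 4) rfl (by simp [NExp.cost]) hkf.ne'
      (fun ζ hζ => by simp only [NExp.eval]; rw [hζ.natVar 3 rfl, c3])
      (fun ζ hζ => by simp only [NExp.eval]; rw [hζ.natArr 10 rfl, hζ.natVar 6 rfl, c6, c10])
      (by rw [c4]; exact i1 M) (by rw [c4]; exact i1 _)).mono (by rw [c3]; omega) ?_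
    rintro ζ hζ ⟨g1, g2, g3⟩
    rw [c4] at g1 g3
    rw [c3, i2 _ hkf.ne] at g3
    simp only [MState.withNat_natArr]
    have hadd : ∀ g < τ.natVar 5, seqWeight (rowWeight (σ.natArr 2) (ζ.natArr 4 M))
        (τ.natArr 11 g) (τ.natArr 10 g 3) =
        seqWeight (rowWeight (σ.natArr 2) (υ.natArr 4 M)) (τ.natArr 11 g) (τ.natArr 10 g 3) +
        seqWeight (rowWeight (σ.natArr 2) (τ.natArr 4 (τ.natArr 10 f 4))) (τ.natArr 11 g)
          (τ.natArr 10 g 3) := by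
      intro g hg
      have := rowWeight_add ht (t := 1) (a := υ.natArr 4 M) (b := τ.natArr 4 (τ.natArr 10 f 4))
        (c := ζ.natArr 4 M) (fun e he => by rw [g3 e he, one_mul])
        (h.shortest g hg).toClosedSeq
      rwa [one_mul] at this
    refine ⟨fun r e => ?_, fun r hr => by rw [g1 r hr, i2 r hr], fun g hg => ?_⟩
    · by_cases hr : r = M
      · rw [hr]; exact g2 e
      · rw [g1 r hr]; exact i1 r e
    · rcases Nat.lt_succ_iff_lt_or_eq.1 hg with hlt | rfl
      · rw [hadd g (hlt.trans hf), i3 g hlt, h.orth g (hlt.trans hf) _ (h.witness_mono g f hlt hf) hkf,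
          add_zero]
      · rw [hadd g hf, ← hpair, hsh.odd]
        have : ω.natVar 13 = 1 - cycleBit τ g := by omega
        have h01 : cycleBit τ g = 0 ∨ cycleBit τ g = 1 := by omega
        rcases h01 with e | e <;> rw [this, e] <;> decide

theorem writeOutput_spec {H : SimpleGraph ℕ} {σ : MState}
    (ht : EdgeTables H.Adj (σ.natArr 1) (σ.natArr 2) (σ.natVar 2) (σ.natVar 3)) :
    Runs writeOutput σ (σ.natVar 2 * 60 + 10) fun τ =>
      (∀ i j, ¬ H.Adj i j → τ.realArr 0 i j = σ.realArr 0 i j) ∧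
      ∀ i j, H.Adj i j → τ.realArr 0 i j =
        if σ.natArr 4 (σ.natVar 3) (σ.natArr 2 i j) = 1 then √(σ.realArr 2 i j)
          else -√(σ.realArr 2 i j) := by
  set val : ℕ → ℕ → ℝ := fun i j => if σ.natArr 4 (σ.natVar 3) (σ.natArr 2 i j) = 1
    then √(σ.realArr 2 i j) else -√(σ.realArr 2 i j) with hval
  refine Runs.forLoop (B := σ.natVar 2) (C := 50) (fun d τ =>
      (∀ i j, ¬ H.Adj i j → τ.realArr 0 i j = σ.realArr 0 i j) ∧
      ∀ d' < d, τ.realArr 0 (σ.natArr 1 d' 0) (σ.natArr 1 d' 1) =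
        val (σ.natArr 1 d' 0) (σ.natArr 1 d' 1)) rfl
    (fun τ hτ => hτ.natVar 2 rfl) (by simp) ?_ ?_ (by simp only [NExp.cost]; omega)
  · rintro d hd τ hτ hv ⟨h1, h2⟩
    have a1 : τ.natArr 1 = σ.natArr 1 := hτ.natArr 1 rfl
    have a2 : τ.natArr 2 = σ.natArr 2 := hτ.natArr 2 rfl
    have a4 : τ.natArr 4 = σ.natArr 4 := hτ.natArr 4 rfl
    have v3 : τ.natVar 3 = σ.natVar 3 := hτ.natVar 3 rfl
    have r2 : τ.realArr 2 = σ.realArr 2 := hτ.realArr 2 rfl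
    have hadj := ht.dir_adj d hd
    refine Runs.straight (by simp [Straight]) (by decide) ?_
    have key : ∀ χ : MState, (∀ i j, χ.realArr 0 i j =
        if i = σ.natArr 1 d 0 ∧ j = σ.natArr 1 d 1 then val (σ.natArr 1 d 0) (σ.natArr 1 d 1)
          else τ.realArr 0 i j) → (∀ i j, ¬ H.Adj i j → χ.realArr 0 i j = σ.realArr 0 i j) ∧
        ∀ d' < d + 1, χ.realArr 0 (σ.natArr 1 d' 0) (σ.natArr 1 d' 1) =
          val (σ.natArr 1 d' 0) (σ.natArr 1 d' 1) := by
      intro χ hχ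
      refine ⟨fun i j hij => ?_, fun d' hd' => ?_⟩
      · rw [hχ, if_neg (by rintro ⟨rfl, rfl⟩; exact hij hadj), h1 i j hij]
      · rw [hχ]
        split_ifs with hc
        · rw [hc.1, hc.2]
        · rcases Nat.lt_succ_iff_lt_or_eq.1 hd' with hlt | rfl
          · exact h2 d' hlt
          · exact absurd ⟨rfl, rfl⟩ hc
    refine key _ fun i j => ?_
    simp only [hval]
    simp [Prog.sem, BExp.eval, NExp.eval, RExp.eval, hv, a1, a2, a4, v3, r2]
    by_cases hb : σ.natArr 4 (σ.natVar 3) (σ.natArr 2 (σ.natArr 1 d 0) (σ.natArr 1 d 1)) = 1 <;>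
      simp [hb]
  · rintro τ hτ ⟨h1, h2⟩
    refine ⟨h1, fun i j hij => ?_⟩
    obtain ⟨d, hd, rfl, rfl⟩ := ht.exists_dir i j hij
    exact h2 d hd

end MomentProgram

/-! ### Signed matching sums -/

namespace MomentProgram

open SimpleGraph

section MatchingSums

variable {V : Type*}

theorem pathSum_congr {W : Type*} {K : V → ℝ} {B : V → V → ℝ} {w : ℕ → V} {K' : W → ℝ}
    {B' : W → W → ℝ} {w' : ℕ → W} {k : ℕ} (hK : ∀ i < k, K (w i) = K' (w' i))
    (hB : ∀ i, i + 1 < k → B (w i) (w (i + 1)) = B' (w' i) (w' (i + 1))) :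
    pathSum K B w k = pathSum K' B' w' k := by
  induction k using Nat.twoStepInduction with
  | zero => rfl
  | one => rw [pathSum, pathSum, hK 0 one_pos]
  | more k h1 h2 =>
    rw [pathSum, pathSum, h1 (fun i hi => hK i (by omega)) fun i hi => hB i (by omega),
      h2 (fun i hi => hK i (by omega)) fun i hi => hB i (by omega),
      hB k (by omega), hK (k + 1) (by omega)]

theorem cycleSum_congr {W : Type*} {K : V → ℝ} {B : V → V → ℝ} {w : ℕ → V} {K' : W → ℝ}
    {B' : W → W → ℝ} {w' : ℕ → W} {s : ℕ} (hs : 2 ≤ s) (hK : ∀ i < s, K (w i) = K' (w' i))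
    (hB : ∀ i, i + 1 < s → B (w i) (w (i + 1)) = B' (w' i) (w' (i + 1)))
    (hB' : B (w (s - 1)) (w 0) = B' (w' (s - 1)) (w' 0)) :
    cycleSum K B w s = cycleSum K' B' w' s := by
  rw [cycleSum, cycleSum, pathSum_congr hK hB, hB', pathSum_congr (k := s - 2)
    (w := fun i => w (i + 1)) (w' := fun i => w' (i + 1)) (fun i hi => hK (i + 1) (by omega))
    fun i hi => hB (i + 1) (by omega)]

open scoped Classical in
/-- The signed matching sum of the subgraph induced by `S`. -/
noncomputable def matchingSum [Fintype V] (G : SimpleGraph V) (K : V → ℝ) (b : Sym2 V → ℝ)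
    (S : Finset V) : ℝ :=
  ∑ M ∈ matchings G S, (-1) ^ M.card * (∏ e ∈ M, b e) *
      ∏ v ∈ S.filter (fun v => ∀ e ∈ M, v ∉ e), K v

theorem mem_matchings [Fintype V] {G : SimpleGraph V} {S : Finset V} {M : Finset (Sym2 V)} :
    M ∈ matchings G S ↔ (∀ e ∈ M, e ∈ G.edgeSet ∧ ∀ v ∈ e, v ∈ S) ∧
      (∀ e ∈ M, ∀ f ∈ M, e ≠ f → ∀ v, v ∈ e → v ∉ f) := by
  simp [matchings]

variable [DecidableEq V]

/-- The recursion of the signed matching sums of the subgraphs induced by finite sets. -/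
structure MatchingRecursion (G : SimpleGraph V) [DecidableRel G.Adj] (K : V → ℝ) (B : V → V → ℝ)
    (m : Finset V → ℝ) : Prop where
  empty : m ∅ = 1
  step : ∀ (S : Finset V), ∀ v ∈ S, m S = K v * m (S.erase v) -
    ∑ u ∈ S with G.Adj v u, B u v * m ((S.erase v).erase u)

/-- The first `k` vertices of `w` induce a path. -/
structure InducedPath (G : SimpleGraph V) (w : ℕ → V) (k : ℕ) : Prop where
  injOn : ∀ i < k, ∀ j < k, w i = w j → i = j
  adj_iff : ∀ i < k, ∀ j < k, G.Adj (w i) (w j) ↔ i + 1 = j ∨ j + 1 = i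

theorem image_range_erase {w : ℕ → V} {k : ℕ} (h : ∀ i < k + 1, ∀ j < k + 1, w i = w j → i = j) :
    ((Finset.range (k + 1)).image w).erase (w k) = (Finset.range k).image w := by
  ext v
  simp only [Finset.mem_erase, Finset.mem_image, Finset.mem_range]
  constructor
  · rintro ⟨hne, i, hi, rfl⟩
    exact ⟨i, by rcases Nat.lt_succ_iff_lt_or_eq.1 hi with h | rfl; exacts [h, (hne rfl).elim], rfl⟩
  · rintro ⟨i, hi, rfl⟩
    exact ⟨fun e => by have := h i (by omega) k (by omega) e; omega, i, by omega, rfl⟩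

/-- The last vertex of an induced path has only its predecessor as a neighbor, so the recursion
collapses to three terms. -/
theorem MatchingRecursion.eq_pathSum {G : SimpleGraph V} [DecidableRel G.Adj] {K : V → ℝ}
    {B : V → V → ℝ} {m : Finset V → ℝ} (h : MatchingRecursion G K B m) {w : ℕ → V} {k : ℕ}
    (hw : InducedPath G w k) : m ((Finset.range k).image w) = pathSum K B w k := by
  induction k using Nat.twoStepInduction with
  | zero => simp [h.empty, pathSum]
  | one => rw [pathSum]; simp [h.step {w 0} (w 0), h.empty, Finset.filter_singleton]
  | more k h1 h2 =>
    have p1 : InducedPath G w (k + 1) :=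
      ⟨fun i hi j hj => hw.injOn i (by omega) j (by omega),
        fun i hi j hj => hw.adj_iff i (by omega) j (by omega)⟩
    have p0 : InducedPath G w k :=
      ⟨fun i hi j hj => hw.injOn i (by omega) j (by omega),
        fun i hi j hj => hw.adj_iff i (by omega) j (by omega)⟩
    have hN : {u ∈ (Finset.range (k + 2)).image w | G.Adj (w (k + 1)) u} = {w k} := by
      ext u
      simp only [Finset.mem_filter, Finset.mem_image, Finset.mem_range, Finset.mem_singleton]
      constructor
      · rintro ⟨⟨i, hi, rfl⟩, ha⟩
        rw [hw.adj_iff _ (by omega) _ hi] at ha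
        congr 1; omega
      · rintro rfl
        exact ⟨⟨k, by omega, rfl⟩, (hw.adj_iff _ (by omega) _ (by omega)).2 (Or.inr rfl)⟩
    rw [h.step _ (w (k + 1)) (Finset.mem_image_of_mem _ (by simp)), hN, Finset.sum_singleton,
      image_range_erase hw.injOn, image_range_erase p1.injOn, h2 p1, h1 p0, pathSum]

/-- The first `s` vertices of `w` induce a cycle. -/
structure InducedCycle (G : SimpleGraph V) (w : ℕ → V) (s : ℕ) : Prop where
  three_le : 3 ≤ s
  injOn : ∀ i < s, ∀ j < s, w i = w j → i = j
  adj_iff : ∀ i < s, ∀ j < s, i < j → (G.Adj (w i) (w j) ↔ i + 1 = j ∨ i = 0 ∧ j + 1 = s)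

/-- Deleting the last vertex leaves a path; deleting it together with one of its two neighbors
leaves a shorter path, which starts at vertex 0 or at vertex 1. -/
theorem MatchingRecursion.eq_cycleSum {G : SimpleGraph V} [DecidableRel G.Adj] {K : V → ℝ}
    {B : V → V → ℝ} {m : Finset V → ℝ} (h : MatchingRecursion G K B m)
    (hB : ∀ a b, B a b = B b a) {w : ℕ → V} {s : ℕ}
    (hw : InducedCycle G w s) : m ((Finset.range s).image w) = cycleSum K B w s := by
  -- An arc is an induced path as soon as it misses one end of the closing edge, i.e. either the
  -- last vertex or vertex 0.
  obtain ⟨s, rfl⟩ := Nat.exists_eq_add_of_le' hw.three_le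
  have hp : ∀ (a k : ℕ), a + k ≤ s + 2 ∨ (0 < a ∧ a + k ≤ s + 3) →
      InducedPath G (fun i => w (i + a)) k := by
    intro a k hak
    refine ⟨fun i hi j hj e => by have := hw.injOn _ (by omega) _ (by omega) e; omega,
      fun i hi j hj => ?_⟩
    rcases lt_trichotomy i j with hlt | rfl | hlt
    · rw [hw.adj_iff _ (by omega) _ (by omega) (by omega)]; omega
    · simp
    · rw [G.adj_comm, hw.adj_iff _ (by omega) _ (by omega) (by omega)]; omega
  have hN : {u ∈ (Finset.range (s + 3)).image w | G.Adj (w (s + 2)) u} = {w (s + 1), w 0} := by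
    ext u
    simp only [Finset.mem_filter, Finset.mem_image, Finset.mem_range, Finset.mem_singleton,
      Finset.mem_insert]
    constructor
    · rintro ⟨⟨i, hi, rfl⟩, ha⟩
      have hne : i ≠ s + 2 := by rintro rfl; exact G.irrefl ha
      rw [G.adj_comm, hw.adj_iff _ hi _ (by omega) (by omega)] at ha
      rcases ha with e | ⟨e, -⟩
      · left; congr 1; omega
      · right; rw [e]
    · rintro (rfl | rfl)
      · exact ⟨⟨s + 1, by omega, rfl⟩,
          ((hw.adj_iff _ (by omega) _ (by omega) (by omega)).2 (Or.inl rfl)).symm⟩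
      · exact ⟨⟨0, by omega, rfl⟩,
          ((hw.adj_iff _ (by omega) _ (by omega) (by omega)).2 (Or.inr ⟨rfl, rfl⟩)).symm⟩
  have hne : w (s + 1) ≠ w 0 := fun e => by
    have := hw.injOn _ (by omega) _ (by omega) e; omega
  have h0 : ((Finset.range (s + 2)).image w).erase (w 0) =
      (Finset.range (s + 1)).image fun i => w (i + 1) := by
    ext v
    simp only [Finset.mem_erase, Finset.mem_image, Finset.mem_range]
    constructor
    · rintro ⟨hv, i, hi, rfl⟩
      have : i ≠ 0 := by rintro rfl; exact hv rfl
      exact ⟨i - 1, by omega, by congr 1; omega⟩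
    · rintro ⟨i, hi, rfl⟩
      exact ⟨fun e => by have := hw.injOn _ (by omega) _ (by omega) e; omega, i + 1, by omega, rfl⟩
  have hrec : pathSum K B w (s + 3) = K (w (s + 2)) * pathSum K B w (s + 2) -
    B (w (s + 1)) (w (s + 2)) * pathSum K B w (s + 1) := rfl
  rw [h.step _ (w (s + 2)) (Finset.mem_image_of_mem _ (by simp)), hN, Finset.sum_pair hne,
    image_range_erase hw.injOn,
    image_range_erase (fun i hi j hj => hw.injOn i (by omega) j (by omega)), h0,
    h.eq_pathSum (w := w) (hp 0 (s + 2) (by omega)), h.eq_pathSum (w := w) (hp 0 (s + 1) (by omega)),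
    h.eq_pathSum (hp 1 (s + 1) (by omega)), cycleSum, hrec, hB (w 0)]
  simp only [Nat.add_one_sub_one, show s + 3 - 2 = s + 1 by omega]
  ring

end MatchingSums

section

open scoped Classical

variable {V : Type*}

/-- Matchings that avoid `v` are the matchings of S without v and contribute the factor K v. Those
that contain the edge vu arise from matchings of S without v and u by inserting that edge, which
reverses the sign. -/
theorem matchingRecursion_matchingSum [Fintype V] (G : SimpleGraph V) (K : V → ℝ)
    (b : Sym2 V → ℝ) :
    MatchingRecursion G K (fun u v => b s(u, v)) (matchingSum G K b) where
  empty := by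
    have : matchings G (∅ : Finset V) = {∅} := by
      ext M
      rw [mem_matchings, Finset.mem_singleton]
      constructor
      · rintro ⟨h, -⟩
        refine Finset.eq_empty_of_forall_notMem fun e he => ?_
        induction e with
        | _ x y => exact Finset.notMem_empty x ((h _ he).2 x (by simp))
      · rintro rfl; simp
    simp [matchingSum, this]
  step S v hv := by
    unfold matchingSum
    rw [← Finset.sum_filter_add_sum_filter_not (matchings G S) (fun M => ∀ e ∈ M, v ∉ e),
      sub_eq_add_neg]
    congr 1
    · have : (matchings G S).filter (fun M => ∀ e ∈ M, v ∉ e) = matchings G (S.erase v) := by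
        ext M
        simp only [Finset.mem_filter, mem_matchings, Finset.mem_erase]
        constructor
        · rintro ⟨⟨h1, h2⟩, h3⟩
          exact ⟨fun e he => ⟨(h1 e he).1, fun u hu =>
            ⟨by rintro rfl; exact h3 e he hu, (h1 e he).2 u hu⟩⟩, h2⟩
        · rintro ⟨h1, h2⟩
          exact ⟨⟨fun e he => ⟨(h1 e he).1, fun u hu => ((h1 e he).2 u hu).2⟩, h2⟩,
            fun e he hve => ((h1 e he).2 v hve).1 rfl⟩
      rw [this, Finset.mul_sum]
      refine Finset.sum_congr rfl fun M hM => ?_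
      have hMv : ∀ e ∈ M, v ∉ e := by
        rw [← this] at hM; exact (Finset.mem_filter.1 hM).2
      have e : S.filter (fun v => ∀ e ∈ M, v ∉ e) =
          insert v ((S.erase v).filter (fun v => ∀ e ∈ M, v ∉ e)) := by
        ext u
        simp only [Finset.mem_filter, Finset.mem_insert, Finset.mem_erase]
        by_cases hu : u = v
        · subst hu; simp [hv]; exact hMv
        · simp [hu]
      rw [e, Finset.prod_insert (by simp)]
      ring
    · rw [← Finset.sum_neg_distrib]
      simp only [Finset.mul_sum, ← Finset.sum_neg_distrib]
      rw [Finset.sum_sigma']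
      symm
      have hdisj : ∀ u M, M ∈ matchings G ((S.erase v).erase u) → s(v, u) ∉ M := by
        intro u M hM hmem
        have := ((mem_matchings.1 hM).1 _ hmem).2 v (by simp)
        simp at this
      have hav : ∀ u M, M ∈ matchings G ((S.erase v).erase u) → ∀ e ∈ M, v ∉ e ∧ u ∉ e := by
        intro u M hM e he
        have := ((mem_matchings.1 hM).1 _ he).2
        exact ⟨fun h => by simpa using this v h, fun h => by simpa using this u h⟩
      refine Finset.sum_bij (fun x _ => insert s(v, x.1) x.2) ?_ ?_ ?_ ?_
      · rintro ⟨u, M⟩ hx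
        simp only [Finset.mem_sigma, Finset.mem_filter] at hx
        obtain ⟨⟨huS, hadj⟩, hM⟩ := hx
        have hM' := mem_matchings.1 hM
        simp only [Finset.mem_filter, mem_matchings, Finset.mem_insert, not_forall, not_not]
        refine ⟨⟨?_, ?_⟩, s(v, u), Or.inl rfl, by simp⟩
        · rintro e (rfl | he)
          · exact ⟨hadj, by simp [hv, huS]⟩
          · exact ⟨(hM'.1 e he).1, fun x hx =>
              Finset.mem_of_mem_erase (Finset.mem_of_mem_erase ((hM'.1 e he).2 x hx))⟩
        · rintro e (rfl | he) f (rfl | hf) hne x hx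
          · exact (hne rfl).elim
          · rcases Sym2.mem_iff.1 hx with rfl | rfl
            · exact (hav u M hM f hf).1
            · exact (hav _ M hM f hf).2
          · intro hx'
            rcases Sym2.mem_iff.1 hx' with rfl | rfl
            · exact (hav u M hM e he).1 hx
            · exact (hav _ M hM e he).2 hx
          · exact hM'.2 e he f hf hne x hx
      · rintro ⟨u, M⟩ hx ⟨u', M'⟩ hx' heq
        simp only [Finset.mem_sigma, Finset.mem_filter] at hx hx'
        have hu : u = u' := by
          have : s(v, u) ∈ insert s(v, u') M' := by
            rw [← heq]; exact Finset.mem_insert_self _ _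
          rcases Finset.mem_insert.1 this with h | h
          · rcases Sym2.eq_iff.1 h with ⟨-, h⟩ | ⟨h, h'⟩
            exacts [h, h'.trans h]
          · exact absurd (by simp) (hav u' M' hx'.2 _ h).1
        subst hu
        have : M = M' := by
          rw [← Finset.erase_insert (hdisj u M hx.2), ← Finset.erase_insert (hdisj u M' hx'.2)]
          simp only at heq
          rw [heq]
        rw [this]
      · intro M hM
        simp only [Finset.mem_filter, mem_matchings, not_forall, not_not] at hM
        obtain ⟨⟨h1, h2⟩, e, he, hve⟩ := hM
        obtain ⟨u, rfl⟩ := hve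
        refine ⟨⟨u, M.erase s(v, u)⟩, ?_, Finset.insert_erase he⟩
        simp only [Finset.mem_sigma, Finset.mem_filter, mem_matchings, Finset.mem_erase]
        refine ⟨⟨(h1 _ he).2 u (by simp), (h1 _ he).1⟩, fun f hf => ⟨(h1 f hf.2).1, fun x hx =>
          ⟨?_, ?_, (h1 f hf.2).2 x hx⟩⟩, fun f hf g hg => h2 f hf.2 g hg.2⟩
        · rintro rfl
          exact h2 _ he f hf.2 hf.1.symm x (by simp) hx
        · rintro rfl
          exact h2 _ he f hf.2 hf.1.symm x (by simp) hx
      · rintro ⟨u, M⟩ hx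
        simp only [Finset.mem_sigma, Finset.mem_filter] at hx
        obtain ⟨⟨huS, hadj⟩, hM⟩ := hx
        have e : S.filter (fun x => ∀ e ∈ insert s(v, u) M, x ∉ e) =
            ((S.erase v).erase u).filter (fun x => ∀ e ∈ M, x ∉ e) := by
          ext x
          simp only [Finset.mem_filter, Finset.mem_insert, Finset.mem_erase, forall_eq_or_imp,
            Sym2.mem_iff, not_or]
          tauto
        simp only
        rw [e, Finset.card_insert_of_notMem (hdisj u M hM), Finset.prod_insert (hdisj u M hM),
          Sym2.eq_swap (a := u)]
        ring

end

theorem matchingSum_inducedCycle {V : Type*} [Fintype V] [DecidableEq V] {G : SimpleGraph V}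
    (K : V → ℝ) (b : Sym2 V → ℝ) {w : ℕ → V} {s : ℕ} (hw : InducedCycle G w s) :
    matchingSum G K b ((Finset.range s).image w) = cycleSum K (fun u v => b s(u, v)) w s := by
  have := @MatchingRecursion.eq_cycleSum V (fun a b => Classical.propDecidable (a = b)) G
    (fun a b => Classical.propDecidable _) K _ _ (matchingRecursion_matchingSum G K b)
    (fun u v => by rw [Sym2.eq_swap]) w s hw
  convert this

end MomentProgram

/-! ### Determinants of cycle-shaped matrices -/

namespace MomentProgram

open SimpleGraph Equiv

section Involutions

variable {V : Type*} [Fintype V] [DecidableEq V]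

/-- The involutions that fix everything outside `S`. -/
def involutionsOn (S : Finset V) : Finset (Perm V) :=
  Finset.univ.filter fun σ => (∀ i, σ (σ i) = i) ∧ ∀ i, i ∉ S → σ i = i

theorem mem_involutionsOn {S : Finset V} {σ : Perm V} :
    σ ∈ involutionsOn S ↔ (∀ i, σ (σ i) = i) ∧ ∀ i, i ∉ S → σ i = i := by simp [involutionsOn]

/-- The part of the Leibniz expansion of the principal minor at `S` that belongs to involutions. -/
noncomputable def involutionSum (A : Matrix V V ℝ) (S : Finset V) : ℝ :=
  ∑ σ ∈ involutionsOn S, ((Perm.sign σ : ℤ) : ℝ) * ∏ i ∈ S, A (σ i) i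

theorem sum_involutionsOn_fixing (A : Matrix V V ℝ) {S : Finset V} {v : V} (hv : v ∈ S) :
    ∑ σ ∈ involutionsOn S with σ v = v, ((Perm.sign σ : ℤ) : ℝ) * ∏ i ∈ S, A (σ i) i =
      A v v * involutionSum A (S.erase v) := by
  have : (involutionsOn S).filter (fun σ => σ v = v) = involutionsOn (S.erase v) := by
    ext σ
    simp only [Finset.mem_filter, mem_involutionsOn, Finset.mem_erase, not_and_or, not_not]
    constructor
    · rintro ⟨⟨h1, h2⟩, h3⟩
      exact ⟨h1, fun i hi => hi.elim (fun h => by rw [h, h3]) (h2 i)⟩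
    · rintro ⟨h1, h2⟩
      exact ⟨⟨h1, fun i hi => h2 i (Or.inr hi)⟩, h2 v (Or.inl rfl)⟩
  rw [involutionSum, Finset.mul_sum, ← this]
  refine Finset.sum_congr rfl fun σ hσ => ?_
  rw [← Finset.mul_prod_erase S _ hv, (Finset.mem_filter.1 hσ).2]
  ring

/-- Multiplication by the transposition of `u` and `v` is a bijection from the involutions that
exchange them onto those fixing both, and it reverses the sign. -/
theorem sum_involutionsOn_moving (A : Matrix V V ℝ) {S : Finset V} {u v : V} (hv : v ∈ S)
    (hu : u ∈ S) (huv : u ≠ v) :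
    ∑ σ ∈ involutionsOn S with σ v = u, ((Perm.sign σ : ℤ) : ℝ) * ∏ i ∈ S, A (σ i) i =
      -(A u v * A v u * involutionSum A ((S.erase v).erase u)) := by
  rw [involutionSum, Finset.mul_sum, ← Finset.sum_neg_distrib]
  have hu' : u ∈ S.erase v := Finset.mem_erase.2 ⟨huv, hu⟩
  have hval : ∀ σ : Perm V, (∀ i, σ (σ i) = i) → σ v = u → ∀ i, i ≠ v → i ≠ u →
      (swap v u * σ) i = σ i := by
    intro σ hσ hσv i hiv hiu
    refine swap_apply_of_ne_of_ne (fun e => hiu ?_) (fun e => hiv ?_)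
    · rw [← hσ i, e, hσv]
    · rw [← hσ i, e, ← hσv, hσ]
  have hval' : ∀ σ : Perm V, (∀ i, i ∉ (S.erase v).erase u → σ i = i) → ∀ i, i ≠ v → i ≠ u →
      (swap v u * σ) i = σ i := by
    intro σ hσ i hiv hiu
    have h1 : σ u = u := hσ u (by simp)
    have h2 : σ v = v := hσ v (by simp)
    refine swap_apply_of_ne_of_ne (fun e => hiv ?_) (fun e => hiu ?_)
    · exact σ.injective (e.trans h2.symm)
    · exact σ.injective (e.trans h1.symm)
  refine Finset.sum_bij' (fun σ _ => swap v u * σ) (fun σ _ => swap v u * σ) ?_ ?_ ?_ ?_ ?_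
  · intro σ hσ
    obtain ⟨hσ, hσv⟩ := Finset.mem_filter.1 hσ
    obtain ⟨h1, h2⟩ := mem_involutionsOn.1 hσ
    have hσu : σ u = v := by rw [← hσv, h1]
    have ev : (swap v u * σ) v = v := by simp [hσv]
    have eu : (swap v u * σ) u = u := by simp [hσu]
    refine mem_involutionsOn.2 ⟨fun i => ?_, fun i hi => ?_⟩
    · by_cases hiv : i = v
      · rw [hiv, ev, ev]
      by_cases hiu : i = u
      · rw [hiu, eu, eu]
      rw [hval σ h1 hσv i hiv hiu, hval σ h1 hσv, h1]
      · exact fun e => hiu (by rw [← h1 i, e, hσv])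
      · exact fun e => hiv (by rw [← h1 i, e, hσu])
    · by_cases hiv : i = v
      · rw [hiv, ev]
      by_cases hiu : i = u
      · rw [hiu, eu]
      rw [hval σ h1 hσv i hiv hiu]
      exact h2 i fun h => hi (by simp [hiv, hiu, h])
  · intro σ hσ
    obtain ⟨h1, h2⟩ := mem_involutionsOn.1 hσ
    have h3 : σ u = u := h2 u (by simp)
    have h4 : σ v = v := h2 v (by simp)
    have ev : (swap v u * σ) v = u := by simp [h4]
    have eu : (swap v u * σ) u = v := by simp [h3]
    refine Finset.mem_filter.2 ⟨mem_involutionsOn.2 ⟨fun i => ?_, fun i hi => ?_⟩, ev⟩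
    · by_cases hiv : i = v
      · rw [hiv, ev, eu]
      by_cases hiu : i = u
      · rw [hiu, eu, ev]
      rw [hval' σ h2 i hiv hiu, hval' σ h2, h1]
      · exact fun e => hiv (by rw [← h1 i, e, h4])
      · exact fun e => hiu (by rw [← h1 i, e, h3])
    · have hiv : i ≠ v := by rintro rfl; exact hi hv
      have hiu : i ≠ u := by rintro rfl; exact hi hu
      rw [hval' σ h2 i hiv hiu]
      exact h2 i fun h => hi (by simp only [Finset.mem_erase] at h; exact h.2.2)
  · intro σ _; rw [← mul_assoc, swap_mul_self, one_mul]
  · intro σ _; rw [← mul_assoc, swap_mul_self, one_mul]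
  · intro σ hσ
    obtain ⟨hσ, hσv⟩ := Finset.mem_filter.1 hσ
    obtain ⟨h1, -⟩ := mem_involutionsOn.1 hσ
    have hσu : σ u = v := by rw [← hσv, h1]
    rw [← Finset.mul_prod_erase S _ hv, ← Finset.mul_prod_erase _ _ hu', hσv, hσu, Perm.sign_mul,
      Perm.sign_swap huv.symm, Finset.prod_congr rfl fun i hi => by
        rw [← hval σ h1 hσv i (Finset.ne_of_mem_erase (Finset.mem_of_mem_erase hi))
          (Finset.ne_of_mem_erase hi)]]
    push_cast
    ring

/-- An involution is a matching in disguise, each transposition contributing the negative square of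
an entry. Verifying the common recursion suffices to evaluate the sum on a cycle; no bijection with
matchings is needed. -/
theorem matchingRecursion_involutionSum (G : SimpleGraph V) [DecidableRel G.Adj] (A : Matrix V V ℝ)
    (hs : ∀ i j, A i j = A j i) (hA : ∀ i j, i ≠ j → A i j ≠ 0 → G.Adj i j) :
    MatchingRecursion G (fun v => A v v) (fun u v => A u v ^ 2) (involutionSum A) where
  empty := by
    have : involutionsOn (∅ : Finset V) = {1} := by
      ext σ
      simp only [mem_involutionsOn, Finset.mem_singleton]
      constructor
      · rintro ⟨-, h⟩; exact Equiv.ext fun i => h i (by simp)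
      · rintro rfl; simp
    simp [involutionSum, this]
  step S v hv := by
    rw [involutionSum, ← Finset.sum_fiberwise_of_maps_to (s := involutionsOn S) (t := S)
      (g := fun σ => σ v), ← Finset.add_sum_erase _ _ hv, sum_involutionsOn_fixing A hv,
      Finset.sum_congr rfl fun u hu => sum_involutionsOn_moving A hv (Finset.mem_of_mem_erase hu)
        (Finset.ne_of_mem_erase hu), Finset.sum_neg_distrib, ← sub_eq_add_neg]
    · congr 1
      rw [Finset.sum_filter, ← Finset.add_sum_erase _ _ hv, if_neg G.irrefl, zero_add]
      refine Finset.sum_congr rfl fun u hu => ?_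
      split_ifs with hadj
      · rw [hs v u, sq]
      · have : A u v = 0 := by
          by_contra h
          exact hadj (hA u v (Finset.ne_of_mem_erase hu) h).symm
        rw [this, zero_mul, zero_mul]
    · intro σ hσ
      obtain ⟨h1, h2⟩ := mem_involutionsOn.1 hσ
      by_contra h
      have h' := h2 _ h
      rw [h1] at h'
      exact h (h' ▸ hv)

end Involutions

/-! ### Permutations that move points cyclically by at most one -/

section Rotations

variable {n : ℕ}

/-- If i moves to i + 1 and is not exchanged with it, then i + 1 can be neither fixed, by
injectivity, nor sent back, so it moves to i + 2. That point is not sent back either, since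
otherwise injectivity would force 2 = 0 in a cyclic group of order at least three. The pattern
propagates all the way round. -/
theorem perm_eq_add_one {σ : Perm (Fin (n + 3))}
    (hσ : ∀ k, σ k = k ∨ σ k = k + 1 ∨ k = σ k + 1) {i : Fin (n + 3)} (hi : σ i = i + 1)
    (hi' : σ (i + 1) ≠ i) (j : Fin (n + 3)) : σ j = j + 1 := by
  have h1 : (1 : Fin (n + 3)) ≠ 0 := by simp
  have h2 : (1 + 1 : Fin (n + 3)) ≠ 0 := by
    intro h
    have := congrArg Fin.val h
    rw [Fin.val_add, Fin.val_one, Nat.mod_eq_of_lt (by omega)] at this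
    simp at this
  let c : ℕ → Fin (n + 3) := Fin.ofNat (n + 3)
  have hc : ∀ t, c (t + 1) = c t + 1 := fun t => by ext; simp [c, Fin.val_add]
  have key : ∀ t : ℕ, σ (i + c t) = i + c t + 1 ∧ σ (i + c t + 1) ≠ i + c t := by
    intro t
    induction t with
    | zero => simpa [show c 0 = 0 from rfl] using ⟨hi, hi'⟩
    | succ t ih =>
      obtain ⟨e1, e2⟩ := ih
      have e3 : σ (i + c t + 1) = i + c t + 1 + 1 := by
        rcases hσ (i + c t + 1) with h | h | h
        · rw [← e1] at h
          have := σ.injective h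
          rw [e1] at this
          simp at this
        · exact h
        · exact absurd (add_right_cancel h).symm e2
      rw [hc, ← add_assoc]
      refine ⟨e3, fun h => ?_⟩
      rw [← e1] at h
      have := σ.injective h
      rw [e1, add_assoc _ 1 1] at this
      have h3 : i + c t + (1 + 1) = i + c t + 0 := by rw [this, add_zero]
      exact h2 (add_left_cancel h3)
  have := (key (j - i).val).1
  rwa [show c (j - i).val = j - i from Fin.ofNat_val_eq_self _, add_sub_cancel] at this

theorem perm_involution_or_rotation {σ : Perm (Fin (n + 3))}
    (hσ : ∀ k, σ k = k ∨ σ k = k + 1 ∨ k = σ k + 1) :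
    (∀ i, σ (σ i) = i) ∨ σ = finRotate (n + 3) ∨ σ = (finRotate (n + 3))⁻¹ := by
  by_contra! h
  obtain ⟨⟨i, hi⟩, h1, h2⟩ := h
  rcases hσ i with e | e | e
  · exact hi (by rw [e, e])
  · refine h1 (Equiv.ext fun j => ?_)
    rw [finRotate_apply]
    exact perm_eq_add_one hσ e (by rwa [← e]) j
  · refine h2 ?_
    rw [← inv_inv σ]
    congr 1
    refine Equiv.ext fun j => ?_
    rw [finRotate_apply]
    refine perm_eq_add_one (i := σ i) (fun k => ?_) ?_ ?_ j
    · rcases hσ (σ⁻¹ k) with h | h | h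
      · left; simpa using h.symm
      · right; right; simpa using h
      · right; left; simpa using h
    · simpa using e
    · rw [← e]
      intro h
      exact hi (by rw [← h]; simp)

/-- A nonzero Leibniz term moves every index cyclically by at most one, so it belongs to an
involution or to one of the two rotations. A rotation of n + 3 points has sign (-1)^(n+2), and by
symmetry of `A` the two give the same product, hence the factor 2. -/
theorem det_cyclic (A : Matrix (Fin (n + 3)) (Fin (n + 3)) ℝ) (hs : ∀ i j, A i j = A j i)
    (hA : ∀ i j, A i j ≠ 0 → i = j ∨ i = j + 1 ∨ j = i + 1) :
    A.det = involutionSum A Finset.univ + 2 * (-1) ^ n * ∏ i, A i (i + 1) := by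
  set r := finRotate (n + 3) with hr
  have hrr : ¬ ∀ i, r (r i) = i := by
    intro h
    have := h 0
    simp only [hr, finRotate_apply] at this
    have := congrArg Fin.val this
    rw [zero_add, Fin.val_add, Fin.val_one, Nat.mod_eq_of_lt (by omega)] at this
    simp at this
  have hne : r ≠ r⁻¹ := by
    intro h
    refine hrr fun i => ?_
    nth_rewrite 1 [h]
    simp
  rw [Matrix.det_apply', ← Finset.sum_filter_add_sum_filter_not Finset.univ
    (fun σ : Perm (Fin (n + 3)) => ∀ i, σ (σ i) = i)]
  congr 1
  · rw [involutionSum]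
    refine Finset.sum_congr ?_ fun _ _ => rfl
    ext σ; simp [mem_involutionsOn]
  · rw [← Finset.sum_subset (s₁ := {r, r⁻¹})]
    · rw [Finset.sum_pair hne, Perm.sign_inv, hr, sign_finRotate]
      have e1 : ∏ i, A (finRotate (n + 3) i) i = ∏ i, A i (i + 1) :=
        Finset.prod_congr rfl fun i _ => by rw [finRotate_apply, hs]
      have e2 : ∏ i, A ((finRotate (n + 3))⁻¹ i) i = ∏ i, A i (i + 1) := by
        rw [← Equiv.prod_comp (finRotate (n + 3))]
        exact Finset.prod_congr rfl fun i _ => by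
          rw [Perm.coe_inv, Equiv.symm_apply_apply, finRotate_apply]
      rw [e1, e2]
      push_cast
      ring
    · intro σ hσ
      simp only [Finset.mem_insert, Finset.mem_singleton] at hσ
      rw [Finset.mem_filter]
      refine ⟨Finset.mem_univ _, ?_⟩
      rcases hσ with rfl | rfl
      · exact hrr
      · intro h
        refine hrr fun i => ?_
        have := h (r (r i))
        simpa using this.symm
    · intro σ hσ hσ'
      simp only [Finset.mem_insert, Finset.mem_singleton, not_or] at hσ'
      by_contra hz
      have hp := Finset.prod_ne_zero_iff.1 (right_ne_zero_of_mul hz)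
      rcases perm_involution_or_rotation (σ := σ) fun k => by
        have := hA _ _ (hp k (Finset.mem_univ k))
        tauto with h | h | h
      · exact (Finset.mem_filter.1 hσ).2 h
      · exact hσ'.1 h
      · exact hσ'.2 h

/-- The cycle with the vertices `0, …, n + 2`. -/
def finCycle (n : ℕ) : SimpleGraph (Fin (n + 3)) := SimpleGraph.fromRel fun i j => j = i + 1

theorem finCycle_inducedCycle (n : ℕ) :
    InducedCycle (finCycle n) (Fin.ofNat (n + 3)) (n + 3) where
  three_le := by omega
  injOn i hi j hj e := by
    have := congrArg Fin.val e
    simpa [Nat.mod_eq_of_lt hi, Nat.mod_eq_of_lt hj] using this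
  adj_iff i hi j hj hij := by
    rw [finCycle, SimpleGraph.fromRel_adj, Fin.ne_iff_vne, Fin.ext_iff, Fin.ext_iff, Fin.val_add,
      Fin.val_add, Fin.val_ofNat, Fin.val_ofNat, Nat.mod_eq_of_lt hi, Nat.mod_eq_of_lt hj,
      Fin.val_one, Nat.mod_eq_of_lt (show i + 1 < n + 3 by omega)]
    rcases Nat.lt_or_ge (j + 1) (n + 3) with h | h
    · rw [Nat.mod_eq_of_lt h]; omega
    · rw [show j + 1 = n + 3 by omega, Nat.mod_self]; omega

end Rotations

/-- The principal minor of a symmetric matrix at the vertex set of an induced cycle. -/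
theorem principalMinor_cycle {N : ℕ} {K : Matrix (Fin N) (Fin N) ℝ} (hs : ∀ i j, K i j = K j i)
    {w : ℕ → Fin N} {s : ℕ} (h3 : 3 ≤ s) (hclosed : w s = w 0)
    (hinj : ∀ i < s, ∀ j < s, w i = w j → i = j)
    (hzero : ∀ i < s, ∀ j < s, i < j → K (w i) (w j) ≠ 0 → i + 1 = j ∨ i = 0 ∧ j + 1 = s) :
    principalMinor K ((Finset.range s).image w) =
      cycleSum (fun v => K v v) (fun u v => K u v ^ 2) w s +
        2 * (-1) ^ (s + 1) * ∏ i ∈ Finset.range s, K (w i) (w (i + 1)) := by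
  classical
  obtain ⟨n, rfl⟩ := Nat.exists_eq_add_of_le' h3
  set A : Matrix (Fin (n + 3)) (Fin (n + 3)) ℝ := fun i j => K (w i) (w j) with hA
  have hval : ∀ i j : Fin (n + 3), i < j → A i j ≠ 0 → j = i + 1 ∨ i = j + 1 := by
    intro i j hij h
    rcases hzero i i.2 j j.2 hij h with e | ⟨e1, e2⟩
    · left
      rw [Fin.ext_iff, Fin.val_add, Fin.val_one, Nat.mod_eq_of_lt (by omega)]
      exact e.symm
    · right
      rw [Fin.ext_iff, Fin.val_add, Fin.val_one, e2, Nat.mod_self]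
      exact e1
  have hA' : ∀ i j, A i j ≠ 0 → i = j ∨ i = j + 1 ∨ j = i + 1 := by
    intro i j h
    rcases lt_trichotomy i j with hlt | rfl | hlt
    · have := hval i j hlt h; tauto
    · exact Or.inl rfl
    · have := hval j i hlt (by rw [hA]; simpa [hs (w j)] using h); tauto
  have hdet : principalMinor K ((Finset.range (n + 3)).image w) = A.det := by
    let e : Fin (n + 3) ≃ ((Finset.range (n + 3)).image w : Finset (Fin N)) :=
      Equiv.ofBijective (fun i => ⟨w i, Finset.mem_image_of_mem _ (Finset.mem_range.2 i.2)⟩) (by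
        constructor
        · intro i j h
          exact Fin.ext (hinj i i.2 j j.2 (congrArg Subtype.val h))
        · rintro ⟨v, hv⟩
          obtain ⟨i, hi, rfl⟩ := Finset.mem_image.1 hv
          exact ⟨⟨i, Finset.mem_range.1 hi⟩, rfl⟩)
    rw [principalMinor, ← Matrix.det_submatrix_equiv_self e]
    rfl
  have hrec := matchingRecursion_involutionSum (finCycle n) A (fun i j => hs _ _) fun i j hne h => by
    rw [finCycle, SimpleGraph.fromRel_adj]
    refine ⟨hne, ?_⟩
    have := hA' i j h
    tauto
  have huniv : (Finset.range (n + 3)).image (Fin.ofNat (n + 3)) = Finset.univ := by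
    ext i
    simp only [Finset.mem_image, Finset.mem_range, Finset.mem_univ, iff_true]
    exact ⟨i, i.2, Fin.ofNat_val_eq_self i⟩
  have hI := hrec.eq_cycleSum (fun a b => by rw [hA]; simp only; rw [hs]) (finCycle_inducedCycle n)
  rw [huniv] at hI
  have hval : ∀ i < n + 3, (Fin.ofNat (n + 3) i : ℕ) = i := fun i hi => by
    rw [Fin.val_ofNat, Nat.mod_eq_of_lt hi]
  have hcongr : cycleSum (fun v => A v v) (fun u v => A u v ^ 2) (Fin.ofNat (n + 3)) (n + 3) =
      cycleSum (fun v => K v v) (fun u v => K u v ^ 2) w (n + 3) := by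
    refine cycleSum_congr (by omega) (fun i hi => ?_) (fun i hi => ?_) ?_ <;> simp only [hA]
    · rw [hval i hi]
    · rw [hval i (by omega), hval (i + 1) hi]
    · rw [hval _ (by omega), hval 0 (by omega)]
  rw [hdet, det_cyclic A (fun i j => hs _ _) hA', hI, hcongr]
  congr 1
  -- The exponent s + 1 equals n + 4, of the same parity as the n in `det_cyclic`.
  rw [Finset.prod_range fun i => K (w i) (w (i + 1)), show n + 3 + 1 = n + 2 * 2 by ring, pow_add,
    pow_mul]
  norm_num
  refine Finset.prod_congr rfl fun i _ => ?_
  rw [hA]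
  simp only
  congr 1
  rw [Fin.val_add, Fin.val_one]
  rcases Nat.lt_or_ge ((i : ℕ) + 1) (n + 3) with h | h
  · rw [Nat.mod_eq_of_lt h]
  · have : (i : ℕ) + 1 = n + 3 := by omega
    rw [this, Nat.mod_self, hclosed]

end MomentProgram

/-! ### The whole program -/

namespace MomentProgram

open Prog SimpleGraph

theorem EdgeTables.ncard_edgeSet {H : SimpleGraph ℕ} {D I : ℕ → ℕ → ℕ} {m₂ m : ℕ}
    (h : EdgeTables H.Adj D I m₂ m) : H.edgeSet.ncard = m := by
  have hsym : ∀ i j, (fun a b => I a b) i j = (fun a b => I a b) j i := fun i j => h.idx_comm i j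
  have himg : (fun e => Sym2.lift ⟨fun a b => I a b, hsym⟩ e) '' H.edgeSet = Set.Iio m := by
    ext e
    constructor
    · rintro ⟨p, hp, rfl⟩
      induction p with
      | _ a b => exact h.idx_lt a b hp
    · intro he
      obtain ⟨i, j, ha, hi⟩ := h.idx_surj e he
      exact ⟨s(i, j), ha, hi⟩
  rw [← Set.InjOn.ncard_image (f := fun e => Sym2.lift ⟨fun a b => I a b, hsym⟩ e), himg,
    Set.ncard_eq_toFinset_card', Set.toFinset_Iio, Nat.card_Iio]
  intro p hp q hq hpq
  induction p with
  | _ a b =>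
    induction q with
    | _ a' b' => exact h.idx_inj a b a' b' hp hq hpq

theorem EdgeTables.le_sq {H : SimpleGraph ℕ} {D I : ℕ → ℕ → ℕ} {m₂ m N : ℕ}
    (h : EdgeTables H.Adj D I m₂ m) (hN : ∀ i j, H.Adj i j → i < N) : m ≤ N * N := by
  have : ∀ e : Fin m, ∃ p : Fin N × Fin N, I p.1 p.2 = e := by
    intro e
    obtain ⟨i, j, ha, hi⟩ := h.idx_surj e e.2
    exact ⟨(⟨i, hN i j ha⟩, ⟨j, hN j i ha.symm⟩), hi⟩
  choose g hg using this
  have hinj : Function.Injective g := fun e e' he => Fin.ext (by rw [← hg e, ← hg e', he])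
  simpa using Fintype.card_le_of_injective g hinj

/-- Complements `BfsInv.cnt_le`, which bounds trees by edges: the cost per sample has to be bounded
in terms of N. -/
theorem IsSearchTree.cnt_le {H : SimpleGraph ℕ} {v cnt : ℕ} {seen ord par dn : ℕ → ℕ}
    {dr : ℕ → ℝ} (h : IsSearchTree H v cnt seen ord par dn dr) {N : ℕ} (hv : v < N)
    (hN : ∀ i j, H.Adj i j → i < N) : cnt ≤ N := by
  have hlt : ∀ i < cnt, ord i < N := by
    intro i hi
    rcases Nat.eq_zero_or_pos i with rfl | h0
    · rw [h.ord_zero]; exact hv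
    · obtain ⟨i', -, -, ha, -⟩ := h.par_ord i hi h0
      exact hN _ _ ha.symm
  have := Finset.card_le_card_of_injOn (s := Finset.range cnt) (t := Finset.range N) ord
    (fun i hi => by simpa using hlt i (by simpa using hi))
    (fun i hi j hj e => h.inj i (by simpa using hi) j (by simpa using hj) e)
  simpa using this

/-- The output table `out` results from a family of witnesses: the states `σ` and `τ` hold the edge
tables and the cycles, and `x` is the vector of the signs. -/
structure EstimateOutput (H : SimpleGraph ℕ) (N n : ℕ) (bit : ℕ → ℕ → ℕ) (σ τ : MState)
    (x : ℕ → ℕ) (out : ℕ → ℕ → ℝ) : Prop where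
  tables : EdgeTables H.Adj (σ.natArr 1) (σ.natArr 2) (σ.natVar 2) (σ.natVar 3)
  cycles : CycleBasisInv H σ (σ.natVar 3) τ
  bits : ∀ e, x e ≤ 1
  solution : ∀ f < τ.natVar 5, ∃ b : ℕ, b ≤ 1 ∧ seqWeight (rowWeight (σ.natArr 2) x)
      (τ.natArr 11 f) (τ.natArr 10 f 3) = (b : ZMod 2) ∧
    (b = 0 ↔ containCount bit n (τ.natArr 11 f) (τ.natArr 10 f 3) / n -
      cycleSum (fun i => pairCount bit n i i / n) (countB (pairCount bit n) n)
        (τ.natArr 11 f) (τ.natArr 10 f 3) ≤ 0)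
  diag : ∀ i < N, out i i = pairCount bit n i i / n
  nonadj : ∀ i j, i ≠ j → ¬ H.Adj i j → out i j = 0
  adj : ∀ i j, H.Adj i j → out i j = if x (σ.natArr 2 i j) = 1
    then √(countB (pairCount bit n) n i j) else -√(countB (pairCount bit n) n i j)

theorem countB_pairCount_comm (bit : ℕ → ℕ → ℕ) (n : ℕ) (m : ℝ) (i j : ℕ) :
    countB (pairCount bit n) m i j = countB (pairCount bit n) m j i := by
  have : pairCount bit n i j = pairCount bit n j i := by
    unfold pairCount; simp only [and_comm]
  rw [countB, countB, this]; ring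

/-- Search trees, basis and linear system are cubic in M because R ≤ M and F ≤ M. Counting cycles
costs n(RN + F), which is of order nN² because R ≤ N and F ≤ M ≤ N². Lower order terms are absorbed
since N and n are at least 1. -/
theorem estimate_cost_le {M N n R F : ℕ} (hN : 0 < N) (hn : 0 < n) (hR : R ≤ M) (hRN : R ≤ N)
    (hF : F ≤ M) (hM : M ≤ N * N) :
    (n * (N * (N * 50 + 50) + 50) + 50) + ((N * (N * 120 + 100) + 10) +
      ((R * (2 * M * (2 * M * 70 + 50) + 70) + 10) + ((M * (M * (M * 540 + 600) + 210) + 10) +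
        ((n * (R * (N * 60 + 50) + F * 50 + 40) + 10) + ((F * (4 * M * 130 + M * 40 + 150) + 10) +
          (2 * M * 60 + 10)))))) ≤ 5000 * (M ^ 3 + n * N ^ 2) := by
  have h1 : M ≤ M ^ 3 := Nat.le_self_pow (by norm_num) M
  have h2 : M * M ≤ M ^ 3 := by
    rw [pow_succ, sq]
    rcases Nat.eq_zero_or_pos M with rfl | h
    · simp
    · exact Nat.le_mul_of_pos_right _ h
  have h3 : N ≤ N * N := Nat.le_mul_of_pos_right _ hN
  have h4 : n * N ≤ n * (N * N) := Nat.mul_le_mul_left n h3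
  have h5 : n ≤ n * N := Nat.le_mul_of_pos_right _ hN
  have h6 : N * N ≤ n * (N * N) := Nat.le_mul_of_pos_left _ hn
  have h7 : R * (2 * M * (2 * M * 70 + 50) + 70) ≤ M * (2 * M * (2 * M * 70 + 50) + 70) :=
    Nat.mul_le_mul_right _ hR
  have h8 : n * (R * (N * 60 + 50) + F * 50 + 40) ≤ n * (N * (N * 60 + 50) + N * N * 50 + 40) :=
    Nat.mul_le_mul_left _ (by
      have := Nat.mul_le_mul_right (N * 60 + 50) hRN
      omega)
  have h9 : F * (4 * M * 130 + M * 40 + 150) ≤ M * (4 * M * 130 + M * 40 + 150) :=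
    Nat.mul_le_mul_right _ hF
  nlinarith [h1, h2, h3, h4, h5, h6, h7, h8, h9]

theorem estimate_spec {H : SimpleGraph ℕ} {σ : MState} {N n : ℕ} (hN0 : 0 < N) (hn0 : 0 < n)
    (hN : σ.natVar 0 = N) (hn : σ.natVar 1 = n) (hv : ∀ x ∈ [2, 3, 4, 5], σ.natVar x = 0)
    (ha : ∀ a, a ≠ 0 → ∀ i j, σ.natArr a i j = 0) (hr1 : σ.realVar 1 = 0)
    (hr : ∀ a i j, σ.realArr a i j = 0)
    (hH : ∀ i j, j < i → i < N → (H.Adj i j ↔ σ.realVar 0 * σ.realVar 0 / 2 ≤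
      countB (pairCount (σ.natArr 0) n) n i j))
    (hHN : ∀ i j, H.Adj i j → i < N) :
    Runs estimate σ (5000 * (H.edgeSet.ncard ^ 3 + n * N ^ 2)) fun ω =>
      ∃ σ' τ x, EstimateOutput H N n (σ.natArr 0) σ' τ x (ω.realArr 0) := by
  obtain ⟨t₁, σ₁, e₁, ht₁, r1, hc⟩ := countPairs_spec hN hn hr1 (hr 1)
  have f₁ := e₁.frame
  have hB : ∀ i j, i < N → j < N → countB (σ₁.realArr 1) n i j =
      countB (pairCount (σ.natArr 0) n) n i j := by
    intro i j hi hj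
    rw [countB, countB, hc i hi i hi, hc j hj j hj, hc i hi j hj]
  obtain ⟨t₂, σ₂, e₂, ht₂, hg⟩ := buildGraph_spec (H := H) (σ := σ₁) (N := N)
    (by rw [f₁.natVar 0 rfl, hN]) r1
    (by rw [f₁.natVar 2 rfl, hv 2 (by simp)]) (by rw [f₁.natVar 3 rfl, hv 3 (by simp)])
    (by rw [f₁.natVar 4 rfl, hv 4 (by simp)])
    (by rw [f₁.natArr 4 rfl]; exact ha 4 (by norm_num))
    (by rw [f₁.natArr 2 rfl]; exact ha 2 (by norm_num))
    (by rw [f₁.realArr 0 rfl]; exact hr 0)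
    (fun i j hj hi => by rw [hB i j hi (hj.trans hi), f₁.realVar 0 rfl]; exact hH i j hj hi)
  have f₂ := e₂.frame
  have hA : (fun x y => H.Adj x y ∧ Precedes N 0 x y) = H.Adj := by
    funext x y
    refine propext ⟨fun h => h.1, fun h => ⟨h, Or.inl ?_⟩⟩
    exact max_lt (hHN _ _ h) (hHN _ _ h.symm)
  have htab := hg.graph.tables
  rw [hA] at htab
  obtain ⟨t₃, σ₃, e₃, ht₃, htree, hroot⟩ := bfsAll_spec htab hg.roots_le
    (by rw [f₂.natArr 5 rfl, f₁.natArr 5 rfl]; exact ha 5 (by norm_num))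
    (by rw [f₂.natArr 8 rfl, f₁.natArr 8 rfl]; exact ha 8 (by norm_num))
    (by rw [f₂.realArr 3 rfl, f₁.realArr 3 rfl]; exact hr 3)
  have f₃ := e₃.frame
  have v2 : σ₃.natVar 2 = σ₂.natVar 2 := f₃.natVar 2 rfl
  have v3 : σ₃.natVar 3 = σ₂.natVar 3 := f₃.natVar 3 rfl
  have v4 : σ₃.natVar 4 = σ₂.natVar 4 := f₃.natVar 4 rfl
  have htab₃ : EdgeTables H.Adj (σ₃.natArr 1) (σ₃.natArr 2) (σ₃.natVar 2) (σ₃.natVar 3) := by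
    rw [f₃.natArr 1 rfl, f₃.natArr 2 rfl, v2, v3]; exact htab
  have hs : Searched H σ₃ := by
    refine ⟨htab₃, by rw [v4]; exact htree, fun i j hadj hji => ?_, by rw [v3, v4]; exact hg.roots_le⟩
    obtain ⟨q, hq, e⟩ := hg.roots.exists_root i j hadj hji (hHN _ _ hadj)
    exact ⟨q, by rwa [v4], by rw [hroot, e]⟩
  obtain ⟨t₄, σ₄, e₄, ht₄, hcyc⟩ := cycleBasis_spec hs
    (by rw [f₃.natVar 5 rfl, f₂.natVar 5 rfl, f₁.natVar 5 rfl, hv 5 (by simp)])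
    (by rw [f₃.natArr 4 rfl, v3]; exact hg.graph.identity)
  have f₄ := e₄.frame
  have hs₄ : Searched H σ₄ := hs.frame f₄ (by decide) (by decide) rfl
  have a5 : σ₄.natArr 5 = σ₃.natArr 5 := f₄.natArr 5 rfl
  have a7 : σ₄.natArr 7 = σ₃.natArr 7 := f₄.natArr 7 rfl
  have a8 : σ₄.natArr 8 = σ₃.natArr 8 := f₄.natArr 8 rfl
  have w4 : σ₄.natVar 4 = σ₃.natVar 4 := f₄.natVar 4 rfl
  have hrec : ∀ f < σ₄.natVar 5, CycleRecord H σ₄ (σ₄.natArr 10 f) (σ₄.natArr 11 f) := by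
    intro f hf
    obtain ⟨c1, c2, c3, c4, c5⟩ := hcyc.records f hf
    refine ⟨by rw [w4]; exact c1, c2, by rw [a5]; exact c3, by rw [a8]; exact c4, ?_⟩
    rw [a7, a8]; exact c5
  obtain ⟨t₅, σ₅, e₅, ht₅, hcount⟩ := countCycles_spec hs₄ (N := N) hrec (fun q hq => by
    obtain ⟨t, -⟩ := hs₄.trees q hq
    refine t.cnt_le ?_ hHN
    rw [f₄.natArr 3 rfl, hroot]
    exact hg.roots.lt q (by rwa [w4, v4] at hq)) (fun f => by
      rw [f₄.realArr 4 rfl, f₃.realArr 4 rfl, f₂.realArr 4 rfl, f₁.realArr 4 rfl]; exact hr 4 f 0)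
  have f₅ := e₅.frame
  have b4 : σ₅.natArr 4 = σ₄.natArr 4 := f₅.natArr 4 rfl
  have b10 : σ₅.natArr 10 = σ₄.natArr 10 := f₅.natArr 10 rfl
  have b11 : σ₅.natArr 11 = σ₄.natArr 11 := f₅.natArr 11 rfl
  have w5 : σ₅.natVar 5 = σ₄.natVar 5 := f₅.natVar 5 rfl
  have hcyc₅ : CycleBasisInv H σ₃ (σ₃.natVar 3) σ₅ := by
    obtain ⟨c1, c2, c3, c4, c5, c6, c7, c8, c9, c10⟩ := hcyc
    constructor <;> simp only [b4, b10, b11, w5] <;> assumption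
  have hM : H.edgeSet.ncard = σ₃.natVar 3 := htab₃.ncard_edgeSet
  -- A crude bound: each depth is below the size of the tree, which is at most 2M.
  have hlen : ∀ f < σ₅.natVar 5, σ₅.natArr 10 f 3 ≤ 4 * σ₃.natVar 3 := by
    intro f hf
    obtain ⟨c1, c2, c3, c4, c5⟩ := hcyc₅.records f hf
    obtain ⟨t, hcnt⟩ := hs.trees _ c1
    have h1 := t.dn_lt c3
    have h2 := t.dn_lt (t.closure _ _ c3 c2).1
    have h3 := htab₃.two_mul
    omega
  have x2 : σ₅.natArr 2 = σ₃.natArr 2 := by rw [f₅.natArr 2 rfl, f₄.natArr 2 rfl]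
  have x3 : σ₅.natVar 3 = σ₃.natVar 3 := by rw [f₅.natVar 3 rfl, f₄.natVar 3 rfl]
  obtain ⟨t₆, σ₆, e₆, ht₆, hbits, hsol⟩ := solveSigns_spec htab₃ hcyc₅ x2 x3 hlen
  have f₆ := e₆.frame
  have htab₆ : EdgeTables H.Adj (σ₆.natArr 1) (σ₆.natArr 2) (σ₆.natVar 2) (σ₆.natVar 3) := by
    rw [f₆.natArr 1 rfl, f₅.natArr 1 rfl, f₄.natArr 1 rfl, f₆.natArr 2 rfl, x2, f₆.natVar 2 rfl,
      f₅.natVar 2 rfl, f₄.natVar 2 rfl, f₆.natVar 3 rfl, x3]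
    exact htab₃
  obtain ⟨t₇, σ₇, e₇, ht₇, hout, hout'⟩ := writeOutput_spec htab₆
  have hd6 : σ₆.realArr 0 = σ₂.realArr 0 := by
    rw [f₆.realArr 0 rfl, f₅.realArr 0 rfl, f₄.realArr 0 rfl, f₃.realArr 0 rfl]
  have hd5 : σ₅.realArr 0 = σ₂.realArr 0 := by
    rw [f₅.realArr 0 rfl, f₄.realArr 0 rfl, f₃.realArr 0 rfl]
  have hb6 : σ₆.realArr 2 = σ₂.realArr 2 := by
    rw [f₆.realArr 2 rfl, f₅.realArr 2 rfl, f₄.realArr 2 rfl, f₃.realArr 2 rfl]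
  have hb5 : σ₅.realArr 2 = σ₂.realArr 2 := by
    rw [f₅.realArr 2 rfl, f₄.realArr 2 rfl, f₃.realArr 2 rfl]
  have hdiag : ∀ i < N, σ₂.realArr 0 i i = pairCount (σ.natArr 0) n i i / n := fun i hi => by
    rw [hg.diag i hi, hc i hi i hi]
  have hbval : ∀ i j, i ≠ j → i < N → j < N → σ₂.realArr 2 i j =
      countB (pairCount (σ.natArr 0) n) n i j := by
    intro i j hij hi hj
    rcases lt_or_gt_of_ne hij with hlt | hlt
    · rw [(hg.graph.values j i hlt (Or.inl (max_lt hj hi))).2, hB j i hj hi, countB_pairCount_comm]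
    · rw [(hg.graph.values i j hlt (Or.inl (max_lt hi hj))).1, hB i j hi hj]
  refine ⟨_, σ₇, .seq e₁ (.seq e₂ (.seq e₃ (.seq e₄ (.seq e₅ (.seq e₆ e₇))))), ?_, σ₃, σ₅,
    σ₆.natArr 4 (σ₃.natVar 3), htab₃, hcyc₅, hbits, fun f hf => ?_, fun i hi => ?_,
    fun i j hij hadj => ?_, fun i j hadj => ?_⟩
  · rw [hM]
    have hcost := estimate_cost_le (M := σ₃.natVar 3) (F := σ₅.natVar 5) hN0 hn0 hs.roots_le
      (by rw [v4]; exact hg.roots.le) hcyc₅.found_le (htab₃.le_sq hHN)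
    have k2 := htab₃.two_mul
    have k6 : σ₆.natVar 2 = 2 * σ₃.natVar 3 := by
      rw [htab₆.two_mul, f₆.natVar 3 rfl, x3]
    rw [k6] at ht₇
    rw [← v2, ← v4, k2] at ht₃
    rw [f₄.natVar 1 rfl, f₃.natVar 1 rfl, f₂.natVar 1 rfl, f₁.natVar 1 rfl, hn, w4, ← w5] at ht₅
    refine le_trans ?_ hcost
    gcongr
  · refine ⟨cycleBit σ₅ f, by unfold cycleBit; split_ifs <;> simp, hsol f hf, ?_⟩
    have hsh := hcyc₅.shortest f hf
    have hwN : ∀ i < σ₅.natArr 10 f 3, σ₅.natArr 11 f i < N := fun i hi =>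
      hHN _ _ (hsh.adj i hi)
    have h3le : 3 ≤ σ₅.natArr 10 f 3 := hsh.three_le (htab₃.rowWeight_comm _)
    have hinj := hsh.injOn (htab₃.rowWeight_comm _)
    have e1 : cycleSum (fun i => σ₅.realArr 0 i i) (σ₅.realArr 2) (σ₅.natArr 11 f)
        (σ₅.natArr 10 f 3) = cycleSum (fun i => pairCount (σ.natArr 0) n i i / n)
          (countB (pairCount (σ.natArr 0) n) n) (σ₅.natArr 11 f) (σ₅.natArr 10 f 3) := by
      refine cycleSum_congr (by omega) (fun i hi => ?_) (fun i hi => ?_) ?_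
      · rw [hd5]; exact hdiag _ (hwN i hi)
      · rw [hb5]
        exact hbval _ _ (hsh.adj i (by omega)).ne (hwN i (by omega)) (hwN _ hi)
      · rw [hb5]
        refine hbval _ _ (fun e => ?_) (hwN _ (by omega)) (hwN 0 (by omega))
        have := hinj (Set.mem_Iio.2 (by omega)) (Set.mem_Iio.2 (by omega)) e
        omega
    have e2 : σ₅.realVar 1 = n := by
      rw [f₅.realVar 1 rfl, f₄.realVar 1 rfl, f₃.realVar 1 rfl, f₂.realVar 1 rfl, r1]
    have e3 : σ₅.realArr 4 f 0 = containCount (σ.natArr 0) n (σ₅.natArr 11 f)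
        (σ₅.natArr 10 f 3) := by
      rw [hcount f (by rwa [← w5]), b10, b11, f₄.natArr 0 rfl, f₃.natArr 0 rfl, f₂.natArr 0 rfl,
        f₁.natArr 0 rfl, f₄.natVar 1 rfl, f₃.natVar 1 rfl, f₂.natVar 1 rfl, f₁.natVar 1 rfl, hn]
    rw [cycleBit, e1, e2, e3]
    split_ifs with h <;> simp [h]
  · rw [hout i i H.irrefl, hd6, hdiag i hi]
  · rw [hout i j hadj, hd6, hg.offDiag i j hij]
  · rw [hout' i j hadj, hb6, hbval i j hadj.ne (hHN _ _ hadj) (hHN _ _ hadj.symm), f₆.natArr 2 rfl,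
      x2, f₆.natVar 3 rfl, x3]

end MomentProgram

/-! ### Correctness of the program -/

namespace SimpleGraph

variable {V W : Type*} {G : SimpleGraph V} {H : SimpleGraph W}

theorem Walk.weight_map (φ : G →g H) {F : W → W → ZMod 2} {F' : V → V → ZMod 2}
    (hF : ∀ a b, G.Adj a b → F' a b = F (φ a) (φ b)) {u v : V} (p : G.Walk u v) :
    (p.map φ).weight F = p.weight F' := by
  induction p with
  | nil => simp
  | cons h p ih => rw [Walk.map_cons, Walk.weight_cons, Walk.weight_cons, ih, hF _ _ h]

theorem NoOddWalk.of_hom (φ : G →g H) {F : W → W → ZMod 2} {F' : V → V → ZMod 2}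
    (hF : ∀ a b, G.Adj a b → F' a b = F (φ a) (φ b)) (h : NoOddWalk H F) : NoOddWalk G F' :=
  fun v p => by rw [← p.weight_map φ hF, h]

/-- Every closed walk of `G` has an image of the same length and weight, so minimality pulls back;
an embedding also reflects adjacency, which makes the preimage a closed walk. -/
theorem IsShortestOdd.of_embedding (φ : G ↪g H) {F : W → W → ZMod 2} {F' : V → V → ZMod 2}
    (hF : ∀ a b, G.Adj a b → F' a b = F (φ a) (φ b)) {w : ℕ → W} {w' : ℕ → V} {s : ℕ}
    (h : IsShortestOdd H F w s) (hw : ∀ i ≤ s, φ (w' i) = w i) : IsShortestOdd G F' w' s where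
  closed := φ.injective (by rw [hw s le_rfl, hw 0 (Nat.zero_le s), h.closed])
  adj i hi := φ.map_rel_iff.1 (by rw [hw i hi.le, hw (i + 1) hi]; exact h.adj i hi)
  odd := by
    rw [← h.odd]
    refine Finset.sum_congr rfl fun i hi => ?_
    have hi := Finset.mem_range.1 hi
    rw [hF _ _ (φ.map_rel_iff.1 (by rw [hw i hi.le, hw (i + 1) hi]; exact h.adj i hi)),
      hw i hi.le, hw (i + 1) hi]
  le_length v p hp := by
    rw [← p.length_map φ.toHom]
    exact h.le_length _ _ (by rw [p.weight_map φ.toHom hF, hp])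

theorem IsShortestOdd.inducedCycle [DecidableEq V] {F : V → V → ZMod 2} (hF : ∀ a b, F a b = F b a)
    {w : ℕ → V} {s : ℕ} (h : IsShortestOdd G F w s) : MomentProgram.InducedCycle G w s where
  three_le := h.three_le hF
  injOn i hi j hj e := h.injOn hF hi hj e
  adj_iff i hi j hj hij := by
    constructor
    · intro ha
      rcases h.consecutive_of_adj hF hij hj ha with e | e
      · exact Or.inl e.symm
      · exact Or.inr e
    · rintro (rfl | ⟨rfl, rfl⟩)
      · exact h.adj i hi
      · have := h.adj j hj
        rw [h.closed] at this
        exact this.symm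

end SimpleGraph

section Estimator

variable {N n : ℕ} (α : ℝ) (Y : Fin n → Finset (Fin N))

theorem empH_inducedCycle {w : ℕ → Fin N} {s : ℕ}
    (hw : MomentProgram.InducedCycle (empGraph α Y) w s) :
    empH α Y ((Finset.range s).image w) = empMinor Y ((Finset.range s).image w) -
      MomentProgram.cycleSum (fun v => empMinor Y {v}) (empB Y) w s := by
  have := MomentProgram.matchingSum_inducedCycle (fun v => empMinor Y {v}) (empBSym Y) hw
  have hB : (fun u v => empBSym Y s(u, v)) = empB Y := rfl
  have hH : ∀ S, empH α Y S = empMinor Y S -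
      MomentProgram.matchingSum (empGraph α Y) (fun v => empMinor Y {v}) (empBSym Y) S :=
    fun S => by
      rw [empH, MomentProgram.matchingSum]
      congr!
  rw [hH, this, hB]

theorem empGraph_adj (i j : Fin N) :
    (empGraph α Y).Adj i j ↔ i ≠ j ∧ α ^ 2 / 2 ≤ empB Y i j := by
  rw [empGraph, SimpleGraph.fromRel_adj, empB_comm Y j i, or_self]

end Estimator

namespace MomentProgram

open SimpleGraph

variable {N n : ℕ} (α : ℝ) (Y : Fin n → Finset (Fin N))

theorem inputState_bit (p i : ℕ) : (inputState α Y).natArr 0 p i = 1 ↔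
    ∃ (hp : p < n) (hi : i < N), (⟨i, hi⟩ : Fin N) ∈ Y ⟨p, hp⟩ := by
  simp [inputState]

theorem sum_range_ite_eq_card (P : ℕ → Prop) [DecidablePred P] (Q : Fin n → Prop) [DecidablePred Q]
    (h : ∀ p : Fin n, P p ↔ Q p) :
    (∑ p ∈ Finset.range n, if P p then (1 : ℝ) else 0) = (Finset.univ.filter Q).card := by
  rw [Finset.sum_range, Finset.sum_boole]
  simp only [h]

theorem pairCount_inputState (i j : Fin N) :
    pairCount ((inputState α Y).natArr 0) n i j / n = empMinor Y {i, j} := by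
  rw [empMinor, pairCount, sum_range_ite_eq_card _ (fun p => {i, j} ⊆ Y p)]
  · ring
  · intro p
    rw [inputState_bit, inputState_bit]
    simp [Finset.insert_subset_iff]

theorem pairCount_inputState_self (i : Fin N) :
    pairCount ((inputState α Y).natArr 0) n i i / n = empMinor Y {i} := by
  rw [pairCount_inputState, Finset.pair_eq_singleton]

theorem countB_inputState (i j : Fin N) :
    countB (pairCount ((inputState α Y).natArr 0) n) n i j = empB Y i j := by
  rw [countB, pairCount_inputState_self, pairCount_inputState_self, pairCount_inputState, empB]

theorem containCount_inputState (w : ℕ → Fin N) (w' : ℕ → ℕ) (s : ℕ) (hw : ∀ i < s, (w i : ℕ) = w' i) :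
    containCount ((inputState α Y).natArr 0) n w' s / n =
      empMinor Y ((Finset.range s).image w) := by
  classical
  rw [empMinor, containCount, sum_range_ite_eq_card _ (fun p => (Finset.range s).image w ⊆ Y p)]
  · ring
  · intro p
    simp only [inputState_bit, Finset.image_subset_iff, Finset.mem_range]
    refine forall₂_congr fun i hi => ?_
    rw [← hw i hi]
    simp

/-- The graph of the estimator on the natural numbers. -/
def natGraph : SimpleGraph ℕ := (empGraph α Y).map Fin.valEmbedding

theorem natGraph_adj_val (i j : Fin N) : (natGraph α Y).Adj i j ↔ (empGraph α Y).Adj i j :=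
  SimpleGraph.map_adj_apply (G := empGraph α Y) (f := Fin.valEmbedding)

theorem natGraph_lt {i j : ℕ} (h : (natGraph α Y).Adj i j) : i < N := by
  obtain ⟨a, b, -, rfl, -⟩ := (SimpleGraph.map_adj _ _ _ _).1 h
  exact a.2

theorem ncard_edgeSet_natGraph :
    (natGraph α Y).edgeSet.ncard = (empGraph α Y).edgeSet.ncard := by
  rw [natGraph, SimpleGraph.edgeSet_map, Set.ncard_image_of_injective _ (Function.Embedding.injective _)]

variable {α Y} {σ τ : MState} {x : ℕ → ℕ} {out : ℕ → ℕ → ℝ}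

/-- The machine names vertices by natural numbers, and everything is pulled back along the embedding
of the vertex set. The triangular solution satisfies the linear system, so the all-ones alternative
never occurs, and a vanishing Ĥ has been given the bit 0. -/
theorem EstimateOutput.isMomentEstimate (hN : 0 < N)
    (h : EstimateOutput (natGraph α Y) N n ((inputState α Y).natArr 0) σ τ x out) :
    IsMomentEstimate α Y (Matrix.of fun i j => out i j) := by
  classical
  set G := empGraph α Y with hG
  set I := σ.natArr 2 with hI
  set M := σ.natVar 3 with hM
  let φ : G ↪g natGraph α Y := SimpleGraph.Embedding.map Fin.valEmbedding G
  have hφ : ∀ i, φ i = (i : ℕ) := fun i => rfl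
  have ht := h.tables
  have hc := h.cycles
  let idx : G.edgeSet → ℕ := fun e => Sym2.lift ⟨fun a b : Fin N => I a b, fun a b => ht.idx_comm a b⟩ e.1
  have hidx : ∀ a b (hab : G.Adj a b), idx ⟨s(a, b), hab⟩ = I a b := fun a b hab => rfl
  have hidx_lt : ∀ e, idx e < M := by
    rintro ⟨e, he⟩
    induction e with
    | _ a b => exact ht.idx_lt a b ((natGraph_adj_val α Y a b).2 he)
  have hidx_inj : Function.Injective idx := by
    rintro ⟨e, he⟩ ⟨e', he'⟩ hee
    induction e with
    | _ a b =>
      induction e' with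
      | _ a' b' =>
        have := ht.idx_inj a b a' b' ((natGraph_adj_val α Y a b).2 he)
          ((natGraph_adj_val α Y a' b').2 he') hee
        refine Subtype.ext ?_
        simpa [Fin.ext_iff] using this
  let vec : (ℕ → ℕ) → G.edgeSet → ZMod 2 := fun row e => (row (idx e) : ZMod 2)
  have hvec : ∀ row a b, G.Adj a b → edgeFun (vec row) a b = rowWeight I row (φ a) (φ b) := by
    intro row a b hab
    rw [edgeFun_of_adj _ hab]; rfl
  -- The default vertex is never met at the positions up to the length of the cycle.
  let w : ℕ → ℕ → Fin N := fun f i => if hi : τ.natArr 11 f i < N then ⟨_, hi⟩ else ⟨0, hN⟩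
  let s : ℕ → ℕ := fun f => τ.natArr 10 f 3
  let K : ℕ → ℕ := fun f => τ.natArr 10 f 4
  have hsh := hc.shortest
  have hw : ∀ f < τ.natVar 5, ∀ i ≤ s f, (w f i : ℕ) = τ.natArr 11 f i := by
    intro f hf i hi
    have hlt : τ.natArr 11 f i < N := by
      rcases hi.lt_or_eq with hlt | rfl
      · exact natGraph_lt α Y ((hsh f hf).adj i hlt)
      · rw [(hsh f hf).closed]
        have := (hsh f hf).three_le (ht.rowWeight_comm _)
        exact natGraph_lt α Y ((hsh f hf).adj 0 (by omega))
    simp [w, hlt]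
  have hshG : ∀ f < τ.natVar 5, IsShortestOdd G (edgeFun (vec (τ.natArr 4 (K f)))) (w f) (s f) :=
    fun f hf => (hsh f hf).of_embedding φ (hvec _) (hw f hf)
  have hseq : ∀ f < τ.natVar 5, ∀ row, seqWeight (edgeFun (vec row)) (w f) (s f) =
      seqWeight (rowWeight I row) (τ.natArr 11 f) (s f) := by
    intro f hf row
    refine Finset.sum_congr rfl fun i hi => ?_
    have hi := Finset.mem_range.1 hi
    rw [hvec _ _ _ ((hshG f hf).adj i hi), hφ, hφ, hw f hf i hi.le, hw f hf (i + 1) hi]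
  let ν := τ.natVar 5
  let C : Fin ν → G.Subgraph := fun f => (⊤ : G.Subgraph).induce (w f '' Set.Iio (s f))
  have hbasis : IsShortestMaximalCycleBasis C := by
    refine isShortestMaximalCycleBasis_of_witnesses (fun f : Fin ν => vec (τ.natArr 4 (K f)))
      (fun f => w f) (fun f => s f) (fun f => hshG f f.2) (fun f g hfg => ?_)
      {t | ∃ l < M, t = vec (τ.natArr 4 l) ∧ NoOddWalk (natGraph α Y) (rowWeight I (τ.natArr 4 l))}
      ?_ ?_
    · rw [hseq f f.2]
      exact hc.orth f f.2 _ (hc.witness_mono f g hfg g.2) (hc.witness_lt g g.2)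
    · rintro _ ⟨l, -, rfl, hno⟩
      exact hno.of_hom φ.toHom (hvec _)
    · intro z hz hz'
      have hpair : ∀ l < M, edgePairing z (vec (τ.natArr 4 l)) = 0 := by
        intro l hl
        rcases hc.rest l hl with ⟨f, hf, rfl⟩ | hno
        · exact hz ⟨f, hf⟩
        · exact hz' _ ⟨l, hl, rfl, hno⟩
      -- An edge vector is transported to edge indices, where the separation property `span` of the
      -- witnesses is formulated. Each witness either belongs to a recorded cycle or has no odd
      -- closed walk, so all of them are covered.
      let z' : ℕ → ZMod 2 := fun k => ∑ e, if idx e = k then z e else 0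
      have hz0 : ∀ k < M, z' k = 0 := by
        refine hc.span z' fun l hl => ?_
        rw [← hpair l hl, edgePairing]
        simp only [z', Finset.mul_sum]
        rw [Finset.sum_comm]
        refine Finset.sum_congr rfl fun e _ => ?_
        rw [Finset.sum_eq_single (idx e)]
        · rw [if_pos rfl, mul_comm]
        · intro k _ hk; rw [if_neg hk.symm, mul_zero]
        · intro hk; exact absurd (Finset.mem_range.2 (hidx_lt e)) hk
      funext e
      have := hz0 (idx e) (hidx_lt e)
      simp only [z'] at this
      rw [Finset.sum_eq_single e] at this
      · simpa using this
      · intro e' _ hne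
        rw [if_neg fun h => hne (hidx_inj h)]
      · intro hk; exact absurd (Finset.mem_univ e) hk
  choose b hb1 hb2 hb3 using h.solution
  have hmul : ∀ f : Fin ν, edgePairing (incidenceVec (C f)) (vec x) = (b f f.2 : ZMod 2) := by
    intro f
    rw [((hshG f f.2).tracesCycle (edgeFun_comm _)).edgePairing_eq, hseq f f.2]
    exact hb2 f f.2
  have hempH : ∀ f : Fin ν, empH α Y ((C f).verts.toFinset) =
      containCount ((inputState α Y).natArr 0) n (τ.natArr 11 f) (τ.natArr 10 f 3) / n -
      cycleSum (fun i => pairCount ((inputState α Y).natArr 0) n i i / n)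
        (countB (pairCount ((inputState α Y).natArr 0) n) n) (τ.natArr 11 f) (τ.natArr 10 f 3) := by
    intro f
    have e : (C f).verts.toFinset = (Finset.range (s f)).image (w f) := by
      ext v
      simp [C]
    have h3 := (hshG f f.2).three_le (edgeFun_comm _)
    rw [e, empH_inducedCycle _ _ ((hshG f f.2).inducedCycle (edgeFun_comm _)),
      containCount_inputState α Y (w f) _ _ fun i hi => hw f f.2 i hi.le]
    congr 1
    refine cycleSum_congr (by omega) (fun i hi => ?_) (fun i hi => ?_) ?_
    · rw [← hw f f.2 i hi.le, pairCount_inputState_self]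
    · rw [← hw f f.2 i (by omega), ← hw f f.2 (i + 1) hi.le, countB_inputState]
    · rw [← hw f f.2 _ (Nat.sub_le _ _), ← hw f f.2 0 (Nat.zero_le _), countB_inputState]
  refine ⟨ν, C, fun f => (b f f.2 : ZMod 2), vec x, hbasis, fun f => ?_, Or.inl ?_, fun i => ?_,
    fun i j hij hadj => ?_, fun i j hadj => ?_⟩
  · rw [hempH]
    have h01 := hb1 f f.2
    have hiff := hb3 f f.2
    refine ⟨fun hp => ?_, fun hp => ?_⟩
    · have : b f f.2 = 1 := by
        have : b f f.2 ≠ 0 := fun h => absurd (hiff.1 h) (not_le.2 hp)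
        omega
      simp only [this, Nat.cast_one]
    · simp only [hiff.2 hp.le, Nat.cast_zero]
  · funext f; exact hmul f
  · rw [Matrix.of_apply, h.diag i i.2, pairCount_inputState_self]
  · rw [Matrix.of_apply, h.nonadj i j (fun e => hij (Fin.ext e)) fun ha =>
      hadj ((natGraph_adj_val α Y i j).1 ha)]
  · rw [Matrix.of_apply, h.adj i j ((natGraph_adj_val α Y i j).2 hadj), countB_inputState]
    change (if x (I i j) = 1 then _ else _) = (2 * (((x (I i j) : ZMod 2)).val : ℝ) - 1) * _
    have h01 := h.bits (I i j)
    have : x (I i j) = 0 ∨ x (I i j) = 1 := by omega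
    rcases this with e | e <;> rw [e]
    · simp
    · simp [ZMod.val_one]; ring

theorem computesEstimateWithin (α : ℝ) (Y : Fin n → Finset (Fin N)) (hN : 0 < N) (hn : 0 < n) :
    ComputesEstimateWithin estimate α Y
      (5000 * ((empGraph α Y).edgeSet.ncard ^ 3 + n * N ^ 2)) := by
  have := estimate_spec (H := natGraph α Y) (σ := inputState α Y) (N := N) (n := n) hN hn rfl rfl
    (by simp [inputState]) (fun a ha i j => by simp [inputState, ha]) (by simp [inputState])
    (fun a i j => rfl) (fun i j hji hi => ?_) (fun i j h => natGraph_lt α Y h)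
  · obtain ⟨t, ω, he, ht, σ', τ, x, hout⟩ := this
    rw [ncard_edgeSet_natGraph] at ht
    exact ⟨t, ω, he, ht, hout.isMomentEstimate hN⟩
  · have hj : j < N := hji.trans hi
    have e1 := natGraph_adj_val α Y ⟨i, hi⟩ ⟨j, hj⟩
    have e2 := countB_inputState α Y ⟨i, hi⟩ ⟨j, hj⟩
    simp only at e1 e2
    rw [e1, e2, empGraph_adj]
    simp only [inputState, if_true, ne_eq, Fin.mk.injEq, hji.ne', not_false_eq_true, true_and, sq]

end MomentProgram

/-! ### Perturbation of matching sums -/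

namespace MomentProgram

section Perturbation

variable {V : Type*} {K K' : V → ℝ} {B B' : V → V → ℝ} {w : ℕ → V}

theorem abs_mul_sub_mul_le {a b a' b' x y : ℝ} (hx : |a - a'| ≤ x) (hy : |b - b'| ≤ y) {A B : ℝ}
    (ha : |a| ≤ A) (hb : |b'| ≤ B) : |a * b - a' * b'| ≤ A * y + x * B := by
  have e : a * b - a' * b' = a * (b - b') + (a - a') * b' := by ring
  rw [e]
  refine (abs_add_le _ _).trans ?_
  rw [abs_mul, abs_mul]
  exact add_le_add (mul_le_mul ha hy (abs_nonneg _) ((abs_nonneg _).trans ha))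
    (mul_le_mul hx hb (abs_nonneg _) ((abs_nonneg _).trans hx))

theorem abs_pathSum_le {k : ℕ} (hK : ∀ i < k, |K (w i)| ≤ 1)
    (hB : ∀ i, i + 1 < k → |B (w i) (w (i + 1))| ≤ 1) : |pathSum K B w k| ≤ 2 ^ k := by
  induction k using Nat.twoStepInduction with
  | zero => simp [pathSum]
  | one => exact (hK 0 one_pos).trans (by norm_num)
  | more k h1 h2 =>
    have h1 := h1 (fun i hi => hK i (by omega)) fun i hi => hB i (by omega)
    have h2 := h2 (fun i hi => hK i (by omega)) fun i hi => hB i (by omega)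
    rw [pathSum]
    calc |K (w (k + 1)) * pathSum K B w (k + 1) - B (w k) (w (k + 1)) * pathSum K B w k|
        ≤ |K (w (k + 1))| * |pathSum K B w (k + 1)| +
          |B (w k) (w (k + 1))| * |pathSum K B w k| := by
          rw [← abs_mul, ← abs_mul]; exact abs_sub _ _
      _ ≤ 1 * 2 ^ (k + 1) + 1 * 2 ^ k := by
          gcongr
          · exact hK _ (by omega)
          · exact hB _ (by omega)
      _ ≤ 2 ^ (k + 2) := by
          have : (0 : ℝ) ≤ 2 ^ k := by positivity
          rw [pow_succ, pow_add]; linarith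

/-- The bound 3t is the accuracy of `B̂` when minors have accuracy t. With path sums bounded by 2^k,
the error at k + 2 is at most the sum of the two previous errors plus (2^(k+1) + 3·2^k)t, and 4^k -
1 dominates this recursion. -/
theorem abs_pathSum_sub_le {k : ℕ} {t : ℝ} (ht : 0 ≤ t) (hK : ∀ i < k, |K (w i)| ≤ 1)
    (hK' : ∀ i < k, |K' (w i)| ≤ 1) (hB : ∀ i, i + 1 < k → |B (w i) (w (i + 1))| ≤ 1)
    (hB' : ∀ i, i + 1 < k → |B' (w i) (w (i + 1))| ≤ 1)
    (hKK : ∀ i < k, |K (w i) - K' (w i)| ≤ t)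
    (hBB : ∀ i, i + 1 < k → |B (w i) (w (i + 1)) - B' (w i) (w (i + 1))| ≤ 3 * t) :
    |pathSum K B w k - pathSum K' B' w k| ≤ (4 ^ k - 1) * t := by
  induction k using Nat.twoStepInduction with
  | zero => simp [pathSum]
  | one => exact (hKK 0 one_pos).trans (by linarith)
  | more k h1 h2 =>
    have h1 := h1 (fun i hi => hK i (by omega)) (fun i hi => hK' i (by omega))
      (fun i hi => hB i (by omega)) (fun i hi => hB' i (by omega)) (fun i hi => hKK i (by omega))
      fun i hi => hBB i (by omega)
    have h2 := h2 (fun i hi => hK i (by omega)) (fun i hi => hK' i (by omega))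
      (fun i hi => hB i (by omega)) (fun i hi => hB' i (by omega)) (fun i hi => hKK i (by omega))
      fun i hi => hBB i (by omega)
    have b1 := abs_pathSum_le (K := K') (B := B') (w := w) (k := k + 1)
      (fun i hi => hK' i (by omega)) fun i hi => hB' i (by omega)
    have b2 := abs_pathSum_le (K := K') (B := B') (w := w) (k := k)
      (fun i hi => hK' i (by omega)) fun i hi => hB' i (by omega)
    have m1 := abs_mul_sub_mul_le (hKK (k + 1) (by omega)) h2 (hK (k + 1) (by omega)) b1
    have m2 := abs_mul_sub_mul_le (hBB k (by omega)) h1 (hB k (by omega)) b2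
    have e : pathSum K B w (k + 2) - pathSum K' B' w (k + 2) =
        (K (w (k + 1)) * pathSum K B w (k + 1) - K' (w (k + 1)) * pathSum K' B' w (k + 1)) -
        (B (w k) (w (k + 1)) * pathSum K B w k - B' (w k) (w (k + 1)) * pathSum K' B' w k) := by
      rw [pathSum, pathSum]; ring
    rw [e]
    refine (abs_sub _ _).trans ((add_le_add m1 m2).trans ?_)
    have h24 : (2 : ℝ) ^ k ≤ 4 ^ k := by gcongr; norm_num
    have h4 : (1 : ℝ) ≤ 4 ^ k := one_le_pow₀ (by norm_num)
    have : (1 * ((4 ^ (k + 1) - 1) * t) + t * 2 ^ (k + 1) + (1 * ((4 ^ k - 1) * t) +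
        3 * t * 2 ^ k)) = (5 * 4 ^ k - 2 + 5 * 2 ^ k) * t := by ring
    rw [this]
    refine mul_le_mul_of_nonneg_right ?_ ht
    rw [pow_add]
    linarith

/-- The summand -1 in the constant is kept so that the error t of the minor itself can be added in
`abs_empH_sub_le` with total 2·4^s·t. -/
theorem abs_cycleSum_sub_le {s : ℕ} (hs : 2 ≤ s) {t : ℝ} (ht : 0 ≤ t)
    (hK : ∀ i < s, |K (w i)| ≤ 1)
    (hK' : ∀ i < s, |K' (w i)| ≤ 1) (hB : ∀ i < s, ∀ j < s, i ≠ j → |B (w i) (w j)| ≤ 1)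
    (hB' : ∀ i < s, ∀ j < s, i ≠ j → |B' (w i) (w j)| ≤ 1)
    (hKK : ∀ i < s, |K (w i) - K' (w i)| ≤ t)
    (hBB : ∀ i < s, ∀ j < s, i ≠ j → |B (w i) (w j) - B' (w i) (w j)| ≤ 3 * t) :
    |cycleSum K B w s - cycleSum K' B' w s| ≤ (2 * 4 ^ s - 1) * t := by
  have m1 := abs_pathSum_sub_le (w := w) ht hK hK' (fun i hi => hB i (by omega) _ hi (by omega))
    (fun i hi => hB' i (by omega) _ hi (by omega)) hKK
    (fun i hi => hBB i (by omega) _ hi (by omega))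
  have m2 := abs_pathSum_sub_le (w := fun i => w (i + 1)) (K := K) (K' := K') (B := B) (B' := B')
    (k := s - 2) ht (fun i hi => hK _ (by omega)) (fun i hi => hK' _ (by omega))
    (fun i hi => hB _ (by omega) _ (by omega) (by omega))
    (fun i hi => hB' _ (by omega) _ (by omega) (by omega)) (fun i hi => hKK _ (by omega))
    (fun i hi => hBB _ (by omega) _ (by omega) (by omega))
  have b2 := abs_pathSum_le (w := fun i => w (i + 1)) (K := K') (B := B') (k := s - 2)
    (fun i hi => hK' _ (by omega)) (fun i hi => hB' _ (by omega) _ (by omega) (by omega))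
  have m3 := abs_mul_sub_mul_le (hBB (s - 1) (by omega) 0 (by omega) (by omega)) m2
    (hB (s - 1) (by omega) 0 (by omega) (by omega)) b2
  have e : cycleSum K B w s - cycleSum K' B' w s = (pathSum K B w s - pathSum K' B' w s) -
      (B (w (s - 1)) (w 0) * pathSum K B (fun i => w (i + 1)) (s - 2) -
        B' (w (s - 1)) (w 0) * pathSum K' B' (fun i => w (i + 1)) (s - 2)) := by
    rw [cycleSum, cycleSum]; ring
  rw [e]
  refine (abs_sub _ _).trans ((add_le_add m1 m3).trans ?_)
  obtain ⟨k, rfl⟩ := Nat.exists_eq_add_of_le' hs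
  rw [Nat.add_sub_cancel]
  have h24 : (2 : ℝ) ^ k ≤ 4 ^ k := by gcongr; norm_num
  have : (4 ^ (k + 2) - 1) * t + (1 * ((4 ^ k - 1) * t) + 3 * t * 2 ^ k) =
      (17 * 4 ^ k - 2 + 3 * 2 ^ k) * t := by ring
  rw [this]
  refine mul_le_mul_of_nonneg_right ?_ ht
  rw [pow_add]
  have : (1 : ℝ) ≤ 4 ^ k := one_le_pow₀ (by norm_num)
  linarith

end Perturbation

end MomentProgram

/-! ### Existence of bases of induced cycles -/

namespace SimpleGraph

variable {V : Type*} [Fintype V] (G : SimpleGraph V)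

open scoped Classical in
/-- Every functional on the edge space is a pairing. -/
theorem exists_edgePairing_eq (f : Module.Dual (ZMod 2) (G.edgeSet → ZMod 2)) :
    ∃ x : G.edgeSet → ZMod 2, ∀ c, f c = edgePairing c x := by
  refine ⟨fun e => f (Pi.single e 1), fun c => ?_⟩
  conv_lhs => rw [pi_eq_sum_univ' c]
  rw [map_sum, edgePairing]
  refine Finset.sum_congr rfl fun e _ => ?_
  rw [map_smul, smul_eq_mul]

/-- The incidence vectors of the induced simple cycles span the cycle space. -/
theorem span_inducedCycles : Submodule.span (ZMod 2)
    {x | ∃ C : G.Subgraph, IsSimpleCycle C ∧ C.IsInduced ∧ x = incidenceVec C} = cycleSpace G := by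
  classical
  refine le_antisymm (Submodule.span_le.2 ?_) fun c hc => ?_
  · rintro _ ⟨C, hC, -, rfl⟩
    exact hC.incidenceVec_mem
  · by_contra hcon
    -- A functional that kills the induced cycles but not `c` is a pairing with some `x`. If a
    -- closed walk were odd for `x`, a shortest one would be an induced cycle that is not killed;
    -- otherwise `x` annihilates the cycle space and so `c`.
    obtain ⟨f, hf, hmap⟩ := Submodule.exists_dual_map_eq_bot_of_notMem hcon inferInstance
    obtain ⟨x, hx⟩ := exists_edgePairing_eq G f
    refine hf ?_
    rw [hx]
    refine NoOddWalk.edgePairing_eq_zero ?_ hc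
    by_contra hn
    obtain ⟨w, s, hw⟩ := exists_isShortestOdd hn
    have h1 := hw.edgePairing_eq_one
    have hmem : f (incidenceVec ((⊤ : G.Subgraph).induce (w '' Set.Iio s))) ∈ Submodule.map f
        (Submodule.span (ZMod 2)
          {x | ∃ C : G.Subgraph, IsSimpleCycle C ∧ C.IsInduced ∧ x = incidenceVec C}) :=
      Submodule.mem_map_of_mem (Submodule.subset_span
        ⟨_, (hw.tracesCycle (edgeFun_comm x)).isSimpleCycle, induce_top_isInduced _, rfl⟩)
    rw [hmap, Submodule.mem_bot, hx, h1] at hmem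
    exact one_ne_zero hmem

/-- A basis is selected from the spanning set of induced cycles; thus the set of lengths that
defines `cycleSparsity` is not empty. -/
theorem exists_isInducedCycleBasis :
    ∃ (l ν : ℕ) (C : Fin ν → G.Subgraph), IsInducedCycleBasis C l := by
  classical
  obtain ⟨b, hb, hspan, hli⟩ := exists_linearIndependent (ZMod 2)
    {x | ∃ C : G.Subgraph, IsSimpleCycle C ∧ C.IsInduced ∧ x = incidenceVec C}
  have : Finite b := hli.finite
  let e := Finite.equivFin b
  have hb' : ∀ x : b, ∃ C : G.Subgraph, IsSimpleCycle C ∧ C.IsInduced ∧ x.1 = incidenceVec C :=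
    fun x => hb x.2
  choose C hC1 hC2 hC3 using hb'
  have hC3' : (fun i => incidenceVec (C (e.symm i))) = fun i => ((e.symm i : b) : G.edgeSet → ZMod 2) :=
    funext fun i => (hC3 _).symm
  refine ⟨Finset.univ.sup fun i => (C (e.symm i)).verts.ncard, Nat.card b, fun i => C (e.symm i),
    ⟨fun i => hC1 _, ?_, ?_⟩, fun i => ⟨hC2 _, Finset.le_sup
      (f := fun i => (C (e.symm i)).verts.ncard) (Finset.mem_univ i)⟩⟩
  · rw [hC3']
    exact hli.comp _ e.symm.injective
  · rw [hC3', ← span_inducedCycles, ← hspan]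
    congr 1
    ext x
    constructor
    · rintro ⟨i, rfl⟩; exact (e.symm i).2
    · intro hx; exact ⟨e ⟨x, hx⟩, congrArg Subtype.val (e.symm_apply_apply ⟨x, hx⟩)⟩

/-- Ensures that singletons and pairs are among the sets whose minors are controlled, as the
estimates of the diagonal and of `B̂` require. -/
theorem two_le_cycleSparsity : 2 ≤ cycleSparsity G := by
  classical
  rw [cycleSparsity]
  split_ifs with h
  · exact le_rfl
  · obtain ⟨l, hl⟩ := exists_isInducedCycleBasis G
    obtain ⟨ν, C, hC⟩ := Nat.sInf_mem (s := {l : ℕ | ∃ (ν : ℕ) (C : Fin ν → G.Subgraph),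
      IsInducedCycleBasis C l}) ⟨l, hl⟩
    have hν : 0 < ν := by
      by_contra h0
      have : ν = 0 := by omega
      subst this
      refine h ?_
      rw [← hC.1.2.2]
      simp
    obtain ⟨w, s, hw⟩ := exists_tracesCycle (hC.1.1 ⟨0, hν⟩)
    have h1 := (hC.2 ⟨0, hν⟩).2
    have h2 := hw.three_le
    rw [hw.ncard_verts] at h1
    omega

end SimpleGraph

namespace SimpleGraph

theorem TracesCycle.inducedCycle {V : Type*} {G : SimpleGraph V} {C : G.Subgraph} {w : ℕ → V} {s : ℕ}
    (h : TracesCycle C w s) (hC : C.IsInduced) : MomentProgram.InducedCycle G w s where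
  three_le := h.three_le
  injOn i hi j hj e := h.injOn hi hj e
  adj_iff i hi j hj hij := by
    have hv : ∀ i < s, w i ∈ C.verts := fun i hi => h.verts ▸ ⟨i, hi, rfl⟩
    have : G.Adj (w i) (w j) ↔ C.Adj (w i) (w j) :=
      ⟨fun ha => hC (hv i hi) (hv j hj) ha, fun ha => ha.adj_sub⟩
    rw [this, h.adj_iff]
    constructor
    · rintro ⟨k, hk, e⟩
      have hk1 : ∃ k' < s, w (k + 1) = w k' ∧ (k' = k + 1 ∨ (k + 1 = s ∧ k' = 0)) := by
        rcases Nat.lt_or_ge (k + 1) s with h1 | h1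
        · exact ⟨k + 1, h1, rfl, Or.inl rfl⟩
        · have : k + 1 = s := by omega
          exact ⟨0, by omega, by rw [this, h.closed], Or.inr ⟨this, rfl⟩⟩
      obtain ⟨k', hk', e', hkk⟩ := hk1
      rw [e'] at e
      rcases Sym2.eq_iff.1 e with ⟨e1, e2⟩ | ⟨e1, e2⟩
      · have := h.injOn hi hk e1
        have := h.injOn hj hk' e2
        omega
      · have := h.injOn hi hk' e1
        have := h.injOn hj hk e2
        omega
    · rintro (rfl | ⟨rfl, rfl⟩)
      · exact ⟨i, hi, rfl⟩
      · exact ⟨j, hj, by rw [h.closed, Sym2.eq_swap]⟩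

end SimpleGraph

/-! ### Recovery from accurate minors -/

open MomentProgram SimpleGraph

section Minors

variable {N : ℕ} {K : Matrix (Fin N) (Fin N) ℝ}

theorem principalMinor_singleton (i : Fin N) : principalMinor K {i} = K i i := by
  rw [principalMinor]
  have : Unique ({i} : Finset (Fin N)) :=
    ⟨⟨⟨i, Finset.mem_singleton_self i⟩⟩, fun j => Subtype.ext (Finset.mem_singleton.1 j.2)⟩
  rw [Matrix.det_unique, Matrix.submatrix_apply, Finset.mem_singleton.1 (Subtype.prop default)]

theorem principalMinor_pair {i j : Fin N} (hij : i ≠ j) :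
    principalMinor K {i, j} = K i i * K j j - K i j * K j i := by
  let e : Fin 2 → ({i, j} : Finset (Fin N)) := ![⟨i, by simp⟩, ⟨j, by simp⟩]
  have he : Function.Bijective e := by
    constructor
    · intro a b h
      fin_cases a <;> fin_cases b <;> simp_all [e, hij.symm]
    · rintro ⟨v, hv⟩
      rcases Finset.mem_insert.1 hv with rfl | h
      · exact ⟨0, rfl⟩
      · exact ⟨1, Subtype.ext (Finset.mem_singleton.1 h).symm⟩
  rw [principalMinor, ← Matrix.det_submatrix_equiv_self (Equiv.ofBijective e he), Matrix.det_fin_two]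
  rfl

end Minors

section Empirical

variable {N n : ℕ} (Y : Fin n → Finset (Fin N))

theorem empMinor_nonneg (S : Finset (Fin N)) : 0 ≤ empMinor Y S := by
  unfold empMinor; positivity

theorem empMinor_le_one (S : Finset (Fin N)) : empMinor Y S ≤ 1 := by
  rw [empMinor, one_div, inv_mul_eq_div]
  refine div_le_one_of_le₀ ?_ (Nat.cast_nonneg n)
  exact_mod_cast (Finset.card_filter_le _ _).trans (by simp)

theorem abs_empMinor_le_one (S : Finset (Fin N)) : |empMinor Y S| ≤ 1 := by
  rw [abs_of_nonneg (empMinor_nonneg Y S)]; exact empMinor_le_one Y S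

theorem abs_empB_le_one (i j : Fin N) : |empB Y i j| ≤ 1 := by
  have h1 := empMinor_nonneg Y {i}
  have h2 := empMinor_le_one Y {i}
  have h3 := empMinor_nonneg Y {j}
  have h4 := empMinor_le_one Y {j}
  have h5 := empMinor_nonneg Y {i, j}
  have h6 := empMinor_le_one Y {i, j}
  rw [empB, abs_le]
  constructor
  · nlinarith [mul_nonneg h1 h3]
  · nlinarith [mul_le_one₀ h2 h3 h4]

end Empirical

/-- The sign of a product is determined by the parity of the number of positive factors. -/
theorem prod_neg_sign (a : ℕ → ℝ) (s : ℕ) (ha : ∀ i < s, a i ≠ 0) :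
    ((∑ i ∈ Finset.range s, if 0 < a i then (1 : ZMod 2) else 0) = 0 →
      0 < ∏ i ∈ Finset.range s, -a i) ∧
    ((∑ i ∈ Finset.range s, if 0 < a i then (1 : ZMod 2) else 0) = 1 →
      ∏ i ∈ Finset.range s, -a i < 0) := by
  induction s with
  | zero => simp
  | succ s ih =>
    obtain ⟨ih0, ih1⟩ := ih fun i hi => ha i (by omega)
    rw [Finset.sum_range_succ, Finset.prod_range_succ]
    rcases zmod_two_cases (∑ i ∈ Finset.range s, if 0 < a i then (1 : ZMod 2) else 0) with h | h
    · rw [h]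
      have := ih0 h
      rcases (ha s (by omega)).lt_or_gt with hs | hs
      · rw [if_neg hs.not_gt]
        exact ⟨fun _ => mul_pos this (neg_pos.2 hs), by simp⟩
      · rw [if_pos hs]
        exact ⟨by simp, fun _ => mul_neg_of_pos_of_neg this (neg_lt_zero.2 hs)⟩
    · rw [h]
      have := ih1 h
      rcases (ha s (by omega)).lt_or_gt with hs | hs
      · rw [if_neg hs.not_gt]
        exact ⟨by simp, fun _ => mul_neg_of_neg_of_pos this (neg_pos.2 hs)⟩
      · rw [if_pos hs]
        exact ⟨fun _ => mul_pos_of_neg_of_neg this (neg_lt_zero.2 hs),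
          fun h => absurd h (by decide)⟩

theorem zmod_two_sign_add (a b c : ZMod 2) : 2 * ((a + b + c).val : ℝ) - 1 =
    (1 - 2 * (b.val : ℝ)) * (2 * (a.val : ℝ) - 1) * (1 - 2 * (c.val : ℝ)) := by
  have h2 : (1 + 1 : ZMod 2) = 0 := by decide
  rcases zmod_two_cases a with rfl | rfl <;> rcases zmod_two_cases b with rfl | rfl <;>
    rcases zmod_two_cases c with rfl | rfl <;> simp [h2, ZMod.val_one] <;> norm_num

theorem zmod_two_sign_eq (a : ZMod 2) : 2 * (a.val : ℝ) - 1 = 1 ∨ 2 * (a.val : ℝ) - 1 = -1 := by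
  rcases zmod_two_cases a with rfl | rfl <;> simp [ZMod.val_one]; norm_num

theorem kernelDist_le {N : ℕ} {K K' : Matrix (Fin N) (Fin N) ℝ} {D : Matrix (Fin N) (Fin N) ℝ}
    (hD : D ∈ signMatrices N) {r : ℝ} (hr : 0 ≤ r) (h : ∀ i j, |(D * K * D - K') i j| ≤ r) :
    kernelDist K K' ≤ r := by
  refine (ciInf_le ⟨0, ?_⟩ (⟨D, hD⟩ : signMatrices N)).trans (Real.iSup_le (fun p => h _ _) hr)
  rintro _ ⟨D', rfl⟩
  exact Real.iSup_nonneg fun p => abs_nonneg _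

section Recovery

variable {N n : ℕ} {α t : ℝ} {K : Matrix (Fin N) (Fin N) ℝ} {Y : Fin n → Finset (Fin N)} {l : ℕ}

/-- The product of the two diagonal entries, all bounded by 1, contributes 2t and the minor of the
pair contributes t. -/
theorem abs_empB_sub_le (hs : ∀ i j, K i j = K j i) (hdiag : ∀ i, |K i i| ≤ 1) (hl : 2 ≤ l)
    (hE : ∀ S : Finset (Fin N), S.Nonempty → S.card ≤ l → |empMinor Y S - principalMinor K S| ≤ t)
    {i j : Fin N} (hij : i ≠ j) : |empB Y i j - K i j ^ 2| ≤ 3 * t := by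
  have h1 := hE {i} (by simp) (by simp; omega)
  have h2 := hE {j} (by simp) (by simp; omega)
  have h3 := hE {i, j} (by simp) (by rw [Finset.card_pair hij]; exact hl)
  rw [principalMinor_singleton] at h1 h2
  rw [principalMinor_pair hij, hs j i] at h3
  have h4 := abs_mul_sub_mul_le h1 h2 (abs_empMinor_le_one Y _) (hdiag j)
  have e : empB Y i j - K i j ^ 2 = (empMinor Y {i} * empMinor Y {j} - K i i * K j j) -
      (empMinor Y {i, j} - (K i i * K j j - K i j * K i j)) := by rw [empB]; ring
  rw [e]
  exact (abs_sub _ _).trans (by linarith)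

theorem EntrySeparated.le_abs (hsep : EntrySeparated α K) (hs : ∀ i j, K i j = K j i) {i j : Fin N}
    (hij : i ≠ j) (h : K i j ≠ 0) : α ≤ |K i j| := by
  rcases hij.lt_or_gt with h' | h'
  · exact (hsep i j h').resolve_left h
  · rw [hs] at h ⊢; exact (hsep j i h').resolve_left h

theorem kernelGraph_adj (hs : ∀ i j, K i j = K j i) {i j : Fin N} :
    (kernelGraph K).Adj i j ↔ i ≠ j ∧ K i j ≠ 0 := by
  rw [kernelGraph, SimpleGraph.fromRel_adj, hs j i, or_self]

/-- A threshold below the square of the smallest entry recovers the graph. -/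
theorem empGraph_eq_kernelGraph (hs : ∀ i j, K i j = K j i) (hα : 0 < α)
    (hsep : EntrySeparated α K)
    (hB : ∀ i j : Fin N, i ≠ j → |empB Y i j - K i j ^ 2| < α ^ 2 / 2) :
    empGraph α Y = kernelGraph K := by
  ext i j
  rw [empGraph_adj, kernelGraph_adj hs]
  refine and_congr_right fun hij => ?_
  have h := abs_lt.1 (hB i j hij)
  constructor
  · intro h1 h0
    rw [h0] at h
    linarith [h.2]
  · intro h0
    have := hsep.le_abs hs hij h0
    have : α ^ 2 ≤ K i j ^ 2 := by rw [← sq_abs (K i j)]; gcongr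
    linarith [h.1]

/-- Factor a - b² as (√a - |b|)(√a + |b|); the second factor is at least α. -/
theorem abs_sqrt_sub_abs_le {a b r : ℝ} (hα : 0 < α) (ha : 0 ≤ a) (hb : α ≤ |b|)
    (h : |a - b ^ 2| ≤ r) : |Real.sqrt a - (|b|)| ≤ r / α := by
  rw [le_div_iff₀ hα]
  refine le_trans ?_ h
  have : a - b ^ 2 = (Real.sqrt a - |b|) * (Real.sqrt a + |b|) := by
    rw [← sq_abs b]
    nlinarith [Real.sq_sqrt ha]
  rw [this, abs_mul]
  have h0 := Real.sqrt_nonneg a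
  exact mul_le_mul_of_nonneg_left ((by linarith : α ≤ _).trans (le_abs_self _)) (abs_nonneg _)

/-- The empirical `H` of an induced cycle is close to its limit. -/
theorem abs_empH_sub_le (hs : ∀ i j, K i j = K j i) (hdiag : ∀ i, |K i i| ≤ 1)
    (hoff : ∀ i j, i ≠ j → K i j ^ 2 ≤ 1) (ht : 0 ≤ t)
    (hE : ∀ S : Finset (Fin N), S.Nonempty → S.card ≤ l → |empMinor Y S - principalMinor K S| ≤ t)
    (hG : empGraph α Y = kernelGraph K) {w : ℕ → Fin N} {s : ℕ} (hclosed : w s = w 0) (hsl : s ≤ l)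
    (hw : InducedCycle (empGraph α Y) w s) :
    |empH α Y ((Finset.range s).image w) + 2 * ∏ i ∈ Finset.range s, -K (w i) (w (i + 1))| ≤
      2 * 4 ^ s * t := by
  have h3 := hw.three_le
  have hcard : ((Finset.range s).image w).card ≤ s := by
    simpa using Finset.card_image_le (s := Finset.range s) (f := w)
  have h1 := hE ((Finset.range s).image w) (by simp; omega) (hcard.trans hsl)
  have hne : ∀ i < s, ∀ j < s, i ≠ j → w i ≠ w j := fun i hi j hj h e => h (hw.injOn i hi j hj e)
  have h2 := abs_cycleSum_sub_le (K := fun v => empMinor Y {v}) (K' := fun v => K v v)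
    (B := empB Y) (B' := fun u v => K u v ^ 2) (w := w) (s := s) (by omega) ht
    (fun i _ => abs_empMinor_le_one Y _) (fun i _ => hdiag _)
    (fun i _ j _ _ => abs_empB_le_one Y _ _)
    (fun i hi j hj h => by rw [abs_of_nonneg (sq_nonneg _)]; exact hoff _ _ (hne i hi j hj h))
    (fun i _ => by
      have := hE {w i} (by simp) (by simp; omega)
      rwa [principalMinor_singleton] at this)
    (fun i hi j hj h => abs_empB_sub_le hs hdiag (by omega) hE (hne i hi j hj h))
  rw [principalMinor_cycle hs h3 hclosed hw.injOn fun i hi j hj hij h =>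
    (hw.adj_iff i hi j hj hij).1 (by rw [hG, kernelGraph_adj hs]; exact ⟨hne i hi j hj hij.ne, h⟩)]
    at h1
  rw [empH_inducedCycle α Y hw]
  have e : (∏ i ∈ Finset.range s, -K (w i) (w (i + 1))) =
      (-1) ^ s * ∏ i ∈ Finset.range s, K (w i) (w (i + 1)) := by
    rw [Finset.prod_neg, Finset.card_range]
  rw [e]
  set P := ∏ i ∈ Finset.range s, K (w i) (w (i + 1))
  set a := cycleSum (fun v => empMinor Y {v}) (empB Y) w s
  set b := cycleSum (fun v => K v v) (fun u v => K u v ^ 2) w s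
  have e' : empMinor Y ((Finset.range s).image w) - a + 2 * ((-1) ^ s * P) =
      (empMinor Y ((Finset.range s).image w) - (b + 2 * (-1) ^ (s + 1) * P)) - (a - b) := by
    rw [pow_succ]; ring
  rw [e']
  -- The empirical minor contributes t and the cycle sums contribute (2·4^s - 1)t.
  exact (abs_sub _ _).trans (by linarith)

theorem le_abs_prod {a : ℕ → ℝ} {s : ℕ} (hα : 0 ≤ α) (h : ∀ i < s, α ≤ |a i|) :
    α ^ s ≤ |∏ i ∈ Finset.range s, -a i| := by
  rw [Finset.abs_prod, ← Finset.card_range s, ← Finset.prod_const, Finset.card_range]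
  exact Finset.prod_le_prod (fun _ _ => hα) fun i hi => by
    rw [abs_neg]; exact h i (Finset.mem_range.1 hi)

/-- If all minors up to the cycle sparsity are accurate, every result of the estimation procedure
recovers the signs and is close to the kernel. -/
theorem IsMomentEstimate.recovers (hs : ∀ i j, K i j = K j i) (hdiag : ∀ i, |K i i| ≤ 1)
    (hoff : ∀ i j, i ≠ j → K i j ^ 2 ≤ 1) (hα : 0 < α) (hα1 : α < 1) (hsep : EntrySeparated α K)
    (ht : 0 ≤ t)
    (hE : ∀ S : Finset (Fin N), S.Nonempty → S.card ≤ cycleSparsity (kernelGraph K) →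
      |empMinor Y S - principalMinor K S| ≤ t)
    (hG : empGraph α Y = kernelGraph K)
    (htα : ∀ i j : Fin N, i ≠ j → t < (α / 4) ^ cycleSparsity (kernelGraph K))
    {Khat : Matrix (Fin N) (Fin N) ℝ} (hK : IsMomentEstimate α Y Khat) :
    RecoversSigns K Khat ∧ kernelDist K Khat ≤ 3 * t / α := by
  classical
  obtain ⟨ν, C, b, x, hC, hb, hx, hKd, hK0, hKe⟩ := hK
  have hl := two_le_cycleSparsity (kernelGraph K)
  have hC' := hC
  rw [IsShortestMaximalCycleBasis, show cycleSparsity (empGraph α Y) = cycleSparsity (kernelGraph K)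
    by rw [hG]] at hC'
  set l := cycleSparsity (kernelGraph K)
  have hadj : ∀ {i j}, (empGraph α Y).Adj i j → i ≠ j ∧ K i j ≠ 0 := fun h => by
    rwa [hG, kernelGraph_adj hs] at h
  -- The true sign vector. It solves the linear system, and every other solution is compared with
  -- it.
  let xs : (empGraph α Y).edgeSet → ZMod 2 := fun e =>
    Sym2.lift ⟨fun i j => if 0 < K i j then 1 else 0, fun i j => by simp only [hs i j]⟩ e.1
  have hsol : ∀ i, edgePairing (incidenceVec (C i)) xs = b i := by
    intro i
    obtain ⟨w, s, hw⟩ := exists_tracesCycle (hC.1.1 i)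
    have hind := hw.inducedCycle (hC.2 i).1
    have hsl : s ≤ l := by rw [← hw.ncard_verts]; exact (hC'.2 i).2
    have hadj' : ∀ k < s, (empGraph α Y).Adj (w k) (w (k + 1)) := hw.closedSeq.adj
    have hverts : (C i).verts.toFinset = (Finset.range s).image w := by
      ext v; simp [hw.verts]
    have hbi := hb i
    have hcl := abs_empH_sub_le hs hdiag hoff ht hE hG hw.closed hsl hind
    have hne01 : w 0 ≠ w 1 := (hadj' 0 (by have := hw.three_le; omega)).ne
    -- Since s ≤ l, the accuracy is below (α/4)^s, so the error of Ĥ is below 2α^s. Twice the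
    -- modulus of the product along the cycle is at least that, whence Ĥ has the sign of its limit.
    have hlt : 2 * 4 ^ s * t < 2 * α ^ s := by
      have h1 : t < (α / 4) ^ s := (htα _ _ hne01).trans_le
        (pow_le_pow_of_le_one (by positivity) (by linarith) hsl)
      rw [div_pow, lt_div_iff₀ (by positivity)] at h1
      linarith
    have hP := le_abs_prod (a := fun k => K (w k) (w (k + 1))) (s := s) hα.le fun k hk =>
      hsep.le_abs hs (hadj (hadj' k hk)).1 (hadj (hadj' k hk)).2
    have hsign := prod_neg_sign (fun k => K (w k) (w (k + 1))) s fun k hk => (hadj (hadj' k hk)).2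
    have hsw : seqWeight (edgeFun xs) w s =
        ∑ k ∈ Finset.range s, if 0 < K (w k) (w (k + 1)) then (1 : ZMod 2) else 0 :=
      Finset.sum_congr rfl fun k hk => by
        rw [edgeFun_of_adj xs (hadj' k (Finset.mem_range.1 hk))]; rfl
    rw [hw.edgePairing_eq, hsw]
    have hcl' := abs_lt.1 (hcl.trans_lt hlt)
    rcases zmod_two_cases
      (∑ k ∈ Finset.range s, if 0 < K (w k) (w (k + 1)) then (1 : ZMod 2) else 0) with h | h
    · rw [h]
      refine (hbi.2 ?_).symm
      have := hsign.1 h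
      rw [abs_of_pos this] at hP
      have hv : empH α Y ((Finset.range s).image w) < 0 := by linarith [hcl'.2]
      convert hv
    · rw [h]
      refine (hbi.1 ?_).symm
      have := hsign.2 h
      rw [abs_of_neg this] at hP
      have hv : 0 < empH α Y ((Finset.range s).image w) := by linarith [hcl'.1]
      convert hv
  have hxs : (Matrix.of fun i => incidenceVec (C i)).mulVec xs = b := by
    funext i; exact hsol i
  have hx' : ∀ i, edgePairing (incidenceVec (C i)) x = b i := by
    rcases hx with hx | ⟨hx, -⟩
    · exact fun i => congrFun hx i
    · exact absurd ⟨xs, hxs⟩ hx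
  -- The difference of two solutions is orthogonal to a basis of the cycle space, hence the
  -- coboundary of some `p`. The signs (-1)^p form the matrix D.
  have hpair : ∀ c ∈ cycleSpace (empGraph α Y), edgePairing c (x - xs) = 0 := by
    intro c hc
    rw [← hC.1.2.2] at hc
    have : Submodule.span (ZMod 2) (Set.range fun i => incidenceVec (C i)) ≤
        LinearMap.ker (edgePairingLeft (x - xs)) := by
      refine Submodule.span_le.2 ?_
      rintro _ ⟨i, rfl⟩
      show edgePairing (incidenceVec (C i)) (x - xs) = 0
      have : edgePairing (incidenceVec (C i)) (x - xs) =
          edgePairing (incidenceVec (C i)) x - edgePairing (incidenceVec (C i)) xs := by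
        simp [edgePairing, mul_sub]
      rw [this, hx', hsol, sub_self]
    exact this hc
  obtain ⟨p, hp⟩ := (noOddWalk_of_edgePairing hpair).exists_potential (edgeFun_comm _)
  let d : Fin N → ℝ := fun i => 1 - 2 * ((p i).val : ℝ)
  have hd : ∀ i, d i = 1 ∨ d i = -1 := fun i => by
    rcases zmod_two_sign_eq (p i) with h | h
    · exact Or.inr (by simp only [d]; linarith)
    · exact Or.inl (by simp only [d]; linarith)
  have hD : Matrix.diagonal d ∈ signMatrices N := ⟨d, hd, rfl⟩
  have hDKD : ∀ i j, (Matrix.diagonal d * K * Matrix.diagonal d) i j = d i * K i j * d j :=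
    fun i j => by rw [Matrix.mul_diagonal, Matrix.diagonal_mul]
  have hBB : ∀ i j : Fin N, i ≠ j → |empB Y i j - K i j ^ 2| ≤ 3 * t := fun i j hij =>
    abs_empB_sub_le hs hdiag hl hE hij
  have hzero : ∀ i j, i ≠ j → ¬ (empGraph α Y).Adj i j → K i j = 0 := fun i j hij h => by
    by_contra h0
    rw [hG, kernelGraph_adj hs] at h
    exact h ⟨hij, h0⟩
  have hedge : ∀ i j, (empGraph α Y).Adj i j → ∃ e : ℝ, (e = 1 ∨ e = -1) ∧
      Khat i j = e * Real.sqrt (empB Y i j) ∧ d i * K i j * d j = e * |K i j| := by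
    intro i j h
    refine ⟨_, zmod_two_sign_eq (x ⟨s(i, j), h⟩), hKe i j h, ?_⟩
    have h1 := hp i j h
    rw [edgeFun_of_adj _ h, Pi.sub_apply, sub_eq_iff_eq_add] at h1
    have h2 : xs ⟨s(i, j), h⟩ = if 0 < K i j then 1 else 0 := rfl
    have h3 : x ⟨s(i, j), h⟩ = xs ⟨s(i, j), h⟩ + p i + p j := by rw [h1]; ring
    rw [h3, zmod_two_sign_add, h2]
    have h4 : K i j = (2 * ((if 0 < K i j then 1 else 0 : ZMod 2).val : ℝ) - 1) * |K i j| := by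
      split_ifs with h5
      · rw [abs_of_pos h5, ZMod.val_one]; push_cast; ring
      · rw [abs_of_nonpos (not_lt.1 h5), ZMod.val_zero]; push_cast; ring
    conv_lhs => rw [h4]
    simp only [d]
    ring
  have hBpos : ∀ i j, (empGraph α Y).Adj i j → 0 < empB Y i j := fun i j h =>
    (by positivity : 0 < α ^ 2 / 2).trans_le ((empGraph_adj α Y i j).1 h).2
  refine ⟨⟨_, hD, fun i j hij => ?_⟩, kernelDist_le hD (by positivity) fun i j => ?_⟩
  · rw [hDKD]
    by_cases h : (empGraph α Y).Adj i j
    · obtain ⟨e, he, h1, h2⟩ := hedge i j h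
      rw [h1, h2, sign_mul, sign_mul, sign_pos (Real.sqrt_pos.2 (hBpos i j h)),
        sign_pos (abs_pos.2 (hadj h).2)]
    · rw [hK0 i j hij h, hzero i j hij h]
      simp
  · rw [Matrix.sub_apply, hDKD]
    by_cases h : (empGraph α Y).Adj i j
    · obtain ⟨e, he, h1, h2⟩ := hedge i j h
      rw [h1, h2, ← mul_sub, abs_mul, abs_sub_comm]
      have : |e| = 1 := by rcases he with rfl | rfl <;> simp
      rw [this, one_mul]
      exact abs_sqrt_sub_abs_le hα (hBpos i j h).le (hsep.le_abs hs (hadj h).1 (hadj h).2)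
        (hBB i j (hadj h).1)
    · by_cases hij : i = j
      -- Conjugation by signs leaves the diagonal unchanged, and t ≤ 3t/α because α < 1.
      · subst hij
        have h1 := hE {i} (by simp) (by simp; omega)
        rw [principalMinor_singleton, abs_sub_comm] at h1
        have : d i * K i i * d i = K i i := by
          rcases hd i with e | e <;> rw [e] <;> ring
        rw [this, hKd, le_div_iff₀ hα]
        nlinarith [abs_nonneg (K i i - empMinor Y {i})]
      · rw [hK0 i j hij h, hzero i j hij h]
        simp
        positivity

end Recovery

/-! ### Concentration of the empirical minors -/

open MeasureTheory ProbabilityTheory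

section Concentration

variable {N n : ℕ} {Ω : Type*} [MeasurableSpace Ω] {μ : Measure Ω}
  {K : Matrix (Fin N) (Fin N) ℝ} {Y : Fin n → Ω → Finset (Fin N)}

open scoped Classical in
/-- The indicator of `S ⊆ T`. -/
noncomputable def subsetIndicator (S T : Finset (Fin N)) : ℝ := if S ⊆ T then 1 else 0

theorem subsetIndicator_mem_Icc (S T : Finset (Fin N)) : subsetIndicator S T ∈ Set.Icc (0 : ℝ) 1 := by
  rw [subsetIndicator]; split_ifs <;> simp

theorem measurableSet_superset (S : Finset (Fin N)) : MeasurableSet {T : Finset (Fin N) | S ⊆ T} := by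
  have : {T : Finset (Fin N) | S ⊆ T} = ⋂ v ∈ S, {T : Finset (Fin N) | v ∈ T} := by
    ext T; simp [Finset.subset_iff]
  rw [this]
  exact Finset.measurableSet_biInter _ fun v _ => measurableSet_setOfPred.2 (by fun_prop)

theorem measurable_subsetIndicator (S : Finset (Fin N)) : Measurable (subsetIndicator S) := by
  classical
  exact Measurable.ite (measurableSet_superset S) measurable_const measurable_const

theorem IsDPP.integral_subsetIndicator {Z : Ω → Finset (Fin N)} (h : IsDPP μ K Z)
    (S : Finset (Fin N)) : ∫ ω, subsetIndicator S (Z ω) ∂μ = principalMinor K S := by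
  classical
  have hm : MeasurableSet {ω | S ⊆ Z ω} := h.1 (measurableSet_superset S)
  have : (fun ω => subsetIndicator S (Z ω)) = Set.indicator {ω | S ⊆ Z ω} 1 := by
    ext ω
    by_cases hS : S ⊆ Z ω <;> simp [subsetIndicator, hS]
  rw [this, integral_indicator_one hm, h.2]

theorem empMinor_eq_sum (T : Fin n → Finset (Fin N)) (S : Finset (Fin N)) :
    empMinor T S = 1 / (n : ℝ) * ∑ p, subsetIndicator S (T p) := by
  classical
  rw [empMinor, Finset.card_filter]
  push_cast
  simp only [subsetIndicator]

variable [IsProbabilityMeasure μ]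

/-- Hoeffding's inequality for an empirical minor. -/
theorem measureReal_abs_empMinor_sub_ge_le (hn : 0 < n) (hind : iIndepFun Y μ)
    (hY : ∀ p, IsDPP μ K (Y p)) (S : Finset (Fin N)) {t : ℝ} (ht : 0 ≤ t) :
    μ.real {ω | t ≤ |empMinor (fun p => Y p ω) S - principalMinor K S|} ≤
      2 * Real.exp (-2 * n * t ^ 2) := by
  have hn' : (0 : ℝ) < n := Nat.cast_pos.2 hn
  have hX : ∀ p, AEMeasurable (fun ω => subsetIndicator S (Y p ω)) μ := fun p =>
    ((measurable_subsetIndicator S).comp (hY p).1).aemeasurable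
  have hsub : ∀ p, HasSubgaussianMGF (fun ω => subsetIndicator S (Y p ω) - principalMinor K S)
      ((‖(1 : ℝ) - 0‖₊ / 2) ^ 2) μ := by
    intro p
    have := hasSubgaussianMGF_of_mem_Icc (hX p)
      (Filter.Eventually.of_forall fun ω => subsetIndicator_mem_Icc S (Y p ω))
    rwa [(hY p).integral_subsetIndicator] at this
  have hi : iIndepFun (fun p ω => subsetIndicator S (Y p ω) - principalMinor K S) μ :=
    hind.comp (fun _ T => subsetIndicator S T - principalMinor K S)
      fun _ => (measurable_subsetIndicator S).sub_const _
  have hi' : iIndepFun (fun p ω => -(subsetIndicator S (Y p ω) - principalMinor K S)) μ :=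
    hi.comp (fun _ x => -x) fun _ => measurable_neg
  have h1 := HasSubgaussianMGF.measure_sum_ge_le_of_iIndepFun hi (s := Finset.univ)
    (fun p _ => hsub p) (ε := n * t) (by positivity)
  have h2 := HasSubgaussianMGF.measure_sum_ge_le_of_iIndepFun hi' (s := Finset.univ)
    (fun p _ => (hsub p).neg) (ε := n * t) (by positivity)
  -- Each indicator has variance proxy 1/4, so the exponent for the deviation nt of the sum is
  -- -(nt)²/(2n/4).
  have hc : Real.exp (-(n * t) ^ 2 / (2 * ((∑ _p : Fin n, (‖(1 : ℝ) - 0‖₊ / 2) ^ 2 : NNReal) : ℝ))) =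
      Real.exp (-2 * n * t ^ 2) := by
    congr 1
    simp
    field_simp
  push_cast at hc h1 h2
  rw [hc] at h1 h2
  have hsum : ∀ ω, n * (empMinor (fun p => Y p ω) S - principalMinor K S) =
      ∑ p, (subsetIndicator S (Y p ω) - principalMinor K S) := by
    intro ω
    rw [empMinor_eq_sum, Finset.sum_sub_distrib]
    simp
    field_simp
  have hsubset : {ω | t ≤ |empMinor (fun p => Y p ω) S - principalMinor K S|} ⊆
      {ω | n * t ≤ ∑ p, (subsetIndicator S (Y p ω) - principalMinor K S)} ∪
      {ω | n * t ≤ ∑ p, -(subsetIndicator S (Y p ω) - principalMinor K S)} := by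
    intro ω hω
    rcases le_abs.1 (show t ≤ |_| from hω) with h | h
    · left
      rw [Set.mem_ofPred_eq, ← hsum]
      gcongr
    · right
      rw [Set.mem_ofPred_eq, Finset.sum_neg_distrib, ← hsum, ← mul_neg]
      gcongr
  calc _ ≤ _ := measureReal_mono hsubset
    _ ≤ _ := measureReal_union_le _ _
    _ ≤ _ := by linarith

/-- A set smaller than l is padded by repeating one of its elements; the union bound can then run
over the N^l tuples. -/
theorem exists_image_eq_of_card_le {S : Finset (Fin N)} (hS : S.Nonempty) {l : ℕ} (h : S.card ≤ l) :
    ∃ f : Fin l → Fin N, Finset.univ.image f = S := by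
  obtain ⟨v, hv⟩ := hS
  refine ⟨fun i => if hi : i.1 < S.card then S.equivFin.symm ⟨i, hi⟩ else v, ?_⟩
  ext x
  simp only [Finset.mem_image, Finset.mem_univ, true_and]
  constructor
  · rintro ⟨i, rfl⟩
    split_ifs
    · exact Subtype.prop _
    · exact hv
  · intro hx
    have := (S.equivFin ⟨x, hx⟩).2
    exact ⟨⟨S.equivFin ⟨x, hx⟩, by omega⟩, by simp⟩

/-- All empirical minors of size at most `l` are simultaneously close to the minors. -/
theorem one_sub_le_measureReal_of_empMinor (hn : 0 < n) (hind : iIndepFun Y μ)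
    (hY : ∀ p, IsDPP μ K (Y p)) (l : ℕ) {t : ℝ} (ht : 0 ≤ t) {A : Set Ω}
    (hA : ∀ ω, (∀ S : Finset (Fin N), S.Nonempty → S.card ≤ l →
      |empMinor (fun p => Y p ω) S - principalMinor K S| < t) → ω ∈ A) :
    1 - N ^ l * (2 * Real.exp (-2 * n * t ^ 2)) ≤ μ.real A := by
  -- The space is covered by `A` and the failure events, so that subadditivity suffices and `A` need
  -- not be measurable.
  have hcover : Set.univ ⊆ A ∪ ⋃ f ∈ (Finset.univ : Finset (Fin l → Fin N)),
      {ω | t ≤ |empMinor (fun p => Y p ω) (Finset.univ.image f) -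
        principalMinor K (Finset.univ.image f)|} := by
    intro ω _
    by_cases h : ∀ f : Fin l → Fin N, |empMinor (fun p => Y p ω) (Finset.univ.image f) -
        principalMinor K (Finset.univ.image f)| < t
    · left
      refine hA ω fun S hS hl => ?_
      obtain ⟨f, rfl⟩ := exists_image_eq_of_card_le hS hl
      exact h f
    · right
      push Not at h
      obtain ⟨f, hf⟩ := h
      simp only [Set.mem_iUnion]
      exact ⟨f, Finset.mem_univ _, hf⟩
  have h1 := (measureReal_mono (μ := μ) hcover).trans (measureReal_union_le _ _)
  rw [probReal_univ] at h1
  have h2 := measureReal_biUnion_finset_le (μ := μ) (Finset.univ : Finset (Fin l → Fin N))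
    fun f => {ω | t ≤ |empMinor (fun p => Y p ω) (Finset.univ.image f) -
        principalMinor K (Finset.univ.image f)|}
  have h3 := h2.trans (Finset.sum_le_sum fun f _ =>
    measureReal_abs_empMinor_sub_ge_le hn hind hY (Finset.univ.image f) ht)
  rw [Finset.sum_const, Finset.card_univ, Fintype.card_fun, Fintype.card_fin, Fintype.card_fin,
    nsmul_eq_mul] at h3
  push_cast at h3
  linarith

end Concentration

/-! ### Sample complexity -/

section Recovery

open MeasureTheory ProbabilityTheory

variable {N n : ℕ} {α δ : ℝ} {K : Matrix (Fin N) (Fin N) ℝ} {Ω : Type*} [MeasurableSpace Ω]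
  {μ : Measure Ω} [IsProbabilityMeasure μ]

theorem IsDPP.diag_mem_Icc {Z : Ω → Finset (Fin N)} (h : IsDPP μ K Z) (i : Fin N) :
    K i i ∈ Set.Icc (0 : ℝ) 1 := by
  rw [← principalMinor_singleton (K := K), ← h.2]
  exact ⟨measureReal_nonneg, measureReal_le_one⟩

/-- The minor of a pair is a probability, hence nonnegative, and the diagonal entries are
probabilities as well. -/
theorem IsDPP.sq_le_one {Z : Ω → Finset (Fin N)} (h : IsDPP μ K Z) (hs : ∀ i j, K i j = K j i)
    {i j : Fin N} (hij : i ≠ j) : K i j ^ 2 ≤ 1 := by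
  have h1 : 0 ≤ principalMinor K {i, j} := by rw [← h.2]; exact measureReal_nonneg
  rw [principalMinor_pair hij, hs j i] at h1
  have h2 := h.diag_mem_Icc i
  have h3 := h.diag_mem_Icc j
  nlinarith [mul_le_one₀ h2.2 h3.1 h3.2]

/-- With high probability the graph is recovered, and every result of the estimation procedure
recovers the signs and is close to the kernel. -/
theorem one_sub_le_measureReal_recovers {Y : Fin n → Ω → Finset (Fin N)} (hN : 0 < N) (hα : 0 < α)
    (hα1 : α < 1) (hδ : 0 < δ) (hδ1 : δ < 1) (hs : ∀ i j, K i j = K j i)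
    (hsep : EntrySeparated α K) (hind : iIndepFun Y μ) (hY : ∀ p, IsDPP μ K (Y p))
    (hn : Real.log ((N : ℝ) ^ (cycleSparsity (kernelGraph K) + 1) / δ) /
      (α / 4) ^ (2 * cycleSparsity (kernelGraph K)) < (n : ℝ)) {A : Set Ω}
    (hA : ∀ ω, 0 < n → empGraph α (fun p => Y p ω) = kernelGraph K →
      (∀ Khat : Matrix (Fin N) (Fin N) ℝ, IsMomentEstimate α (fun p => Y p ω) Khat →
        RecoversSigns K Khat ∧ kernelDist K Khat < 1 / α * Real.sqrt (8 * Real.log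
          (4 * (N : ℝ) ^ (cycleSparsity (kernelGraph K) + 1) / δ) / n)) → ω ∈ A) :
    1 - δ ≤ μ.real A := by
  have hl := SimpleGraph.two_le_cycleSparsity (kernelGraph K)
  set l := cycleSparsity (kernelGraph K)
  have hN1 : (1 : ℝ) ≤ N := by exact_mod_cast hN
  have hNl : (1 : ℝ) ≤ (N : ℝ) ^ l := one_le_pow₀ hN1
  have hNl1 : (N : ℝ) ^ l ≤ (N : ℝ) ^ (l + 1) := pow_le_pow_right₀ hN1 (Nat.le_succ l)
  have hlog : 0 < Real.log ((N : ℝ) ^ (l + 1) / δ) :=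
    Real.log_pos ((one_lt_div hδ).2 (by linarith))
  have hα4 : 0 < (α / 4) ^ (2 * l) := by positivity
  have hnR : (0 : ℝ) < n := (div_pos hlog hα4).trans hn
  have hn0 : 0 < n := Nat.cast_pos.1 hnR
  rw [div_lt_iff₀ hα4] at hn
  -- Chosen so that the accuracy t = √(L/(2n)) makes the union bound equal to δ exactly.
  set L := Real.log (2 * (N : ℝ) ^ l / δ) with hL
  have hL0 : 0 < L := Real.log_pos ((one_lt_div hδ).2 (by linarith))
  set t := Real.sqrt (L / (2 * n)) with htdef
  have ht0 : 0 ≤ t := Real.sqrt_nonneg _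
  have ht2 : t ^ 2 = L / (2 * n) := Real.sq_sqrt (by positivity)
  have htail : (N : ℝ) ^ l * (2 * Real.exp (-2 * n * t ^ 2)) = δ := by
    have : -2 * n * t ^ 2 = -L := by rw [ht2]; field_simp
    rw [this, Real.exp_neg, hL, Real.exp_log (by positivity)]
    field_simp
  rw [← htail]
  refine one_sub_le_measureReal_of_empMinor hn0 hind hY l ht0 fun ω hE => ?_
  have hdiag : ∀ i, |K i i| ≤ 1 := fun i => by
    have := (hY ⟨0, hn0⟩).diag_mem_Icc i
    rw [abs_of_nonneg this.1]; exact this.2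
  have hoff : ∀ i j, i ≠ j → K i j ^ 2 ≤ 1 := fun i j hij => (hY ⟨0, hn0⟩).sq_le_one hs hij
  have hE' : ∀ S : Finset (Fin N), S.Nonempty → S.card ≤ l →
      |empMinor (fun p => Y p ω) S - principalMinor K S| ≤ t := fun S h1 h2 => (hE S h1 h2).le
  -- Two distinct indices force N ≥ 2, and then the factor 2 in `L` is absorbed by passing from N^l
  -- to N^(l+1). For N = 1 no such estimate is needed because there are no off-diagonal entries.
  have htα : ∀ i j : Fin N, i ≠ j → t < (α / 4) ^ l := by
    intro i j hij
    have hN2 : (2 : ℝ) ≤ N := by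
      have : 2 ≤ N := by
        have := Fin.val_ne_of_ne hij
        omega
      exact_mod_cast this
    have hLL : L ≤ Real.log ((N : ℝ) ^ (l + 1) / δ) := by
      refine Real.log_le_log (by positivity) ?_
      rw [pow_succ']
      gcongr
    rw [htdef, Real.sqrt_lt' (by positivity), ← pow_mul, mul_comm l, div_lt_iff₀ (by positivity)]
    nlinarith [mul_pos hnR hα4]
  have hG : empGraph α (fun p => Y p ω) = kernelGraph K := by
    -- The error 3t is below 3(α/4)², which is less than the threshold α²/2, because l ≥ 2.
    refine empGraph_eq_kernelGraph hs hα hsep fun i j hij => ?_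
    refine (abs_empB_sub_le hs hdiag hl hE' hij).trans_lt ?_
    have h1 : (α / 4) ^ l ≤ (α / 4) ^ 2 :=
      pow_le_pow_of_le_one (by positivity) (by linarith) hl
    nlinarith [htα i j hij, sq_nonneg α]
  refine hA ω hn0 hG fun Khat hK => ?_
  obtain ⟨h1, h2⟩ := hK.recovers hs hdiag hoff hα hα1 hsep ht0 hE' hG htα
  refine ⟨h1, h2.trans_lt ?_⟩
  rw [one_div, inv_mul_eq_div]
  refine div_lt_div_of_pos_right (Real.lt_sqrt_of_sq_lt ?_) hα
  have hLL : L ≤ Real.log (4 * (N : ℝ) ^ (l + 1) / δ) := by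
    refine Real.log_le_log (by positivity) ?_
    gcongr
    linarith
  -- The square of 3t is (9/2)L/n, and L is at most the logarithm in the claim; 9/2 < 8 makes the
  -- inequality strict.
  rw [mul_pow, ht2, lt_div_iff₀ hnR]
  have : 3 ^ 2 * (L / (2 * n)) * n = 9 / 2 * L := by field_simp; norm_num
  rw [this]
  linarith

end Recovery

theorem mainTheorem4 :
    ∃ (P : Prog) (c : ℕ),
      (∀ (N n : ℕ) (α : ℝ) (Y : Fin n → Finset (Fin N)),
        0 < N → 0 < n → 0 < α → α < 1 →
        ComputesEstimateWithin P α Y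
          (c * ((empGraph α Y).edgeSet.ncard ^ 3 + n * N ^ 2))) ∧
      (∀ (N n : ℕ) (α δ : ℝ) (K : Matrix (Fin N) (Fin N) ℝ)
        (Ω : Type*) [MeasurableSpace Ω] (μ : MeasureTheory.Measure Ω)
        [MeasureTheory.IsProbabilityMeasure μ] (Y : Fin n → Ω → Finset (Fin N)),
        0 < N → 0 < α → α < 1 → 0 < δ → δ < 1 →
        K.PosSemidef → (1 - K).PosSemidef → EntrySeparated α K →
        ProbabilityTheory.iIndepFun Y μ → (∀ p, IsDPP μ K (Y p)) →
        Real.log ((N : ℝ) ^ (cycleSparsity (kernelGraph K) + 1) / δ) /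
            (α / 4) ^ (2 * cycleSparsity (kernelGraph K)) < (n : ℝ) →
        1 - δ ≤ μ.real {ω |
          ComputesEstimateWithin P α (fun p => Y p ω)
            (c * ((kernelGraph K).edgeSet.ncard ^ 3 + n * N ^ 2)) ∧
          ∀ Khat : Matrix (Fin N) (Fin N) ℝ, IsMomentEstimate α (fun p => Y p ω) Khat →
            RecoversSigns K Khat ∧
            kernelDist K Khat < 1 / α *
              Real.sqrt (8 * Real.log
                (4 * (N : ℝ) ^ (cycleSparsity (kernelGraph K) + 1) / δ) / n)}) := by
  refine ⟨MomentProgram.estimate, 5000, fun N n α Y hN hn _ _ =>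
    MomentProgram.computesEstimateWithin α Y hN hn, ?_⟩
  intro N n α δ K Ω _ μ _ Y hN hα hα1 hδ hδ1 hK _ hsep hind hY hn
  have hs : ∀ i j, K i j = K j i := fun i j => by
    simpa using (hK.isHermitian.apply i j).symm
  refine one_sub_le_measureReal_recovers hN hα hα1 hδ hδ1 hs hsep hind hY hn
    fun ω hn0 hG h => ⟨?_, h⟩
  -- On the good event the estimated graph is that of the kernel, so the deterministic bound in
  -- terms of m̂ is the bound in terms of m.
  rw [← hG]
  exact MomentProgram.computesEstimateWithin α _ hN hn0
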